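/- **Setting.** Let $\mathfrak K\colon\mathbb R^2\to[0,1]$ be a rotation-invariant $\mathcal C^2$ function with compact support contained in the open ball $B(0,3)$, with $\int\mathfrak K(x)\,dx=1$ and $\int\mathfrak K(x)|x|^2\,dx=4$. For $0<\gamma<\frac13$ put $$N=\lfloor\gamma^{-2}\rfloor,\qquad \varepsilon=\tfrac{2}{2N+1},\qquad \alpha=\gamma^2,\qquad \delta=\gamma,$$ let $\Lambda_N=\mathbb Z^2/(2N+1)\mathbb Z^2$, identified with $\{-N,\dots,N\}^2$, and let $\Lambda_\varepsilon=\varepsilon\Lambda_N\subset\mathbb T^2=[-1,1]^2$ (with periodic subtraction). Let $\kappa_\gamma(0)=0$ and $\kappa_\gamma(k)=c_\gamma\gamma^2\mathfrak K(\gamma k)$ for $k\in\Lambda_N\setminus\{0\}$, with $c_\gamma^{-1}=\sum_{k\ne0}\gamma^2\mathfrak K(\gamma k)$; for $\sigma\in\{-1,1\}^{\Lambda_N}$ let $h_\gamma(\sigma,k)=\sum_{j}\kappa_\gamma(k-j)\sigma(j)$, and let $\lambda_\gamma(\sigma)\propto\exp\big(\frac\beta2\sum_{k,j}\kappa_\gamma(k-j)\sigma(j)\sigma(k)\big)$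 be the Gibbs measure. Let $K_\gamma(x)=\varepsilon^{-2}\kappa_\gamma(\varepsilon^{-1}x)$ for $x\in\Lambda_\varepsilon$. For $Y$ on $\Lambda_\varepsilon$ let $\hat Y(\omega)=\sum_{x\in\Lambda_\varepsilon}\varepsilon^2Y(x)e^{-i\pi\omega\cdot x}$ if $\omega\in\{-N,\dots,N\}^2$ and $\hat Y(\omega)=0$ for the other $\omega\in\mathbb Z^2$; $Y$ is extended to $\mathbb T^2$ by $Y(x)=\frac14\sum_\omega\hat Y(\omega)e^{i\pi\omega\cdot x}$. The inverse temperature is $$\beta=1+\gamma^2(\mathfrak c_\gamma+A),\qquad \mathfrak c_\gamma=\frac14\sum_{0\neq\omega\in\{-N,\dots,N\}^2}\frac{|\hat K_\gamma(\omega)|^2}{\gamma^{-2}(1-\hat K_\gamma(\omega))},\qquad A\in\mathbb R .$$ Let $(\sigma(t))_{t\ge0}$ be the càdlàg Glauber dynamics, i.e. the pure jump Markov process on $\{-1,1\}^{\Lambda_N}$, with arbitrary initial distribution, whose generator is $$\mathcal L f(\sigma)=\sum_{j\in\Lambda_N}\frac{\lambda_\gamma(\sigma^j)}{\lambda_\gamma(\sigma)+\lambda_\gamma(\sigma^j)}\,\big(f(\sigma^j)-f(\sigma)\big),$$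 where $\sigma^j$ is $\sigma$ with the spin at $j$ flipped. Let $m_\gamma(t,k)=h_\gamma(\sigma(t),k)-h_\gamma(\sigma(0),k)-\int_0^t\mathcal L h_\gamma(\cdot,k)(\sigma(r))\,dr$ and $M_\gamma(t,x)=\delta^{-1}m_\gamma(t/\alpha,x/\varepsilon)$ for $x\in\Lambda_\varepsilon$. Let $P^\gamma_t$ be the function on $\Lambda_\varepsilon$ with Fourier transform $\exp\big(t\gamma^{-2}(\hat K_\gamma(\omega)-1)\big)$, $\omega\in\{-N,\dots,N\}^2$. For $0\le s\le t$ and $x\in\Lambda_\varepsilon$ set $$R_{\gamma,t}(s,x)=\int_{(0,s]}\sum_{y\in\Lambda_\varepsilon}\varepsilon^2P^\gamma_{t-r}(x-y)\,dM_\gamma(r,y),\qquad [R_{\gamma,t}(\cdot,x)]_s=R_{\gamma,t}(s,x)^2-2\int_{(0,s]}R_{\gamma,t}(r^-,x)\,dR_{\gamma,t}(r,x),$$ and extend both to $x\in\mathbb T^2$ as trigonometric polynomials as above. (All integrals against $dM_\gamma$, $dR_{\gamma,t}$ are pathwise Lebesgue–Stieltjes integrals.) Set $\hat R^{:1:}_{\gamma,t}=\hat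 R_{\gamma,t}$ and, for $n\ge2$ and $\omega\in\mathbb Z^2$, $$\hat R^{:n:}_{\gamma,t}(s,\omega)=n\int_{(0,s]}\frac14\sum_{\tilde\omega\in\mathbb Z^2}\hat R^{:n-1:}_{\gamma,t}(r^-,\omega-\tilde\omega)\,d\hat R_{\gamma,t}(r,\tilde\omega),\qquad R^{:n:}_{\gamma,t}(s,x)=\frac14\sum_{\omega\in\mathbb Z^2}\hat R^{:n:}_{\gamma,t}(s,\omega)e^{i\pi\omega\cdot x}.$$ Finally let $H_0=1$, $H_n=XH_{n-1}-T\,\partial_XH_{n-1}$ be the Hermite polynomials $H_n(X,T)$, and for $x\in\mathbb T^2$ put $$E^{:n:}_{\gamma,t}(s,x)=H_n\big(R_{\gamma,t}(s,x),[R_{\gamma,t}(\cdot,x)]_s\big)-R^{:n:}_{\gamma,t}(s,x).$$ **Proposition 5.3.** There exists $\gamma_0\in(0,\frac13]$, depending only on $\mathfrak K$, such that for every integer $n\ge1$, every $\kappa>0$, $t>0$ and $1\le p<\infty$ there exists a constant $C>0$, depending only on $n,p,t,\kappa$ (and $\mathfrak K$), such that for every $0<\gamma<\gamma_0$ (and every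 $A\in\mathbb R$ and every initial distribution of the spins) $$\Big(\mathbb E\sup_{x\in\mathbb T^2}\ \sup_{0\le s\le t}\big|E^{:n:}_{\gamma,t}(s,x)\big|^p\Big)^{1/p}\le C\,\gamma^{1-\kappa}.$$ -/

import Mathlib

open MeasureTheory Filter Topology
open scoped NNReal ENNReal

universe u

noncomputable section

namespace IsingKac

/-! ### The Kac kernel and the microscopic spin system -/

/-- The assumptions on the kernel `𝔎 : ℝ² → [0,1]`. In the plane, invariance under rotations
means that the value depends only on the Euclidean norm. -/
structure IsKacKernel (𝔎 : EuclideanSpace ℝ (Fin 2) → ℝ) : Prop where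
  nonneg : ∀ x, 0 ≤ 𝔎 x
  le_one : ∀ x, 𝔎 x ≤ 1
  contDiff : ContDiff ℝ 2 𝔎
  tsupport_subset : tsupport 𝔎 ⊆ Metric.ball 0 3
  rotation_invariant : ∀ x y, ‖x‖ = ‖y‖ → 𝔎 x = 𝔎 y
  integral_eq_one : ∫ x, 𝔎 x = 1
  integral_mul_sq_eq_four : ∫ x, 𝔎 x * ‖x‖ ^ 2 = 4

/-- The discrete torus `Λ_N = ℤ² / (2N+1)ℤ²`. -/
abbrev Lattice (N : ℕ) := Fin 2 → ZMod (2 * N + 1)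

/-- The representative of a point of `Λ_N` in `{-N, …, N}²`. -/
def rep {N : ℕ} (k : Lattice N) (i : Fin 2) : ℤ := (k i).valMinAbs

/-- Spin configurations, `{-1, +1}^{Λ_N}`. -/
abbrev Config (N : ℕ) := Lattice N → ℤˣ

/-- The value `σ(k) ∈ {-1, 1} ⊆ ℝ` of the spin at `k`. -/
def spin {N : ℕ} (σ : Config N) (k : Lattice N) : ℝ := ((σ k : ℤ) : ℝ)

/-- The point `γ k ∈ ℝ²`, for `k ∈ Λ_N` identified with `{-N, …, N}²`. -/
def scaledPoint (γ : ℝ) {N : ℕ} (k : Lattice N) : EuclideanSpace ℝ (Fin 2) :=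
  WithLp.toLp 2 fun i => γ * (rep k i : ℝ)

/-- The normalisation: its inverse is `∑_{k ≠ 0} γ² 𝔎(γ k)`. -/
def normConst (𝔎 : EuclideanSpace ℝ (Fin 2) → ℝ) (γ : ℝ) (N : ℕ) : ℝ :=
  (∑ k ∈ (Finset.univ : Finset (Lattice N)).erase 0, γ ^ 2 * 𝔎 (scaledPoint γ k))⁻¹

/-- The interaction kernel `κ_γ : Λ_N → [0, ∞)`, vanishing at the origin. -/
def kac (𝔎 : EuclideanSpace ℝ (Fin 2) → ℝ) (γ : ℝ) {N : ℕ} (k : Lattice N) : ℝ :=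
  if k = 0 then 0 else normConst 𝔎 γ N * γ ^ 2 * 𝔎 (scaledPoint γ k)

/-- The locally averaged field `h_γ(σ, k) = ∑_j κ_γ(k - j) σ(j)`. -/
def localField (𝔎 : EuclideanSpace ℝ (Fin 2) → ℝ) (γ : ℝ) {N : ℕ}
    (σ : Config N) (k : Lattice N) : ℝ :=
  ∑ j, kac 𝔎 γ (k - j) * spin σ j

/-- The Hamiltonian. -/
def hamiltonian (𝔎 : EuclideanSpace ℝ (Fin 2) → ℝ) (γ : ℝ) {N : ℕ} (σ : Config N) : ℝ :=
  -(1 / 2) * ∑ k, ∑ j, kac 𝔎 γ (k - j) * spin σ j * spin σ k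

/-- The probability of `σ` under the Gibbs measure at inverse temperature `β`. -/
def gibbs (𝔎 : EuclideanSpace ℝ (Fin 2) → ℝ) (γ β : ℝ) {N : ℕ} (σ : Config N) : ℝ :=
  Real.exp (-β * hamiltonian 𝔎 γ σ) / ∑ η : Config N, Real.exp (-β * hamiltonian 𝔎 γ η)

/-- The configuration `σ^j`, in which the spin at `j` is flipped. -/
def flip {N : ℕ} (σ : Config N) (j : Lattice N) : Config N :=
  Function.update σ j (-σ j)

/-- The jump rates of the Glauber dynamics. -/
def rate (𝔎 : EuclideanSpace ℝ (Fin 2) → ℝ) (γ β : ℝ) {N : ℕ}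
    (σ : Config N) (j : Lattice N) : ℝ :=
  gibbs 𝔎 γ β (flip σ j) / (gibbs 𝔎 γ β σ + gibbs 𝔎 γ β (flip σ j))

/-- The generator of the Glauber dynamics. -/
def generator (𝔎 : EuclideanSpace ℝ (Fin 2) → ℝ) (γ β : ℝ) {N : ℕ}
    (f : Config N → ℝ) (σ : Config N) : ℝ :=
  ∑ j, rate 𝔎 γ β σ j * (f (flip σ j) - f σ)

/-- `σ` is a pure jump Markov process on the finite set of spin configurations, with the generator
of the Glauber dynamics: it is adapted, its paths are right-continuous with left limits (for the
discrete topology), and it solves the martingale problem of the generator. There is no restriction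
on the initial distribution. -/
structure IsGlauberDynamics (𝔎 : EuclideanSpace ℝ (Fin 2) → ℝ) (γ β : ℝ) {N : ℕ}
    {Ω : Type u} {mΩ : MeasurableSpace Ω} (μ : Measure Ω) (ℱ : Filtration ℝ≥0 mΩ)
    (σ : ℝ≥0 → Ω → Config N) : Prop where
  adapted : ∀ t η, MeasurableSet[ℱ t] {ω | σ t ω = η}
  right_continuous : ∀ ω t, ∀ᶠ r in 𝓝[>] t, σ r ω = σ t ω
  left_limits : ∀ ω t, ∃ η, ∀ᶠ r in 𝓝[<] t, σ r ω = η
  martingale : ∀ f : Config N → ℝ,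
    Martingale (fun (t : ℝ≥0) ω => f (σ t ω) - f (σ 0 ω) -
      ∫ r in (0 : ℝ)..t, generator 𝔎 γ β f (σ r.toNNReal ω)) ℱ μ

/-- The martingale `m_γ(t, k) = h_γ(t, k) - h_γ(0, k) - ∫₀ᵗ 𝓛 h_γ(r, k) dr`, as a function of the
path of the spin system. -/
def microMartingale (𝔎 : EuclideanSpace ℝ (Fin 2) → ℝ) (γ β : ℝ) {N : ℕ}
    (σ : ℝ≥0 → Config N) (t : ℝ≥0) (k : Lattice N) : ℝ :=
  localField 𝔎 γ (σ t) k - localField 𝔎 γ (σ 0) k -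
    ∫ r in (0 : ℝ)..t, generator 𝔎 γ β (fun η => localField 𝔎 γ η k) (σ r.toNNReal)

/-! ### Scaling and Fourier analysis on the discrete torus

A point `x = ε k` of the rescaled torus `Λ_ε ⊆ [-1,1]²` is represented by `k ∈ Λ_N`.
Quantities obtained from Fourier series take values in `ℂ`. -/

/-- `N = ⌊γ⁻²⌋`. -/
def size (γ : ℝ) : ℕ := ⌊(γ ^ 2)⁻¹⌋₊

/-- The mesh `2 / (2N+1)`. -/
def mesh (N : ℕ) : ℝ := 2 / (2 * (N : ℝ) + 1)

/-- The frequencies `{-N, …, N}²`. -/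
def freqBox (N : ℕ) : Finset (Fin 2 → ℤ) :=
  Fintype.piFinset fun _ => Finset.Icc (-(N : ℤ)) (N : ℤ)

/-- `e^{i π w · x}`. -/
def fourierMode (w : Fin 2 → ℤ) (x : Fin 2 → ℝ) : ℂ :=
  Complex.exp (Complex.I * Real.pi * ∑ i, (w i : ℂ) * (x i : ℂ))

/-- The point `x = ε k ∈ [-1,1]²`. -/
def macroPoint {N : ℕ} (k : Lattice N) (i : Fin 2) : ℝ := mesh N * (rep k i : ℝ)

/-- The Fourier transform of `Y : Λ_ε → ℂ`, set to zero outside `{-N, …, N}²`. -/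
def fourierTransform {N : ℕ} (Y : Lattice N → ℂ) (w : Fin 2 → ℤ) : ℂ :=
  if w ∈ freqBox N then
    ∑ k, (mesh N : ℂ) ^ 2 * Y k * fourierMode (-w) (macroPoint k)
  else 0

/-- The extension of `Y : Λ_ε → ℂ` by a trigonometric polynomial of degree at most `N`. -/
def trigExtension {N : ℕ} (Y : Lattice N → ℂ) (x : Fin 2 → ℝ) : ℂ :=
  (1 / 4) * ∑ w ∈ freqBox N, fourierTransform Y w * fourierMode w x

/-- The Fourier transform of the rescaled kernel `K_γ(x) = ε⁻² κ_γ(ε⁻¹ x)`. -/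
def kacHat (𝔎 : EuclideanSpace ℝ (Fin 2) → ℝ) (γ : ℝ) (w : Fin 2 → ℤ) : ℂ :=
  fourierTransform (fun k : Lattice (size γ) =>
    (((mesh (size γ) ^ 2)⁻¹ * kac 𝔎 γ k : ℝ) : ℂ)) w

/-- The renormalisation constant. As `K_γ` is even, its Fourier transform is real. -/
def renormConst (𝔎 : EuclideanSpace ℝ (Fin 2) → ℝ) (γ : ℝ) : ℝ :=
  (1 / 4) * ∑ w ∈ (freqBox (size γ)).erase 0,
    ‖kacHat 𝔎 γ w‖ ^ 2 / ((γ ^ 2)⁻¹ * (1 - (kacHat 𝔎 γ w).re))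

/-- The inverse temperature, `β - 1 = γ² (𝔠_γ + A)`. -/
def invTemp (𝔎 : EuclideanSpace ℝ (Fin 2) → ℝ) (γ A : ℝ) : ℝ :=
  1 + γ ^ 2 * (renormConst 𝔎 γ + A)

/-- The kernel on `Λ_ε` of the semigroup `P^γ_t` generated by `Y ↦ γ⁻² (K_γ ⋆ Y - Y)`, which is
given by its Fourier transform `exp (t γ⁻² (K̂_γ(w) - 1))`, `w ∈ {-N, …, N}²`. -/
def heatKernel (𝔎 : EuclideanSpace ℝ (Fin 2) → ℝ) (γ : ℝ) (t : ℝ) (k : Lattice (size γ)) : ℂ :=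
  (1 / 4) * ∑ w ∈ freqBox (size γ),
    Complex.exp ((t : ℂ) * ((γ : ℂ) ^ 2)⁻¹ * (kacHat 𝔎 γ w - 1)) * fourierMode w (macroPoint k)

/-! ### Pathwise stochastic integrals -/

open Classical in
/-- The Lebesgue-Stieltjes integral `∫_{(0,s]} f(r) dg(r)` against a right-continuous function `g`
of bounded variation on `[0, s]`. -/
def stieltjes (f g : ℝ≥0 → ℂ) (s : ℝ≥0) : ℂ :=
  if h : BoundedVariationOn (fun r => g (min r s)) Set.univ then
    (h.vectorMeasure.restrict (Set.Ioc 0 s)).integral f (ContinuousLinearMap.mul ℝ ℂ)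
  else 0

/-- The bracket process `[X]_s = X(s)² - 2 ∫_{(0,s]} X(r⁻) dX(r)` of a process of bounded variation
with `X(0) = 0`. -/
def bracket (X : ℝ≥0 → ℂ) (s : ℝ≥0) : ℂ :=
  X s ^ 2 - 2 * stieltjes (Function.leftLim X) X s

/-- The rescaled martingale `M_γ(s, x) = δ⁻¹ m_γ(s/α, x/ε)`, with `δ = γ` and `α = γ²`. -/
def macroMartingale (𝔎 : EuclideanSpace ℝ (Fin 2) → ℝ) (γ β : ℝ)
    (σ : ℝ≥0 → Config (size γ)) (s : ℝ≥0) (k : Lattice (size γ)) : ℝ :=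
  γ⁻¹ * microMartingale 𝔎 γ β σ (s / (γ ^ 2).toNNReal) k

/-- `R_{γ,t}(s, x) = ∫_{(0,s]} P^γ_{t-r} dM_γ(r, x)` for `x ∈ Λ_ε`. -/
def R (𝔎 : EuclideanSpace ℝ (Fin 2) → ℝ) (γ β : ℝ) (σ : ℝ≥0 → Config (size γ))
    (t s : ℝ≥0) (k : Lattice (size γ)) : ℂ :=
  ∑ j, (mesh (size γ) : ℂ) ^ 2 *
    stieltjes (fun r => heatKernel 𝔎 γ ((t : ℝ) - (r : ℝ)) (k - j))
      (fun r => (macroMartingale 𝔎 γ β σ r j : ℂ)) s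

/-- The Fourier coefficients of the iterated integrals `R_{γ,t}^{:n:}(s, ·)`. The recursion starts
at `n = 1`; the value at `n = 0` (the constant function `1`) is a convention. -/
def wickHat (𝔎 : EuclideanSpace ℝ (Fin 2) → ℝ) (γ β : ℝ) (σ : ℝ≥0 → Config (size γ))
    (t : ℝ≥0) : ℕ → ℝ≥0 → (Fin 2 → ℤ) → ℂ
  | 0, _, w => if w = 0 then 4 else 0
  | 1, s, w => fourierTransform (R 𝔎 γ β σ t s) w
  | n + 2, s, w => ((n + 2 : ℕ) : ℂ) * ((1 / 4) * ∑' v : Fin 2 → ℤ,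
      stieltjes (Function.leftLim fun r => wickHat 𝔎 γ β σ t (n + 1) r (w - v))
        (fun r => fourierTransform (R 𝔎 γ β σ t r) v) s)

/-- The iterated integral `R_{γ,t}^{:n:}(s, x)`, for `x ∈ 𝕋²`. -/
def wick (𝔎 : EuclideanSpace ℝ (Fin 2) → ℝ) (γ β : ℝ) (σ : ℝ≥0 → Config (size γ))
    (t : ℝ≥0) (n : ℕ) (s : ℝ≥0) (x : Fin 2 → ℝ) : ℂ :=
  (1 / 4) * ∑' w : Fin 2 → ℤ, wickHat 𝔎 γ β σ t n s w * fourierMode w x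

/-- The Hermite polynomials `H_n(X, T)`, with `X = X 0` and `T = X 1`:
`H_0 = 1` and `H_{n+1} = X H_n - T ∂_X H_n`. -/
def hermite : ℕ → MvPolynomial (Fin 2) ℂ
  | 0 => 1
  | n + 1 => MvPolynomial.X 0 * hermite n - MvPolynomial.X 1 * MvPolynomial.pderiv 0 (hermite n)

/-- `E_{γ,t}^{:n:}(s, x) = H_n(R_{γ,t}(s, x), [R_{γ,t}(·, x)]_s) - R_{γ,t}^{:n:}(s, x)` for
`x ∈ 𝕋²`, where both `R_{γ,t}(s, ·)` and the bracket `[R_{γ,t}(·, ·)]_s` are extended from `Λ_ε`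
to `𝕋²` by trigonometric polynomials of degree at most `N`. -/
def wickError (𝔎 : EuclideanSpace ℝ (Fin 2) → ℝ) (γ β : ℝ) (σ : ℝ≥0 → Config (size γ))
    (t : ℝ≥0) (n : ℕ) (s : ℝ≥0) (x : Fin 2 → ℝ) : ℂ :=
  MvPolynomial.eval
      ![trigExtension (R 𝔎 γ β σ t s) x,
        trigExtension (fun k => bracket (fun r => R 𝔎 γ β σ t r k) s) x]
      (hermite n)
    - wick 𝔎 γ β σ t n s x

end IsingKac

end

noncomputable section

namespace IsingKac

/-! ### Stieltjes integrals against paths with finitely many jumps -/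

/-! Fix a point x of the torus. The path s ↦ R(s, x) has finitely many jumps and a right-continuous
drift between them, so the normalised iterated integrals I_n = R^{:n:}/n! satisfy Newton's
identities, like elementary symmetric functions: (n+1) I_{n+1} = Σ_k (-1)^k I_{n-k} p_k, where p_0 =
R and p_k, for k ≥ 1, is the sum of the (k+1)-st powers of the jumps (`newton_identity`). This holds
at every x, and not only at lattice points, because the Fourier coefficients of R^{:n:} are not
truncated. The normalised Hermite polynomials H_n(R, T)/n! satisfy the same recursion with T in
place of p_1 and 0 in place of p_k for k ≥ 2. The error is therefore driven by two quantities
(`norm_hermite_sub_le`): the power sums p_k with k ≥ 2, and T - p_1. Here T is the interpolation of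
the bracket, while p_1 is the sum of the squares of the interpolated jumps.

Both are small by a factor γ, up to logarithms. One spin flip changes R by O(γ log²), and the higher
power sums are bounded by powers of the largest jump times the sum of the squared moduli. Squaring
commutes with interpolation for frequencies at most N/2, so T - p_1 contains only products with a
high-frequency factor; at high frequencies the kernel has Fourier transform O(γ²) and relaxation
rate at least of order γ⁻² (`KernelBounds.high`). The estimates on the kernel come from two
summations by parts (`IsKacKernel.kacHat_decay`) and from a box on which the kernel is bounded below
(`IsKacKernel.kacHat_re_bound`).

The probabilistic input is one inequality: for a functional that adds up W over the jumps, the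
exponential of the compensated sum has expectation at most 1 (`IsJumpProcess.lintegral_exp_le_one`).
It is applied to real projections of R at the times of a grid, to squared jumps, to products with
high-frequency jumps, and to sums of moduli of jumps over the cells of the grid. The number of these
functionals is polynomial in γ⁻¹, so the average Z of all the exponentials has mean at most 1 and
every functional is at most log(number) + log(1 + Z). The supremum over times is reduced to the grid
by the sums over cells, the supremum over x to lattice points by the Lebesgue constant of
interpolation, which is O(log²).

The outcome is a pathwise bound of the form γ (1 + log γ⁻¹)^{5n} (1 + log(1 + Z))^n. Powers of log(1
+ Z) are integrable and powers of log γ⁻¹ are absorbed by γ^{-κ}. Of the jump rates only the bounds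
0 and γ⁻² are used, which gives uniformity in A and in the initial distribution. -/

theorem integral_withDensityVec {X : Type*} {mX : MeasurableSpace X} (ν : Measure X)
    {b : X → ℂ} (hb : Integrable b ν) {f : X → ℂ} (hf : StronglyMeasurable f) {C : ℝ}
    (hC : ∀ x, ‖f x‖ ≤ C) :
    (ν.withDensityᵥ b).integral f (ContinuousLinearMap.mul ℝ ℂ) = ∫ x, f x * b x ∂ν := by
  have hvar : (ν.withDensityᵥ b).variation = ν.withDensity fun x => ‖b x‖ₑ :=
    Measure.variation_withDensityᵥ hb
  have hfin : IsFiniteMeasure (ν.withDensityᵥ b).variation := by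
    rw [hvar]
    exact isFiniteMeasure_withDensity hb.2.ne
  -- Both sides are linear in the integrand, so the formula is checked on simple functions and
  -- extended by dominated convergence on each side.
  have hsimple : ∀ g : SimpleFunc X ℂ,
      (ν.withDensityᵥ b).integral g (ContinuousLinearMap.mul ℝ ℂ) = ∫ x, g x * b x ∂ν := by
    intro g
    induction g using SimpleFunc.induction with
    | const c hs =>
      rename_i s
      have e1 : ((SimpleFunc.piecewise s hs (SimpleFunc.const X c) (SimpleFunc.const X 0)
          : SimpleFunc X ℂ) : X → ℂ) = s.indicator fun _ => c := by
        ext x; by_cases hx : x ∈ s <;> simp [hx]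
      rw [e1, VectorMeasure.integral_indicator_const c hs, withDensityᵥ_apply hb hs]
      rw [show (fun x => s.indicator (fun _ => c) x * b x) = s.indicator fun x => c * b x by
        ext x; by_cases hx : x ∈ s <;> simp [hx]]
      rw [integral_indicator hs, integral_const_mul]
      simp
    | add hfg h1 h2 =>
      rename_i f g
      have i1 : ∀ f : SimpleFunc X ℂ, (ν.withDensityᵥ b).Integrable f := fun f =>
        SimpleFunc.integrable_of_isFiniteMeasure f
      have i2 : ∀ f : SimpleFunc X ℂ, Integrable (fun x => f x * b x) ν := by
        intro f
        obtain ⟨C, hC⟩ := f.exists_forall_norm_le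
        exact hb.bdd_mul f.aestronglyMeasurable (Eventually.of_forall hC)
      rw [SimpleFunc.coe_add]
      rw [VectorMeasure.integral_add (i1 f) (i1 g), h1, h2]
      simp only [Pi.add_apply, add_mul]
      rw [integral_add (i2 f) (i2 g)]
  rcases isEmpty_or_nonempty X with hX | ⟨⟨x0⟩⟩
  · simp [VectorMeasure.integral_of_isEmpty, integral_of_isEmpty]
  have hC0 : 0 ≤ C := (norm_nonneg _).trans (hC x0)
  have l1 : Tendsto (fun n => (ν.withDensityᵥ b).integral (hf.approxBounded C n)
      (ContinuousLinearMap.mul ℝ ℂ)) atTop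
      (𝓝 ((ν.withDensityᵥ b).integral f (ContinuousLinearMap.mul ℝ ℂ))) :=
    VectorMeasure.tendsto_integral_of_dominated_convergence (fun _ => C)
      (fun n => (hf.approxBounded C n).aestronglyMeasurable) (integrable_const _)
      (fun n => Eventually.of_forall fun x => hf.norm_approxBounded_le hC0 n x)
      (Eventually.of_forall fun x => hf.tendsto_approxBounded_of_norm_le (hC x))
  have l2 := tendsto_integral_of_dominated_convergence (μ := ν)
    (F := fun n x => hf.approxBounded C n x * b x) (f := fun x => f x * b x)
    (fun x => C * ‖b x‖)
    (fun n => (hf.approxBounded C n).aestronglyMeasurable.mul hb.1) (hb.norm.const_mul C)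
    (fun n => Eventually.of_forall fun x => by
      rw [norm_mul]
      exact mul_le_mul_of_nonneg_right (hf.norm_approxBounded_le hC0 n x) (norm_nonneg _))
    (Eventually.of_forall fun x => (hf.tendsto_approxBounded_of_norm_le (hC x)).mul_const _)
  simp_rw [hsimple] at l1
  exact tendsto_nhds_unique l1 l2

theorem boundedVariationOn_of_dist_le {f : ℝ≥0 → ℂ} {V : ℝ≥0 → ℝ} {C : ℝ}
    (hV : ∀ x, |V x| ≤ C) (hf : ∀ x y, x ≤ y → ‖f y - f x‖ ≤ V y - V x) :
    BoundedVariationOn f Set.univ := by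
  have hmono : Monotone V := fun x y h => by linarith [norm_nonneg (f y - f x), hf x y h]
  have : eVariationOn f Set.univ ≤ ENNReal.ofReal (2 * C) := by
    refine iSup_le fun p => ?_
    calc ∑ i ∈ Finset.range p.1, edist (f (p.2.1 (i + 1))) (f (p.2.1 i))
        ≤ ∑ i ∈ Finset.range p.1, ENNReal.ofReal (V (p.2.1 (i + 1)) - V (p.2.1 i)) := by
          refine Finset.sum_le_sum fun i _ => ?_
          rw [edist_dist, dist_eq_norm]
          exact ENNReal.ofReal_le_ofReal (hf _ _ (p.2.2.1 (Nat.le_succ i)))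
      _ = ENNReal.ofReal (V (p.2.1 p.1) - V (p.2.1 0)) := by
          rw [← ENNReal.ofReal_sum_of_nonneg
            (fun i _ => sub_nonneg.2 (hmono (p.2.2.1 (Nat.le_succ i)))),
            Finset.sum_range_sub (fun i => V (p.2.1 i))]
      _ ≤ ENNReal.ofReal (2 * C) := by
          apply ENNReal.ofReal_le_ofReal
          have h1 := abs_le.1 (hV (p.2.1 p.1))
          have h2 := abs_le.1 (hV (p.2.1 0))
          linarith
  exact (this.trans_lt ENNReal.ofReal_lt_top).ne

/-- The next point of the grid of mesh 1/(n+1) lies strictly to the right of u. Evaluating a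
right-continuous path there involves only countably many times, which is how measurability in time
is obtained. -/
theorem tendsto_floor_add_one_div (u : ℝ≥0) :
    Tendsto (fun n : ℕ => ((⌊(n + 1 : ℝ≥0) * u⌋₊ + 1 : ℝ≥0)) / (n + 1 : ℝ≥0)) atTop (𝓝[>] u) := by
  have hgt : ∀ n : ℕ, u < ((⌊(n + 1 : ℝ≥0) * u⌋₊ + 1 : ℝ≥0)) / (n + 1 : ℝ≥0) := by
    intro n
    rw [lt_div_iff₀ (by positivity), mul_comm]
    exact Nat.lt_floor_add_one _
  refine tendsto_nhdsWithin_iff.2 ⟨?_, Eventually.of_forall hgt⟩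
  refine tendsto_of_tendsto_of_tendsto_of_le_of_le (g := fun _ => u)
    (h := fun n : ℕ => u + 1 / ((n : ℝ≥0) + 1)) tendsto_const_nhds ?_ (fun n => (hgt n).le) ?_
  · simpa using tendsto_const_nhds.add (tendsto_one_div_add_atTop_nhds_zero_nat (𝕜 := ℝ≥0))
  · intro n
    dsimp only
    rw [div_le_iff₀ (by positivity), add_mul u, one_div,
      inv_mul_cancel₀ (by positivity), mul_comm u]
    gcongr
    exact Nat.floor_le (by positivity)

/-- A function on `[0, ∞)` which is right-continuous is Borel measurable. -/
theorem measurable_of_right_continuous {E : Type*} [TopologicalSpace E]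
    [TopologicalSpace.PseudoMetrizableSpace E] [MeasurableSpace E] [BorelSpace E] {f : ℝ≥0 → E}
    (hf : ∀ t, Tendsto f (𝓝[>] t) (𝓝 (f t))) : Measurable f := by
  refine measurable_of_tendsto_metrizable (f := fun (n : ℕ) (u : ℝ≥0) =>
    f (((⌊(n + 1 : ℝ≥0) * u⌋₊ + 1 : ℝ≥0)) / (n + 1 : ℝ≥0))) ?_ ?_
  · intro n
    have h1 : Measurable fun m : ℕ => f ((m + 1 : ℝ≥0) / (n + 1 : ℝ≥0)) := measurable_from_top
    exact h1.comp (Nat.measurable_floor.comp (measurable_const_mul _))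
  · rw [tendsto_pi_nhds]
    exact fun u => (hf u).comp (tendsto_floor_add_one_div u)

theorem intervalIntegrable_of_bdd {b : ℝ≥0 → ℂ} (hb : Measurable b) {T : ℝ≥0} {C : ℝ}
    (hC : ∀ u ≤ T, ‖b u‖ ≤ C) {x y : ℝ} (hx : x ≤ T) (hy : y ≤ T) :
    IntervalIntegrable (fun u : ℝ => b u.toNNReal) volume x y := by
  have hm : Measurable fun u : ℝ => b u.toNNReal := hb.comp measurable_real_toNNReal
  have : IntegrableOn (fun u : ℝ => b u.toNNReal) (Set.uIoc x y) volume := by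
    refine Measure.integrableOn_of_bounded (M := C) (by simp) hm.aestronglyMeasurable ?_
    refine (ae_restrict_mem measurableSet_uIoc).mono fun u hu => hC _ ?_
    rw [Real.toNNReal_le_iff_le_coe]
    exact hu.2.trans (max_le hx hy)
  exact intervalIntegrable_iff.2 this

theorem sum_filter_le_split {M : Type*} [AddCommMonoid M] (J : Finset ℝ≥0) (a : ℝ≥0 → M)
    {x y : ℝ≥0} (hxy : x ≤ y) : ∑ ρ ∈ J with ρ ≤ y, a ρ =
      ∑ ρ ∈ J with ρ ≤ x, a ρ + ∑ ρ ∈ J with x < ρ ∧ ρ ≤ y, a ρ := by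
  rw [← Finset.sum_union]
  · congr 1
    ext ρ
    simp only [Finset.mem_filter, Finset.mem_union]
    constructor
    · rintro ⟨h, h'⟩
      rcases le_or_gt ρ x with h2 | h2
      · exact Or.inl ⟨h, h2⟩
      · exact Or.inr ⟨h, h2, h'⟩
    · rintro (⟨h, h'⟩ | ⟨h, h', h''⟩)
      · exact ⟨h, h'.trans hxy⟩
      · exact ⟨h, h''⟩
  · rw [Finset.disjoint_filter]
    rintro ρ - h1 ⟨h2, -⟩
    exact absurd h1 (not_le.2 h2)

theorem vectorMeasure_sum_apply {X ι : Type*} {mX : MeasurableSpace X} (J : Finset ι)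
    (v : ι → VectorMeasure X ℂ) (A : Set X) : (∑ i ∈ J, v i) A = ∑ i ∈ J, v i A := by
  classical
  induction J using Finset.induction_on with
  | empty => simp
  | insert i J hi ih => rw [Finset.sum_insert hi, Finset.sum_insert hi, add_apply, ih]

/-- The vector measure of the stopped path is a sum of point masses plus a density. The two measures
are compared on half-open intervals, which are stable under nonempty intersections and generate the
Borel σ-algebra. -/
theorem stieltjes_eq {g : ℝ≥0 → ℂ} {s : ℝ≥0} {J : Finset ℝ≥0} {a b f : ℝ≥0 → ℂ} {C C' : ℝ}
    (hJ : ∀ ρ ∈ J, 0 < ρ ∧ ρ ≤ s) (hb : Measurable b) (hbC : ∀ u ≤ s, ‖b u‖ ≤ C)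
    (hg : ∀ r ≤ s, g r = g 0 + ∑ ρ ∈ J with ρ ≤ r, a ρ + ∫ u in (0 : ℝ)..r, b u.toNNReal)
    (hf : Measurable f) (hfC : ∀ u ≤ s, ‖f u‖ ≤ C') :
    stieltjes f g s = ∑ ρ ∈ J, f ρ * a ρ + ∫ u in (0 : ℝ)..s, f u.toNNReal * b u.toNNReal := by
  have hbm : Measurable fun u : ℝ => b u.toNNReal := hb.comp measurable_real_toNNReal
  have hbi : ∀ {x y : ℝ}, x ≤ s → y ≤ s →
      IntervalIntegrable (fun u : ℝ => b u.toNNReal) volume x y :=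
    fun hx hy => intervalIntegrable_of_bdd hb hbC hx hy
  have hsplit : ∀ x y : ℝ≥0, x ≤ y → y ≤ s →
      g y - g x = ∑ ρ ∈ J with x < ρ ∧ ρ ≤ y, a ρ + ∫ u in (x : ℝ)..y, b u.toNNReal := by
    intro x y hxy hys
    rw [hg y hys, hg x (hxy.trans hys)]
    have h1 := sum_filter_le_split J a hxy
    have h2 := intervalIntegral.integral_add_adjacent_intervals (a := (0 : ℝ)) (b := (x : ℝ))
      (c := (y : ℝ)) (hbi s.2 (by exact_mod_cast hxy.trans hys))
      (hbi (by exact_mod_cast hxy.trans hys) (by exact_mod_cast hys))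
    rw [h1, ← h2]
    ring
  have hBV : BoundedVariationOn (fun r => g (min r s)) Set.univ := by
    -- The dominating function is the variation accumulated so far: the moduli of the past jumps
    -- plus `C` times the elapsed time.
    refine boundedVariationOn_of_dist_le (C := ∑ ρ ∈ J, ‖a ρ‖ + C * s)
      (V := fun r => ∑ ρ ∈ J with ρ ≤ min r s, ‖a ρ‖ + C * (min r s : ℝ≥0)) ?_ ?_
    · intro r
      have hC0 : 0 ≤ C := (norm_nonneg _).trans (hbC 0 bot_le)
      rw [abs_of_nonneg (by positivity)]
      refine add_le_add (Finset.sum_le_sum_of_subset_of_nonneg (Finset.filter_subset _ _)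
        fun _ _ _ => norm_nonneg _) (mul_le_mul_of_nonneg_left ?_ hC0)
      exact_mod_cast min_le_right r s
    · intro x y hxy
      have hm : min x s ≤ min y s := min_le_min_right s hxy
      rw [hsplit _ _ hm (min_le_right _ _)]
      have h1 := sum_filter_le_split J (fun ρ => ‖a ρ‖) hm
      rw [h1]
      have h2 : ‖∫ u in ((min x s : ℝ≥0) : ℝ)..(min y s : ℝ≥0), b u.toNNReal‖ ≤
          C * |((min y s : ℝ≥0) : ℝ) - (min x s : ℝ≥0)| := by
        refine intervalIntegral.norm_integral_le_of_norm_le_const fun u hu => hbC _ ?_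
        rw [Real.toNNReal_le_iff_le_coe]
        rw [Set.uIoc_of_le (by exact_mod_cast hm)] at hu
        exact hu.2.trans (by exact_mod_cast min_le_right y s)
      rw [abs_of_nonneg (sub_nonneg.2 (by exact_mod_cast hm))] at h2
      have h3 := norm_add_le (∑ ρ ∈ J with min x s < ρ ∧ ρ ≤ min y s, a ρ)
        (∫ u in ((min x s : ℝ≥0) : ℝ)..(min y s : ℝ≥0), b u.toNNReal)
      have h4 := norm_sum_le (Finset.filter (fun ρ => min x s < ρ ∧ ρ ≤ min y s) J) a
      linarith
  -- Lebesgue measure on (0, s], transported to `ℝ≥0`.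
  set ν : Measure ℝ≥0 := (volume.restrict (Set.Ioc (0 : ℝ) s)).map Real.toNNReal with hν
  have hbν : Integrable b ν := by
    rw [hν, integrable_map_measure hb.aestronglyMeasurable measurable_real_toNNReal.aemeasurable]
    exact (intervalIntegrable_iff_integrableOn_Ioc_of_le s.2).1 (hbi s.2 le_rfl)
  have hae : ∀ᵐ u ∂ν, u ∈ Set.Ioc 0 s := by
    rw [hν]
    refine (ae_map_iff measurable_real_toNNReal.aemeasurable measurableSet_Ioc).2 ?_
    refine (ae_restrict_mem measurableSet_Ioc).mono fun u hu => ?_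
    exact ⟨by simpa using hu.1, by rw [Real.toNNReal_le_iff_le_coe]; exact hu.2⟩
  have hmeas : hBV.vectorMeasure.restrict (Set.Ioc 0 s) =
      ∑ ρ ∈ J, VectorMeasure.dirac ρ (a ρ) + ν.withDensityᵥ b := by
    -- The vector measure of a function of bounded variation is expressed through right limits, so
    -- right-continuity of the stopped path is needed to read off its increments.
    have hrc : ∀ x : ℝ≥0, (fun r => g (min r s)).rightLim x = g (min x s) := by
      intro x
      have hcont : ContinuousWithinAt (fun r => g (min r s)) (Set.Ioi x) x := by
        rcases lt_or_ge x s with hxs | hxs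
        · have h0 : ∀ᶠ y in 𝓝[>] x, (∀ ρ ∈ J, ¬ (x < ρ ∧ ρ ≤ y)) ∧ y < s ∧ x < y := by
            refine Filter.Eventually.and ?_ (Filter.Eventually.and ?_ self_mem_nhdsWithin)
            · rw [Finset.eventually_all]
              intro ρ hρ
              rcases le_or_gt ρ x with h | h
              · exact Eventually.of_forall fun y hy => absurd h (not_le.2 hy.1)
              · filter_upwards [Ioo_mem_nhdsGT h] with y hy h'
                exact absurd h'.2 (not_le.2 hy.2)
            · exact nhdsWithin_le_nhds (Iio_mem_nhds hxs)
          have h1 : Tendsto (fun y : ℝ≥0 => g x + ∫ u in (x : ℝ)..y, b u.toNNReal) (𝓝[>] x)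
              (𝓝 (g x + 0)) := by
            refine tendsto_const_nhds.add ?_
            have hC0 : 0 ≤ C := (norm_nonneg _).trans (hbC 0 bot_le)
            refine squeeze_zero_norm' (a := fun y : ℝ≥0 => C * |(y : ℝ) - x|) ?_ ?_
            · filter_upwards [h0] with y hy
              refine intervalIntegral.norm_integral_le_of_norm_le_const fun u hu => hbC _ ?_
              rw [Real.toNNReal_le_iff_le_coe]
              rw [Set.uIoc_of_le (by exact_mod_cast hy.2.2.le)] at hu
              exact hu.2.trans (by exact_mod_cast hy.2.1.le)
            · have : Tendsto (fun y : ℝ≥0 => C * |(y : ℝ) - x|) (𝓝 x) (𝓝 (C * |(x : ℝ) - x|)) := by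
                refine Continuous.tendsto ?_ x
                fun_prop
              simpa using this.mono_left nhdsWithin_le_nhds
          rw [add_zero] at h1
          change Tendsto _ _ (𝓝 (g (min x s)))
          rw [show min x s = x from min_eq_left hxs.le]
          refine h1.congr' ?_
          filter_upwards [h0] with y hy
          have := hsplit x y hy.2.2.le hy.2.1.le
          rw [Finset.filter_false_of_mem (fun ρ hρ => hy.1 ρ hρ), Finset.sum_empty,
            zero_add] at this
          rw [min_eq_left hy.2.1.le, ← this]
          ring
        · have : (fun r => g (min r s)) =ᶠ[𝓝[>] x] fun _ => g (min x s) := by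
            filter_upwards [self_mem_nhdsWithin] with y hy
            rw [min_eq_right (hxs.trans (le_of_lt hy)), min_eq_right hxs]
          exact (tendsto_const_nhds.congr' this.symm)
      exact (continuousWithinAt_Ioi_iff_Ici.1 hcont).rightLim_eq
    have hIoc : ∀ u v : ℝ≥0, u ≤ v → hBV.vectorMeasure.restrict (Set.Ioc 0 s) (Set.Ioc u v) =
        (∑ ρ ∈ J, VectorMeasure.dirac ρ (a ρ) + ν.withDensityᵥ b) (Set.Ioc u v) := by
      intro u v huv
      have hset : Set.Ioc u v ∩ Set.Ioc 0 s = Set.Ioc (min u s) (min v s) := by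
        ext z
        simp only [Set.mem_inter_iff, Set.mem_Ioc, min_lt_iff, le_min_iff]
        constructor
        · rintro ⟨⟨h1, h2⟩, -, h4⟩
          exact ⟨Or.inl h1, h2, h4⟩
        · rintro ⟨h1, h2, h4⟩
          have h5 : u < z := h1.resolve_right (not_lt.2 h4)
          exact ⟨⟨h5, h2⟩, bot_le.trans_lt h5, h4⟩
      have hm : min u s ≤ min v s := min_le_min_right s huv
      rw [VectorMeasure.restrict_apply _ measurableSet_Ioc measurableSet_Ioc, hset,
        hBV.vectorMeasure_Ioc hm, hrc, hrc, min_eq_left (min_le_right u s),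
        min_eq_left (min_le_right v s), hsplit _ _ hm (min_le_right v s),
        add_apply, withDensityᵥ_apply hbν measurableSet_Ioc]
      congr 1
      · rw [Finset.sum_filter, vectorMeasure_sum_apply]
        refine Finset.sum_congr rfl fun ρ hρ => ?_
        have hmem : (min u s < ρ ∧ ρ ≤ min v s) ↔ ρ ∈ Set.Ioc u v := by
          rw [min_lt_iff, le_min_iff, Set.mem_Ioc]
          exact ⟨fun h => ⟨h.1.resolve_right (not_lt.2 (hJ ρ hρ).2), h.2.1⟩,
            fun h => ⟨Or.inl h.1, h.2, (hJ ρ hρ).2⟩⟩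
        by_cases h : ρ ∈ Set.Ioc u v
        · rw [if_pos (hmem.2 h), VectorMeasure.dirac_apply_of_mem measurableSet_Ioc h]
        · rw [if_neg (fun h' => h (hmem.1 h')), VectorMeasure.dirac_apply_of_notMem h]
      · rw [hν, setIntegral_map measurableSet_Ioc hb.aestronglyMeasurable
          measurable_real_toNNReal.aemeasurable,
          Measure.restrict_restrict (measurable_real_toNNReal measurableSet_Ioc),
          intervalIntegral.integral_of_le (by exact_mod_cast hm)]
        congr 2
        ext z
        simp only [Set.mem_inter_iff, Set.mem_Ioc, Set.mem_preimage, NNReal.coe_min, min_lt_iff,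
          le_min_iff, Real.lt_toNNReal_iff_coe_lt, Real.toNNReal_le_iff_le_coe]
        constructor
        · rintro ⟨h1, h2, h4⟩
          have h5 : (u : ℝ) < z := h1.resolve_right (not_lt.2 h4)
          exact ⟨⟨h5, h2⟩, u.2.trans_lt h5, h4⟩
        · rintro ⟨⟨h1, h2⟩, -, h4⟩
          exact ⟨Or.inl h1, h2, h4⟩
    refine VectorMeasure.ext_of_generateFrom {S : Set ℝ≥0 | ∃ l u, l ≤ u ∧ Set.Ioc l u = S}
      ?_ (BorelSpace.measurable_eq.trans (borel_eq_generateFrom_Ioc_le ℝ≥0)) ?_ ?_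
    · rintro _ ⟨u, v, huv, rfl⟩
      exact hIoc u v huv
    · rintro _ ⟨u, v, -, rfl⟩ _ ⟨u', v', -, rfl⟩ hne
      rw [Set.Ioc_inter_Ioc] at hne ⊢
      exact ⟨_, _, (Set.nonempty_Ioc.1 hne).le, rfl⟩
    -- The measures must also agree on the whole space. Both are carried by (0, s], which is one of
    -- the intervals already treated.
    · have h0 := hIoc 0 s bot_le
      rw [VectorMeasure.restrict_apply _ measurableSet_Ioc measurableSet_Ioc, Set.inter_self] at h0
      rw [VectorMeasure.restrict_apply_univ, h0, add_apply,
        add_apply, withDensityᵥ_apply hbν measurableSet_Ioc,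
        withDensityᵥ_apply hbν MeasurableSet.univ, vectorMeasure_sum_apply,
        vectorMeasure_sum_apply]
      congr 1
      · refine Finset.sum_congr rfl fun ρ hρ => ?_
        rw [VectorMeasure.dirac_apply_of_mem measurableSet_Ioc (hJ ρ hρ),
          VectorMeasure.dirac_apply_of_mem MeasurableSet.univ (Set.mem_univ _)]
      · rw [Measure.restrict_eq_self_of_ae_mem hae, Measure.restrict_univ]
  -- Nothing bounds `f` beyond s. Cutting it off there leaves the integral unchanged and makes it
  -- globally bounded.
  have hcongr : stieltjes f g s =
      (hBV.vectorMeasure.restrict (Set.Ioc 0 s)).integral (Set.indicator (Set.Iic s) f)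
        (ContinuousLinearMap.mul ℝ ℂ) := by
    rw [stieltjes, dif_pos hBV]
    refine VectorMeasure.setIntegral_congr_fun fun x hx => ?_
    rw [Set.indicator_of_mem (show x ∈ Set.Iic s from hx.2)]
  have hfm : StronglyMeasurable (Set.indicator (Set.Iic s) f) :=
    (hf.indicator measurableSet_Iic).stronglyMeasurable
  have hC'0 : 0 ≤ C' := (norm_nonneg _).trans (hfC 0 bot_le)
  have hfb : ∀ x, ‖Set.indicator (Set.Iic s) f x‖ ≤ C' := by
    intro x
    by_cases hx : x ∈ Set.Iic s
    · rw [Set.indicator_of_mem hx]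
      exact hfC x hx
    · rw [Set.indicator_of_notMem hx, norm_zero]
      exact hC'0
  have hid : ∀ ρ ∈ J, (VectorMeasure.dirac ρ (a ρ)).Integrable (Set.indicator (Set.Iic s) f) := by
    intro ρ _
    have : IsFiniteMeasure (VectorMeasure.dirac ρ (a ρ)).variation := by
      rw [VectorMeasure.variation_dirac]
      exact ⟨by simp⟩
    exact Integrable.of_bound hfm.aestronglyMeasurable C' (Eventually.of_forall hfb)
  have hiw : (ν.withDensityᵥ b).Integrable (Set.indicator (Set.Iic s) f) := by
    have : IsFiniteMeasure (ν.withDensityᵥ b).variation := by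
      rw [Measure.variation_withDensityᵥ hbν]
      exact isFiniteMeasure_withDensity hbν.2.ne
    exact Integrable.of_bound hfm.aestronglyMeasurable C' (Eventually.of_forall hfb)
  rw [hcongr, hmeas, VectorMeasure.integral_add_vectorMeasure
    (VectorMeasure.Integrable.finsetSum_vectorMeasure hid) hiw,
    VectorMeasure.integral_finsetSum_vectorMeasure hid, integral_withDensityVec ν hbν hfm hfb]
  congr 1
  · refine Finset.sum_congr rfl fun ρ hρ => ?_
    rw [VectorMeasure.integral_dirac, Set.indicator_of_mem (show ρ ∈ Set.Iic s from (hJ ρ hρ).2)]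
    rfl
  · have hfb' : AEStronglyMeasurable (fun x => Set.indicator (Set.Iic s) f x * b x)
        (Measure.map Real.toNNReal (volume.restrict (Set.Ioc (0 : ℝ) s))) :=
      hfm.aestronglyMeasurable.mul hb.aestronglyMeasurable
    rw [hν, integral_map measurable_real_toNNReal.aemeasurable hfb',
      intervalIntegral.integral_of_le (NNReal.coe_nonneg s)]
    refine setIntegral_congr_fun measurableSet_Ioc fun u hu => ?_
    have : u.toNNReal ∈ Set.Iic s := by
      rw [Set.mem_Iic, Real.toNNReal_le_iff_le_coe]
      exact hu.2
    simp only [Set.indicator_of_mem this]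

/-! ### Calculus of paths with locally finitely many jumps -/

/-- `J s` is the finite set of jump times in `(0, s]`. -/
structure IsJumpTimes (J : ℝ≥0 → Finset ℝ≥0) : Prop where
  mem : ∀ s, ∀ ρ ∈ J s, 0 < ρ ∧ ρ ≤ s
  filter : ∀ s t, s ≤ t → J s = (J t).filter (· ≤ s)

/-- `X` starts from zero, jumps by `a ρ` at the jump times `ρ`, and has derivative `b` otherwise. -/
structure JumpPath (J : ℝ≥0 → Finset ℝ≥0) (X a b : ℝ≥0 → ℂ) : Prop where
  eq : ∀ s : ℝ≥0, X s = ∑ ρ ∈ J s, a ρ + ∫ u in (0 : ℝ)..s, b u.toNNReal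
  supp : ∀ ρ, ρ ∉ J ρ → a ρ = 0
  rc : ∀ s, Tendsto b (𝓝[>] s) (𝓝 (b s))
  bdd : ∀ T, ∃ C, ∀ u ≤ T, ‖b u‖ ≤ C

theorem IsJumpTimes.eventually_right {J : ℝ≥0 → Finset ℝ≥0} (hJ : IsJumpTimes J) (s : ℝ≥0) :
    ∀ᶠ y in 𝓝[>] s, J y = J s := by
  have h1 : ∀ᶠ y in 𝓝[>] s, ∀ ρ ∈ J (s + 1), ¬ (s < ρ ∧ ρ ≤ y) := by
    rw [Finset.eventually_all]
    intro ρ _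
    rcases le_or_gt ρ s with h | h
    · exact Eventually.of_forall fun y hy => absurd h (not_le.2 hy.1)
    · filter_upwards [Ioo_mem_nhdsGT h] with y hy h'
      exact absurd h'.2 (not_le.2 hy.2)
  filter_upwards [h1, Ioo_mem_nhdsGT (lt_add_one s)] with y hy hy'
  rw [hJ.filter y (s + 1) hy'.2.le, hJ.filter s (s + 1) (le_add_of_nonneg_right zero_le_one)]
  refine Finset.filter_congr fun ρ hρ => ⟨fun h => ?_, fun h => h.trans hy'.1.le⟩
  by_contra hlt
  exact hy ρ hρ ⟨not_le.1 hlt, h⟩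

theorem IsJumpTimes.eventually_left {J : ℝ≥0 → Finset ℝ≥0} (hJ : IsJumpTimes J) (s : ℝ≥0) :
    ∀ᶠ y in 𝓝[<] s, J y = (J s).erase s := by
  have h1 : ∀ᶠ y in 𝓝[<] s, ∀ ρ ∈ J s, ρ < s → ρ ≤ y := by
    rw [Finset.eventually_all]
    intro ρ _
    rcases le_or_gt s ρ with h | h
    · exact Eventually.of_forall fun y hy => absurd h (not_le.2 hy)
    · filter_upwards [Ioo_mem_nhdsLT h] with y hy _ using hy.1.le
  filter_upwards [h1, self_mem_nhdsWithin] with y hy hy'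
  rw [hJ.filter y s (le_of_lt hy')]
  ext ρ
  simp only [Finset.mem_filter, Finset.mem_erase]
  constructor
  · rintro ⟨h, h'⟩
    exact ⟨(h'.trans_lt hy').ne, h⟩
  · rintro ⟨h, h'⟩
    exact ⟨h', hy ρ h' (lt_of_le_of_ne (hJ.mem s ρ h').2 h)⟩

theorem tendsto_toNNReal_Ioi (s : ℝ≥0) :
    Tendsto Real.toNNReal (𝓝[>] (s : ℝ)) (𝓝[>] s) := by
  refine tendsto_nhdsWithin_iff.2 ⟨?_, ?_⟩
  · have := (continuous_real_toNNReal.tendsto (s : ℝ)).mono_left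
      (nhdsWithin_le_nhds (s := Set.Ioi (s : ℝ)))
    rwa [Real.toNNReal_coe] at this
  · filter_upwards [self_mem_nhdsWithin] with y hy
    rw [Set.mem_Ioi, Real.lt_toNNReal_iff_coe_lt]
    exact hy

theorem tendsto_coe_Ioi (s : ℝ≥0) :
    Tendsto (fun y : ℝ≥0 => (y : ℝ)) (𝓝[>] s) (𝓝[>] (s : ℝ)) := by
  refine tendsto_nhdsWithin_iff.2
    ⟨(NNReal.continuous_coe.tendsto s).mono_left nhdsWithin_le_nhds, ?_⟩
  filter_upwards [self_mem_nhdsWithin] with y hy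
  exact NNReal.coe_lt_coe.2 hy

namespace JumpPath

variable {J : ℝ≥0 → Finset ℝ≥0} {X a b Y a' b' : ℝ≥0 → ℂ}

theorem measurable_drift (h : JumpPath J X a b) : Measurable b :=
  measurable_of_right_continuous h.rc

theorem intervalIntegrable (h : JumpPath J X a b) (x y : ℝ) :
    IntervalIntegrable (fun u : ℝ => b u.toNNReal) volume x y := by
  obtain ⟨C, hC⟩ := h.bdd (max x y).toNNReal
  exact intervalIntegrable_of_bdd h.measurable_drift hC
    ((le_max_left x y).trans (Real.le_coe_toNNReal _))
    ((le_max_right x y).trans (Real.le_coe_toNNReal _))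

theorem zero (hJ : IsJumpTimes J) (h : JumpPath J X a b) : X 0 = 0 := by
  have h0 : J 0 = ∅ := by
    refine Finset.eq_empty_of_forall_notMem fun ρ hρ => ?_
    have := hJ.mem 0 ρ hρ
    exact absurd this.1 (not_lt.2 this.2)
  rw [h.eq 0, h0]
  simp

theorem bdd_path (hJ : IsJumpTimes J) (h : JumpPath J X a b) (T : ℝ≥0) :
    ∃ C, ∀ u ≤ T, ‖X u‖ ≤ C := by
  obtain ⟨C, hC⟩ := h.bdd T
  have hC0 : 0 ≤ C := (norm_nonneg _).trans (hC 0 bot_le)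
  refine ⟨∑ ρ ∈ J T, ‖a ρ‖ + C * T, fun u hu => ?_⟩
  rw [h.eq u]
  refine (norm_add_le _ _).trans (add_le_add ?_ ?_)
  · refine (norm_sum_le _ _).trans (Finset.sum_le_sum_of_subset_of_nonneg ?_
      fun _ _ _ => norm_nonneg _)
    rw [hJ.filter u T hu]
    exact Finset.filter_subset _ _
  · have : ‖∫ v in (0 : ℝ)..u, b v.toNNReal‖ ≤ C * |(u : ℝ) - 0| := by
      refine intervalIntegral.norm_integral_le_of_norm_le_const fun v hv => hC _ ?_
      rw [Set.uIoc_of_le (NNReal.coe_nonneg u)] at hv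
      rw [Real.toNNReal_le_iff_le_coe]
      exact hv.2.trans (by exact_mod_cast hu)
    refine this.trans (mul_le_mul_of_nonneg_left ?_ hC0)
    rw [sub_zero, NNReal.abs_eq]
    exact_mod_cast hu

/-- No jump occurs immediately after s, so to the right of s the path is a constant plus the
primitive of the right-continuous drift. -/
theorem hasDerivWithinAt (hJ : IsJumpTimes J) (h : JumpPath J X a b) (s : ℝ≥0) :
    HasDerivWithinAt (fun u : ℝ => X u.toNNReal) (b s) (Set.Ici (s : ℝ)) s := by
  have hrc : ContinuousWithinAt (fun u : ℝ => b u.toNNReal) (Set.Ioi (s : ℝ)) s := by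
    change Tendsto _ _ (𝓝 (b (s : ℝ).toNNReal))
    rw [Real.toNNReal_coe]
    exact (h.rc s).comp (tendsto_toNNReal_Ioi s)
  have h1 : HasDerivWithinAt (fun u : ℝ => ∫ v in (0 : ℝ)..u, b v.toNNReal)
      (b (s : ℝ).toNNReal) (Set.Ici (s : ℝ)) s :=
    intervalIntegral.integral_hasDerivWithinAt_right (h.intervalIntegrable 0 s)
      ((h.measurable_drift.comp measurable_real_toNNReal).stronglyMeasurable.stronglyMeasurableAtFilter)
      hrc
  rw [Real.toNNReal_coe] at h1
  have h2 := h1.const_add (∑ ρ ∈ J s, a ρ)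
  refine h2.congr_of_eventuallyEq ?_ ?_
  · have h3 : ∀ᶠ u in 𝓝[>] (s : ℝ), J u.toNNReal = J s :=
      (tendsto_toNNReal_Ioi s).eventually (hJ.eventually_right s)
    rw [← Set.Ioi_insert, nhdsWithin_insert]
    refine Filter.eventually_sup.2 ⟨?_, ?_⟩
    · simp only [eventually_pure]
      rw [h.eq, Real.toNNReal_coe]
    · filter_upwards [h3, self_mem_nhdsWithin] with u hu hu'
      rw [h.eq, hu, Real.coe_toNNReal u (s.2.trans (le_of_lt hu'))]
  · rw [h.eq, Real.toNNReal_coe]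

theorem tendsto_right (hJ : IsJumpTimes J) (h : JumpPath J X a b) (s : ℝ≥0) :
    Tendsto X (𝓝[>] s) (𝓝 (X s)) := by
  have h1 := ((h.hasDerivWithinAt hJ s).continuousWithinAt.mono Set.Ioi_subset_Ici_self)
  have h2 := Tendsto.comp h1 (tendsto_coe_Ioi s)
  simp only [Real.toNNReal_coe] at h2
  refine h2.congr fun y => ?_
  simp

theorem measurable (hJ : IsJumpTimes J) (h : JumpPath J X a b) : Measurable X :=
  measurable_of_right_continuous (h.tendsto_right hJ)

theorem tendsto_left (hJ : IsJumpTimes J) (h : JumpPath J X a b) (s : ℝ≥0) :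
    Tendsto X (𝓝[<] s) (𝓝 (X s - a s)) := by
  obtain ⟨C, hC⟩ := h.bdd s
  have h1 : Tendsto (fun y : ℝ≥0 => ∑ ρ ∈ (J s).erase s, a ρ + ∫ u in (0 : ℝ)..y, b u.toNNReal)
      (𝓝[<] s) (𝓝 (∑ ρ ∈ (J s).erase s, a ρ + ∫ u in (0 : ℝ)..s, b u.toNNReal)) := by
    refine tendsto_const_nhds.add ?_
    have hc : Continuous fun y : ℝ => ∫ u in (0 : ℝ)..y, b u.toNNReal :=
      intervalIntegral.continuous_primitive (fun x y => h.intervalIntegrable x y) 0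
    exact ((hc.comp NNReal.continuous_coe).tendsto s).mono_left nhdsWithin_le_nhds
  have h2 : X s - a s = ∑ ρ ∈ (J s).erase s, a ρ + ∫ u in (0 : ℝ)..s, b u.toNNReal := by
    rw [h.eq s]
    by_cases hs : s ∈ J s
    · rw [← Finset.add_sum_erase _ _ hs]
      ring
    · rw [h.supp s hs, Finset.erase_eq_of_notMem hs, sub_zero]
  rw [h2]
  refine h1.congr' ?_
  filter_upwards [hJ.eventually_left s] with y hy
  rw [h.eq y, hy]

theorem leftLim_eq (hJ : IsJumpTimes J) (h : JumpPath J X a b) (s : ℝ≥0) :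
    Function.leftLim X s = X s - a s := by
  -- At time zero there is no left neighbourhood and `Function.leftLim` returns the value itself;
  -- this is consistent because zero is never a jump time.
  by_cases hs : s = 0
  · subst hs
    have h0 : (0 : ℝ≥0) ∉ J 0 := fun h' => absurd (hJ.mem 0 0 h').1 (lt_irrefl _)
    rw [leftLim_eq_of_isBot (a := (0 : ℝ≥0)) (fun _ => bot_le), h.supp 0 h0, sub_zero]
  · have hpos : 0 < s := bot_lt_iff_ne_bot.2 hs
    have : (𝓝[<] s).NeBot := by
      have hcl : closure (Set.Iio s) = Set.Iic s := closure_Iio' ⟨0, hpos⟩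
      refine mem_closure_iff_nhdsWithin_neBot.1 ?_
      rw [hcl]
      exact Set.self_mem_Iic
    exact leftLim_eq_of_tendsto (h.tendsto_left hJ s)

/-- The uniqueness principle behind `of_local`: the right derivative gives continuity from the
right, the absence of jumps gives continuity from the left, and a continuous function with vanishing
right derivative is constant. -/
theorem eq_zero_of_continuous_of_deriv {F : ℝ≥0 → ℂ} (h0 : F 0 = 0)
    (hd : ∀ s : ℝ≥0, HasDerivWithinAt (fun u : ℝ => F u.toNNReal) 0 (Set.Ici (s : ℝ)) s)
    (hl : ∀ s, Tendsto F (𝓝[<] s) (𝓝 (F s))) (s : ℝ≥0) : F s = 0 := by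
  have hcont : ContinuousOn (fun u : ℝ => F u.toNNReal) (Set.Icc 0 (s : ℝ)) := by
    intro x hx
    lift x to ℝ≥0 using hx.1
    have hr : ContinuousWithinAt (fun u : ℝ => F u.toNNReal) (Set.Ici (x : ℝ)) x :=
      (hd x).continuousWithinAt
    have hl' : ContinuousWithinAt (fun u : ℝ => F u.toNNReal) (Set.Ico 0 (x : ℝ)) x := by
      have ht : Tendsto Real.toNNReal (𝓝[Set.Ico 0 (x : ℝ)] (x : ℝ)) (𝓝[<] x) := by
        refine tendsto_nhdsWithin_iff.2 ⟨?_, ?_⟩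
        · have := (continuous_real_toNNReal.tendsto (x : ℝ)).mono_left
            (nhdsWithin_le_nhds (s := Set.Ico 0 (x : ℝ)))
          rwa [Real.toNNReal_coe] at this
        · filter_upwards [self_mem_nhdsWithin] with y hy
          rw [Set.mem_Iio, Real.toNNReal_lt_iff_lt_coe hy.1]
          exact hy.2
      change Tendsto _ _ (𝓝 (F (x : ℝ).toNNReal))
      rw [Real.toNNReal_coe]
      exact (hl x).comp ht
    refine (hl'.union hr).mono fun y hy => ?_
    rcases lt_or_ge y x with h | h
    · exact Or.inl ⟨hy.1, h⟩
    · exact Or.inr h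
  have := constant_of_has_deriv_right_zero hcont (fun x hx => by
    lift x to ℝ≥0 using hx.1
    exact hd x) s ⟨NNReal.coe_nonneg s, le_rfl⟩
  simpa [h0] using this

/-- A path is determined by its jumps and its right derivative. -/
theorem of_local (hJ : IsJumpTimes J) (h0 : X 0 = 0)
    (hd : ∀ s : ℝ≥0, HasDerivWithinAt (fun u : ℝ => X u.toNNReal) (b s) (Set.Ici (s : ℝ)) s)
    (hl : ∀ s, Tendsto X (𝓝[<] s) (𝓝 (X s - a s)))
    (supp : ∀ ρ, ρ ∉ J ρ → a ρ = 0) (rc : ∀ s, Tendsto b (𝓝[>] s) (𝓝 (b s)))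
    (bdd : ∀ T, ∃ C, ∀ u ≤ T, ‖b u‖ ≤ C) : JumpPath J X a b := by
  have hp : JumpPath J (fun s : ℝ≥0 => ∑ ρ ∈ J s, a ρ + ∫ u in (0 : ℝ)..s, b u.toNNReal) a b :=
    ⟨fun _ => rfl, supp, rc, bdd⟩
  refine ⟨fun s => ?_, supp, rc, bdd⟩
  -- The explicit path with the same jumps and drift is subtracted; the difference neither jumps nor
  -- drifts.
  have h1 : X s - (∑ ρ ∈ J s, a ρ + ∫ u in (0 : ℝ)..s, b u.toNNReal) = 0 := by
    refine eq_zero_of_continuous_of_deriv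
      (F := fun s => X s - (∑ ρ ∈ J s, a ρ + ∫ u in (0 : ℝ)..s, b u.toNNReal)) ?_ ?_ ?_ s
    · have := hp.zero hJ
      rw [h0]
      exact (congrArg (fun z => 0 - z) this).trans (sub_zero 0)
    · intro s
      have := (hd s).sub (hp.hasDerivWithinAt hJ s)
      rw [sub_self] at this
      exact this
    · intro s
      have := (hl s).sub (hp.tendsto_left hJ s)
      rwa [sub_sub_sub_cancel_right] at this
  exact sub_eq_zero.1 h1

theorem add (h : JumpPath J X a b) (h' : JumpPath J Y a' b') :
    JumpPath J (fun s => X s + Y s) (fun s => a s + a' s) (fun s => b s + b' s) := by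
  refine ⟨fun s => ?_, fun ρ hρ => ?_, fun s => (h.rc s).add (h'.rc s), fun T => ?_⟩
  · rw [h.eq, h'.eq, Finset.sum_add_distrib,
      intervalIntegral.integral_add (h.intervalIntegrable 0 s) (h'.intervalIntegrable 0 s)]
    ring
  · rw [h.supp ρ hρ, h'.supp ρ hρ, add_zero]
  · obtain ⟨C, hC⟩ := h.bdd T
    obtain ⟨C', hC'⟩ := h'.bdd T
    exact ⟨C + C', fun u hu => (norm_add_le _ _).trans (add_le_add (hC u hu) (hC' u hu))⟩

theorem const_mul (c : ℂ) (h : JumpPath J X a b) :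
    JumpPath J (fun s => c * X s) (fun s => c * a s) (fun s => c * b s) := by
  refine ⟨fun s => ?_, fun ρ hρ => ?_, fun s => (h.rc s).const_mul c, fun T => ?_⟩
  · rw [h.eq, ← Finset.mul_sum, intervalIntegral.integral_const_mul, mul_add]
  · rw [h.supp ρ hρ, mul_zero]
  · obtain ⟨C, hC⟩ := h.bdd T
    refine ⟨‖c‖ * C, fun u hu => ?_⟩
    rw [norm_mul]
    exact mul_le_mul_of_nonneg_left (hC u hu) (norm_nonneg _)

theorem zero_path : JumpPath J (fun _ => 0) (fun _ => 0) (fun _ => 0) :=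
  ⟨fun s => by simp, fun _ _ => rfl, fun _ => tendsto_const_nhds, fun _ => ⟨0, by simp⟩⟩

theorem sum {ι : Type*} (A : Finset ι) {X a b : ι → ℝ≥0 → ℂ}
    (h : ∀ i ∈ A, JumpPath J (X i) (a i) (b i)) :
    JumpPath J (fun s => ∑ i ∈ A, X i s) (fun s => ∑ i ∈ A, a i s) (fun s => ∑ i ∈ A, b i s) := by
  classical
  induction A using Finset.induction_on with
  | empty => simpa using zero_path
  | insert i A hi ih =>
    simp only [Finset.sum_insert hi]
    exact (h i (Finset.mem_insert_self i A)).add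
      (ih fun j hj => h j (Finset.mem_insert_of_mem hj))

/-- Integration by parts. The jump of a product splits into X₋ΔY + ΔX Y₋ + ΔXΔY, and the last term
is the source of all brackets and power sums. -/
theorem mul (hJ : IsJumpTimes J) (h : JumpPath J X a b) (h' : JumpPath J Y a' b') :
    JumpPath J (fun s => X s * Y s)
      (fun s => (X s - a s) * a' s + a s * (Y s - a' s) + a s * a' s)
      (fun s => b s * Y s + X s * b' s) := by
  refine of_local hJ ?_ ?_ ?_ ?_ ?_ ?_
  · rw [h.zero hJ, zero_mul]
  · intro s
    have := (h.hasDerivWithinAt hJ s).fun_mul (h'.hasDerivWithinAt hJ s)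
    simp only [Real.toNNReal_coe] at this
    exact this
  · intro s
    have := (h.tendsto_left hJ s).mul (h'.tendsto_left hJ s)
    convert this using 2
    ring
  · intro ρ hρ
    rw [h.supp ρ hρ, h'.supp ρ hρ]
    simp
  · exact fun s => ((h.rc s).mul (h'.tendsto_right hJ s)).add
      ((h.tendsto_right hJ s).mul (h'.rc s))
  · intro T
    obtain ⟨C1, hC1⟩ := h.bdd T
    obtain ⟨C2, hC2⟩ := h'.bdd T
    obtain ⟨C3, hC3⟩ := h.bdd_path hJ T
    obtain ⟨C4, hC4⟩ := h'.bdd_path hJ T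
    refine ⟨C1 * C4 + C3 * C2, fun u hu => (norm_add_le _ _).trans ?_⟩
    rw [norm_mul, norm_mul]
    exact add_le_add (mul_le_mul (hC1 u hu) (hC4 u hu) (norm_nonneg _)
      ((norm_nonneg _).trans (hC1 u hu))) (mul_le_mul (hC3 u hu) (hC2 u hu) (norm_nonneg _)
      ((norm_nonneg _).trans (hC3 u hu)))

/-- The Stieltjes integral of a bounded function `f` which away from the jump times coincides with
a right-continuous function `f'`. -/
theorem stieltjes_path (hJ : IsJumpTimes J) {f f' g : ℝ≥0 → ℂ} {c : ℂ}
    (h : JumpPath J X a b) (hg : ∀ s, g s = c + X s)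
    (hf : Measurable f) (hfb : ∀ T, ∃ C, ∀ u ≤ T, ‖f u‖ ≤ C)
    (hf' : ∀ u, u ∉ J u → f u = f' u) (hrc : ∀ s, Tendsto f' (𝓝[>] s) (𝓝 (f' s)))
    (hfb' : ∀ T, ∃ C, ∀ u ≤ T, ‖f' u‖ ≤ C) :
    JumpPath J (fun s => stieltjes f g s) (fun s => f s * a s) (fun s => f' s * b s) := by
  refine ⟨fun s => ?_, fun ρ hρ => ?_, fun s => (hrc s).mul (h.rc s), fun T => ?_⟩
  · obtain ⟨C, hC⟩ := h.bdd s
    obtain ⟨C', hC'⟩ := hfb s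
    rw [stieltjes_eq (J := J s) (a := a) (b := b) (hJ.mem s) h.measurable_drift hC ?_ hf hC']
    · congr 1
      -- `f` and `f'` differ only at the finitely many jump times, which do not matter for the
      -- drift. At the jumps themselves the value of `f` counts.
      refine intervalIntegral.integral_congr_ae ?_
      have hfin : ∀ᵐ u : ℝ, u ∉ ((J s).image fun ρ : ℝ≥0 => (ρ : ℝ) : Finset ℝ) :=
        measure_eq_zero_iff_ae_notMem.1 (Set.Finite.measure_zero (Finset.finite_toSet _) volume)
      filter_upwards [hfin] with u hu hu'
      rw [Set.uIoc_of_le (NNReal.coe_nonneg s)] at hu'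
      rw [hf']
      intro hmem
      refine hu (Finset.mem_image.2 ⟨u.toNNReal, ?_, Real.coe_toNNReal u hu'.1.le⟩)
      rw [hJ.filter u.toNNReal s (Real.toNNReal_le_iff_le_coe.2 hu'.2)] at hmem
      exact (Finset.mem_filter.1 hmem).1
    · intro r hr
      rw [hg r, hg 0, h.zero hJ, add_zero, h.eq r, hJ.filter r s hr, add_assoc]
  · rw [h.supp ρ hρ, mul_zero]
  · obtain ⟨C, hC⟩ := h.bdd T
    obtain ⟨C', hC'⟩ := hfb' T
    refine ⟨C' * C, fun u hu => ?_⟩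
    rw [norm_mul]
    exact mul_le_mul (hC' u hu) (hC u hu) (norm_nonneg _) ((norm_nonneg _).trans (hC' u hu))

/-- The Stieltjes integral of the left limits of a path. -/
theorem stieltjes_leftLim (hJ : IsJumpTimes J) {g : ℝ≥0 → ℂ} (h : JumpPath J X a b)
    (h' : JumpPath J Y a' b') (hg : ∀ s, g s = X s) :
    JumpPath J (fun s => stieltjes (Function.leftLim Y) g s) (fun s => (Y s - a' s) * a s)
      (fun s => Y s * b s) := by
  -- The jump function vanishes off the countable set of jump times, hence is measurable.
  have hm : Measurable a' := by
    have hset : (Function.support a').Countable := by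
      refine Set.Countable.mono (s₂ := ⋃ n : ℕ, (J n : Set ℝ≥0)) ?_
        (Set.countable_iUnion fun n => (J n).countable_toSet)
      intro ρ hρ
      have hρJ : ρ ∈ J ρ := by
        by_contra hn
        exact hρ (h'.supp ρ hn)
      obtain ⟨n, hn⟩ := exists_nat_ge ρ
      rw [hJ.filter ρ n hn] at hρJ
      exact Set.mem_iUnion.2 ⟨n, (Finset.mem_filter.1 hρJ).1⟩
    exact (measurable_zero : Measurable (fun _ : ℝ≥0 => (0 : ℂ))).measurable_of_countable_ne
      (hset.mono fun ρ hρ => fun h0 => hρ (by simpa using h0.symm))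
  have hlim : Function.leftLim Y = fun s => Y s - a' s := funext (h'.leftLim_eq hJ)
  have hbJ : ∀ T, ∃ C, ∀ u ≤ T, ‖Y u - a' u‖ ≤ C := by
    intro T
    obtain ⟨C, hC⟩ := h'.bdd_path hJ T
    refine ⟨C + ∑ ρ ∈ J T, ‖a' ρ‖, fun u hu => (norm_sub_le _ _).trans
      (add_le_add (hC u hu) ?_)⟩
    by_cases hu' : u ∈ J u
    · rw [hJ.filter u T hu] at hu'
      exact Finset.single_le_sum (f := fun ρ => ‖a' ρ‖) (fun _ _ => norm_nonneg _)
        (Finset.mem_filter.1 hu').1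
    · rw [h'.supp u hu', norm_zero]
      exact Finset.sum_nonneg fun _ _ => norm_nonneg _
  rw [hlim]
  refine h.stieltjes_path hJ (c := 0) (fun s => by rw [hg, zero_add])
    ((h'.measurable hJ).sub hm) hbJ (fun u hu => ?_) (h'.tendsto_right hJ) (h'.bdd_path hJ)
  simp [h'.supp u hu]

/-- Identities between iterated integrals are proved with this principle, by comparing jumps and
drifts separately. -/
theorem ext_path (h : JumpPath J X a b) (h' : JumpPath J Y a' b') (ha : ∀ s, a s = a' s)
    (hb : ∀ s, b s = b' s) (s : ℝ≥0) : X s = Y s := by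
  rw [h.eq, h'.eq, funext ha, funext hb]

end JumpPath

/-! ### Step paths with values in a finite set -/

section StepPath

variable {S : Type*}

/-- A right-continuous path with left limits in a discrete space. -/
structure IsStepPath (x : ℝ≥0 → S) : Prop where
  rc : ∀ t, ∀ᶠ r in 𝓝[>] t, x r = x t
  ll : ∀ t, ∃ η, ∀ᶠ r in 𝓝[<] t, x r = η

open Classical in
/-- The left limit of a step path, which at time zero is the initial value. -/
def leftVal (x : ℝ≥0 → S) (s : ℝ≥0) : S :=
  if h : s ≠ 0 ∧ ∃ η, ∀ᶠ r in 𝓝[<] s, x r = η then h.2.choose else x s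

open Classical in
/-- The jump times of a step path in `(0, s]`. -/
def jumps (x : ℝ≥0 → S) (s : ℝ≥0) : Finset ℝ≥0 :=
  if h : ({ρ | leftVal x ρ ≠ x ρ} ∩ Set.Iic s).Finite then h.toFinset else ∅

variable {x : ℝ≥0 → S}

theorem leftVal_zero : leftVal x 0 = x 0 := by
  simp [leftVal]

theorem nhdsLT_zero : 𝓝[<] (0 : ℝ≥0) = ⊥ := by
  have : Set.Iio (0 : ℝ≥0) = ∅ := by
    ext y
    simp
  rw [this, nhdsWithin_empty]

theorem nhdsLT_neBot {s : ℝ≥0} (hs : 0 < s) : (𝓝[<] s).NeBot := by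
  have hcl : closure (Set.Iio s) = Set.Iic s := closure_Iio' ⟨0, hs⟩
  refine mem_closure_iff_nhdsWithin_neBot.1 ?_
  rw [hcl]
  exact Set.self_mem_Iic

theorem IsStepPath.leftVal_spec (hx : IsStepPath x) (s : ℝ≥0) :
    ∀ᶠ r in 𝓝[<] s, x r = leftVal x s := by
  by_cases hs : s = 0
  · subst hs
    rw [nhdsLT_zero]
    exact Filter.eventually_bot
  · have h : s ≠ 0 ∧ ∃ η, ∀ᶠ r in 𝓝[<] s, x r = η := ⟨hs, hx.ll s⟩
    rw [leftVal, dif_pos h]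
    exact h.2.choose_spec

/-- Compactness of [0, s]: the path is constant on a punctured left and on a punctured right
neighbourhood of each point t, so t is the only possible jump nearby. -/
theorem IsStepPath.finite_jumps (hx : IsStepPath x) (s : ℝ≥0) :
    ({ρ | leftVal x ρ ≠ x ρ} ∩ Set.Iic s).Finite := by
  have hcomp : IsCompact (Set.Iic s : Set ℝ≥0) := by
    have : (Set.Iic s : Set ℝ≥0) = Set.Icc 0 s := by ext y; simp
    rw [this]
    exact isCompact_Icc
  refine hcomp.induction_on (p := fun A => ({ρ | leftVal x ρ ≠ x ρ} ∩ A).Finite) (by simp)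
    (fun A B hAB hB => hB.subset (Set.inter_subset_inter_right _ hAB))
    (fun A B hA hB => by rw [Set.inter_union_distrib_left]; exact hA.union hB) ?_
  intro t _
  have hconst : ∀ {η : S} {u : ℝ≥0} {U : Set ℝ≥0}, IsOpen U → u ∈ U → (∀ v ∈ U, x v = η) →
      0 < u → leftVal x u = x u := by
    intro η u U hU hu hη hpos
    have h1 : ∀ᶠ r in 𝓝[<] u, x r = η := by
      filter_upwards [nhdsWithin_le_nhds (hU.mem_nhds hu)] with r hr using hη r hr
    have := nhdsLT_neBot hpos
    obtain ⟨r, h2, h3⟩ := (h1.and (hx.leftVal_spec u)).exists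
    rw [← h3, h2, hη u hu]
  obtain ⟨l, hl⟩ : ∃ A ∈ 𝓝[<] t, ∀ u ∈ A, leftVal x u = x u := by
    by_cases ht : t = 0
    · subst ht
      exact ⟨∅, by rw [nhdsLT_zero]; trivial, by simp⟩
    · obtain ⟨l, hl, hlt⟩ := (mem_nhdsLT_iff_exists_Ioo_subset' (bot_lt_iff_ne_bot.2 ht)).1
        (hx.leftVal_spec t)
      exact ⟨Set.Ioo l t, Ioo_mem_nhdsLT hl, fun u hu =>
        hconst isOpen_Ioo hu (fun v hv => hlt hv) (bot_le.trans_lt hu.1)⟩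
  obtain ⟨r, hr, hrt⟩ := (mem_nhdsGT_iff_exists_Ioo_subset' (lt_add_one t)).1 (hx.rc t)
  refine ⟨l ∪ ({t} ∪ Set.Ioo t r), ?_, ?_⟩
  · refine mem_nhdsWithin_of_mem_nhds ?_
    rw [← nhdsLT_sup_nhdsGE, ← Set.Ioi_insert, nhdsWithin_insert]
    refine ⟨mem_of_superset hl.1 Set.subset_union_left, ?_⟩
    refine ⟨?_, mem_of_superset (Ioo_mem_nhdsGT hr) fun y hy => Or.inr (Or.inr hy)⟩
    exact Or.inr (Or.inl rfl)
  · refine (Set.finite_singleton t).subset ?_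
    rintro u ⟨hu, hu' | hu' | hu'⟩
    · exact absurd (hl.2 u hu') hu
    · exact hu'
    · exact absurd (hconst isOpen_Ioo hu' (fun v hv => hrt hv) (bot_le.trans_lt hu'.1)) hu

theorem IsStepPath.mem_jumps (hx : IsStepPath x) {s ρ : ℝ≥0} :
    ρ ∈ jumps x s ↔ leftVal x ρ ≠ x ρ ∧ ρ ≤ s := by
  rw [jumps, dif_pos (hx.finite_jumps s)]
  simp

theorem IsStepPath.isJumpTimes (hx : IsStepPath x) : IsJumpTimes (jumps x) := by
  refine ⟨fun s ρ hρ => ?_, fun s t hst => ?_⟩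
  · rw [hx.mem_jumps] at hρ
    refine ⟨bot_lt_iff_ne_bot.2 ?_, hρ.2⟩
    rintro rfl
    exact hρ.1 leftVal_zero
  · ext ρ
    rw [Finset.mem_filter, hx.mem_jumps, hx.mem_jumps]
    exact ⟨fun h => ⟨⟨h.1, h.2.trans hst⟩, h.2⟩, fun h => ⟨h.1.1, h.2⟩⟩

theorem IsStepPath.leftVal_eq (hx : IsStepPath x) {ρ : ℝ≥0} (h : ρ ∉ jumps x ρ) :
    leftVal x ρ = x ρ := by
  by_contra hne
  exact h (hx.mem_jumps.2 ⟨hne, le_rfl⟩)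

theorem IsStepPath.jumpPath (hx : IsStepPath x) (f : S → ℂ) :
    JumpPath (jumps x) (fun s => f (x s) - f (x 0)) (fun s => f (x s) - f (leftVal x s))
      (fun _ => 0) := by
  refine JumpPath.of_local hx.isJumpTimes (sub_self _) (fun s => ?_) (fun s => ?_)
    (fun ρ hρ => ?_) (fun _ => tendsto_const_nhds) (fun _ => ⟨0, by simp⟩)
  · have h1 : ∀ᶠ u in 𝓝[>] (s : ℝ), x u.toNNReal = x s :=
      (tendsto_toNNReal_Ioi s).eventually (hx.rc s)
    refine (hasDerivWithinAt_const (s : ℝ) (Set.Ici (s : ℝ)) (f (x s) - f (x 0))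
      ).congr_of_eventuallyEq ?_ (by simp)
    rw [← Set.Ioi_insert, nhdsWithin_insert]
    refine Filter.eventually_sup.2 ⟨by simp, ?_⟩
    filter_upwards [h1] with u hu
    rw [hu]
  · refine (tendsto_const_nhds (x := f (leftVal x s) - f (x 0))).congr' ?_ |>.mono_right ?_
    · filter_upwards [hx.leftVal_spec s] with r hr
      rw [hr]
    · rw [show f (x s) - f (x 0) - (f (x s) - f (leftVal x s)) = f (leftVal x s) - f (x 0) by
        ring]
  · rw [hx.leftVal_eq hρ, sub_self]

theorem IsStepPath.eq_of_no_jump (hx : IsStepPath x) {u v : ℝ≥0} (huv : u ≤ v)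
    (h : ∀ ρ ∈ jumps x v, ¬ u < ρ) : x v = x u := by
  classical
  by_contra hne
  -- The indicator of the state at time u, seen as a path, is a sum over jumps; without jumps in (u,
  -- v] it cannot change.
  have hp := hx.jumpPath (fun η => if η = x u then (1 : ℂ) else 0)
  have e1 := hp.eq u
  have e2 := hp.eq v
  have hJ : jumps x u = jumps x v := by
    rw [hx.isJumpTimes.filter u v huv]
    exact Finset.filter_true_of_mem fun ρ hρ => not_lt.1 (h ρ hρ)
  rw [hJ] at e1
  simp only [intervalIntegral.integral_zero, add_zero, if_true, if_neg hne] at e1 e2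
  rw [← e1] at e2
  exact zero_ne_one (sub_left_inj.1 e2)

theorem IsStepPath.leftVal_of_no_jump (hx : IsStepPath x) {u ρ : ℝ≥0} (huρ : u < ρ)
    (h : ∀ r ∈ jumps x ρ, u < r → r = ρ) : leftVal x ρ = x u := by
  have := nhdsLT_neBot (bot_le.trans_lt huρ)
  obtain ⟨r, h1, h2⟩ := ((hx.leftVal_spec ρ).and (Ioo_mem_nhdsLT huρ)).exists
  rw [← h1]
  refine hx.eq_of_no_jump h2.1.le fun r' hr' hlt => ?_
  have h3 := hx.isJumpTimes.mem r r' hr'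
  rw [hx.isJumpTimes.filter r ρ h2.2.le] at hr'
  have := h r' (Finset.mem_filter.1 hr').1 hlt
  rw [this] at h3
  exact absurd h3.2 (not_le.2 h2.2)

end StepPath

/-! ### Riemann sums along equidistant partitions -/

section Partition

/-- The points of the equidistant partition of `[a, a + d]` into `n` intervals. -/
def partPoint (a d : ℝ≥0) (n i : ℕ) : ℝ≥0 := a + d * i / n

theorem partPoint_zero (a d : ℝ≥0) (n : ℕ) : partPoint a d n 0 = a := by simp [partPoint]

theorem partPoint_self (a d : ℝ≥0) {n : ℕ} (hn : n ≠ 0) : partPoint a d n n = a + d := by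
  rw [partPoint, mul_div_assoc, div_self (by exact_mod_cast hn), mul_one]

theorem partPoint_mono (a d : ℝ≥0) (n : ℕ) : Monotone (partPoint a d n) := by
  intro i j hij
  unfold partPoint
  gcongr

theorem partPoint_succ (a d : ℝ≥0) (n i : ℕ) :
    partPoint a d n (i + 1) = partPoint a d n i + d / n := by
  unfold partPoint
  push_cast
  ring

theorem partPoint_le (a d : ℝ≥0) {n i : ℕ} (hi : i ≤ n) : partPoint a d n i ≤ a + d := by
  rcases Nat.eq_zero_or_pos n with rfl | hn
  · simp [partPoint]
  · rw [← partPoint_self a d hn.ne']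
    exact partPoint_mono a d n hi

theorem partPoint_unique {a d ρ : ℝ≥0} {n i j : ℕ}
    (hi : partPoint a d n i < ρ ∧ ρ ≤ partPoint a d n (i + 1))
    (hj : partPoint a d n j < ρ ∧ ρ ≤ partPoint a d n (j + 1)) : i = j := by
  rcases lt_trichotomy i j with h | h | h
  · exact absurd (hj.1.trans_le hi.2) (not_lt.2 (partPoint_mono a d n h))
  · exact h
  · exact absurd (hi.1.trans_le hj.2) (not_lt.2 (partPoint_mono a d n h))

theorem exists_partPoint {a d ρ : ℝ≥0} (h1 : a < ρ) (h2 : ρ ≤ a + d) {n : ℕ} (hn : n ≠ 0) :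
    ∃ i < n, partPoint a d n i < ρ ∧ ρ ≤ partPoint a d n (i + 1) := by
  classical
  have hex : ∃ i, ρ ≤ partPoint a d n i := ⟨n, by rwa [partPoint_self a d hn]⟩
  have hspec := Nat.find_spec hex
  have hpos : Nat.find hex ≠ 0 := by
    intro h0
    rw [h0, partPoint_zero] at hspec
    exact absurd h1 (not_lt.2 hspec)
  have hle : Nat.find hex ≤ n := Nat.find_min' hex (by rwa [partPoint_self a d hn])
  refine ⟨Nat.find hex - 1, by omega, ?_, ?_⟩
  · exact not_le.1 (Nat.find_min hex (by omega))
  · rwa [Nat.sub_add_cancel (Nat.one_le_iff_ne_zero.2 hpos)]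

open Classical in
/-- The index of the interval of the partition which contains `ρ`. -/
def partIndex (a d ρ : ℝ≥0) (n : ℕ) : ℕ :=
  if h : ∃ i < n, partPoint a d n i < ρ ∧ ρ ≤ partPoint a d n (i + 1) then h.choose else 0

theorem partIndex_spec {a d ρ : ℝ≥0} (h1 : a < ρ) (h2 : ρ ≤ a + d) {n : ℕ} (hn : n ≠ 0) :
    partIndex a d ρ n < n ∧ partPoint a d n (partIndex a d ρ n) < ρ ∧
      ρ ≤ partPoint a d n (partIndex a d ρ n + 1) := by
  have h := exists_partPoint h1 h2 hn
  rw [partIndex, dif_pos h]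
  exact h.choose_spec

/-- The cells are open on the left, so the left endpoint of the cell of ρ approaches ρ strictly from
below, and a step path evaluated there eventually equals its left value at ρ. -/
theorem tendsto_partIndex {a d ρ : ℝ≥0} (h1 : a < ρ) (h2 : ρ ≤ a + d) :
    Tendsto (fun n => partPoint a d n (partIndex a d ρ n)) atTop (𝓝[<] ρ) := by
  have hev : ∀ᶠ n : ℕ in atTop, n ≠ 0 := eventually_ne_atTop 0
  refine tendsto_nhdsWithin_iff.2 ⟨?_, ?_⟩
  · have hlim : Tendsto (fun n : ℕ => ρ - d / n) atTop (𝓝 (ρ - 0)) :=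
      tendsto_const_nhds.sub (tendsto_const_div_atTop_nhds_zero_nat d)
    rw [tsub_zero] at hlim
    refine tendsto_of_tendsto_of_tendsto_of_le_of_le' hlim tendsto_const_nhds ?_ ?_
    · filter_upwards [hev] with n hn
      have := (partIndex_spec h1 h2 hn).2.2
      rw [partPoint_succ] at this
      exact tsub_le_iff_right.2 this
    · filter_upwards [hev] with n hn using (partIndex_spec h1 h2 hn).2.1.le
  · filter_upwards [hev] with n hn using (partIndex_spec h1 h2 hn).2.1

theorem sum_ite_partPoint {M : Type*} [AddCommMonoid M] {a d ρ : ℝ≥0} (h1 : a < ρ)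
    (h2 : ρ ≤ a + d) {n : ℕ} (hn : n ≠ 0) (f : ℕ → M) :
    ∑ i ∈ Finset.range n,
      (if partPoint a d n i < ρ ∧ ρ ≤ partPoint a d n (i + 1) then f i else 0) =
      f (partIndex a d ρ n) := by
  have hs := partIndex_spec h1 h2 hn
  rw [Finset.sum_eq_single (partIndex a d ρ n)]
  · rw [if_pos hs.2]
  · intro i _ hi
    exact if_neg fun h => hi (partPoint_unique h hs.2)
  · exact fun h => absurd (Finset.mem_range.2 hs.1) h

variable {S : Type*} {x : ℝ≥0 → S}

/-- Once the mesh is smaller than every gap between jumps, a cell contains at most one jump and its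
endpoints see exactly the states before and after it. Cells without jumps contribute nothing because
W vanishes on the diagonal; continuity of W in time takes care of the displaced time argument. -/
theorem tendsto_sum_jumps (hx : IsStepPath x) (a d : ℝ≥0) {W : ℝ≥0 → S → S → ℝ}
    (hW : ∀ η η', Continuous fun r => W r η η') (hW0 : ∀ r η, W r η η = 0) :
    Tendsto (fun n : ℕ => ∑ i ∈ Finset.range n,
        W (partPoint a d n i) (x (partPoint a d n i)) (x (partPoint a d n (i + 1)))) atTop
      (𝓝 (∑ ρ ∈ jumps x (a + d) with a < ρ, W ρ (leftVal x ρ) (x ρ))) := by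
  have hJ := hx.isJumpTimes
  have hgap : ∀ᶠ n : ℕ in atTop, ∀ ρ ∈ jumps x (a + d), ∀ ρ' ∈ jumps x (a + d),
      ρ < ρ' → d / n < ρ' - ρ := by
    rw [Finset.eventually_all]
    intro ρ _
    rw [Finset.eventually_all]
    intro ρ' _
    by_cases h : ρ < ρ'
    · filter_upwards [(tendsto_const_div_atTop_nhds_zero_nat d).eventually
        (Iio_mem_nhds (tsub_pos_of_lt h))] with n hn _ using hn
    · exact Eventually.of_forall fun n h' => absurd h' h
  have hlim : Tendsto (fun n : ℕ => ∑ ρ ∈ jumps x (a + d) with a < ρ,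
      W (partPoint a d n (partIndex a d ρ n)) (leftVal x ρ) (x ρ)) atTop
      (𝓝 (∑ ρ ∈ jumps x (a + d) with a < ρ, W ρ (leftVal x ρ) (x ρ))) := by
    refine tendsto_finsetSum _ fun ρ hρ => ?_
    rw [Finset.mem_filter] at hρ
    exact ((hW _ _).tendsto ρ).comp
      ((tendsto_partIndex hρ.2 (hJ.mem _ _ hρ.1).2).mono_right nhdsWithin_le_nhds)
  refine hlim.congr' ?_
  filter_upwards [hgap, eventually_ne_atTop 0] with n hn hn0
  have h1 : ∀ i ∈ Finset.range n,
      W (partPoint a d n i) (x (partPoint a d n i)) (x (partPoint a d n (i + 1))) =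
      ∑ ρ ∈ jumps x (a + d) with a < ρ,
        if partPoint a d n i < ρ ∧ ρ ≤ partPoint a d n (i + 1) then
          W (partPoint a d n i) (leftVal x ρ) (x ρ) else 0 := by
    intro i hi
    have hle : partPoint a d n (i + 1) ≤ a + d := partPoint_le a d (Finset.mem_range.1 hi)
    have hmono := partPoint_mono a d n (Nat.le_succ i)
    have haq : a ≤ partPoint a d n i := by
      rw [partPoint]
      exact le_self_add
    have hone : ∀ ρ ∈ jumps x (a + d), ∀ ρ' ∈ jumps x (a + d), partPoint a d n i < ρ →
        ρ ≤ partPoint a d n (i + 1) → partPoint a d n i < ρ' →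
        ρ' ≤ partPoint a d n (i + 1) → ¬ ρ < ρ' := by
      intro ρ hρ ρ' hρ' h1 _ _ h4 hlt
      have h5 := hn ρ hρ ρ' hρ' hlt
      rw [partPoint_succ] at h4
      have h6 : ρ' - ρ ≤ d / n := by
        rw [tsub_le_iff_right, add_comm]
        exact h4.trans (by gcongr)
      exact absurd h5 (not_lt.2 h6)
    by_cases hex : ∃ ρ ∈ jumps x (a + d), partPoint a d n i < ρ ∧ ρ ≤ partPoint a d n (i + 1)
    · obtain ⟨ρ, hρ, h1, h2⟩ := hex
      rw [Finset.sum_eq_single ρ]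
      · rw [if_pos ⟨h1, h2⟩]
        congr 1
        · refine (hx.leftVal_of_no_jump h1 fun r hr hlt => ?_).symm
          by_contra hne
          have hr' := hJ.mem _ _ hr
          rw [hJ.filter ρ (a + d) (h2.trans hle)] at hr
          exact hone r (Finset.mem_filter.1 hr).1 ρ hρ hlt (hr'.2.trans h2) h1 h2
            (lt_of_le_of_ne hr'.2 hne)
        · refine hx.eq_of_no_jump h2 fun r hr hlt => ?_
          have hr' := hJ.mem _ _ hr
          rw [hJ.filter _ (a + d) hle] at hr
          exact hone ρ hρ r (Finset.mem_filter.1 hr).1 h1 h2 (h1.trans hlt) hr'.2 hlt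
      · intro ρ' hρ' hne
        refine if_neg fun h => ?_
        have hρ'' := (Finset.mem_filter.1 hρ').1
        rcases lt_or_gt_of_ne hne with h' | h'
        · exact hone ρ' hρ'' ρ hρ h.1 h.2 h1 h2 h'
        · exact hone ρ hρ ρ' hρ'' h1 h2 h.1 h.2 h'
      · intro hn'
        exact absurd (Finset.mem_filter.2 ⟨hρ, haq.trans_lt h1⟩) hn'
    · push Not at hex
      rw [Finset.sum_eq_zero fun ρ hρ => if_neg fun h =>
        absurd h.2 (not_le.2 (hex ρ (Finset.mem_filter.1 hρ).1 h.1))]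
      rw [hx.eq_of_no_jump hmono fun r hr hlt => ?_, hW0]
      have hr' := hJ.mem _ _ hr
      rw [hJ.filter _ (a + d) hle] at hr
      exact absurd hr'.2 (not_le.2 (hex r (Finset.mem_filter.1 hr).1 hlt))
  rw [Finset.sum_congr rfl h1, Finset.sum_comm]
  refine Finset.sum_congr rfl fun ρ hρ => ?_
  rw [Finset.mem_filter] at hρ
  rw [sum_ite_partPoint hρ.2 (hJ.mem _ _ hρ.1).2 hn0
    fun i => W (partPoint a d n i) (leftVal x ρ) (x ρ)]

/-- The Riemann sum is the integral of a step function of time. It converges to the integrand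
evaluated at the left value, which is the true value off the finite set of jump times; dominated
convergence concludes. -/
theorem tendsto_sum_integral (hx : IsStepPath x) (a d : ℝ≥0) {c : ℝ≥0 → S → ℝ} {K : ℝ}
    (hc : ∀ η, Continuous fun r => c r η) (hK : ∀ r ≤ a + d, ∀ η, |c r η| ≤ K) :
    Tendsto (fun n : ℕ => ∑ i ∈ Finset.range n,
        (d / n : ℝ) * c (partPoint a d n i) (x (partPoint a d n i))) atTop
      (𝓝 (∫ u in (a : ℝ)..((a + d : ℝ≥0) : ℝ), c u.toNNReal (x u.toNNReal))) := by
  have hJ := hx.isJumpTimes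
  have had : (a : ℝ) ≤ ((a + d : ℝ≥0) : ℝ) := by exact_mod_cast le_self_add
  set F : ℕ → ℝ → ℝ := fun n u => ∑ i ∈ Finset.range n,
    if partPoint a d n i < u.toNNReal ∧ u.toNNReal ≤ partPoint a d n (i + 1) then
      c (partPoint a d n i) (x (partPoint a d n i)) else 0 with hF
  have hFm : ∀ n, Measurable (F n) := by
    intro n
    refine Finset.measurable_fun_sum _ fun i _ => ?_
    refine Measurable.ite ?_ measurable_const measurable_const
    exact measurable_real_toNNReal (measurableSet_Ioc (a := partPoint a d n i)
      (b := partPoint a d n (i + 1)))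
  have hmem : ∀ u ∈ Set.Ioc (a : ℝ) ((a + d : ℝ≥0) : ℝ), a < u.toNNReal ∧ u.toNNReal ≤ a + d :=
    fun u hu => ⟨Real.lt_toNNReal_iff_coe_lt.2 hu.1, Real.toNNReal_le_iff_le_coe.2 hu.2⟩
  have hFeq : ∀ n, n ≠ 0 → ∀ u ∈ Set.Ioc (a : ℝ) ((a + d : ℝ≥0) : ℝ),
      F n u = c (partPoint a d n (partIndex a d u.toNNReal n))
        (x (partPoint a d n (partIndex a d u.toNNReal n))) := by
    intro n hn u hu
    exact sum_ite_partPoint (hmem u hu).1 (hmem u hu).2 hn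
      fun i => c (partPoint a d n i) (x (partPoint a d n i))
  have hinteg : ∀ n, n ≠ 0 → ∫ u in (a : ℝ)..((a + d : ℝ≥0) : ℝ), F n u =
      ∑ i ∈ Finset.range n, (d / n : ℝ) * c (partPoint a d n i) (x (partPoint a d n i)) := by
    intro n hn
    rw [hF, intervalIntegral.integral_of_le had, integral_finsetSum]
    · refine Finset.sum_congr rfl fun i hi => ?_
      have hle : partPoint a d n (i + 1) ≤ a + d := partPoint_le a d (Finset.mem_range.1 hi)
      have hge : a ≤ partPoint a d n i := by rw [partPoint]; exact le_self_add
      have hset : ∀ u : ℝ, (if partPoint a d n i < u.toNNReal ∧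
          u.toNNReal ≤ partPoint a d n (i + 1) then
          c (partPoint a d n i) (x (partPoint a d n i)) else 0) =
          Set.indicator (Set.Ioc (partPoint a d n i : ℝ) (partPoint a d n (i + 1)))
            (fun _ => c (partPoint a d n i) (x (partPoint a d n i))) u := by
        intro u
        rw [Set.indicator_apply]
        congr 1
        rw [Real.lt_toNNReal_iff_coe_lt, Real.toNNReal_le_iff_le_coe, Set.mem_Ioc]
      simp_rw [hset]
      rw [integral_indicator measurableSet_Ioc, Measure.restrict_restrict measurableSet_Ioc,
        Set.inter_eq_left.2 (Set.Ioc_subset_Ioc (by exact_mod_cast hge) (by exact_mod_cast hle)),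
        setIntegral_const, smul_eq_mul, Measure.real, Real.volume_Ioc, partPoint_succ,
        ENNReal.toReal_ofReal]
      · push_cast
        ring
      · push_cast
        have : (0 : ℝ) ≤ d / n := by positivity
        linarith
    · intro i _
      refine Integrable.of_bound (C := |c (partPoint a d n i) (x (partPoint a d n i))|) ?_ ?_
      · refine Measurable.aestronglyMeasurable (Measurable.ite ?_ measurable_const measurable_const)
        exact measurable_real_toNNReal (measurableSet_Ioc (a := partPoint a d n i)
          (b := partPoint a d n (i + 1)))
      · refine Eventually.of_forall fun u => ?_
        rw [Real.norm_eq_abs]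
        split_ifs
        · exact le_rfl
        · simp
  have hlim : Tendsto (fun n => ∫ u in (a : ℝ)..((a + d : ℝ≥0) : ℝ), F n u) atTop
      (𝓝 (∫ u in (a : ℝ)..((a + d : ℝ≥0) : ℝ), c u.toNNReal (x u.toNNReal))) := by
    refine intervalIntegral.tendsto_integral_filter_of_dominated_convergence (fun _ => K)
      (Eventually.of_forall fun n => (hFm n).aestronglyMeasurable) ?_ (by simp) ?_
    · filter_upwards [eventually_ne_atTop 0] with n hn
      refine Eventually.of_forall fun u hu => ?_
      rw [Set.uIoc_of_le had] at hu
      rw [hFeq n hn u hu, Real.norm_eq_abs]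
      exact hK _ ((partIndex_spec (hmem u hu).1 (hmem u hu).2 hn).2.1.le.trans (hmem u hu).2) _
    · have hfin : ∀ᵐ u : ℝ, u ∉ ((jumps x (a + d)).image fun ρ : ℝ≥0 => (ρ : ℝ) : Finset ℝ) :=
        measure_eq_zero_iff_ae_notMem.1 (Set.Finite.measure_zero (Finset.finite_toSet _) volume)
      filter_upwards [hfin] with u hu hu'
      rw [Set.uIoc_of_le had] at hu'
      have hm := hmem u hu'
      have hu0 : 0 ≤ u := a.2.trans hu'.1.le
      have hlv : leftVal x u.toNNReal = x u.toNNReal := by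
        refine hx.leftVal_eq fun hmem => hu (Finset.mem_image.2 ⟨u.toNNReal, ?_, ?_⟩)
        · rw [hJ.filter _ (a + d) hm.2] at hmem
          exact (Finset.mem_filter.1 hmem).1
        · exact Real.coe_toNNReal u hu0
      have ht := tendsto_partIndex hm.1 hm.2
      have h1 : Tendsto (fun n => c (partPoint a d n (partIndex a d u.toNNReal n))
          (x u.toNNReal)) atTop (𝓝 (c u.toNNReal (x u.toNNReal))) :=
        ((hc _).tendsto _).comp (ht.mono_right nhdsWithin_le_nhds)
      refine h1.congr' ?_
      filter_upwards [ht.eventually (hx.leftVal_spec u.toNNReal), eventually_ne_atTop 0]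
        with n hn hn0
      rw [hFeq n hn0 u hu', hn, hlv]
  refine hlim.congr' ?_
  filter_upwards [eventually_ne_atTop 0] with n hn using hinteg n hn

end Partition

/-! ### An exponential inequality for jump processes on a finite set -/

section JumpProcess

variable {S I : Type*} [Fintype S] [Fintype I]

/-- The generator of the process which in the state `η` jumps to `φ η i` with rate `q η i`. -/
def jumpGenerator (φ : S → I → S) (q : S → I → ℝ) (f : S → ℝ) (η : S) : ℝ :=
  ∑ i, q η i * (f (φ η i) - f η)

/-- A càdlàg solution of the martingale problem of `jumpGenerator`. -/
structure IsJumpProcess (φ : S → I → S) (q : S → I → ℝ) {Ω : Type u} {mΩ : MeasurableSpace Ω}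
    (μ : Measure Ω) (ℱ : Filtration ℝ≥0 mΩ) (X : ℝ≥0 → Ω → S) : Prop where
  adapted : ∀ t η, MeasurableSet[ℱ t] {ω | X t ω = η}
  step : ∀ ω, IsStepPath fun t => X t ω
  martingale : ∀ f : S → ℝ, Martingale (fun (t : ℝ≥0) ω => f (X t ω) - f (X 0 ω) -
      ∫ r in (0 : ℝ)..t, jumpGenerator φ q f (X r.toNNReal ω)) ℱ μ

variable {φ : S → I → S} {q : S → I → ℝ} {Ω : Type u} {mΩ : MeasurableSpace Ω}
  {μ : Measure Ω} {ℱ : Filtration ℝ≥0 mΩ} {X : ℝ≥0 → Ω → S}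

theorem IsJumpProcess.measurable_state (h : IsJumpProcess φ q μ ℱ X) {s t : ℝ≥0} (hst : s ≤ t) :
    @Measurable Ω S (ℱ t) ⊤ (X s) := by
  let _ : MeasurableSpace S := ⊤
  intro A _
  have : X s ⁻¹' A = ⋃ η ∈ A, {ω | X s ω = η} := by
    ext ω
    simp
  rw [this]
  exact MeasurableSet.biUnion (Set.to_countable A) fun η _ => ℱ.mono hst _ (h.adapted s η)

theorem IsJumpProcess.measurable_pair (h : IsJumpProcess φ q μ ℱ X) {r s t : ℝ≥0} (hrt : r ≤ t)
    (hst : s ≤ t) (g : S → S → ℝ) : Measurable[ℱ t] fun ω => g (X r ω) (X s ω) := by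
  let _ : MeasurableSpace S := ⊤
  have h1 : Measurable[ℱ t] fun ω => (X r ω, X s ω) :=
    (h.measurable_state hrt).prodMk (h.measurable_state hst)
  have h2 : Measurable fun p : S × S => g p.1 p.2 := Measurable.of_discrete
  exact h2.comp h1

theorem IsJumpProcess.measurable_comp (h : IsJumpProcess φ q μ ℱ X) (t : ℝ≥0) (g : S → ℝ) :
    Measurable fun ω => g (X t ω) :=
  (h.measurable_pair (r := t) (s := t) le_rfl le_rfl fun η _ => g η).mono (ℱ.le t) le_rfl

/-- Joint measurability in time and chance, needed for Fubini. The state at the next point of a fine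
grid eventually coincides with the present state. -/
theorem IsJumpProcess.measurable_uncurry (h : IsJumpProcess φ q μ ℱ X) (g : S → ℝ) :
    Measurable fun p : ℝ × Ω => g (X p.1.toNNReal p.2) := by
  have hlim : ∀ u : ℝ≥0, Tendsto (fun n : ℕ => ((⌊(n + 1 : ℝ≥0) * u⌋₊ + 1 : ℝ≥0)) / (n + 1 : ℝ≥0))
      atTop (𝓝[>] u) := tendsto_floor_add_one_div
  refine measurable_of_tendsto_metrizable (f := fun (n : ℕ) (p : ℝ × Ω) =>
    g (X (((⌊(n + 1 : ℝ≥0) * p.1.toNNReal⌋₊ + 1 : ℝ≥0)) / (n + 1 : ℝ≥0)) p.2)) ?_ ?_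
  · intro n
    have h1 : Measurable fun p : ℕ × Ω => g (X ((p.1 + 1 : ℝ≥0) / (n + 1 : ℝ≥0)) p.2) :=
      measurable_from_prod_countable_right
        (f := fun p : ℕ × Ω => g (X ((p.1 + 1 : ℝ≥0) / (n + 1 : ℝ≥0)) p.2))
        fun m => h.measurable_comp ((m + 1 : ℝ≥0) / (n + 1 : ℝ≥0)) g
    have h2 : Measurable fun p : ℝ × Ω => (⌊(n + 1 : ℝ≥0) * p.1.toNNReal⌋₊, p.2) :=
      (Nat.measurable_floor.comp ((measurable_const_mul _).comp
        (measurable_real_toNNReal.comp measurable_fst))).prodMk measurable_snd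
    exact Measurable.comp (g := fun p : ℕ × Ω => g (X ((p.1 + 1 : ℝ≥0) / (n + 1 : ℝ≥0)) p.2))
      (f := fun p : ℝ × Ω => (⌊(n + 1 : ℝ≥0) * p.1.toNNReal⌋₊, p.2)) h1 h2
  · rw [tendsto_pi_nhds]
    intro p
    refine tendsto_const_nhds.congr' ?_
    filter_upwards [(hlim p.1.toNNReal).eventually ((h.step p.2).rc p.1.toNNReal)] with n hn
    exact congrArg g hn.symm

theorem abs_le_sum_abs {S : Type*} [Fintype S] (g : S → ℝ) (η : S) : |g η| ≤ ∑ ζ, |g ζ| :=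
  Finset.single_le_sum (f := fun ζ => |g ζ|) (fun _ _ => abs_nonneg _) (Finset.mem_univ η)

theorem IsJumpProcess.intervalIntegrable (h : IsJumpProcess φ q μ ℱ X) (g : S → ℝ) (ω : Ω)
    (x y : ℝ) : IntervalIntegrable (fun r => g (X r.toNNReal ω)) volume x y := by
  refine (intervalIntegrable_const (c := ∑ ζ, |g ζ|)).mono_fun' ?_ ?_
  · exact ((h.measurable_uncurry g).comp measurable_prodMk_right).aestronglyMeasurable
  · exact Eventually.of_forall fun r => abs_le_sum_abs g _

variable [IsProbabilityMeasure μ]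

theorem IsJumpProcess.integrable_uncurry (h : IsJumpProcess φ q μ ℱ X) (g : S → ℝ) {Y : Ω → ℝ}
    (hY : Measurable Y) {B : ℝ} (hB : ∀ ω, |Y ω| ≤ B) (x y : ℝ) :
    Integrable (fun p : ℝ × Ω => Y p.2 * g (X p.1.toNNReal p.2))
      ((volume.restrict (Set.Ioc x y)).prod μ) := by
  refine Integrable.of_bound (C := B * ∑ ζ, |g ζ|)
    ((hY.comp measurable_snd).mul (h.measurable_uncurry g)).aestronglyMeasurable
    (Eventually.of_forall fun p => ?_)
  rw [norm_mul]
  exact mul_le_mul (hB _) (abs_le_sum_abs g _) (norm_nonneg _) ((abs_nonneg _).trans (hB p.2))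

theorem IsJumpProcess.integral_mul_integral (h : IsJumpProcess φ q μ ℱ X) (g : S → ℝ) {Y : Ω → ℝ}
    (hY : Measurable Y) {B : ℝ} (hB : ∀ ω, |Y ω| ≤ B) {x y : ℝ} (hxy : x ≤ y) :
    ∫ ω, Y ω * (∫ r in x..y, g (X r.toNNReal ω)) ∂μ =
      ∫ r in x..y, (∫ ω, Y ω * g (X r.toNNReal ω) ∂μ) := by
  rw [intervalIntegral.integral_of_le hxy,
    integral_integral_swap (h.integrable_uncurry g hY hB x y)]
  refine integral_congr_ae (Eventually.of_forall fun ω => ?_)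
  dsimp only
  rw [intervalIntegral.integral_of_le hxy, integral_const_mul]

theorem IsJumpProcess.intervalIntegrable_integral (h : IsJumpProcess φ q μ ℱ X) (g : S → ℝ)
    {Y : Ω → ℝ} (hY : Measurable Y) {B : ℝ} (hB : ∀ ω, |Y ω| ≤ B) {x y : ℝ} (hxy : x ≤ y) :
    IntervalIntegrable (fun r : ℝ => ∫ ω, Y ω * g (X r.toNNReal ω) ∂μ) volume x y := by
  rw [intervalIntegrable_iff_integrableOn_Ioc_of_le hxy]
  exact (h.integrable_uncurry g hY hB x y).integral_prod_left

/-- Dynkin's formula with a bounded weight from the past. The martingale problem enters the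
probabilistic estimates only through it. -/
theorem IsJumpProcess.integral_mul_sub (h : IsJumpProcess φ q μ ℱ X) {s t : ℝ≥0} (hst : s ≤ t)
    (f : S → ℝ) {Y : Ω → ℝ} (hY : Measurable[ℱ s] Y) {B : ℝ} (hB : ∀ ω, |Y ω| ≤ B) :
    ∫ ω, Y ω * (f (X t ω) - f (X s ω)) ∂μ =
      ∫ r in (s : ℝ)..t, (∫ ω, Y ω * jumpGenerator φ q f (X r.toNNReal ω) ∂μ) := by
  set M : ℝ≥0 → Ω → ℝ := fun t ω => f (X t ω) - f (X 0 ω) -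
    ∫ r in (0 : ℝ)..t, jumpGenerator φ q f (X r.toNNReal ω) with hM
  have hmart : Martingale M ℱ μ := h.martingale f
  have hYm : StronglyMeasurable[ℱ s] Y := hY.stronglyMeasurable
  have hYm' : AEStronglyMeasurable Y μ := (hYm.mono (ℱ.le s)).aestronglyMeasurable
  have hYM : ∀ r, Integrable (Y * M r) μ := fun r =>
    (hmart.integrable r).bdd_mul hYm' (Eventually.of_forall hB)
  have h1 : ∫ ω, (Y * M t) ω ∂μ = ∫ ω, (Y * M s) ω ∂μ := by
    rw [← integral_condExp (ℱ.le s) (f := Y * M t)]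
    refine integral_congr_ae ?_
    filter_upwards [condExp_mul_of_stronglyMeasurable_left hYm (hYM t) (hmart.integrable t),
      hmart.2 s t hst] with ω h1 h2
    rw [h1, Pi.mul_apply, Pi.mul_apply, h2]
  have h2 : ∫ ω, Y ω * (M t ω - M s ω) ∂μ = 0 := by
    have : (fun ω => Y ω * (M t ω - M s ω)) = fun ω => (Y * M t) ω - (Y * M s) ω := by
      ext ω
      simp only [Pi.mul_apply]
      ring
    rw [this, integral_sub (hYM t) (hYM s), h1, sub_self]
  have hfi : ∀ r, Integrable (fun ω => f (X r ω)) μ := fun r =>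
    Integrable.of_bound (C := ∑ ζ, |f ζ|)
      (((h.measurable_pair le_rfl le_rfl fun η _ => f η).mono (ℱ.le r) le_rfl
        ).aestronglyMeasurable) (Eventually.of_forall fun ω => abs_le_sum_abs f _)
  have hsplit : ∀ ω, M t ω - M s ω = (f (X t ω) - f (X s ω)) -
      ∫ r in (s : ℝ)..t, jumpGenerator φ q f (X r.toNNReal ω) := by
    intro ω
    have := intervalIntegral.integral_add_adjacent_intervals
      (h.intervalIntegrable (jumpGenerator φ q f) ω 0 s)
      (h.intervalIntegrable (jumpGenerator φ q f) ω s t)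
    simp only [hM]
    rw [← this]
    ring
  have hdi : Integrable (fun ω => Y ω * (f (X t ω) - f (X s ω))) μ :=
    ((hfi t).sub (hfi s)).bdd_mul hYm' (Eventually.of_forall hB)
  have hMi : Integrable (fun ω => Y ω * (M t ω - M s ω)) μ :=
    ((hmart.integrable t).sub (hmart.integrable s)).bdd_mul hYm' (Eventually.of_forall hB)
  have h3 : ∫ ω, (Y ω * (f (X t ω) - f (X s ω)) - Y ω * (M t ω - M s ω)) ∂μ =
      ∫ ω, Y ω * (f (X t ω) - f (X s ω)) ∂μ := by
    rw [integral_sub hdi hMi, h2, sub_zero]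
  rw [← h3, ← h.integral_mul_integral (jumpGenerator φ q f) (hY.mono (ℱ.le s) le_rfl) hB
    (by exact_mod_cast hst)]
  refine integral_congr_ae (Eventually.of_forall fun ω => ?_)
  dsimp only
  rw [hsplit ω]
  ring

/-- The weight lives on the event that the state at time s is η. Dynkin's formula for the indicator
of the complement of η bounds the probability of having left by the total rate times the elapsed
time. -/
theorem IsJumpProcess.integral_leave_le (h : IsJumpProcess φ q μ ℱ X) {Q : ℝ}
    (hq : ∀ η i, 0 ≤ q η i) (hQ : ∀ η, ∑ i, q η i ≤ Q) {s t : ℝ≥0} (hst : s ≤ t) (η : S)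
    {Y : Ω → ℝ} (hY : Measurable[ℱ s] Y) (hY0 : ∀ ω, 0 ≤ Y ω) {B : ℝ} (hB : ∀ ω, |Y ω| ≤ B)
    (hYη : ∀ ω, X s ω ≠ η → Y ω = 0) [DecidableEq S] :
    ∫ ω, Y ω * (if X t ω = η then 0 else 1) ∂μ ≤ Q * (t - s) * ∫ ω, Y ω ∂μ := by
  set f : S → ℝ := fun ζ => if ζ = η then 0 else 1 with hf
  have hgen : ∀ ζ, jumpGenerator φ q f ζ ≤ Q := by
    intro ζ
    refine le_trans (Finset.sum_le_sum fun i _ => ?_) (hQ ζ)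
    have h1 : f (φ ζ i) - f ζ ≤ 1 := by
      simp only [hf]
      split_ifs <;> norm_num
    calc q ζ i * (f (φ ζ i) - f ζ) ≤ q ζ i * 1 := mul_le_mul_of_nonneg_left h1 (hq ζ i)
      _ = q ζ i := mul_one _
  have hYm : AEStronglyMeasurable Y μ :=
    (hY.mono (ℱ.le s) le_rfl).aestronglyMeasurable
  have hYi : Integrable Y μ := Integrable.of_bound hYm B (Eventually.of_forall hB)
  have h1 : ∫ ω, Y ω * (if X t ω = η then 0 else 1) ∂μ =
      ∫ ω, Y ω * (f (X t ω) - f (X s ω)) ∂μ := by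
    refine integral_congr_ae (Eventually.of_forall fun ω => ?_)
    by_cases hω : X s ω = η
    · simp [hf, hω]
    · simp [hYη ω hω]
  have hst' : (s : ℝ) ≤ t := by exact_mod_cast hst
  have hYm' := hY.mono (ℱ.le s) le_rfl
  rw [h1, h.integral_mul_sub hst f hY hB]
  have h2 : ∀ r ∈ Set.Icc (s : ℝ) t, ∫ ω, Y ω * jumpGenerator φ q f (X r.toNNReal ω) ∂μ ≤
      Q * ∫ ω, Y ω ∂μ := by
    intro r _
    rw [← integral_const_mul]
    refine integral_mono_ae ?_ (hYi.const_mul Q) (Eventually.of_forall fun ω => ?_)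
    · exact (Integrable.of_bound (C := ∑ ζ, |jumpGenerator φ q f ζ|)
        (h.measurable_comp _ _).aestronglyMeasurable
        (Eventually.of_forall fun ω => abs_le_sum_abs _ _)).bdd_mul hYm (Eventually.of_forall hB)
    · dsimp only
      rw [mul_comm Q]
      exact mul_le_mul_of_nonneg_left (hgen _) (hY0 ω)
  calc ∫ r in (s : ℝ)..t, (∫ ω, Y ω * jumpGenerator φ q f (X r.toNNReal ω) ∂μ)
      ≤ ∫ r in (s : ℝ)..t, (Q * ∫ ω, Y ω ∂μ) :=
        intervalIntegral.integral_mono_on hst' (h.intervalIntegrable_integral _ hYm' hB hst')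
          intervalIntegrable_const h2
    _ = Q * (t - s) * ∫ ω, Y ω ∂μ := by
        rw [intervalIntegral.integral_const, smul_eq_mul]
        ring

/-- First-order expansion in the length of the step. In Dynkin's formula the generator at time r may
be replaced by its value at η, with an error of at most 2G on the event that η has been left; that
event has probability O(t - s), so the total error is quadratic. -/
theorem IsJumpProcess.integral_one_step_le (h : IsJumpProcess φ q μ ℱ X) {Q : ℝ}
    (hq : ∀ η i, 0 ≤ q η i) (hQ : ∀ η, ∑ i, q η i ≤ Q) {s t : ℝ≥0} (hst : s ≤ t) (η : S)
    {Y : Ω → ℝ} (hY : Measurable[ℱ s] Y) (hY0 : ∀ ω, 0 ≤ Y ω) {B : ℝ} (hB : ∀ ω, |Y ω| ≤ B)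
    (hYη : ∀ ω, X s ω ≠ η → Y ω = 0) (f : S → ℝ) {G : ℝ}
    (hG : ∀ ζ, |jumpGenerator φ q f ζ| ≤ G) :
    ∫ ω, Y ω * f (X t ω) ∂μ ≤
      (f η + (t - s) * jumpGenerator φ q f η + 2 * G * Q * (t - s) ^ 2) * ∫ ω, Y ω ∂μ := by
  classical
  have hst' : (s : ℝ) ≤ t := by exact_mod_cast hst
  have hYm := hY.mono (ℱ.le s) le_rfl
  have hYi : Integrable Y μ :=
    Integrable.of_bound hYm.aestronglyMeasurable B (Eventually.of_forall hB)
  have hinteg : ∀ (g : S → ℝ) (r : ℝ≥0), Integrable (fun ω => Y ω * g (X r ω)) μ := fun g r =>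
    (Integrable.of_bound (C := ∑ ζ, |g ζ|) (h.measurable_comp r g).aestronglyMeasurable
      (Eventually.of_forall fun ω => abs_le_sum_abs g _)).bdd_mul hYm.aestronglyMeasurable
      (Eventually.of_forall hB)
  have hI0 : 0 ≤ ∫ ω, Y ω ∂μ := integral_nonneg hY0
  have hG0 : 0 ≤ G := (abs_nonneg _).trans (hG η)
  have h1 : ∫ ω, Y ω * f (X t ω) ∂μ =
      f η * ∫ ω, Y ω ∂μ + ∫ ω, Y ω * (f (X t ω) - f (X s ω)) ∂μ := by
    rw [← integral_const_mul, ← integral_add (hYi.const_mul _)]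
    · refine integral_congr_ae (Eventually.of_forall fun ω => ?_)
      dsimp only
      by_cases hω : X s ω = η
      · rw [hω]
        ring
      · rw [hYη ω hω]
        ring
    · simp only [mul_sub]
      exact (hinteg f t).sub (hinteg f s)
  have h2 : ∀ r ∈ Set.Icc (s : ℝ) t, ∫ ω, Y ω * jumpGenerator φ q f (X r.toNNReal ω) ∂μ ≤
      (jumpGenerator φ q f η + 2 * G * (Q * (t - s))) * ∫ ω, Y ω ∂μ := by
    intro r hr
    have hr0 : 0 ≤ r := s.2.trans hr.1
    have hsr : s ≤ r.toNNReal := (Real.le_toNNReal_iff_coe_le hr0).2 hr.1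
    have hleave := h.integral_leave_le hq hQ hsr η hY hY0 hB hYη
    have hQ0 : 0 ≤ Q := (Finset.sum_nonneg fun i _ => hq η i).trans (hQ η)
    rw [Real.coe_toNNReal r hr0] at hleave
    have hle2 : ∫ ω, Y ω * (if X r.toNNReal ω = η then 0 else 1) ∂μ ≤
        Q * (t - s) * ∫ ω, Y ω ∂μ := by
      refine hleave.trans (mul_le_mul_of_nonneg_right (mul_le_mul_of_nonneg_left ?_ hQ0) hI0)
      linarith [hr.2]
    calc ∫ ω, Y ω * jumpGenerator φ q f (X r.toNNReal ω) ∂μ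
        ≤ ∫ ω, (jumpGenerator φ q f η * Y ω +
            2 * G * (Y ω * (if X r.toNNReal ω = η then 0 else 1))) ∂μ := by
          refine integral_mono_ae (hinteg _ _) ((hYi.const_mul _).add
            ((hinteg (fun ζ => if ζ = η then 0 else 1) _).const_mul _))
            (Eventually.of_forall fun ω => ?_)
          dsimp only
          by_cases hω : X r.toNNReal ω = η
          · rw [hω, if_pos rfl]
            apply le_of_eq
            ring
          · rw [if_neg hω]
            have h3 : jumpGenerator φ q f (X r.toNNReal ω) ≤ jumpGenerator φ q f η + 2 * G := by
              linarith [(abs_le.1 (hG (X r.toNNReal ω))).2, (abs_le.1 (hG η)).1]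
            nlinarith [mul_le_mul_of_nonneg_left h3 (hY0 ω)]
      _ = jumpGenerator φ q f η * ∫ ω, Y ω ∂μ +
            2 * G * ∫ ω, Y ω * (if X r.toNNReal ω = η then 0 else 1) ∂μ := by
          rw [integral_add (hYi.const_mul _)
            ((hinteg (fun ζ => if ζ = η then 0 else 1) _).const_mul _), integral_const_mul,
            integral_const_mul]
      _ ≤ jumpGenerator φ q f η * ∫ ω, Y ω ∂μ + 2 * G * (Q * (t - s) * ∫ ω, Y ω ∂μ) := by
          gcongr
      _ = _ := by ring
  rw [h1, h.integral_mul_sub hst f hY hB]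
  have h3 : ∫ r in (s : ℝ)..t, (∫ ω, Y ω * jumpGenerator φ q f (X r.toNNReal ω) ∂μ) ≤
      ∫ r in (s : ℝ)..t, ((jumpGenerator φ q f η + 2 * G * (Q * (t - s))) * ∫ ω, Y ω ∂μ) :=
    intervalIntegral.integral_mono_on hst' (h.intervalIntegrable_integral _ hYm hB hst')
      intervalIntegrable_const h2
  rw [intervalIntegral.integral_const, smul_eq_mul] at h3
  calc _ ≤ f η * ∫ ω, Y ω ∂μ + (t - s) *
        ((jumpGenerator φ q f η + 2 * G * (Q * (t - s))) * ∫ ω, Y ω ∂μ) := by gcongr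
    _ = _ := by ring

/-- The compensator of the exponential of the functional which adds up `W` over the jumps. -/
def expRate (φ : S → I → S) (q : S → I → ℝ) (W : ℝ≥0 → S → S → ℝ) (r : ℝ≥0) (η : S) : ℝ :=
  ∑ i, q η i * (Real.exp (W r η (φ η i)) - 1)

/-- The discretisation of the exponential martingale of `W`. -/
def expSum (φ : S → I → S) (q : S → I → ℝ) (W : ℝ≥0 → S → S → ℝ) (a d : ℝ≥0) (n : ℕ)
    (x : ℝ≥0 → S) (i : ℕ) : ℝ :=
  ∑ j ∈ Finset.range i,
      W (partPoint a d n j) (x (partPoint a d n j)) (x (partPoint a d n (j + 1))) -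
    ∑ j ∈ Finset.range i, (d / n : ℝ) * expRate φ q W (partPoint a d n j) (x (partPoint a d n j))

theorem abs_exp_sub_one_le {v B : ℝ} (h : |v| ≤ B) : |Real.exp v - 1| ≤ Real.exp B := by
  have h1 := Real.exp_le_exp.2 (abs_le.1 h).2
  have h2 := Real.one_le_exp ((abs_nonneg v).trans h)
  have h3 := Real.exp_pos v
  rw [abs_le]
  constructor <;> linarith

theorem abs_expRate_le {Q B : ℝ} (hq : ∀ η i, 0 ≤ q η i) (hQ : ∀ η, ∑ i, q η i ≤ Q)
    {W : ℝ≥0 → S → S → ℝ} {r : ℝ≥0} (hB : ∀ η η', |W r η η'| ≤ B) (η : S) :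
    |expRate φ q W r η| ≤ Q * Real.exp B := by
  refine (Finset.abs_sum_le_sum_abs _ _).trans ?_
  calc ∑ i, |q η i * (Real.exp (W r η (φ η i)) - 1)| ≤ ∑ i, q η i * Real.exp B := by
        refine Finset.sum_le_sum fun i _ => ?_
        rw [abs_mul, abs_of_nonneg (hq η i)]
        exact mul_le_mul_of_nonneg_left (abs_exp_sub_one_le (hB _ _)) (hq η i)
    _ ≤ Q * Real.exp B := by
        rw [← Finset.sum_mul]
        exact mul_le_mul_of_nonneg_right (hQ η) (Real.exp_pos _).le

theorem IsJumpProcess.measurable_expSum (h : IsJumpProcess φ q μ ℱ X) (W : ℝ≥0 → S → S → ℝ)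
    (a d : ℝ≥0) (n i : ℕ) :
    Measurable[ℱ (partPoint a d n i)] fun ω => expSum φ q W a d n (fun t => X t ω) i := by
  refine Measurable.sub ?_ ?_
  · refine Finset.measurable_fun_sum _ fun j hj => ?_
    exact h.measurable_pair (partPoint_mono a d n (Finset.mem_range.1 hj).le)
      (partPoint_mono a d n (Finset.mem_range.1 hj)) (W (partPoint a d n j))
  · refine Finset.measurable_fun_sum _ fun j hj => ?_
    exact h.measurable_pair (partPoint_mono a d n (Finset.mem_range.1 hj).le)
      (partPoint_mono a d n (Finset.mem_range.1 hj).le)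
      fun η _ => (d / n : ℝ) * expRate φ q W (partPoint a d n j) η

theorem abs_expSum_le {Q B : ℝ} (hq : ∀ η i, 0 ≤ q η i) (hQ : ∀ η, ∑ i, q η i ≤ Q)
    {W : ℝ≥0 → S → S → ℝ} {a d : ℝ≥0} (hB : ∀ r ≤ a + d, ∀ η η', |W r η η'| ≤ B) {n i : ℕ}
    (hi : i ≤ n) (x : ℝ≥0 → S) :
    |expSum φ q W a d n x i| ≤ i * B + i * ((d / n) * (Q * Real.exp B)) := by
  have hp : ∀ j ∈ Finset.range i, partPoint a d n j ≤ a + d := fun j hj =>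
    partPoint_le a d ((Finset.mem_range.1 hj).le.trans hi)
  refine (abs_sub _ _).trans (add_le_add ?_ ?_)
  · refine (Finset.abs_sum_le_sum_abs _ _).trans ((Finset.sum_le_card_nsmul _ _ B
      fun j hj => hB _ (hp j hj) _ _).trans (by simp))
  · refine (Finset.abs_sum_le_sum_abs _ _).trans ((Finset.sum_le_card_nsmul _ _
      ((d / n) * (Q * Real.exp B)) fun j hj => ?_).trans (by simp))
    rw [abs_mul, abs_of_nonneg (by positivity : (0 : ℝ) ≤ d / n)]
    exact mul_le_mul_of_nonneg_left (abs_expRate_le hq hQ (hB _ (hp j hj)) _) (by positivity)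

/-- Given the state η at the start of a step of length h, the new factor has conditional mean at
most e^{-hc}(1 + hc + O(h²)), where c is the compensator at η. The first-order terms cancel and each
step costs only 1 + O(h²). -/
theorem IsJumpProcess.integral_exp_expSum_le (h : IsJumpProcess φ q μ ℱ X) {Q B : ℝ}
    (hq : ∀ η i, 0 ≤ q η i) (hQ : ∀ η, ∑ i, q η i ≤ Q) {W : ℝ≥0 → S → S → ℝ}
    (hW0 : ∀ r η, W r η η = 0) {a d : ℝ≥0} (hB : ∀ r ≤ a + d, ∀ η η', |W r η η'| ≤ B) {n : ℕ}
    (hn : n ≠ 0) {i : ℕ} (hi : i ≤ n) :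
    ∫ ω, Real.exp (expSum φ q W a d n (fun t => X t ω) i) ∂μ ≤
      (1 + 2 * (Q * Real.exp B) * Q * (d / n) ^ 2 * Real.exp (d * (Q * Real.exp B))) ^ i := by
  classical
  induction i with
  | zero => simp [expSum]
  | succ i ih =>
    have ih := ih (Nat.le_of_succ_le hi)
    set T := partPoint a d n i with hT
    set T' := partPoint a d n (i + 1) with hT'
    set G := Q * Real.exp B with hG
    set D := 1 + 2 * G * Q * (d / n) ^ 2 * Real.exp (d * G) with hD
    have hTT : T ≤ T' := partPoint_mono a d n (Nat.le_succ i)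
    have hdiff : (T' : ℝ) - T = d / n := by
      rw [hT', partPoint_succ]
      push_cast
      ring
    have hTle : T ≤ a + d := partPoint_le a d (Nat.le_of_succ_le hi)
    obtain ⟨ω₀⟩ : Nonempty Ω := by
      by_contra hne
      rw [not_nonempty_iff] at hne
      exact IsProbabilityMeasure.ne_zero μ (Measure.eq_zero_of_isEmpty μ)
    have hQ0 : 0 ≤ Q :=
      (Finset.sum_nonneg fun i _ => hq (X 0 ω₀) i).trans (hQ _)
    have hB0 : 0 ≤ B := (abs_nonneg _).trans (hB 0 bot_le (X 0 ω₀) (X 0 ω₀))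
    have hG0 : 0 ≤ G := by positivity
    have hS := h.measurable_expSum W a d n i
    have hSb := fun ω => abs_expSum_le hq hQ hB (Nat.le_of_succ_le hi) (φ := φ) fun t => X t ω
    set U : Ω → ℝ := fun ω => Real.exp (expSum φ q W a d n (fun t => X t ω) i) with hU
    set c := expRate φ q W T with hc
    have hcG : ∀ η, |c η| ≤ G := abs_expRate_le hq hQ (hB T hTle)
    set bd := Real.exp (i * B + i * ((d / n) * (Q * Real.exp B))) with hbd
    have hUm : Measurable[ℱ T] U := Real.measurable_exp.comp hS
    have hUb : ∀ ω, |U ω| ≤ bd := fun ω => by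
      rw [abs_of_pos (Real.exp_pos _)]
      exact Real.exp_le_exp.2 (abs_le.1 (hSb ω)).2
    have hind : ∀ η, Measurable[ℱ T] fun ω => if X T ω = η then (1 : ℝ) else 0 := fun η =>
      Measurable.ite (h.adapted T η) measurable_const measurable_const
    set Y : S → Ω → ℝ := fun η ω => U ω * (if X T ω = η then 1 else 0) with hY
    have hYm : ∀ η, Measurable[ℱ T] (Y η) := fun η => hUm.mul (hind η)
    have hYb : ∀ η ω, |Y η ω| ≤ bd := fun η ω => by
      simp only [hY]
      split_ifs
      · rw [mul_one]; exact hUb ω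
      · rw [mul_zero, abs_zero]; exact (Real.exp_pos _).le
    have hY0 : ∀ η ω, 0 ≤ Y η ω := fun η ω => by
      simp only [hY]
      split_ifs
      · rw [mul_one]; exact (Real.exp_pos _).le
      · rw [mul_zero]
    have hYi : ∀ η, Integrable (Y η) μ := fun η => Integrable.of_bound
      ((hYm η).mono (ℱ.le T) le_rfl).aestronglyMeasurable bd (Eventually.of_forall (hYb η))
    -- Decomposing according to the present state makes W a function of the next state alone, to
    -- which the one-step estimate applies.
    have hsplit : ∀ ω, Real.exp (expSum φ q W a d n (fun t => X t ω) (i + 1)) =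
        ∑ η, Real.exp (-((d / n) * c η)) * (Y η ω * Real.exp (W T η (X T' ω))) := by
      intro ω
      rw [Finset.sum_eq_single (X T ω)]
      · have : expSum φ q W a d n (fun t => X t ω) (i + 1) =
            -((d / n) * c (X T ω)) + (expSum φ q W a d n (fun t => X t ω) i +
              W T (X T ω) (X T' ω)) := by
          rw [expSum, expSum, Finset.sum_range_succ, Finset.sum_range_succ]
          ring
        rw [this, Real.exp_add, Real.exp_add]
        simp only [hY, if_true, mul_one, hU]
      · intro η _ hne
        simp only [hY, if_neg (Ne.symm hne), mul_zero, zero_mul]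
      · exact fun hn => absurd (Finset.mem_univ _) hn
    have hYf : ∀ η, Integrable (fun ω => Y η ω * Real.exp (W T η (X T' ω))) μ := fun η =>
      (Integrable.of_bound (C := ∑ ζ, |Real.exp (W T η ζ)|)
        (h.measurable_comp T' fun ζ => Real.exp (W T η ζ)).aestronglyMeasurable
        (Eventually.of_forall fun ω => abs_le_sum_abs (fun ζ => Real.exp (W T η ζ)) _)).bdd_mul
        (hYi η).aestronglyMeasurable (Eventually.of_forall (hYb η))
    have hstep : ∀ η, Real.exp (-((d / n) * c η)) * ∫ ω, Y η ω * Real.exp (W T η (X T' ω)) ∂μ ≤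
        D * ∫ ω, Y η ω ∂μ := by
      intro η
      -- As W vanishes on the diagonal, the generator applied to ζ ↦ exp W(η, ζ) at η is precisely
      -- the compensator.
      have hgen : jumpGenerator φ q (fun ζ => Real.exp (W T η ζ)) η = c η := by
        simp only [jumpGenerator, hc, expRate, hW0, Real.exp_zero]
      have hgenb : ∀ ζ, |jumpGenerator φ q (fun ζ => Real.exp (W T η ζ)) ζ| ≤ G := by
        intro ζ
        refine (Finset.abs_sum_le_sum_abs _ _).trans ?_
        refine le_trans (Finset.sum_le_sum (g := fun i => q ζ i * Real.exp B) fun i _ => ?_) ?_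
        · rw [abs_mul, abs_of_nonneg (hq ζ i)]
          refine mul_le_mul_of_nonneg_left ?_ (hq ζ i)
          have e1 := Real.exp_le_exp.2 (abs_le.1 (hB T hTle η ζ)).2
          have e2 := Real.exp_le_exp.2 (abs_le.1 (hB T hTle η (φ ζ i))).2
          have e3 := Real.exp_pos (W T η ζ)
          have e4 := Real.exp_pos (W T η (φ ζ i))
          rw [abs_le]
          constructor <;> linarith
        · rw [← Finset.sum_mul]
          exact mul_le_mul_of_nonneg_right (hQ ζ) (Real.exp_pos _).le
      have h1 := h.integral_one_step_le hq hQ hTT η (hYm η) (hY0 η) (hYb η)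
        (fun ω hω => by simp only [hY, if_neg hω, mul_zero])
        (fun ζ => Real.exp (W T η ζ)) hgenb
      rw [hgen, hdiff] at h1
      simp only [hW0, Real.exp_zero] at h1
      have hI0 : 0 ≤ ∫ ω, Y η ω ∂μ := integral_nonneg (hY0 η)
      have hdn : (0 : ℝ) ≤ d / n := by positivity
      have hdn' : (d / n : ℝ) ≤ d :=
        div_le_self d.2 (by exact_mod_cast Nat.one_le_iff_ne_zero.2 hn)
      have h2 : Real.exp (-((d / n) * c η)) *
          (1 + d / n * c η + 2 * G * Q * (d / n) ^ 2) ≤ D := by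
        have e1 : Real.exp (-((d / n) * c η)) * (1 + d / n * c η) ≤ 1 := by
          calc _ ≤ Real.exp (-((d / n) * c η)) * Real.exp (d / n * c η) := by
                gcongr
                linarith [Real.add_one_le_exp ((d : ℝ) / n * c η)]
            _ = 1 := by rw [← Real.exp_add]; simp
        have e2 : Real.exp (-((d / n) * c η)) ≤ Real.exp (d * G) := by
          refine Real.exp_le_exp.2 ?_
          calc -((d / n) * c η) = (d / n) * (-c η) := by ring
            _ ≤ (d / n) * G := by gcongr; linarith [(abs_le.1 (hcG η)).1]
            _ ≤ d * G := by gcongr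
        have e3 : 0 ≤ 2 * G * Q * ((d : ℝ) / n) ^ 2 := by positivity
        have e4 := mul_le_mul_of_nonneg_left e2 e3
        simp only [hD]
        linarith
      calc _ ≤ Real.exp (-((d / n) * c η)) *
            ((1 + d / n * c η + 2 * G * Q * (d / n) ^ 2) * ∫ ω, Y η ω ∂μ) := by gcongr
        _ = (Real.exp (-((d / n) * c η)) * (1 + d / n * c η + 2 * G * Q * (d / n) ^ 2)) *
            ∫ ω, Y η ω ∂μ := by ring
        _ ≤ _ := by gcongr
    have hsumY : ∑ η, ∫ ω, Y η ω ∂μ = ∫ ω, U ω ∂μ := by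
      rw [← integral_finsetSum _ fun η _ => hYi η]
      refine integral_congr_ae (Eventually.of_forall fun ω => ?_)
      simp [hY]
    have hD0 : 0 ≤ D := by positivity
    calc ∫ ω, Real.exp (expSum φ q W a d n (fun t => X t ω) (i + 1)) ∂μ
        = ∑ η, Real.exp (-((d / n) * c η)) * ∫ ω, Y η ω * Real.exp (W T η (X T' ω)) ∂μ := by
          simp_rw [hsplit]
          rw [integral_finsetSum _ fun η _ => (hYf η).const_mul _]
          exact Finset.sum_congr rfl fun η _ => integral_const_mul _ _
      _ ≤ ∑ η, D * ∫ ω, Y η ω ∂μ := Finset.sum_le_sum fun η _ => hstep η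
      _ = D * ∫ ω, U ω ∂μ := by rw [← Finset.mul_sum, hsumY]
      _ ≤ D * D ^ i := by gcongr
      _ = D ^ (i + 1) := by ring

/-- The exponent of the exponential martingale of the functional which adds up `W` over the jumps
in `(a, a + d]`. -/
def expFunctional (φ : S → I → S) (q : S → I → ℝ) (W : ℝ≥0 → S → S → ℝ) (a d : ℝ≥0)
    (x : ℝ≥0 → S) : ℝ :=
  ∑ ρ ∈ jumps x (a + d) with a < ρ, W ρ (leftVal x ρ) (x ρ) -
    ∫ u in (a : ℝ)..((a + d : ℝ≥0) : ℝ), expRate φ q W u.toNNReal (x u.toNNReal)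

theorem tendsto_expSum {x : ℝ≥0 → S} (hx : IsStepPath x) {Q B : ℝ}
    (hq : ∀ η i, 0 ≤ q η i) (hQ : ∀ η, ∑ i, q η i ≤ Q) {W : ℝ≥0 → S → S → ℝ}
    (hW : ∀ η η', Continuous fun r => W r η η') (hW0 : ∀ r η, W r η η = 0) {a d : ℝ≥0}
    (hB : ∀ r ≤ a + d, ∀ η η', |W r η η'| ≤ B) :
    Tendsto (fun n : ℕ => expSum φ q W a d n x n) atTop (𝓝 (expFunctional φ q W a d x)) := by
  refine (tendsto_sum_jumps hx a d hW hW0).sub (tendsto_sum_integral hx a d (fun η => ?_)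
    fun r hr η => abs_expRate_le hq hQ (hB r hr) η)
  unfold expRate
  exact continuous_finsetSum _ fun i _ => continuous_const.mul
    ((Real.continuous_exp.comp (hW _ _)).sub continuous_const)

theorem exists_bound_of_continuous {S : Type*} [Fintype S] {W : ℝ≥0 → S → S → ℝ}
    (hW : ∀ η η', Continuous fun r => W r η η') (T : ℝ≥0) :
    ∃ B, ∀ r ≤ T, ∀ η η', |W r η η'| ≤ B := by
  have : ∀ η η', ∃ B, ∀ r ≤ T, |W r η η'| ≤ B := by
    intro η η'
    obtain ⟨B, hB⟩ := (isCompact_Icc (a := (0 : ℝ≥0)) (b := T)).exists_bound_of_continuousOn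
      (hW η η').continuousOn
    exact ⟨B, fun r hr => hB r ⟨bot_le, hr⟩⟩
  choose B hB using this
  refine ⟨∑ η, ∑ η', |B η η'|, fun r hr η η' => ((hB η η' r hr).trans (le_abs_self _)).trans ?_⟩
  refine (abs_le_sum_abs (B η) η').trans ?_
  exact Finset.single_le_sum (f := fun η => ∑ η', |B η η'|)
    (fun _ _ => Finset.sum_nonneg fun _ _ => abs_nonneg _) (Finset.mem_univ η)

theorem IsJumpProcess.measurable_expFunctional (h : IsJumpProcess φ q μ ℱ X)
    (hq : ∀ η i, 0 ≤ q η i) {W : ℝ≥0 → S → S → ℝ}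
    (hW : ∀ η η', Continuous fun r => W r η η') (hW0 : ∀ r η, W r η η = 0) (a d : ℝ≥0) :
    Measurable fun ω => expFunctional φ q W a d fun t => X t ω := by
  obtain ⟨B, hB⟩ := exists_bound_of_continuous hW (a + d)
  have hQ : ∀ η, ∑ i, q η i ≤ ∑ η, |∑ i, q η i| := fun η =>
    (le_abs_self _).trans (abs_le_sum_abs (fun η => ∑ i, q η i) η)
  refine measurable_of_tendsto_metrizable
    (f := fun (n : ℕ) ω => expSum φ q W a d n (fun t => X t ω) n)
    (fun n => (h.measurable_expSum W a d n n).mono (ℱ.le _) le_rfl)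
    (tendsto_pi_nhds.2 fun ω => tendsto_expSum (h.step ω) hq hQ hW hW0 hB)

/-- With n steps of length d/n the discrete bound is (1 + K/n²)^n ≤ e^{K/n}, which tends to 1.
Fatou's lemma passes to the limit without uniform integrability, since only the inequality is
wanted. -/
theorem IsJumpProcess.lintegral_exp_le_one (h : IsJumpProcess φ q μ ℱ X)
    (hq : ∀ η i, 0 ≤ q η i) {W : ℝ≥0 → S → S → ℝ}
    (hW : ∀ η η', Continuous fun r => W r η η') (hW0 : ∀ r η, W r η η = 0) (a d : ℝ≥0) :
    ∫⁻ ω, ENNReal.ofReal (Real.exp (expFunctional φ q W a d fun t => X t ω)) ∂μ ≤ 1 := by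
  obtain ⟨B, hB⟩ := exists_bound_of_continuous hW (a + d)
  set Q := ∑ η, |∑ i, q η i| with hQd
  have hQ : ∀ η, ∑ i, q η i ≤ Q := fun η =>
    (le_abs_self _).trans (abs_le_sum_abs (fun η => ∑ i, q η i) η)
  have hQ0 : 0 ≤ Q := Finset.sum_nonneg fun _ _ => abs_nonneg _
  set F : ℕ → Ω → ℝ≥0∞ := fun n ω =>
    ENNReal.ofReal (Real.exp (expSum φ q W a d n (fun t => X t ω) n)) with hF
  have hFm : ∀ n, Measurable (F n) := fun n =>
    (Real.measurable_exp.comp ((h.measurable_expSum W a d n n).mono (ℱ.le _) le_rfl)).ennreal_ofReal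
  have hlim : ∀ ω, Tendsto (fun n => F n ω) atTop
      (𝓝 (ENNReal.ofReal (Real.exp (expFunctional φ q W a d fun t => X t ω)))) := fun ω =>
    ENNReal.tendsto_ofReal ((Real.continuous_exp.tendsto _).comp
      (tendsto_expSum (h.step ω) hq hQ hW hW0 hB))
  set K := 2 * (Q * Real.exp B) * Q * d ^ 2 * Real.exp (d * (Q * Real.exp B)) with hK
  have hK0 : 0 ≤ K := by positivity
  have hbound : ∀ n : ℕ, n ≠ 0 → ∫⁻ ω, F n ω ∂μ ≤ ENNReal.ofReal (Real.exp (K / n)) := by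
    intro n hn
    have hinteg : Integrable (fun ω => Real.exp (expSum φ q W a d n (fun t => X t ω) n)) μ := by
      refine Integrable.of_bound (C := Real.exp (n * B + n * ((d / n) * (Q * Real.exp B))))
        (Real.measurable_exp.comp
          ((h.measurable_expSum W a d n n).mono (ℱ.le _) le_rfl)).aestronglyMeasurable
        (Eventually.of_forall fun ω => ?_)
      rw [Real.norm_eq_abs, abs_of_pos (Real.exp_pos _)]
      exact Real.exp_le_exp.2 (abs_le.1 (abs_expSum_le hq hQ hB le_rfl _)).2
    rw [← ofReal_integral_eq_lintegral_ofReal hinteg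
      (Eventually.of_forall fun ω => (Real.exp_pos _).le)]
    refine ENNReal.ofReal_le_ofReal ((h.integral_exp_expSum_le hq hQ hW0 hB hn le_rfl).trans ?_)
    have hn0 : (n : ℝ) ≠ 0 := by exact_mod_cast hn
    have e1 : 2 * (Q * Real.exp B) * Q * ((d : ℝ) / n) ^ 2 * Real.exp (d * (Q * Real.exp B)) =
        K / n ^ 2 := by
      rw [hK]
      ring
    rw [e1]
    calc (1 + K / n ^ 2) ^ n ≤ (Real.exp (K / n ^ 2)) ^ n := by
          gcongr
          linarith [Real.add_one_le_exp (K / (n : ℝ) ^ 2)]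
      _ = Real.exp (K / n) := by
          rw [← Real.exp_nat_mul]
          congr 1
          field_simp
  have hone : Tendsto (fun n : ℕ => ENNReal.ofReal (Real.exp (K / n))) atTop (𝓝 1) := by
    have := ENNReal.tendsto_ofReal ((Real.continuous_exp.tendsto _).comp
      (tendsto_const_div_atTop_nhds_zero_nat K))
    simpa using this
  calc ∫⁻ ω, ENNReal.ofReal (Real.exp (expFunctional φ q W a d fun t => X t ω)) ∂μ
      = ∫⁻ ω, liminf (fun n => F n ω) atTop ∂μ :=
        lintegral_congr fun ω => ((hlim ω).liminf_eq).symm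
    _ ≤ liminf (fun n => ∫⁻ ω, F n ω ∂μ) atTop := lintegral_liminf_le hFm
    _ ≤ liminf (fun n : ℕ => ENNReal.ofReal (Real.exp (K / n))) atTop := by
        refine liminf_le_liminf ?_
        filter_upwards [eventually_ne_atTop 0] with n hn using hbound n hn
    _ = 1 := hone.liminf_eq

/-- Almost surely, all jumps are of the form `η ↦ φ η i`. -/
theorem IsJumpProcess.ae_jumps (h : IsJumpProcess φ q μ ℱ X) (hq : ∀ η i, 0 ≤ q η i) (T : ℝ≥0) :
    ∀ᵐ ω ∂μ, ∀ ρ ∈ jumps (fun t => X t ω) T,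
      ∃ i, X ρ ω = φ (leftVal (fun t => X t ω) ρ) i := by
  classical
  -- A penalty m is charged for each forbidden jump. Permitted jumps are free, so the compensator
  -- vanishes, and the exponential inequality gives m · P(bad) ≤ 1 for all m.
  set W : ℕ → ℝ≥0 → S → S → ℝ := fun m _ η η' =>
    if η' = η ∨ ∃ i, η' = φ η i then 0 else m with hW
  have hrate : ∀ m r η, expRate φ q (W m) r η = 0 := by
    intro m r η
    refine Finset.sum_eq_zero fun i _ => ?_
    have : W m r η (φ η i) = 0 := if_pos (Or.inr ⟨i, rfl⟩)
    rw [this, Real.exp_zero, sub_self, mul_zero]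
  have hfun : ∀ m ω, expFunctional φ q (W m) 0 T (fun t => X t ω) =
      ∑ ρ ∈ jumps (fun t => X t ω) T, W m ρ (leftVal (fun t => X t ω) ρ) (X ρ ω) := by
    intro m ω
    rw [expFunctional]
    simp only [hrate, intervalIntegral.integral_zero, sub_zero, zero_add]
    congr 1
    exact Finset.filter_true_of_mem fun ρ hρ => ((h.step ω).isJumpTimes.mem _ _ hρ).1
  have hle := fun m => h.lintegral_exp_le_one hq (W := W m) (fun _ _ => continuous_const)
    (fun r η => if_pos (Or.inl rfl)) 0 T
  have hmeas := fun m => h.measurable_expFunctional hq (W := W m) (fun _ _ => continuous_const)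
    (fun r η => if_pos (Or.inl rfl)) 0 T
  set bad : Set Ω := {ω | ¬ ∀ ρ ∈ jumps (fun t => X t ω) T,
      ∃ i, X ρ ω = φ (leftVal (fun t => X t ω) ρ) i} with hbad
  change μ bad = 0
  have hbig : ∀ m : ℕ, ∀ ω ∈ bad, (m : ℝ≥0∞) ≤
      ENNReal.ofReal (Real.exp (expFunctional φ q (W m) 0 T fun t => X t ω)) := by
    intro m ω hω
    simp only [hbad, Set.mem_ofPred_eq, not_forall] at hω
    obtain ⟨ρ, hρ, hno⟩ := hω
    have hW1 : W m ρ (leftVal (fun t => X t ω) ρ) (X ρ ω) = m := by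
      refine if_neg ?_
      rintro (h1 | h1)
      · exact ((h.step ω).mem_jumps.1 hρ).1 h1.symm
      · exact hno h1
    rw [hfun, ← ENNReal.ofReal_natCast]
    refine ENNReal.ofReal_le_ofReal ?_
    have h2 : (m : ℝ) ≤
        ∑ ρ ∈ jumps (fun t => X t ω) T, W m ρ (leftVal (fun t => X t ω) ρ) (X ρ ω) := by
      rw [← hW1]
      refine Finset.single_le_sum
        (f := fun ρ => W m ρ (leftVal (fun t => X t ω) ρ) (X ρ ω)) (fun r _ => ?_) hρ
      simp only [hW]
      split_ifs
      · exact le_rfl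
      · exact Nat.cast_nonneg _
    exact h2.trans ((le_add_of_nonneg_right zero_le_one).trans (Real.add_one_le_exp _))
  have hmul : ∀ m : ℕ, (m : ℝ≥0∞) * μ bad ≤ 1 := by
    intro m
    refine le_trans ?_ ((mul_meas_ge_le_lintegral
      ((Real.measurable_exp.comp (hmeas m)).ennreal_ofReal) (m : ℝ≥0∞)).trans (hle m))
    exact mul_le_mul_right (measure_mono fun ω hω => hbig m ω hω) _
  by_contra hne
  obtain ⟨m, hm⟩ := ENNReal.exists_nat_mul_gt hne ENNReal.one_ne_top
  exact absurd (hmul m) (not_le.2 hm)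

end JumpProcess

/-! ### Fourier analysis on the discrete torus -/

section Fourier

open ZMod

theorem fourierMode_eq_prod (w : Fin 2 → ℤ) (x : Fin 2 → ℝ) :
    fourierMode w x = ∏ i, Complex.exp (Complex.I * ((Real.pi * (w i * x i) : ℝ) : ℂ)) := by
  rw [← Complex.exp_sum, fourierMode, mul_assoc, Finset.mul_sum, Finset.mul_sum]
  push_cast
  rfl

theorem norm_fourierMode (w : Fin 2 → ℤ) (x : Fin 2 → ℝ) : ‖fourierMode w x‖ = 1 := by
  rw [fourierMode_eq_prod, norm_prod]
  exact Finset.prod_eq_one fun i _ => Complex.norm_exp_I_mul_ofReal _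

theorem fourierMode_add (w v : Fin 2 → ℤ) (x : Fin 2 → ℝ) :
    fourierMode (w + v) x = fourierMode w x * fourierMode v x := by
  rw [fourierMode, fourierMode, fourierMode, ← Complex.exp_add, ← mul_add,
    ← Finset.sum_add_distrib]
  congr 2
  refine Finset.sum_congr rfl fun i _ => ?_
  rw [Pi.add_apply]
  push_cast
  ring

theorem fourierMode_zero (x : Fin 2 → ℝ) : fourierMode 0 x = 1 := by simp [fourierMode]

theorem fourierMode_neg (w : Fin 2 → ℤ) (x : Fin 2 → ℝ) :
    fourierMode (-w) x = (starRingEnd ℂ) (fourierMode w x) := by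
  rw [fourierMode, fourierMode, ← Complex.exp_conj]
  congr 1
  simp only [Pi.neg_apply, Int.cast_neg, map_mul, Complex.conj_I, Complex.conj_ofReal, map_sum,
    neg_mul, Finset.sum_neg_distrib, mul_neg]
  congr 2
  refine Finset.sum_congr rfl fun i _ => ?_
  rw [← Complex.ofReal_intCast, Complex.conj_ofReal]

variable {N : ℕ}

theorem mesh_pos (N : ℕ) : 0 < mesh N := by
  rw [mesh]
  positivity

theorem mesh_mul (N : ℕ) : mesh N * (2 * N + 1) = 2 := by
  rw [mesh]
  field_simp

theorem mesh_sq_mul (N : ℕ) : (mesh N : ℂ) ^ 2 * (2 * N + 1) ^ 2 = 4 := by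
  rw [← mul_pow]
  have := congrArg (fun r : ℝ => (r : ℂ)) (mesh_mul N)
  push_cast at this
  rw [this]
  norm_num

/-- Since π · mesh = 2π/(2N+1), Fourier modes at lattice points are the standard characters of the
cyclic group; periodicity and orthogonality follow from the group structure. -/
theorem exp_mesh (N : ℕ) (m z : ℤ) :
    Complex.exp (Complex.I * ((Real.pi * (m * (mesh N * z)) : ℝ) : ℂ)) =
      stdAddChar ((m : ZMod (2 * N + 1)) * (z : ZMod (2 * N + 1))) := by
  rw [← Int.cast_mul, stdAddChar_coe, mesh]
  congr 1
  push_cast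
  ring

/-- The character `k ↦ e^{i π w · ε k}` of the discrete torus. -/
def latticeChar (w : Fin 2 → ℤ) (k : Lattice N) : ℂ := fourierMode w (macroPoint k)

theorem latticeChar_eq (w : Fin 2 → ℤ) (k : Lattice N) :
    latticeChar w k = ∏ i, stdAddChar ((w i : ZMod (2 * N + 1)) * k i) := by
  rw [latticeChar, fourierMode_eq_prod]
  refine Finset.prod_congr rfl fun i _ => ?_
  rw [macroPoint, exp_mesh, rep, coe_valMinAbs]

theorem norm_latticeChar (w : Fin 2 → ℤ) (k : Lattice N) : ‖latticeChar w k‖ = 1 :=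
  norm_fourierMode _ _

theorem latticeChar_add (w : Fin 2 → ℤ) (k j : Lattice N) :
    latticeChar w (k + j) = latticeChar w k * latticeChar w j := by
  simp only [latticeChar_eq, ← Finset.prod_mul_distrib]
  refine Finset.prod_congr rfl fun i _ => ?_
  rw [Pi.add_apply, mul_add, AddChar.map_add_eq_mul]

theorem latticeChar_add_left (w v : Fin 2 → ℤ) (k : Lattice N) :
    latticeChar (w + v) k = latticeChar w k * latticeChar v k := fourierMode_add _ _ _

theorem latticeChar_neg_left (w : Fin 2 → ℤ) (k : Lattice N) :
    latticeChar (-w) k = (starRingEnd ℂ) (latticeChar w k) := fourierMode_neg _ _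

theorem latticeChar_neg_right (w : Fin 2 → ℤ) (k : Lattice N) :
    latticeChar w (-k) = latticeChar (-w) k := by
  simp only [latticeChar_eq]
  refine Finset.prod_congr rfl fun i _ => ?_
  simp

theorem latticeChar_sub (w : Fin 2 → ℤ) (k j : Lattice N) :
    latticeChar w (k - j) = latticeChar w k * latticeChar (-w) j := by
  rw [sub_eq_add_neg, latticeChar_add, latticeChar_neg_right]

theorem valMinAbs_mem_Icc (a : ZMod (2 * N + 1)) : a.valMinAbs ∈ Finset.Icc (-(N : ℤ)) N := by
  have := valMinAbs_mem_Ioc a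
  rw [Set.mem_Ioc] at this
  rw [Finset.mem_Icc]
  push_cast at this
  constructor <;> omega

theorem valMinAbs_intCast {m : ℤ} (hm : m ∈ Finset.Icc (-(N : ℤ)) N) :
    ((m : ZMod (2 * N + 1))).valMinAbs = m := by
  rw [valMinAbs_spec]
  rw [Finset.mem_Icc] at hm
  refine ⟨rfl, ?_⟩
  rw [Set.mem_Ioc]
  push_cast
  constructor <;> omega

theorem sum_Icc_eq_sum_zmod {M : Type*} [AddCommMonoid M] (f : ℤ → M) :
    ∑ m ∈ Finset.Icc (-(N : ℤ)) N, f m = ∑ a : ZMod (2 * N + 1), f a.valMinAbs :=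
  Finset.sum_bij' (fun m _ => (m : ZMod (2 * N + 1))) (fun a _ => a.valMinAbs)
    (fun _ _ => Finset.mem_univ _) (fun a _ => valMinAbs_mem_Icc a)
    (fun m hm => valMinAbs_intCast hm) (fun a _ => coe_valMinAbs a)
    (fun m hm => by rw [valMinAbs_intCast hm])

theorem mem_freqBox {w : Fin 2 → ℤ} :
    w ∈ freqBox N ↔ ∀ i, w i ∈ Finset.Icc (-(N : ℤ)) N := Fintype.mem_piFinset

theorem sum_latticeChar {w : Fin 2 → ℤ} {i : Fin 2} (hw : (w i : ZMod (2 * N + 1)) ≠ 0) :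
    ∑ k : Lattice N, latticeChar w k = 0 := by
  simp only [latticeChar_eq]
  rw [← Fintype.piFinset_univ, ← Finset.prod_univ_sum (fun _ => Finset.univ)
    fun i a => (stdAddChar ((w i : ZMod (2 * N + 1)) * a) : ℂ)]
  refine Finset.prod_eq_zero (Finset.mem_univ i) ?_
  simp only [mul_comm (w i : ZMod (2 * N + 1))]
  rw [AddChar.sum_mulShift _ (isPrimitive_stdAddChar _), if_neg hw, Nat.cast_zero]

theorem card_lattice (N : ℕ) : Fintype.card (Lattice N) = (2 * N + 1) ^ 2 := by
  simp [Lattice, ZMod.card]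

theorem sum_latticeChar_sub {w v : Fin 2 → ℤ} (hw : w ∈ freqBox N) (hv : v ∈ freqBox N) :
    ∑ k : Lattice N, latticeChar w k * latticeChar (-v) k =
      if w = v then (2 * (N : ℂ) + 1) ^ 2 else 0 := by
  simp only [← latticeChar_add_left]
  split_ifs with h
  · subst h
    simp [latticeChar, fourierMode_zero]
  · obtain ⟨i, hi⟩ := Function.ne_iff.1 h
    refine sum_latticeChar (i := i) fun h0 => hi ?_
    have : ((w i : ℤ) : ZMod (2 * N + 1)) = (v i : ℤ) := by
      rw [Pi.add_apply, Pi.neg_apply] at h0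
      push_cast at h0
      linear_combination h0
    rw [← valMinAbs_intCast (mem_freqBox.1 hw i), this, valMinAbs_intCast (mem_freqBox.1 hv i)]

theorem fourierTransform_latticeChar {w v : Fin 2 → ℤ} (hw : w ∈ freqBox N) (hv : v ∈ freqBox N) :
    fourierTransform (fun k : Lattice N => latticeChar w k) v = if w = v then 4 else 0 := by
  rw [fourierTransform, if_pos hv]
  calc _ = (mesh N : ℂ) ^ 2 * ∑ k : Lattice N, latticeChar w k * latticeChar (-v) k := by
        rw [Finset.mul_sum]
        exact Finset.sum_congr rfl fun k _ => by rw [mul_assoc]; rfl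
    _ = _ := by
        rw [sum_latticeChar_sub hw hv]
        split_ifs
        · exact mesh_sq_mul N
        · simp

theorem trigExtension_latticeChar {w : Fin 2 → ℤ} (hw : w ∈ freqBox N) (x : Fin 2 → ℝ) :
    trigExtension (fun k : Lattice N => latticeChar w k) x = fourierMode w x := by
  rw [trigExtension, Finset.sum_eq_single w]
  · rw [fourierTransform_latticeChar hw hw, if_pos rfl]
    ring
  · intro v hv hne
    rw [fourierTransform_latticeChar hw hv, if_neg (Ne.symm hne), zero_mul]
  · exact fun h => absurd hw h

/-- The kernel of the trigonometric interpolation. -/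
def interpKernel (N : ℕ) (x : Fin 2 → ℝ) (k : Lattice N) : ℂ :=
  (1 / 4) * ∑ w ∈ freqBox N, (mesh N : ℂ) ^ 2 * fourierMode (-w) (macroPoint k) * fourierMode w x

theorem trigExtension_eq (Y : Lattice N → ℂ) (x : Fin 2 → ℝ) :
    trigExtension Y x = ∑ k, interpKernel N x k * Y k := by
  simp only [trigExtension, interpKernel, Finset.mul_sum, Finset.sum_mul]
  rw [Finset.sum_comm]
  refine Finset.sum_congr rfl fun w hw => ?_
  rw [fourierTransform, if_pos hw, Finset.sum_mul, Finset.mul_sum]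
  exact Finset.sum_congr rfl fun k _ => by ring

theorem trigExtension_sum {ι : Type*} (A : Finset ι) (Y : ι → Lattice N → ℂ) (x : Fin 2 → ℝ) :
    trigExtension (fun k => ∑ i ∈ A, Y i k) x = ∑ i ∈ A, trigExtension (Y i) x := by
  simp only [trigExtension_eq, Finset.mul_sum]
  rw [Finset.sum_comm]

theorem trigExtension_const_mul (c : ℂ) (Y : Lattice N → ℂ) (x : Fin 2 → ℝ) :
    trigExtension (fun k => c * Y k) x = c * trigExtension Y x := by
  simp only [trigExtension_eq, Finset.mul_sum]
  exact Finset.sum_congr rfl fun k _ => by ring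

/-- Parseval on the discrete torus: frequencies in the box give distinct, hence orthogonal,
characters, and the factor 1/4 reflects the area 4 of the torus. -/
theorem sum_norm_sq_latticeChar {B : Finset (Fin 2 → ℤ)} (hB : B ⊆ freqBox N)
    (c : (Fin 2 → ℤ) → ℂ) :
    ∑ k : Lattice N, mesh N ^ 2 * ‖(1 / 4) * ∑ w ∈ B, c w * latticeChar w k‖ ^ 2 =
      (1 / 4) * ∑ w ∈ B, ‖c w‖ ^ 2 := by
  have h : ∀ z : ℂ, ((‖z‖ ^ 2 : ℝ) : ℂ) = z * (starRingEnd ℂ) z := fun z => by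
    rw [Complex.mul_conj, Complex.normSq_eq_norm_sq]
  apply Complex.ofReal_injective
  simp only [Complex.ofReal_sum, Complex.ofReal_mul, h]
  have e1 : ∀ k : Lattice N, ((mesh N ^ 2 : ℝ) : ℂ) * (1 / 4 * ∑ w ∈ B, c w * latticeChar w k *
      1) * (starRingEnd ℂ) (1 / 4 * ∑ w ∈ B, c w * latticeChar w k) =
      ∑ w ∈ B, ∑ v ∈ B, ((mesh N : ℂ) ^ 2 / 16 * (c w * (starRingEnd ℂ) (c v))) *
        (latticeChar w k * latticeChar (-v) k) := by
    intro k
    simp only [map_mul, map_sum, mul_one, ← latticeChar_neg_left]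
    rw [show ((mesh N ^ 2 : ℝ) : ℂ) * (1 / 4 * ∑ w ∈ B, c w * latticeChar w k) *
      ((starRingEnd ℂ) (1 / 4) * ∑ w ∈ B, (starRingEnd ℂ) (c w) * latticeChar (-w) k) =
      ((mesh N : ℂ) ^ 2 / 16) * ((∑ w ∈ B, c w * latticeChar w k) *
      ∑ w ∈ B, (starRingEnd ℂ) (c w) * latticeChar (-w) k) by
        rw [map_div₀, map_one, map_ofNat]; push_cast; ring]
    rw [Finset.sum_mul_sum, Finset.mul_sum]
    refine Finset.sum_congr rfl fun w _ => ?_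
    rw [Finset.mul_sum]
    exact Finset.sum_congr rfl fun v _ => by ring
  simp only [mul_one, mul_assoc] at e1 ⊢
  rw [Finset.sum_congr rfl fun k _ => e1 k, Finset.sum_comm, Finset.mul_sum]
  refine Finset.sum_congr rfl fun w hw => ?_
  rw [Finset.sum_comm]
  simp only [← mul_assoc]
  simp only [mul_assoc, ← Finset.mul_sum]
  rw [Finset.sum_eq_single w]
  · rw [sum_latticeChar_sub (hB hw) (hB hw), if_pos rfl]
    have := mesh_sq_mul N
    push_cast
    linear_combination (1 / 16 * c w * (starRingEnd ℂ) (c w)) * this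
  · intro v hv hne
    rw [sum_latticeChar_sub (hB hw) (hB hv), if_neg (Ne.symm hne)]
    simp
  · exact fun h => absurd hw h

end Fourier

/-! ### The Lebesgue constant of trigonometric interpolation -/

section Lebesgue

open ZMod

/-- The normalised Dirichlet kernel. -/
def dirichletKernel (N : ℕ) (y : ℝ) : ℂ :=
  (1 / (2 * (N : ℂ) + 1)) * ∑ m ∈ Finset.Icc (-(N : ℤ)) N,
    Complex.exp (Complex.I * ((Real.pi * (m * y) : ℝ) : ℂ))

/-- A quantity of the order of `log N`. -/
def logSize (N : ℕ) : ℝ := 1 + ∑ m ∈ Finset.Icc 1 N, (m : ℝ)⁻¹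

variable {N : ℕ}

theorem one_le_logSize (N : ℕ) : 1 ≤ logSize N :=
  le_add_of_nonneg_right (Finset.sum_nonneg fun _ _ => by positivity)

theorem interpKernel_eq (x : Fin 2 → ℝ) (k : Lattice N) :
    interpKernel N x k = ∏ i, dirichletKernel N (x i - macroPoint k i) := by
  simp only [dirichletKernel, Finset.prod_mul_distrib]
  rw [← Finset.sum_prod_piFinset (Finset.Icc (-(N : ℤ)) N) fun i m =>
    Complex.exp (Complex.I * ((Real.pi * (m * (x i - macroPoint k i)) : ℝ) : ℂ))]
  have h4 := mesh_sq_mul N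
  have hne : (2 * (N : ℂ) + 1) ≠ 0 := by exact_mod_cast (by omega : 2 * N + 1 ≠ 0)
  have hc : (1 / 4 : ℂ) * (mesh N : ℂ) ^ 2 = ∏ _i : Fin 2, (1 / (2 * (N : ℂ) + 1)) := by
    rw [Fin.prod_univ_two]
    field_simp
    linear_combination h4
  rw [← hc, interpKernel, mul_assoc, freqBox]
  congr 1
  rw [Finset.mul_sum]
  refine Finset.sum_congr rfl fun w _ => ?_
  rw [mul_assoc, fourierMode_eq_prod, fourierMode_eq_prod, ← Finset.prod_mul_distrib]
  congr 1
  refine Finset.prod_congr rfl fun i _ => ?_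
  rw [← Complex.exp_add]
  congr 1
  rw [Pi.neg_apply]
  push_cast
  ring

theorem dirichletKernel_add_two_mul (y : ℝ) (z : ℤ) :
    dirichletKernel N (y + 2 * z) = dirichletKernel N y := by
  unfold dirichletKernel
  congr 1
  refine Finset.sum_congr rfl fun m _ => ?_
  rw [Complex.exp_eq_exp_iff_exists_int]
  refine ⟨m * z, ?_⟩
  push_cast
  ring

theorem card_Icc_neg (N : ℕ) : (Finset.Icc (-(N : ℤ)) N).card = 2 * N + 1 := by
  rw [Int.card_Icc]
  omega

theorem norm_dirichletKernel_le_one (y : ℝ) : ‖dirichletKernel N y‖ ≤ 1 := by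
  have hpos : (0 : ℝ) < 2 * N + 1 := by positivity
  have h1 : ‖∑ m ∈ Finset.Icc (-(N : ℤ)) N,
      Complex.exp (Complex.I * ((Real.pi * (m * y) : ℝ) : ℂ))‖ ≤ 2 * N + 1 := by
    refine (norm_sum_le _ _).trans ?_
    simp only [Complex.norm_exp_I_mul_ofReal, Finset.sum_const, card_Icc_neg]
    simp
  have h2 : ‖(1 / (2 * (N : ℂ) + 1))‖ = (2 * (N : ℝ) + 1)⁻¹ := by
    rw [show (2 * (N : ℂ) + 1) = ((2 * N + 1 : ℝ) : ℂ) by push_cast; ring, one_div, norm_inv,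
      Complex.norm_real, Real.norm_of_nonneg hpos.le]
  rw [dirichletKernel, norm_mul, h2, inv_mul_le_one₀ hpos]
  exact h1

theorem sum_Icc_shift {M : Type*} [AddCommGroup M] (f : ℤ → M) (N : ℕ) :
    ∑ m ∈ Finset.Icc (-(N : ℤ)) N, (f (m + 1) - f m) = f (N + 1) - f (-(N : ℤ)) := by
  induction N with
  | zero => simp
  | succ N ih =>
    have h : Finset.Icc (-((N + 1 : ℕ) : ℤ)) ((N + 1 : ℕ) : ℤ) =
        insert (-((N + 1 : ℕ) : ℤ)) (insert ((N + 1 : ℕ) : ℤ) (Finset.Icc (-(N : ℤ)) N)) := by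
      ext m
      simp only [Finset.mem_insert, Finset.mem_Icc]
      push_cast
      omega
    rw [h, Finset.sum_insert, Finset.sum_insert, ih]
    · push_cast
      rw [show -((N : ℤ) + 1) + 1 = -N by ring]
      abel
    · simp
    · simp only [Finset.mem_insert, Finset.mem_Icc]
      push_cast
      omega

/-- The geometric sum telescopes after multiplication by e^{iπy} - 1, leaving a difference of two
unimodular numbers, while |e^{iπy} - 1| = 2|sin(πy/2)|. -/
theorem norm_dirichletKernel_mul_sin_le (y : ℝ) :
    ‖dirichletKernel N y‖ * ((2 * N + 1) * |Real.sin (Real.pi * y / 2)|) ≤ 1 := by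
  have hpos : (0 : ℝ) < 2 * N + 1 := by positivity
  have hne : (2 * (N : ℂ) + 1) ≠ 0 := by exact_mod_cast (by omega : 2 * N + 1 ≠ 0)
  have h1 : dirichletKernel N y * ((2 * (N : ℂ) + 1) *
      (Complex.exp (Complex.I * ((Real.pi * y : ℝ) : ℂ)) - 1)) =
      Complex.exp (Complex.I * ((Real.pi * (((N + 1 : ℤ) : ℝ) * y) : ℝ) : ℂ)) -
      Complex.exp (Complex.I * ((Real.pi * (((-(N : ℤ) : ℤ) : ℝ) * y) : ℝ) : ℂ)) := by
    rw [← sum_Icc_shift fun m : ℤ => Complex.exp (Complex.I * ((Real.pi * (m * y) : ℝ) : ℂ))]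
    rw [dirichletKernel]
    field_simp
    rw [Finset.sum_mul]
    refine Finset.sum_congr rfl fun m _ => ?_
    rw [mul_sub, mul_one, ← Complex.exp_add]
    congr 2 <;>
    · push_cast
      ring
  have h2 := congrArg norm h1
  rw [norm_mul, norm_mul, Complex.norm_exp_I_mul_ofReal_sub_one] at h2
  have h3 : ‖(2 * (N : ℂ) + 1)‖ = 2 * (N : ℝ) + 1 := by
    rw [show (2 * (N : ℂ) + 1) = ((2 * N + 1 : ℝ) : ℂ) by push_cast; ring,
      Complex.norm_real, Real.norm_of_nonneg hpos.le]
  have h4 : ‖(2 : ℝ) * Real.sin (Real.pi * y / 2)‖ = 2 * |Real.sin (Real.pi * y / 2)| := by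
    rw [norm_mul, Real.norm_eq_abs, Real.norm_eq_abs, abs_two]
  rw [h3, h4] at h2
  have h5 := norm_sub_le (Complex.exp (Complex.I * ((Real.pi * (((N + 1 : ℤ) : ℝ) * y) : ℝ) : ℂ)))
    (Complex.exp (Complex.I * ((Real.pi * (((-(N : ℤ) : ℤ) : ℝ) * y) : ℝ) : ℂ)))
  rw [Complex.norm_exp_I_mul_ofReal, Complex.norm_exp_I_mul_ofReal] at h5
  rw [← h2] at h5
  linarith

theorem sum_Icc_neg_le {f : ℤ → ℝ} (N : ℕ) (hf0 : f 0 ≤ 1)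
    (hf : ∀ m : ℕ, 1 ≤ m → m ≤ N → f m ≤ (m : ℝ)⁻¹ ∧ f (-m) ≤ (m : ℝ)⁻¹) :
    ∑ m ∈ Finset.Icc (-(N : ℤ)) N, f m ≤ 2 * logSize N := by
  have key : ∑ m ∈ Finset.Icc (-(N : ℤ)) N, f m ≤ 1 + 2 * ∑ m ∈ Finset.Icc 1 N, (m : ℝ)⁻¹ := by
    induction N with
    | zero => simpa using hf0
    | succ N ih =>
      have h : Finset.Icc (-((N + 1 : ℕ) : ℤ)) ((N + 1 : ℕ) : ℤ) =
          insert (-((N + 1 : ℕ) : ℤ)) (insert ((N + 1 : ℕ) : ℤ) (Finset.Icc (-(N : ℤ)) N)) := by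
        ext m
        simp only [Finset.mem_insert, Finset.mem_Icc]
        push_cast
        omega
      rw [h, Finset.sum_insert, Finset.sum_insert, Finset.sum_Icc_succ_top (by omega)]
      · have h1 := ih fun m h1 h2 => hf m h1 (h2.trans (Nat.le_succ N))
        have h2 := hf (N + 1) (by omega) le_rfl
        linarith [h2.1, h2.2]
      · simp
      · simp only [Finset.mem_insert, Finset.mem_Icc]
        push_cast
        omega
  rw [logSize]
  linarith

/-- The lattice is recentred at the node nearest to x. The node at m steps from it contributes at
most 1/|m|, and the nearest node at most 1, so the sum is harmonic. -/
theorem sum_norm_dirichletKernel_le (x : ℝ) :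
    ∑ a : ZMod (2 * N + 1), ‖dirichletKernel N (x - mesh N * a.valMinAbs)‖ ≤ 2 * logSize N := by
  have hm := mesh_pos N
  set z : ℤ := round (x / mesh N) with hz
  set y : ℝ := x - mesh N * z with hy
  have hyb : |y| ≤ mesh N / 2 := by
    have h1 := abs_sub_round (x / mesh N)
    have h2 : y = mesh N * (x / mesh N - z) := by
      rw [hy]
      field_simp
    rw [h2, abs_mul, abs_of_pos hm]
    calc mesh N * |x / mesh N - z| ≤ mesh N * (1 / 2) := by gcongr
      _ = _ := by ring
  have hshift : ∑ a : ZMod (2 * N + 1), ‖dirichletKernel N (x - mesh N * a.valMinAbs)‖ =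
      ∑ a : ZMod (2 * N + 1), ‖dirichletKernel N (y - mesh N * a.valMinAbs)‖ := by
    rw [← Equiv.sum_comp (Equiv.addRight (z : ZMod (2 * N + 1)))]
    refine Finset.sum_congr rfl fun a _ => ?_
    congr 1
    -- The shift of representatives is correct up to a multiple of 2N+1, which is a multiple of the
    -- period 2 after scaling by the mesh.
    obtain ⟨c, hc⟩ : ((2 * N + 1 : ℕ) : ℤ) ∣
        a.valMinAbs + z - (a + (z : ZMod (2 * N + 1))).valMinAbs := by
      rw [← intCast_zmod_eq_zero_iff_dvd]
      push_cast
      simp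
    rw [← dirichletKernel_add_two_mul (y - mesh N * a.valMinAbs) c]
    congr 1
    have hc' : (a.valMinAbs : ℝ) + z - (a + (z : ZMod (2 * N + 1))).valMinAbs =
        (2 * N + 1) * c := by exact_mod_cast hc
    have hmm := mesh_mul N
    rw [Equiv.coe_addRight, hy]
    linear_combination mesh N * hc' + c * hmm
  rw [hshift, ← sum_Icc_eq_sum_zmod fun m => ‖dirichletKernel N (y - mesh N * m)‖]
  have hmain : ∀ m : ℤ, 1 ≤ |m| → |m| ≤ N →
      ‖dirichletKernel N (y - mesh N * m)‖ ≤ (|m| : ℝ)⁻¹ := by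
    intro m h1 h2
    have h1' : (1 : ℝ) ≤ |(m : ℝ)| := by exact_mod_cast h1
    have h2' : |(m : ℝ)| ≤ N := by exact_mod_cast h2
    have hmm := mesh_mul N
    set u := y - mesh N * m with hu
    have habs : |mesh N * (m : ℝ)| = mesh N * |(m : ℝ)| := by rw [abs_mul, abs_of_pos hm]
    -- The offset is at most half a cell and |m| ≤ N, so |u| ≤ (N + 1/2) mesh = 1. This is the range
    -- in which Jordan's inequality |sin(πu/2)| ≥ |u| is available.
    have hu1 : |u| ≤ 1 := by
      have : |u| ≤ |y| + |mesh N * (m : ℝ)| := abs_sub _ _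
      rw [habs] at this
      nlinarith
    have hu2 : mesh N * |(m : ℝ)| / 2 ≤ |u| := by
      have h3 : |mesh N * (m : ℝ)| - |y| ≤ |u| := by
        rw [hu, abs_sub_comm y]
        exact abs_sub_abs_le_abs_sub _ _
      rw [habs] at h3
      nlinarith
    have hsin : |u| ≤ |Real.sin (Real.pi * u / 2)| := by
      have h3 : |Real.pi * u / 2| = Real.pi * |u| / 2 := by
        rw [abs_div, abs_mul, abs_of_pos Real.pi_pos, abs_two]
      have h4 := Real.mul_abs_le_abs_sin (x := Real.pi * u / 2) (by
        rw [h3]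
        nlinarith [Real.pi_pos])
      rw [h3] at h4
      refine le_trans (le_of_eq ?_) h4
      field_simp
    have h5 := norm_dirichletKernel_mul_sin_le (N := N) u
    have h6 : |(m : ℝ)| ≤ (2 * N + 1) * |Real.sin (Real.pi * u / 2)| := by
      calc |(m : ℝ)| = (2 * N + 1) * (mesh N * |(m : ℝ)| / 2) := by
            linear_combination (-|(m : ℝ)| / 2) * hmm
        _ ≤ (2 * N + 1) * |Real.sin (Real.pi * u / 2)| := by
            gcongr
            exact hu2.trans hsin
    rw [← one_div, le_div_iff₀ (by linarith)]
    exact (mul_le_mul_of_nonneg_left h6 (norm_nonneg _)).trans h5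
  refine sum_Icc_neg_le N (norm_dirichletKernel_le_one _) fun m h1 h2 => ?_
  constructor
  · have := hmain m (by simpa using h1) (by simpa using h2)
    simpa using this
  · have := hmain (-m) (by simpa using h1) (by simpa using h2)
    simpa using this

/-- The Lebesgue constant of the trigonometric interpolation. -/
theorem sum_norm_interpKernel_le (x : Fin 2 → ℝ) :
    ∑ k : Lattice N, ‖interpKernel N x k‖ ≤ (2 * logSize N) ^ 2 := by
  simp only [interpKernel_eq, norm_prod]
  have h := Finset.prod_univ_sum (fun _ : Fin 2 => (Finset.univ : Finset (ZMod (2 * N + 1))))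
    fun i a => ‖dirichletKernel N (x i - mesh N * a.valMinAbs)‖
  rw [Fintype.piFinset_univ] at h
  simp only [macroPoint, rep]
  rw [← h, Fin.prod_univ_two, sq]
  exact mul_le_mul (sum_norm_dirichletKernel_le _) (sum_norm_dirichletKernel_le _)
    (Finset.sum_nonneg fun _ _ => norm_nonneg _) (by linarith [one_le_logSize N])

theorem norm_trigExtension_le {Y : Lattice N → ℂ} {C : ℝ} (hY : ∀ k, ‖Y k‖ ≤ C)
    (x : Fin 2 → ℝ) : ‖trigExtension Y x‖ ≤ (2 * logSize N) ^ 2 * C := by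
  have hC : 0 ≤ C := (norm_nonneg _).trans (hY 0)
  rw [trigExtension_eq]
  refine (norm_sum_le _ _).trans ?_
  calc ∑ k, ‖interpKernel N x k * Y k‖ ≤ ∑ k, ‖interpKernel N x k‖ * C := by
        refine Finset.sum_le_sum fun k _ => ?_
        rw [norm_mul]
        exact mul_le_mul_of_nonneg_left (hY k) (norm_nonneg _)
    _ ≤ _ := by
        rw [← Finset.sum_mul]
        exact mul_le_mul_of_nonneg_right (sum_norm_interpKernel_le x) hC

end Lebesgue

/-! ### The Fourier transform of the Kac kernel -/

section Kernel

open ZMod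

/-! #### Elementary bounds on the scales -/

theorem size_mul_le {γ : ℝ} (hγ : 0 < γ) : γ ^ 2 * size γ ≤ 1 := by
  have h := Nat.floor_le (a := (γ ^ 2)⁻¹) (by positivity)
  calc γ ^ 2 * size γ ≤ γ ^ 2 * (γ ^ 2)⁻¹ := by
        unfold size
        gcongr
    _ = 1 := mul_inv_cancel₀ (by positivity)

theorem one_le_size_mul {γ : ℝ} (hγ : 0 < γ) : 1 ≤ γ ^ 2 * (size γ + 1) := by
  have h := (Nat.lt_floor_add_one (γ ^ 2)⁻¹).le
  calc 1 = γ ^ 2 * (γ ^ 2)⁻¹ := (mul_inv_cancel₀ (by positivity)).symm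
    _ ≤ γ ^ 2 * (size γ + 1) := by
        unfold size
        gcongr

/-- The rescaled kernel is supported in radius 3/γ, so with this bound its support does not wrap
around the torus. -/
theorem three_le_mul_size {γ : ℝ} (hγ : 0 < γ) (hγ' : γ ≤ 1 / 4) : 3 ≤ γ * size γ := by
  have h := one_le_size_mul hγ
  nlinarith

theorem mesh_size_le {γ : ℝ} (hγ : 0 < γ) : mesh (size γ) ≤ 2 * γ ^ 2 := by
  have h := one_le_size_mul hγ
  rw [mesh, div_le_iff₀ (by positivity)]
  nlinarith

theorem le_mesh_size {γ : ℝ} (hγ : 0 < γ) (hγ' : γ ≤ 1 / 4) :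
    2 / 3 * γ ^ 2 ≤ mesh (size γ) := by
  have h := size_mul_le hγ
  rw [mesh, le_div_iff₀ (by positivity)]
  nlinarith

/-! #### Lattice points -/

variable {N : ℕ}

/-- The lattice point with integer coordinates `v`. -/
def latticePoint (N : ℕ) (v : Fin 2 → ℤ) : Lattice N := fun i => (v i : ZMod (2 * N + 1))

theorem latticeChar_latticePoint (w v : Fin 2 → ℤ) :
    latticeChar w (latticePoint N v) = fourierMode w fun i => mesh N * v i := by
  rw [latticeChar_eq, fourierMode_eq_prod]
  refine Finset.prod_congr rfl fun i _ => ?_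
  rw [exp_mesh]
  rfl

theorem rep_latticePoint {v : Fin 2 → ℤ} (hv : v ∈ freqBox N) : rep (latticePoint N v) = v := by
  ext i
  exact valMinAbs_intCast (mem_freqBox.1 hv i)

theorem latticePoint_rep (k : Lattice N) : latticePoint N (rep k) = k := by
  ext i
  exact coe_valMinAbs (k i)

theorem rep_mem_freqBox (k : Lattice N) : rep k ∈ freqBox N :=
  mem_freqBox.2 fun i => valMinAbs_mem_Icc (k i)

theorem latticePoint_injOn : Set.InjOn (latticePoint N) (freqBox N : Set (Fin 2 → ℤ)) := by
  intro v hv v' hv' h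
  rw [← rep_latticePoint hv, h, rep_latticePoint hv']

theorem latticePoint_add (v v' : Fin 2 → ℤ) :
    latticePoint N (v + v') = latticePoint N v + latticePoint N v' := by
  ext i
  simp [latticePoint]

theorem latticePoint_ne_zero {v : Fin 2 → ℤ} (hv : v ∈ freqBox N) (h0 : v ≠ 0) :
    latticePoint N v ≠ 0 := by
  intro h
  refine h0 (latticePoint_injOn hv (mem_freqBox.2 fun i => ?_) ?_)
  · simp
  · rw [h]
    ext i
    simp [latticePoint]

theorem fourierMode_re (w : Fin 2 → ℤ) (x : Fin 2 → ℝ) :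
    (fourierMode w x).re = Real.cos (Real.pi * ∑ i, w i * x i) := by
  have : Complex.I * Real.pi * ∑ i, (w i : ℂ) * (x i : ℂ) =
      ((Real.pi * ∑ i, w i * x i : ℝ) : ℂ) * Complex.I := by
    push_cast
    ring
  rw [fourierMode, this, Complex.exp_ofReal_mul_I_re]

theorem abs_mesh_mul_le {w : Fin 2 → ℤ} (hw : w ∈ freqBox N) (i : Fin 2) :
    mesh N * |(w i : ℝ)| ≤ 1 := by
  have h := Finset.mem_Icc.1 (mem_freqBox.1 hw i)
  have h1 : |(w i : ℝ)| ≤ N := by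
    rw [abs_le]
    exact ⟨by exact_mod_cast h.1, by exact_mod_cast h.2⟩
  have := mesh_mul N
  have := mesh_pos N
  nlinarith

theorem one_sub_re_latticeChar_single {w : Fin 2 → ℤ} (i : Fin 2) {n : ℕ}
    (hn : mesh N * (n * |(w i : ℝ)|) ≤ 1) :
    2 * (mesh N * (n * |(w i : ℝ)|)) ^ 2 ≤
      1 - (latticeChar w (latticePoint N (Pi.single i (n : ℤ)))).re := by
  rw [latticeChar_latticePoint, fourierMode_re]
  have hs : ∑ j, (w j : ℝ) * (mesh N * ((Pi.single i (n : ℤ) : Fin 2 → ℤ) j : ℝ)) =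
      mesh N * (n * w i) := by
    rw [Finset.sum_eq_single i]
    · rw [Pi.single_eq_same]
      push_cast
      ring
    · intro j _ hj
      rw [Pi.single_eq_of_ne hj]
      simp
    · simp
  rw [hs]
  have habs : |Real.pi * (mesh N * (n * w i))| = Real.pi * (mesh N * (n * |(w i : ℝ)|)) := by
    rw [abs_mul, abs_mul, abs_mul, abs_of_pos Real.pi_pos, abs_of_pos (mesh_pos N), Nat.abs_cast]
  have h1 := Real.cos_le_one_sub_mul_cos_sq (x := Real.pi * (mesh N * (n * w i))) (by
    rw [habs]
    nlinarith [Real.pi_pos])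
  rw [← sq_abs (Real.pi * (mesh N * (n * w i))), habs, mul_pow] at h1
  have hpi : (2 / Real.pi ^ 2) * (Real.pi ^ 2 * (mesh N * (n * |(w i : ℝ)|)) ^ 2) =
      2 * (mesh N * (n * |(w i : ℝ)|)) ^ 2 := by
    field_simp
  rw [hpi] at h1
  linarith

theorem norm_sub_one_sq {u : ℂ} (hu : ‖u‖ = 1) : ‖u - 1‖ ^ 2 = 2 * (1 - u.re) := by
  have h := Complex.sq_norm_sub_sq_re u
  rw [hu] at h
  rw [← Complex.normSq_eq_norm_sq, Complex.normSq_apply]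
  simp only [Complex.sub_re, Complex.one_re, Complex.sub_im, Complex.one_im, sub_zero]
  nlinarith

/-- For unimodular u one has 1 - Re u = |u - 1|²/2, and the claim is the triangle inequality for
χ(k)(χ(j) - 1) = (χ(k+j) - 1) - (χ(k) - 1). Whatever the phase at k, a pair of points differing by j
sees the oscillation of χ(j). -/
theorem one_sub_re_latticeChar_le (w : Fin 2 → ℤ) (k j : Lattice N) :
    1 - (latticeChar w j).re ≤
      2 * ((1 - (latticeChar w k).re) + (1 - (latticeChar w (k + j)).re)) := by
  have h1 := norm_sub_one_sq (norm_latticeChar w k)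
  have h2 := norm_sub_one_sq (norm_latticeChar w j)
  have h3 := norm_sub_one_sq (norm_latticeChar w (k + j))
  have h4 : ‖latticeChar w j - 1‖ ≤ ‖latticeChar w k - 1‖ + ‖latticeChar w (k + j) - 1‖ := by
    have e1 : latticeChar w k * (latticeChar w j - 1) =
        (latticeChar w (k + j) - 1) - (latticeChar w k - 1) := by
      rw [latticeChar_add]
      ring
    have e2 := congrArg norm e1
    rw [norm_mul, norm_latticeChar, one_mul] at e2
    rw [e2, add_comm ‖latticeChar w k - 1‖]
    exact norm_sub_le (latticeChar w (k + j) - 1) (latticeChar w k - 1)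
  have h5 : ‖latticeChar w j - 1‖ ^ 2 ≤
      2 * (‖latticeChar w k - 1‖ ^ 2 + ‖latticeChar w (k + j) - 1‖ ^ 2) := by
    nlinarith [sq_nonneg (‖latticeChar w k - 1‖ - ‖latticeChar w (k + j) - 1‖),
      norm_nonneg (latticeChar w j - 1), norm_nonneg (latticeChar w k - 1),
      norm_nonneg (latticeChar w (k + j) - 1)]
  linarith

theorem one_sub_re_latticeChar_nonneg (w : Fin 2 → ℤ) (k : Lattice N) :
    0 ≤ 1 - (latticeChar w k).re := by
  have := Complex.re_le_norm (latticeChar w k)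
  rw [norm_latticeChar] at this
  linarith

/-! #### The kernel on the lattice -/

variable {𝔎 : EuclideanSpace ℝ (Fin 2) → ℝ} {γ : ℝ}

theorem IsKacKernel.eq_zero (h : IsKacKernel 𝔎) {x : EuclideanSpace ℝ (Fin 2)} {i : Fin 2}
    (hx : 3 ≤ |x i|) : 𝔎 x = 0 := by
  by_contra hne
  have h1 := h.tsupport_subset (subset_tsupport _ (Function.mem_support.2 hne))
  rw [mem_ball_zero_iff] at h1
  have h2 := PiLp.norm_apply_le x i
  rw [Real.norm_eq_abs] at h2
  linarith

theorem IsKacKernel.hasCompactSupport (h : IsKacKernel 𝔎) : HasCompactSupport 𝔎 :=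
  (isCompact_closedBall (0 : EuclideanSpace ℝ (Fin 2)) 3).of_isClosed_subset (isClosed_tsupport _)
    (h.tsupport_subset.trans Metric.ball_subset_closedBall)

/-- The derivative of a compactly supported C² function is Lipschitz. The second difference is an
increment over [0, 1] of the first difference along the segment, whose derivative is O(‖v‖²). -/
theorem IsKacKernel.second_difference (h : IsKacKernel 𝔎) :
    ∃ C : ℝ, 0 ≤ C ∧ ∀ x v, |2 * 𝔎 x - 𝔎 (x + v) - 𝔎 (x - v)| ≤ C * ‖v‖ ^ 2 := by
  obtain ⟨C, hC⟩ := ContDiff.lipschitzWith_of_hasCompactSupport (n := 1) (𝕂 := ℝ)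
    (f := fderiv ℝ 𝔎) (h.hasCompactSupport.fderiv (𝕜 := ℝ))
    (h.contDiff.fderiv_right (by norm_num)) (by norm_num)
  refine ⟨C, C.2, fun x v => ?_⟩
  have hd : Differentiable ℝ 𝔎 := h.contDiff.differentiable (by norm_num)
  set g : ℝ → ℝ := fun s => 𝔎 (x + s • v) - 𝔎 (x + s • v - v) with hg
  have hder : ∀ s : ℝ, HasDerivAt g
      (fderiv ℝ 𝔎 (x + s • v) v - fderiv ℝ 𝔎 (x + s • v - v) v) s := by
    intro s
    have hl : HasDerivAt (fun s : ℝ => x + s • v) v s := by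
      simpa using ((hasDerivAt_id s).smul_const v).const_add x
    exact ((hd _).hasFDerivAt.comp_hasDerivAt s hl).sub
      ((hd _).hasFDerivAt.comp_hasDerivAt s (hl.sub_const v))
  have hb : ∀ s : ℝ, ‖fderiv ℝ 𝔎 (x + s • v) v - fderiv ℝ 𝔎 (x + s • v - v) v‖ ≤ C * ‖v‖ ^ 2 := by
    intro s
    rw [← sub_apply]
    refine (ContinuousLinearMap.le_opNorm _ _).trans ?_
    have h1 := hC.dist_le_mul (x + s • v) (x + s • v - v)
    rw [dist_eq_norm, dist_eq_norm] at h1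
    have h2 : x + s • v - (x + s • v - v) = v := by abel
    rw [h2] at h1
    rw [sq, ← mul_assoc]
    exact mul_le_mul_of_nonneg_right h1 (norm_nonneg _)
  have h3 := convex_univ.norm_image_sub_le_of_norm_hasDerivWithin_le (f := g)
    (s := Set.univ) (x := 0) (y := 1) (fun s _ => (hder s).hasDerivWithinAt) (fun s _ => hb s)
    (Set.mem_univ _) (Set.mem_univ _)
  have h4 : 2 * 𝔎 x - 𝔎 (x + v) - 𝔎 (x - v) = -(g 1 - g 0) := by
    simp only [hg, one_smul, zero_smul, add_zero, add_sub_cancel_right]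
    ring
  rw [h4, abs_neg]
  simpa using h3

/-- The lattice points in a ball (for the supremum norm) of radius `4 / γ`. -/
def nearOrigin (γ : ℝ) (N : ℕ) : Finset (Lattice N) :=
  Finset.univ.filter fun k => ∀ i, |γ * (rep k i : ℝ)| ≤ 4

theorem card_nearOrigin_le (hγ : 0 < γ) (hγ' : γ ≤ 1 / 4) :
    γ ^ 2 * ((nearOrigin γ N).card : ℝ) ≤ 81 := by
  set m : ℕ := ⌊4 / γ⌋₊ with hm
  have h1 : (nearOrigin γ N).card ≤
      (Fintype.piFinset fun _ : Fin 2 => Finset.Icc (-(m : ℤ)) m).card := by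
    refine Finset.card_le_card_of_injOn (fun k => rep k) (fun k hk => ?_) ?_
    · have hk' := (Finset.mem_filter.1 hk).2
      refine Finset.mem_coe.2 (Fintype.mem_piFinset.2 fun i => ?_)
      have h2 : |(rep k i : ℝ)| ≤ 4 / γ := by
        rw [le_div_iff₀ hγ, mul_comm]
        have := hk' i
        rwa [abs_mul, abs_of_pos hγ] at this
      have h3 : (rep k i).natAbs ≤ m := by
        rw [hm, Nat.le_floor_iff (by positivity), Nat.cast_natAbs, Int.cast_abs]
        exact h2
      have h4 : -(m : ℤ) ≤ rep k i ∧ rep k i ≤ m := by omega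
      exact Finset.mem_Icc.2 h4
    · intro k _ k' _ h
      rw [← latticePoint_rep k, ← latticePoint_rep k']
      exact congrArg _ h
  rw [Fintype.card_piFinset_const, card_Icc_neg] at h1
  have h2 : ((nearOrigin γ N).card : ℝ) ≤ (2 * m + 1) ^ 2 := by exact_mod_cast h1
  have h3 : (m : ℝ) ≤ 4 / γ := Nat.floor_le (by positivity)
  -- The source of 81: a square of side 2m + 1 with γm ≤ 4 and γ ≤ 1.
  have h4 : γ * (2 * m + 1) ≤ 9 := by
    have : γ * m ≤ 4 := by
      calc γ * m ≤ γ * (4 / γ) := by gcongr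
        _ = 4 := by field_simp
    linarith
  calc γ ^ 2 * ((nearOrigin γ N).card : ℝ) ≤ γ ^ 2 * (2 * m + 1) ^ 2 := by gcongr
    _ = (γ * (2 * m + 1)) ^ 2 := by ring
    _ ≤ 9 ^ 2 := by gcongr
    _ = 81 := by norm_num

theorem IsKacKernel.eq_zero_of_notMem (h : IsKacKernel 𝔎) {k : Lattice N}
    (hk : k ∉ nearOrigin γ N) : 𝔎 (scaledPoint γ k) = 0 := by
  simp only [nearOrigin, Finset.mem_filter, Finset.mem_univ, true_and, not_forall, not_le] at hk
  obtain ⟨i, hi⟩ := hk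
  refine h.eq_zero (i := i) ?_
  change 3 ≤ |γ * (rep k i : ℝ)|
  linarith

theorem IsKacKernel.sum_le (h : IsKacKernel 𝔎) (hγ : 0 < γ) (hγ' : γ ≤ 1 / 4) :
    ∑ k ∈ (Finset.univ : Finset (Lattice N)).erase 0, γ ^ 2 * 𝔎 (scaledPoint γ k) ≤ 81 := by
  calc ∑ k ∈ (Finset.univ : Finset (Lattice N)).erase 0, γ ^ 2 * 𝔎 (scaledPoint γ k)
      ≤ ∑ k : Lattice N, γ ^ 2 * 𝔎 (scaledPoint γ k) :=
        Finset.sum_le_sum_of_subset_of_nonneg (Finset.erase_subset _ _)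
          fun k _ _ => mul_nonneg (by positivity) (h.nonneg _)
    _ = ∑ k ∈ nearOrigin γ N, γ ^ 2 * 𝔎 (scaledPoint γ k) := by
        refine (Finset.sum_subset (Finset.subset_univ _) fun k _ hk => ?_).symm
        rw [h.eq_zero_of_notMem hk, mul_zero]
    _ ≤ ∑ _k ∈ nearOrigin γ N, γ ^ 2 := by
        refine Finset.sum_le_sum fun k _ => ?_
        have := h.le_one (scaledPoint γ k)
        nlinarith [sq_nonneg γ]
    _ ≤ 81 := by
        rw [Finset.sum_const, nsmul_eq_mul, mul_comm]
        exact card_nearOrigin_le hγ hγ'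

/-- By continuity the kernel is bounded below on a ball, which after scaling contains a box of 2m ×
2m integer points with m of order γ⁻¹. The side 2m leaves room to translate a box of side m by up to
m steps. -/
theorem IsKacKernel.exists_box (h : IsKacKernel 𝔎) :
    ∃ c r γ₁ : ℝ, 0 < c ∧ 0 < r ∧ 0 < γ₁ ∧ γ₁ ≤ 1 / 4 ∧ ∀ γ, 0 < γ → γ < γ₁ →
      ∃ (z : Fin 2 → ℤ) (m : ℕ), r ≤ γ * m ∧ ∀ v : Fin 2 → ℤ,
        (∀ i, z i ≤ v i ∧ v i < z i + 2 * m) →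
          v ∈ freqBox (size γ) ∧ v ≠ 0 ∧ c ≤ 𝔎 (WithLp.toLp 2 fun i => γ * (v i : ℝ)) := by
  -- The second moment, rather than the total mass, is used to find a point of positivity different
  -- from the origin, where `kac` is set to zero.
  obtain ⟨x₀, hx₀⟩ : ∃ x₀, 𝔎 x₀ * ‖x₀‖ ^ 2 ≠ 0 := by
    by_contra! hall
    have := h.integral_mul_sq_eq_four
    simp only [hall, integral_zero] at this
    norm_num at this
  have hpos : 0 < 𝔎 x₀ := lt_of_le_of_ne (h.nonneg _) (left_ne_zero_of_mul hx₀).symm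
  have hne : x₀ ≠ 0 := fun h0 => hx₀ (by rw [h0]; simp)
  have hcont : Continuous fun v : Fin 2 → ℝ => (WithLp.toLp 2 v : EuclideanSpace ℝ (Fin 2)) :=
    PiLp.continuous_toLp 2 _
  have hopen : IsOpen {v : Fin 2 → ℝ | 𝔎 x₀ / 2 < 𝔎 (WithLp.toLp 2 v) ∧
      (WithLp.toLp 2 v : EuclideanSpace ℝ (Fin 2)) ≠ 0} :=
    (isOpen_lt continuous_const (h.contDiff.continuous.comp hcont)).inter
      (isOpen_ne.preimage hcont)
  have hmem : (fun i => x₀ i) ∈ {v : Fin 2 → ℝ | 𝔎 x₀ / 2 < 𝔎 (WithLp.toLp 2 v) ∧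
      (WithLp.toLp 2 v : EuclideanSpace ℝ (Fin 2)) ≠ 0} := by
    refine ⟨?_, hne⟩
    change 𝔎 x₀ / 2 < 𝔎 x₀
    linarith
  obtain ⟨δ, hδ, hball⟩ := Metric.isOpen_iff.1 hopen _ hmem
  refine ⟨𝔎 x₀ / 2, δ / 8, min (1 / 4) (δ / 8), by positivity, by positivity,
    by positivity, min_le_left _ _, fun γ hγ hγ1 => ?_⟩
  have hγ4 : γ ≤ 1 / 4 := hγ1.le.trans (min_le_left _ _)
  have hγδ : γ ≤ δ / 8 := hγ1.le.trans (min_le_right _ _)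
  refine ⟨fun i => ⌈(x₀ i - δ / 2) / γ⌉, ⌊δ / (4 * γ)⌋₊, ?_, fun v hv => ?_⟩
  · have h1 := (Nat.lt_floor_add_one (δ / (4 * γ))).le
    have h2 : δ / 4 ≤ γ * (⌊δ / (4 * γ)⌋₊ + 1) := by
      calc δ / 4 = γ * (δ / (4 * γ)) := by field_simp
        _ ≤ _ := by gcongr
    linarith
  · have hclose : ∀ i, |γ * (v i : ℝ) - x₀ i| < δ := by
      intro i
      have h1 : (x₀ i - δ / 2) / γ ≤ v i :=
        (Int.le_ceil _).trans (Int.cast_le.2 (hv i).1)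
      have h2 : (v i : ℝ) < (x₀ i - δ / 2) / γ + 1 + 2 * ⌊δ / (4 * γ)⌋₊ := by
        have e1 : (v i : ℝ) < (⌈(x₀ i - δ / 2) / γ⌉ : ℝ) + 2 * ⌊δ / (4 * γ)⌋₊ := by
          exact_mod_cast (hv i).2
        linarith [Int.ceil_lt_add_one ((x₀ i - δ / 2) / γ)]
      have h3 : (⌊δ / (4 * γ)⌋₊ : ℝ) ≤ δ / (4 * γ) := Nat.floor_le (by positivity)
      have h4 : x₀ i - δ / 2 ≤ γ * v i := by
        rw [div_le_iff₀ hγ] at h1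
        linarith
      have h5 : γ * v i ≤ x₀ i - δ / 2 + γ + δ / 2 := by
        calc γ * v i ≤ γ * ((x₀ i - δ / 2) / γ + 1 + 2 * (δ / (4 * γ))) := by
              gcongr
              linarith
          _ = x₀ i - δ / 2 + γ + δ / 2 := by
              field_simp
              ring
      rw [abs_lt]
      constructor <;> linarith
    have hin := hball (show (fun i => γ * (v i : ℝ)) ∈ Metric.ball (fun i => x₀ i) δ by
      rw [Metric.mem_ball, dist_pi_lt_iff hδ]
      intro i
      rw [Real.dist_eq]
      exact hclose i)
    refine ⟨mem_freqBox.2 fun i => ?_, fun h0 => hin.2 ?_, hin.1.le⟩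
    · have hne0 : 𝔎 (WithLp.toLp 2 fun i => γ * (v i : ℝ)) ≠ 0 := by
        have := hin.1
        linarith
      have h1 : ¬ 3 ≤ |γ * (v i : ℝ)| := fun h3 => hne0 (h.eq_zero (i := i) h3)
      have h2 := three_le_mul_size hγ hγ4
      have h3 : |(v i : ℝ)| < size γ := by
        rw [abs_mul, abs_of_pos hγ] at h1
        by_contra! hcon
        have := mul_le_mul_of_nonneg_left hcon hγ.le
        linarith
      rw [abs_lt] at h3
      rw [Finset.mem_Icc]
      exact ⟨by exact_mod_cast h3.1.le, by exact_mod_cast h3.2.le⟩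
    · ext i
      simp [h0]

end Kernel

/-! #### Bounds on the Fourier transform of the Kac kernel -/

section KernelBounds

open ZMod

variable {N : ℕ} {𝔎 : EuclideanSpace ℝ (Fin 2) → ℝ} {γ : ℝ}

theorem sum_latticePoint_le {A : Finset (Fin 2 → ℤ)} (hA : A ⊆ freqBox N) {g : Lattice N → ℝ}
    (hg : ∀ k, 0 ≤ g k) : ∑ v ∈ A, g (latticePoint N v) ≤ ∑ k, g k := by
  classical
  rw [← Finset.sum_image (f := g) (latticePoint_injOn.mono (Finset.coe_subset.2 hA))]
  exact Finset.sum_le_sum_of_subset_of_nonneg (Finset.subset_univ _) fun k _ _ => hg k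

theorem card_box (z : Fin 2 → ℤ) (m : ℕ) :
    (Fintype.piFinset fun i => Finset.Ico (z i) (z i + m)).card = m ^ 2 := by
  simp [Fintype.card_piFinset]

theorem mem_box {z v : Fin 2 → ℤ} {m : ℕ} :
    v ∈ (Fintype.piFinset fun i => Finset.Ico (z i) (z i + m)) ↔
      ∀ i, z i ≤ v i ∧ v i < z i + m := by
  simp [Fintype.mem_piFinset]

theorem scaledPoint_latticePoint {v : Fin 2 → ℤ} (hv : v ∈ freqBox N) :
    scaledPoint γ (latticePoint N v) = WithLp.toLp 2 fun i => γ * (v i : ℝ) := by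
  rw [scaledPoint, rep_latticePoint hv]

theorem kac_nonneg (h : IsKacKernel 𝔎) (k : Lattice N) : 0 ≤ kac 𝔎 γ k := by
  rw [kac]
  split_ifs
  · exact le_rfl
  · refine mul_nonneg (mul_nonneg (inv_nonneg.2 ?_) (sq_nonneg _)) (h.nonneg _)
    exact Finset.sum_nonneg fun k _ => mul_nonneg (sq_nonneg _) (h.nonneg _)

theorem sum_kac : ∑ k : Lattice N, kac 𝔎 γ k = normConst 𝔎 γ N *
    ∑ k ∈ (Finset.univ : Finset (Lattice N)).erase 0, γ ^ 2 * 𝔎 (scaledPoint γ k) := by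
  rw [← Finset.sum_erase (a := 0) _ (by simp [kac]), Finset.mul_sum]
  refine Finset.sum_congr rfl fun k hk => ?_
  rw [kac, if_neg (Finset.ne_of_mem_erase hk), mul_assoc]

theorem kacHat_eq {w : Fin 2 → ℤ} (hw : w ∈ freqBox (size γ)) :
    kacHat 𝔎 γ w = ∑ k : Lattice (size γ), (kac 𝔎 γ k : ℂ) * latticeChar (-w) k := by
  rw [kacHat, fourierTransform, if_pos hw]
  refine Finset.sum_congr rfl fun k _ => ?_
  have : (mesh (size γ) : ℂ) ≠ 0 := by exact_mod_cast (mesh_pos _).ne'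
  rw [latticeChar]
  push_cast
  field_simp

theorem norm_kacHat_le_one (h : IsKacKernel 𝔎) {w : Fin 2 → ℤ} (hw : w ∈ freqBox (size γ)) :
    ‖kacHat 𝔎 γ w‖ ≤ 1 := by
  rw [kacHat_eq hw]
  refine (norm_sum_le _ _).trans ?_
  have h1 : ∀ k : Lattice (size γ), ‖(kac 𝔎 γ k : ℂ) * latticeChar (-w) k‖ = kac 𝔎 γ k := by
    intro k
    rw [norm_mul, norm_latticeChar, mul_one, Complex.norm_real,
      Real.norm_of_nonneg (kac_nonneg h k)]
  simp only [h1]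
  rw [sum_kac]
  exact inv_mul_le_one

theorem IsKacKernel.normConst_bounds (h : IsKacKernel 𝔎) :
    ∃ C γ₁ : ℝ, 0 < C ∧ 0 < γ₁ ∧ γ₁ ≤ 1 / 4 ∧ ∀ γ, 0 < γ → γ < γ₁ →
      1 / 81 ≤ normConst 𝔎 γ (size γ) ∧ normConst 𝔎 γ (size γ) ≤ C ∧
        ∑ k : Lattice (size γ), kac 𝔎 γ k = 1 := by
  obtain ⟨c, r, γ₁, hc, hr, hγ₁, hγ₁', hbox⟩ := h.exists_box
  refine ⟨(c * r ^ 2)⁻¹, γ₁, by positivity, hγ₁, hγ₁', fun γ hγ hγ' => ?_⟩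
  obtain ⟨z, m, hm, hv⟩ := hbox γ hγ hγ'
  have hup := h.sum_le (N := size γ) hγ (hγ'.le.trans hγ₁')
  set A := Fintype.piFinset fun i => Finset.Ico (z i) (z i + m) with hA
  have hvA : ∀ v ∈ A, v ∈ freqBox (size γ) ∧ v ≠ 0 ∧
      c ≤ 𝔎 (WithLp.toLp 2 fun i => γ * (v i : ℝ)) := by
    intro v hvm
    refine hv v fun i => ?_
    have := mem_box.1 hvm i
    exact ⟨this.1, by omega⟩
  have hlow : c * r ^ 2 ≤
      ∑ k ∈ (Finset.univ : Finset (Lattice (size γ))).erase 0, γ ^ 2 * 𝔎 (scaledPoint γ k) := by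
    have h1 := sum_latticePoint_le (N := size γ) (A := A) (fun v hvm => (hvA v hvm).1)
      (g := fun k => if k = 0 then 0 else γ ^ 2 * 𝔎 (scaledPoint γ k)) (fun k => by
        split_ifs
        · exact le_rfl
        · exact mul_nonneg (sq_nonneg _) (h.nonneg _))
    have h2 : ∑ k : Lattice (size γ), (if k = 0 then 0 else γ ^ 2 * 𝔎 (scaledPoint γ k)) =
        ∑ k ∈ (Finset.univ : Finset (Lattice (size γ))).erase 0,
          γ ^ 2 * 𝔎 (scaledPoint γ k) := by
      rw [← Finset.sum_erase (a := 0) _ (by simp)]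
      exact Finset.sum_congr rfl fun k hk => if_neg (Finset.ne_of_mem_erase hk)
    rw [h2] at h1
    refine le_trans ?_ h1
    calc c * r ^ 2 ≤ c * (γ * m) ^ 2 := by gcongr
      _ = ∑ _v ∈ A, γ ^ 2 * c := by
          rw [Finset.sum_const, hA, card_box, nsmul_eq_mul]
          push_cast
          ring
      _ ≤ _ := by
          refine Finset.sum_le_sum fun v hvm => ?_
          obtain ⟨h3, h4, h5⟩ := hvA v hvm
          rw [if_neg (latticePoint_ne_zero h3 h4), scaledPoint_latticePoint h3]
          gcongr
  have hpos : 0 < ∑ k ∈ (Finset.univ : Finset (Lattice (size γ))).erase 0,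
      γ ^ 2 * 𝔎 (scaledPoint γ k) := lt_of_lt_of_le (by positivity) hlow
  refine ⟨?_, ?_, ?_⟩
  · rw [normConst, one_div]
    exact inv_anti₀ hpos hup
  · exact inv_anti₀ (by positivity) hlow
  · rw [sum_kac]
    exact inv_mul_cancel₀ hpos.ne'

/-- As κ has total mass one, 1 - Re K̂ is the average of 1 - Re χ under κ, and κ is at least of
order γ² on a box with of order γ⁻² points. Each point of the box is paired with its translate by q
steps in direction i; by `one_sub_re_latticeChar_le` every pair contributes at least (ε q w_i)²,
where ε is the mesh. -/
theorem IsKacKernel.kacHat_re_bound (h : IsKacKernel 𝔎) :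
    ∃ c γ₁ : ℝ, 0 < c ∧ 0 < γ₁ ∧ γ₁ ≤ 1 / 4 ∧ ∀ γ, 0 < γ → γ < γ₁ →
      ∀ w ∈ freqBox (size γ), ∀ i, c * min 1 ((γ * w i) ^ 2) ≤ 1 - (kacHat 𝔎 γ w).re := by
  obtain ⟨C, γ₁, hC, hγ₁, hγ₁', hnorm⟩ := h.normConst_bounds
  obtain ⟨c, r, γ₂, hc, hr, hγ₂, -, hbox⟩ := h.exists_box
  refine ⟨c / 81 * r ^ 2 / 2 * min (1 / 4) (4 / 9 * r ^ 2), min γ₁ γ₂, by positivity,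
    by positivity, (min_le_left _ _).trans hγ₁', fun γ hγ hγ' w hw i => ?_⟩
  obtain ⟨hn1, -, hn3⟩ := hnorm γ hγ (hγ'.trans_le (min_le_left _ _))
  obtain ⟨z, m, hm, hv⟩ := hbox γ hγ (hγ'.trans_le (min_le_right _ _))
  have hγ4 : γ ≤ 1 / 4 := (hγ'.trans_le (min_le_left _ _)).le.trans hγ₁'
  set N := size γ with hN
  set A := Fintype.piFinset fun i => Finset.Ico (z i) (z i + m) with hA
  set g : Lattice N → ℝ := fun k => 1 - (latticeChar (-w) k).re with hg
  have hg0 : ∀ k, 0 ≤ g k := one_sub_re_latticeChar_nonneg (-w)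
  have hre : 1 - (kacHat 𝔎 γ w).re = ∑ k : Lattice N, kac 𝔎 γ k * g k := by
    rw [kacHat_eq hw, Complex.re_sum]
    simp only [hg, mul_sub, mul_one, Finset.sum_sub_distrib, hn3, Complex.re_ofReal_mul]
    rfl
  have hkac : ∀ v : Fin 2 → ℤ, (∀ i, z i ≤ v i ∧ v i < z i + 2 * m) →
      c / 81 * γ ^ 2 ≤ kac 𝔎 γ (latticePoint N v) := by
    intro v hvm
    obtain ⟨h1, h2, h3⟩ := hv v hvm
    rw [kac, if_neg (latticePoint_ne_zero h1 h2), scaledPoint_latticePoint h1]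
    calc c / 81 * γ ^ 2 = 1 / 81 * γ ^ 2 * c := by ring
      _ ≤ _ := by gcongr
  have hq : ∀ q : ℕ, q ≤ m → mesh N * (q * |(w i : ℝ)|) ≤ 1 →
      c / 81 * r ^ 2 / 2 * (mesh N * (q * |(w i : ℝ)|)) ^ 2 ≤ 1 - (kacHat 𝔎 γ w).re := by
    intro q hqm hq1
    set e : Fin 2 → ℤ := Pi.single i (q : ℤ) with he
    have he0 : ∀ j, 0 ≤ e j ∧ e j ≤ q := by
      intro j
      by_cases hj : j = i
      · rw [hj, he, Pi.single_eq_same]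
        exact ⟨by positivity, le_rfl⟩
      · rw [he, Pi.single_eq_of_ne hj]
        exact ⟨le_rfl, by positivity⟩
    have hb1 : ∀ v ∈ A, ∀ i, z i ≤ v i ∧ v i < z i + 2 * m := by
      intro v hvm i
      have := mem_box.1 hvm i
      exact ⟨this.1, by omega⟩
    have hb2 : ∀ v ∈ A, ∀ i, z i ≤ (v + e) i ∧ (v + e) i < z i + 2 * m := by
      intro v hvm i
      have h1 := mem_box.1 hvm i
      have h2 := he0 i
      rw [Pi.add_apply]
      constructor <;> omega
    have s1 : ∑ v ∈ A, c / 81 * γ ^ 2 * g (latticePoint N v) ≤ 1 - (kacHat 𝔎 γ w).re := by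
      rw [hre]
      refine le_trans (Finset.sum_le_sum fun v hvm => ?_)
        (sum_latticePoint_le (A := A) (fun v hvm => (hv v (hb1 v hvm)).1)
          (g := fun k => kac 𝔎 γ k * g k) fun k => mul_nonneg (kac_nonneg h k) (hg0 k))
      exact mul_le_mul_of_nonneg_right (hkac v (hb1 v hvm)) (hg0 _)
    have s2 : ∑ v ∈ A, c / 81 * γ ^ 2 * g (latticePoint N (v + e)) ≤
        1 - (kacHat 𝔎 γ w).re := by
      classical
      rw [hre]
      have hinj : Set.InjOn (fun v : Fin 2 → ℤ => v + e) (A : Set (Fin 2 → ℤ)) :=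
        fun a _ b _ hab => add_right_cancel hab
      rw [← Finset.sum_image (f := fun v => c / 81 * γ ^ 2 * g (latticePoint N v)) hinj]
      have hsub : ∀ v ∈ A.image (fun v => v + e), ∀ i, z i ≤ v i ∧ v i < z i + 2 * m := by
        intro v hvm
        obtain ⟨u, hu, rfl⟩ := Finset.mem_image.1 hvm
        exact hb2 u hu
      refine le_trans (Finset.sum_le_sum fun v hvm => ?_)
        (sum_latticePoint_le (fun v hvm => (hv v (hsub v hvm)).1)
          (g := fun k => kac 𝔎 γ k * g k) fun k => mul_nonneg (kac_nonneg h k) (hg0 k))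
      exact mul_le_mul_of_nonneg_right (hkac v (hsub v hvm)) (hg0 _)
    have hchar := one_sub_re_latticeChar_single (N := N) (w := -w) i (n := q) (by simpa using hq1)
    have hlow : ∀ v ∈ A, (mesh N * (q * |(w i : ℝ)|)) ^ 2 ≤
        g (latticePoint N v) + g (latticePoint N (v + e)) := by
      intro v _
      have h1 := one_sub_re_latticeChar_le (-w) (latticePoint N v) (latticePoint N e)
      rw [← latticePoint_add] at h1
      simp only [Pi.neg_apply, Int.cast_neg, abs_neg] at hchar
      simp only [hg]
      linarith
    have s3 : ∑ v ∈ A, c / 81 * γ ^ 2 * (mesh N * (q * |(w i : ℝ)|)) ^ 2 ≤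
        2 * (1 - (kacHat 𝔎 γ w).re) := by
      refine le_trans (Finset.sum_le_sum fun v hvm =>
        mul_le_mul_of_nonneg_left (hlow v hvm) (by positivity)) ?_
      simp only [mul_add, Finset.sum_add_distrib]
      linarith
    rw [Finset.sum_const, hA, card_box, nsmul_eq_mul] at s3
    have s4 : c / 81 * r ^ 2 * (mesh N * (q * |(w i : ℝ)|)) ^ 2 ≤
        c / 81 * (γ * m) ^ 2 * (mesh N * (q * |(w i : ℝ)|)) ^ 2 := by gcongr
    push_cast at s3
    nlinarith
  rcases eq_or_ne (w i) 0 with h0 | h0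
  · rw [h0]
    simp only [Int.cast_zero, mul_zero, ne_eq, OfNat.ofNat_ne_zero, not_false_eq_true, zero_pow,
      min_eq_right zero_le_one]
    rw [hre]
    exact Finset.sum_nonneg fun k _ => mul_nonneg (kac_nonneg h k) (hg0 k)
  set a : ℝ := mesh N * |(w i : ℝ)| with ha
  have ha1 : a ≤ 1 := abs_mesh_mul_le hw i
  have ha0 : 0 < a := mul_pos (mesh_pos N) (abs_pos.2 (by exact_mod_cast h0))
  -- The longest translation allowed by the box and by the range of the cosine bound. If the box is
  -- the constraint, q is of order γ⁻¹ and the gain is (γ w_i)²; otherwise q·a ≥ 1/2 and the gain is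
  -- a constant.
  set q : ℕ := min m ⌊1 / a⌋₊ with hqd
  have hfl : (⌊1 / a⌋₊ : ℝ) ≤ 1 / a := Nat.floor_le (by positivity)
  have hqa : ∀ n : ℕ, mesh N * (n * |(w i : ℝ)|) = n * a := fun n => by rw [ha]; ring
  have hq1 : (q : ℝ) * a ≤ 1 := by
    have : (q : ℝ) ≤ 1 / a := le_trans (by exact_mod_cast min_le_right _ _) hfl
    rwa [le_div_iff₀ ha0] at this
  have hmain := hq q (min_le_left _ _) (by rw [hqa]; exact hq1)
  rw [hqa] at hmain
  refine le_trans ?_ hmain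
  rw [mul_assoc (c / 81 * r ^ 2 / 2)]
  refine mul_le_mul_of_nonneg_left ?_ (by positivity)
  have hma : 2 / 3 * r * (γ * |(w i : ℝ)|) ≤ m * a := by
    have h1 := le_mesh_size hγ hγ4
    calc 2 / 3 * r * (γ * |(w i : ℝ)|) ≤ 2 / 3 * (γ * m) * (γ * |(w i : ℝ)|) := by gcongr
      _ = m * ((2 / 3 * γ ^ 2) * |(w i : ℝ)|) := by ring
      _ ≤ m * (mesh N * |(w i : ℝ)|) := by gcongr
  have hsq : (γ * (w i : ℝ)) ^ 2 = (γ * |(w i : ℝ)|) ^ 2 := by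
    rw [mul_pow, mul_pow, sq_abs]
  rcases le_total m ⌊1 / a⌋₊ with hle | hle
  · have hqm : q = m := min_eq_left hle
    rw [hqm]
    calc min (1 / 4) (4 / 9 * r ^ 2) * min 1 ((γ * w i) ^ 2)
        ≤ (4 / 9 * r ^ 2) * (γ * w i) ^ 2 :=
          mul_le_mul (min_le_right _ _) (min_le_right _ _) (by positivity) (by positivity)
      _ = (2 / 3 * r * (γ * |(w i : ℝ)|)) ^ 2 := by rw [hsq]; ring
      _ ≤ (m * a) ^ 2 := by gcongr
  · have hqf : q = ⌊1 / a⌋₊ := min_eq_right hle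
    have h1a : 1 ≤ 1 / a := by rwa [le_div_iff₀ ha0, one_mul]
    have hq2 : 1 / 2 ≤ (q : ℝ) * a := by
      have e1 : (1 : ℝ) ≤ q := by
        rw [hqf]
        exact_mod_cast (Nat.one_le_floor_iff _).2 h1a
      have e2 : 1 / a ≤ q + 1 := by
        rw [hqf]
        exact (Nat.lt_floor_add_one _).le
      have e3 : 1 ≤ ((q : ℝ) + 1) * a := by rwa [div_le_iff₀ ha0] at e2
      nlinarith
    calc min (1 / 4) (4 / 9 * r ^ 2) * min 1 ((γ * w i) ^ 2) ≤ 1 / 4 * 1 :=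
          mul_le_mul (min_le_left _ _) (min_le_left _ _) (by positivity) (by positivity)
      _ = (1 / 2) ^ 2 := by norm_num
      _ ≤ (q * a) ^ 2 := by gcongr

/-- A step on the torus agrees with a step in the plane unless it crosses the boundary of the
fundamental square, and there both values of the kernel vanish. -/
theorem IsKacKernel.shift (h : IsKacKernel 𝔎) (hN : 3 ≤ γ * N) (hγ : 0 < γ) (k : Lattice N)
    (i : Fin 2) {d : ℤ} (hd : d = 1 ∨ d = -1) :
    𝔎 (scaledPoint γ (k + latticePoint N (Pi.single i d))) =
      𝔎 (scaledPoint γ k + WithLp.toLp 2 fun j => γ * ((Pi.single i d : Fin 2 → ℤ) j : ℝ)) := by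
  by_cases hmem : rep k + Pi.single i d ∈ freqBox N
  · congr 1
    have h1 : k + latticePoint N (Pi.single i d) = latticePoint N (rep k + Pi.single i d) := by
      rw [latticePoint_add, latticePoint_rep]
    rw [h1, scaledPoint_latticePoint hmem]
    ext j
    simp [scaledPoint, mul_add]
  · have hk := mem_freqBox.1 (rep_mem_freqBox k)
    have hout : ¬ (rep k i + d ∈ Finset.Icc (-(N : ℤ)) N) := by
      intro hi
      refine hmem (mem_freqBox.2 fun j => ?_)
      by_cases hj : j = i
      · rw [hj, Pi.add_apply, Pi.single_eq_same]
        exact hi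
      · rw [Pi.add_apply, Pi.single_eq_of_ne hj, add_zero]
        exact hk j
    have hki := Finset.mem_Icc.1 (hk i)
    rw [Finset.mem_Icc] at hout
    -- Leaving the square by one step means landing at distance N + 1 in the plane, and at the
    -- opposite side, at distance N, on the torus.
    have habs : rep k i + d = N + 1 ∧ d = 1 ∨ rep k i + d = -(N + 1) ∧ d = -1 := by omega
    have hz : (2 * (N : ZMod (2 * N + 1)) + 1) = 0 := by
      have := ZMod.natCast_self (2 * N + 1)
      push_cast at this
      exact this
    have hcast : (k + latticePoint N (Pi.single i d)) i =
        ((rep k i + d : ℤ) : ZMod (2 * N + 1)) := by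
      rw [Pi.add_apply]
      simp [latticePoint, rep]
    have hrep : |(rep (k + latticePoint N (Pi.single i d)) i : ℝ)| = N := by
      rw [rep, hcast]
      rcases habs with ⟨h1, -⟩ | ⟨h1, -⟩
      · have : ((rep k i + d : ℤ) : ZMod (2 * N + 1)) = ((-(N : ℤ) : ℤ) : ZMod (2 * N + 1)) := by
          rw [h1]
          push_cast
          linear_combination hz
        rw [this, valMinAbs_intCast (by simp)]
        simp
      · have : ((rep k i + d : ℤ) : ZMod (2 * N + 1)) = (((N : ℤ) : ℤ) : ZMod (2 * N + 1)) := by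
          rw [h1]
          push_cast
          linear_combination -hz
        rw [this, valMinAbs_intCast (by simp)]
        simp
    rw [h.eq_zero (i := i), h.eq_zero (i := i)]
    · change 3 ≤ |γ * (rep k i : ℝ) + γ * ((Pi.single i d : Fin 2 → ℤ) i : ℝ)|
      rw [Pi.single_eq_same, ← mul_add, abs_mul, abs_of_pos hγ]
      have h2 : |((rep k i : ℝ) + d)| = N + 1 := by
        rcases habs with ⟨h1, -⟩ | ⟨h1, -⟩
        · have : (rep k i : ℝ) + d = N + 1 := by exact_mod_cast h1
          rw [this, abs_of_nonneg (by positivity)]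
        · have : (rep k i : ℝ) + d = -(N + 1) := by exact_mod_cast h1
          rw [this, abs_neg, abs_of_nonneg (by positivity)]
      rw [h2]
      nlinarith
    · change 3 ≤ |γ * (rep (k + latticePoint N (Pi.single i d)) i : ℝ)|
      rw [abs_mul, abs_of_pos hγ, hrep]
      exact hN

theorem IsKacKernel.sum_second_difference (h : IsKacKernel 𝔎) :
    ∃ C : ℝ, 0 ≤ C ∧ ∀ (γ : ℝ) (N : ℕ) (i : Fin 2), 0 < γ → γ ≤ 1 / 4 → 3 ≤ γ * N →
      ∑ k : Lattice N, |2 * 𝔎 (scaledPoint γ k) -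
        𝔎 (scaledPoint γ (k + latticePoint N (Pi.single i 1))) -
        𝔎 (scaledPoint γ (k + latticePoint N (Pi.single i (-1))))| ≤ C := by
  obtain ⟨C, hC0, hC⟩ := h.second_difference
  refine ⟨C * 81, by positivity, fun γ N i hγ hγ' hN => ?_⟩
  set e : EuclideanSpace ℝ (Fin 2) := EuclideanSpace.single i γ with he
  have he1 : (WithLp.toLp 2 fun j => γ * ((Pi.single i 1 : Fin 2 → ℤ) j : ℝ) :
      EuclideanSpace ℝ (Fin 2)) = e := by
    ext j
    by_cases hj : j = i
    · subst hj
      simp [he]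
    · simp [he, hj]
  have he2 : (WithLp.toLp 2 fun j => γ * ((Pi.single i (-1) : Fin 2 → ℤ) j : ℝ) :
      EuclideanSpace ℝ (Fin 2)) = -e := by
    ext j
    by_cases hj : j = i
    · subst hj
      simp [he]
    · simp [he, hj]
  have hnorm : ‖e‖ = γ := by
    rw [he, PiLp.norm_single, Real.norm_of_nonneg hγ.le]
  have hterm : ∀ k : Lattice N, 2 * 𝔎 (scaledPoint γ k) -
      𝔎 (scaledPoint γ (k + latticePoint N (Pi.single i 1))) -
      𝔎 (scaledPoint γ (k + latticePoint N (Pi.single i (-1)))) =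
      2 * 𝔎 (scaledPoint γ k) - 𝔎 (scaledPoint γ k + e) - 𝔎 (scaledPoint γ k - e) := by
    intro k
    rw [h.shift hN hγ k i (Or.inl rfl), h.shift hN hγ k i (Or.inr rfl), he1, he2, ← sub_eq_add_neg]
  simp only [hterm]
  calc ∑ k : Lattice N,
        |2 * 𝔎 (scaledPoint γ k) - 𝔎 (scaledPoint γ k + e) - 𝔎 (scaledPoint γ k - e)|
      = ∑ k ∈ nearOrigin γ N,
        |2 * 𝔎 (scaledPoint γ k) - 𝔎 (scaledPoint γ k + e) - 𝔎 (scaledPoint γ k - e)| := by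
        -- The radius 4/γ exceeds that of the support by more than one lattice step, so off
        -- `nearOrigin` all three values vanish.
        refine (Finset.sum_subset (Finset.subset_univ _) fun k _ hk => ?_).symm
        rw [h.eq_zero_of_notMem hk]
        simp only [nearOrigin, Finset.mem_filter, Finset.mem_univ, true_and, not_forall,
          not_le] at hk
        obtain ⟨j, hj⟩ := hk
        have hxj : (scaledPoint γ k) j = γ * (rep k j : ℝ) := rfl
        have hej : |e j| ≤ 1 / 4 := by
          have := PiLp.norm_apply_le e j
          rw [hnorm, Real.norm_eq_abs] at this
          linarith
        rw [← hxj] at hj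
        rw [h.eq_zero (i := j), h.eq_zero (i := j)]
        · simp
        · change 3 ≤ |scaledPoint γ k j - e j|
          have := abs_sub_abs_le_abs_sub (scaledPoint γ k j) (e j)
          linarith
        · change 3 ≤ |scaledPoint γ k j + e j|
          have := abs_sub_abs_le_abs_sub (scaledPoint γ k j) (-e j)
          rw [abs_neg, sub_neg_eq_add] at this
          linarith
    _ ≤ ∑ _k ∈ nearOrigin γ N, C * γ ^ 2 := by
        refine Finset.sum_le_sum fun k _ => ?_
        have := hC (scaledPoint γ k) e
        rwa [hnorm] at this
    _ = C * (γ ^ 2 * (nearOrigin γ N).card) := by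
        rw [Finset.sum_const, nsmul_eq_mul]
        ring
    _ ≤ C * 81 := by
        gcongr
        exact card_nearOrigin_le hγ hγ'

/-- Two summations by parts: the factor 2 - 2cos(π ε w_i) ≥ 4(ε w_i)², with ε the mesh, turns K̂
into the transform of the second differences of κ, whose sum is O(γ²). As ε is of order γ², this is
the claimed decay. -/
theorem IsKacKernel.kacHat_decay (h : IsKacKernel 𝔎) :
    ∃ C γ₁ : ℝ, 0 < C ∧ 0 < γ₁ ∧ γ₁ ≤ 1 / 4 ∧ ∀ γ, 0 < γ → γ < γ₁ →
      ∀ w ∈ freqBox (size γ), ∀ i, ‖kacHat 𝔎 γ w‖ * (γ * w i) ^ 2 ≤ C := by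
  obtain ⟨Cn, γ₁, hCn, hγ₁, hγ₁', hnorm⟩ := h.normConst_bounds
  obtain ⟨Cd, hCd, hdiff⟩ := h.sum_second_difference
  refine ⟨Cn * (Cd + 4), γ₁, by positivity, hγ₁, hγ₁', fun γ hγ hγ' w hw i => ?_⟩
  obtain ⟨hn1, hn2, -⟩ := hnorm γ hγ hγ'
  have hγ4 : γ ≤ 1 / 4 := hγ'.le.trans hγ₁'
  have hN := three_le_mul_size hγ hγ4
  set N := size γ with hNd
  set e : Lattice N := latticePoint N (Pi.single i 1) with he
  have hne : latticePoint N (Pi.single i (-1)) = -e := by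
    ext j
    by_cases hj : j = i
    · subst hj
      simp [he, latticePoint]
    · simp [he, latticePoint, hj]
  set c₀ := normConst 𝔎 γ N with hc₀
  have hc₀0 : 0 < c₀ := lt_of_lt_of_le (by norm_num) hn1
  have hkac : ∀ k : Lattice N, kac 𝔎 γ k =
      c₀ * γ ^ 2 * (𝔎 (scaledPoint γ k) - if k = 0 then 𝔎 (scaledPoint γ k) else 0) := by
    intro k
    rw [kac]
    split_ifs <;> ring
  -- Setting κ to zero at the origin destroys its smoothness there. The correction is a single point
  -- mass, whose second difference has total mass at most 4 and is thus harmless.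
  set g : Lattice N → ℝ := fun k => if k = 0 then 𝔎 (scaledPoint γ k) else 0 with hg
  have hgsum : ∑ k : Lattice N, |g k| ≤ 1 := by
    rw [Finset.sum_eq_single 0]
    · simp only [hg, if_true]
      rw [abs_of_nonneg (h.nonneg _)]
      exact h.le_one _
    · intro k _ hk
      simp [hg, hk]
    · simp
  have hD := hdiff γ N i hγ hγ4 hN
  rw [hne] at hD
  have hsum : ∑ k : Lattice N, |2 * kac 𝔎 γ k - kac 𝔎 γ (k + e) - kac 𝔎 γ (k + -e)| ≤
      Cn * γ ^ 2 * (Cd + 4) := by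
    have h1 : ∀ k : Lattice N, |2 * kac 𝔎 γ k - kac 𝔎 γ (k + e) - kac 𝔎 γ (k + -e)| ≤
        c₀ * γ ^ 2 * (|2 * 𝔎 (scaledPoint γ k) - 𝔎 (scaledPoint γ (k + e)) -
          𝔎 (scaledPoint γ (k + -e))| + (2 * |g k| + |g (k + e)| + |g (k + -e)|)) := by
      intro k
      rw [hkac k, hkac (k + e), hkac (k + -e)]
      have h2 : 2 * (c₀ * γ ^ 2 * (𝔎 (scaledPoint γ k) - g k)) -
          c₀ * γ ^ 2 * (𝔎 (scaledPoint γ (k + e)) - g (k + e)) -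
          c₀ * γ ^ 2 * (𝔎 (scaledPoint γ (k + -e)) - g (k + -e)) =
          c₀ * γ ^ 2 * ((2 * 𝔎 (scaledPoint γ k) - 𝔎 (scaledPoint γ (k + e)) -
          𝔎 (scaledPoint γ (k + -e))) + (-(2 * g k) + g (k + e) + g (k + -e))) := by ring
      change |2 * (c₀ * γ ^ 2 * (𝔎 (scaledPoint γ k) - g k)) -
          c₀ * γ ^ 2 * (𝔎 (scaledPoint γ (k + e)) - g (k + e)) -
          c₀ * γ ^ 2 * (𝔎 (scaledPoint γ (k + -e)) - g (k + -e))| ≤ _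
      rw [h2, abs_mul, abs_of_nonneg (by positivity : 0 ≤ c₀ * γ ^ 2)]
      refine mul_le_mul_of_nonneg_left ?_ (by positivity)
      refine (abs_add_le _ _).trans (add_le_add le_rfl ?_)
      refine (abs_add_three _ _ _).trans ?_
      rw [abs_neg, abs_mul, abs_two]
    refine (Finset.sum_le_sum fun k _ => h1 k).trans ?_
    rw [← Finset.mul_sum]
    have e1 : ∑ k : Lattice N, |g (k + e)| = ∑ k, |g k| :=
      Equiv.sum_comp (Equiv.addRight e) fun k => |g k|
    have e2 : ∑ k : Lattice N, |g (k + -e)| = ∑ k, |g k| :=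
      Equiv.sum_comp (Equiv.addRight (-e)) fun k => |g k|
    have h3 : ∑ k : Lattice N, (|2 * 𝔎 (scaledPoint γ k) - 𝔎 (scaledPoint γ (k + e)) -
          𝔎 (scaledPoint γ (k + -e))| + (2 * |g k| + |g (k + e)| + |g (k + -e)|)) ≤ Cd + 4 := by
      rw [Finset.sum_add_distrib, Finset.sum_add_distrib, Finset.sum_add_distrib, e1, e2,
        ← Finset.mul_sum]
      linarith
    calc _ ≤ c₀ * γ ^ 2 * (Cd + 4) := by gcongr
      _ ≤ Cn * γ ^ 2 * (Cd + 4) := by gcongr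
  have hparts : (2 - latticeChar (-w) (-e) - latticeChar (-w) e) * kacHat 𝔎 γ w =
      ∑ k : Lattice N, ((2 * kac 𝔎 γ k - kac 𝔎 γ (k + e) - kac 𝔎 γ (k + -e) : ℝ) : ℂ) *
        latticeChar (-w) k := by
    have hs : ∀ f : Lattice N, ∑ k : Lattice N, (kac 𝔎 γ (k + f) : ℂ) * latticeChar (-w) k =
        latticeChar (-w) (-f) * ∑ k : Lattice N, (kac 𝔎 γ k : ℂ) * latticeChar (-w) k := by
      intro f
      rw [← Equiv.sum_comp (Equiv.addRight f) fun k => (kac 𝔎 γ k : ℂ) * latticeChar (-w) k,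
        Finset.mul_sum]
      refine Finset.sum_congr rfl fun k _ => ?_
      rw [Equiv.coe_addRight, latticeChar_add]
      have : latticeChar (-w) (-f) * latticeChar (-w) f = 1 := by
        rw [← latticeChar_add, neg_add_cancel]
        simp [latticeChar_eq]
      linear_combination (-(kac 𝔎 γ (k + f) : ℂ) * latticeChar (-w) k) * this
    have h1 := hs e
    have h2 := hs (-e)
    rw [neg_neg] at h2
    rw [kacHat_eq hw, sub_mul, sub_mul, ← h1, ← h2, Finset.mul_sum, ← Finset.sum_sub_distrib,
      ← Finset.sum_sub_distrib]
    refine Finset.sum_congr rfl fun k _ => ?_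
    push_cast
    ring
  have hmode : 4 * (mesh N * |(w i : ℝ)|) ^ 2 ≤
      ‖(2 - latticeChar (-w) (-e) - latticeChar (-w) e : ℂ)‖ := by
    have h1 := one_sub_re_latticeChar_single (N := N) (w := -w) i (n := 1)
      (by simpa using abs_mesh_mul_le hw i)
    simp only [Pi.neg_apply, Int.cast_neg, abs_neg, Nat.cast_one, one_mul] at h1
    have h2 : (latticeChar (-w) (-e)).re = (latticeChar (-w) e).re := by
      rw [latticeChar_neg_right, latticeChar_neg_left, Complex.conj_re]
    refine le_trans ?_ (Complex.re_le_norm _)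
    simp only [Complex.sub_re, h2]
    have h3 : (latticeChar (-w) e).re ≤ 1 - 2 * (mesh N * |(w i : ℝ)|) ^ 2 := by
      linarith
    have h4 : ((2 : ℂ)).re = 2 := rfl
    rw [h4]
    linarith
  have hfin : 4 * (mesh N * |(w i : ℝ)|) ^ 2 * ‖kacHat 𝔎 γ w‖ ≤ Cn * γ ^ 2 * (Cd + 4) := by
    calc 4 * (mesh N * |(w i : ℝ)|) ^ 2 * ‖kacHat 𝔎 γ w‖
        ≤ ‖(2 - latticeChar (-w) (-e) - latticeChar (-w) e : ℂ)‖ * ‖kacHat 𝔎 γ w‖ := by gcongr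
      _ = ‖∑ k : Lattice N, ((2 * kac 𝔎 γ k - kac 𝔎 γ (k + e) - kac 𝔎 γ (k + -e) : ℝ) : ℂ) *
            latticeChar (-w) k‖ := by rw [← norm_mul, hparts]
      _ ≤ ∑ k : Lattice N, |2 * kac 𝔎 γ k - kac 𝔎 γ (k + e) - kac 𝔎 γ (k + -e)| := by
          refine (norm_sum_le _ _).trans (le_of_eq (Finset.sum_congr rfl fun k _ => ?_))
          rw [norm_mul, norm_latticeChar, mul_one, Complex.norm_real, Real.norm_eq_abs]
      _ ≤ _ := hsum
  have hmesh := le_mesh_size hγ hγ4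
  have hk0 := norm_nonneg (kacHat 𝔎 γ w)
  have h5 : 4 * (2 / 3 * γ ^ 2 * |(w i : ℝ)|) ^ 2 * ‖kacHat 𝔎 γ w‖ ≤ Cn * γ ^ 2 * (Cd + 4) := by
    refine le_trans ?_ hfin
    gcongr
  have h6 : γ ^ 2 * (‖kacHat 𝔎 γ w‖ * (γ * w i) ^ 2) ≤ γ ^ 2 * (Cn * (Cd + 4)) := by
    have h7 : (2 / 3 * γ ^ 2 * |(w i : ℝ)|) ^ 2 = 4 / 9 * (γ ^ 2 * (γ * w i) ^ 2) := by
      rw [mul_pow, sq_abs]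
      ring
    rw [h7] at h5
    have h8 : 0 ≤ γ ^ 2 * (γ * w i) ^ 2 * ‖kacHat 𝔎 γ w‖ := by positivity
    nlinarith
  exact le_of_mul_le_mul_left h6 (by positivity)

end KernelBounds

/-! ### The Green function -/

section Green

variable {𝔎 : EuclideanSpace ℝ (Fin 2) → ℝ} {C c γ : ℝ}

/-- The bounds on the Fourier transform of the Kac kernel. -/
structure KernelBounds (𝔎 : EuclideanSpace ℝ (Fin 2) → ℝ) (C c γ : ℝ) : Prop where
  pos : 0 < γ
  le : γ ≤ 1 / 4
  one_le : 1 ≤ C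
  c_pos : 0 < c
  norm_le : ∀ w ∈ freqBox (size γ), ‖kacHat 𝔎 γ w‖ ≤ 1
  decay : ∀ w ∈ freqBox (size γ), ∀ i, ‖kacHat 𝔎 γ w‖ * (γ * w i) ^ 2 ≤ C
  re_bound : ∀ w ∈ freqBox (size γ), ∀ i, c * min 1 ((γ * w i) ^ 2) ≤ 1 - (kacHat 𝔎 γ w).re

theorem IsKacKernel.kernelBounds (h : IsKacKernel 𝔎) :
    ∃ C c γ₀ : ℝ, 0 < γ₀ ∧ γ₀ ≤ 1 / 4 ∧ ∀ γ, 0 < γ → γ < γ₀ → KernelBounds 𝔎 C c γ := by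
  obtain ⟨C, γ₁, -, hγ₁, hγ₁', h1⟩ := h.kacHat_decay
  obtain ⟨c, γ₂, hc, hγ₂, -, h2⟩ := h.kacHat_re_bound
  refine ⟨max 1 C, c, min γ₁ γ₂, by positivity, (min_le_left _ _).trans hγ₁',
    fun γ hγ hγ' => ⟨hγ, ?_, le_max_left _ _, hc, fun w hw => norm_kacHat_le_one h hw,
    fun w hw i => ?_, h2 γ hγ (hγ'.trans_le (min_le_right _ _))⟩⟩
  · exact (hγ'.trans_le (min_le_left _ _)).le.trans hγ₁'
  · exact (h1 γ hγ (hγ'.trans_le (min_le_left _ _)) w hw i).trans (le_max_right _ _)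

/-- `1 / |m|`, and `1` at the origin. -/
def invWeight (m : ℤ) : ℝ := (max 1 |(m : ℝ)|)⁻¹

theorem invWeight_pos (m : ℤ) : 0 < invWeight m := by
  rw [invWeight]
  positivity

theorem sum_invWeight_le (N : ℕ) :
    ∑ m ∈ Finset.Icc (-(N : ℤ)) N, invWeight m ≤ 2 * logSize N := by
  refine sum_Icc_neg_le N (by simp [invWeight]) fun m h1 _ => ?_
  have h1' : (1 : ℝ) ≤ m := by exact_mod_cast h1
  simp [invWeight, h1']

theorem sum_prod_invWeight_le (N : ℕ) :
    ∑ w ∈ freqBox N, ∏ i, invWeight (w i) ≤ 4 * logSize N ^ 2 := by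
  rw [freqBox, Finset.sum_prod_piFinset (Finset.Icc (-(N : ℤ)) N) fun _ m => invWeight m,
    Fin.prod_univ_two]
  have h := sum_invWeight_le N
  have h0 : 0 ≤ ∑ m ∈ Finset.Icc (-(N : ℤ)) N, invWeight m :=
    Finset.sum_nonneg fun m _ => (invWeight_pos m).le
  nlinarith

namespace KernelBounds

/-- The geometric mean of the decay estimates in the two coordinates. The product form makes the sum
over the box a product of two harmonic sums. -/
theorem norm_kacHat_le (h : KernelBounds 𝔎 C c γ) {w : Fin 2 → ℤ} (hw : w ∈ freqBox (size γ)) :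
    γ ^ 2 * ‖kacHat 𝔎 γ w‖ ≤ 4 * C * ∏ i, invWeight (w i) := by
  have hγ := h.pos
  have hγ1 : γ ≤ 1 := h.le.trans (by norm_num)
  have hC := h.one_le
  set a := ‖kacHat 𝔎 γ w‖ with ha
  have ha0 : 0 ≤ a := norm_nonneg _
  have h1 : ∀ i, a * (γ * max 1 |(w i : ℝ)|) ^ 2 ≤ 2 * C := by
    intro i
    have e1 := h.decay w hw i
    have e2 := h.norm_le w hw
    rcases le_total 1 |(w i : ℝ)| with hi | hi
    · rw [max_eq_right hi, mul_pow, sq_abs, ← mul_pow]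
      linarith
    · rw [max_eq_left hi, mul_one]
      nlinarith
  have hp : ∀ i, 0 < max 1 |(w i : ℝ)| := fun i => by positivity
  have h2 : (a * ((γ * max 1 |(w 0 : ℝ)|) * (γ * max 1 |(w 1 : ℝ)|))) ^ 2 ≤ (2 * C) ^ 2 := by
    calc (a * ((γ * max 1 |(w 0 : ℝ)|) * (γ * max 1 |(w 1 : ℝ)|))) ^ 2
        = (a * (γ * max 1 |(w 0 : ℝ)|) ^ 2) * (a * (γ * max 1 |(w 1 : ℝ)|) ^ 2) := by ring
      _ ≤ (2 * C) * (2 * C) := mul_le_mul (h1 0) (h1 1) (by positivity) (by positivity)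
      _ = (2 * C) ^ 2 := by ring
  have h3 : a * ((γ * max 1 |(w 0 : ℝ)|) * (γ * max 1 |(w 1 : ℝ)|)) ≤ 2 * C :=
    le_of_sq_le_sq h2 (by positivity)
  rw [Fin.prod_univ_two, invWeight, invWeight, ← mul_inv, ← div_eq_mul_inv,
    le_div_iff₀ (mul_pos (hp 0) (hp 1))]
  calc γ ^ 2 * a * (max 1 |(w 0 : ℝ)| * max 1 |(w 1 : ℝ)|)
      = a * ((γ * max 1 |(w 0 : ℝ)|) * (γ * max 1 |(w 1 : ℝ)|)) := by ring
    _ ≤ 4 * C := by linarith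

theorem sum_norm_kacHat_le (h : KernelBounds 𝔎 C c γ) :
    γ ^ 2 * ∑ w ∈ freqBox (size γ), ‖kacHat 𝔎 γ w‖ ≤ 16 * C * logSize (size γ) ^ 2 := by
  have hC := h.one_le
  rw [Finset.mul_sum]
  calc _ ≤ ∑ w ∈ freqBox (size γ), 4 * C * ∏ i, invWeight (w i) :=
        Finset.sum_le_sum fun w hw => h.norm_kacHat_le hw
    _ = 4 * C * ∑ w ∈ freqBox (size γ), ∏ i, invWeight (w i) := (Finset.mul_sum _ _ _).symm
    _ ≤ 4 * C * (4 * logSize (size γ) ^ 2) := by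
        gcongr
        exact sum_prod_invWeight_le _
    _ = _ := by ring

end KernelBounds

/-- The decay rate of the frequency `w`. -/
def decayRate (𝔎 : EuclideanSpace ℝ (Fin 2) → ℝ) (γ : ℝ) (w : Fin 2 → ℤ) : ℝ :=
  (γ ^ 2)⁻¹ * (1 - (kacHat 𝔎 γ w).re)

/-- The Fourier transform of `P^γ_τ ⋆ K_γ`. -/
def greenHat (𝔎 : EuclideanSpace ℝ (Fin 2) → ℝ) (γ τ : ℝ) (w : Fin 2 → ℤ) : ℂ :=
  Complex.exp ((τ : ℂ) * ((γ : ℂ) ^ 2)⁻¹ * (kacHat 𝔎 γ w - 1)) * kacHat 𝔎 γ w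

theorem norm_greenHat (τ : ℝ) (w : Fin 2 → ℤ) :
    ‖greenHat 𝔎 γ τ w‖ = Real.exp (-(decayRate 𝔎 γ w * τ)) * ‖kacHat 𝔎 γ w‖ := by
  rw [greenHat, norm_mul, Complex.norm_exp]
  congr 2
  have : (τ : ℂ) * ((γ : ℂ) ^ 2)⁻¹ * (kacHat 𝔎 γ w - 1) =
      ((τ * (γ ^ 2)⁻¹ : ℝ) : ℂ) * (kacHat 𝔎 γ w - 1) := by push_cast; ring
  rw [this, Complex.re_ofReal_mul, decayRate, Complex.sub_re, Complex.one_re]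
  ring

theorem integral_exp_decay_le {b s t : ℝ} (hb : 0 < b) (hst : s ≤ t) :
    ∫ r in (0 : ℝ)..s, Real.exp (-(b * (t - r))) ≤ b⁻¹ := by
  have hder : ∀ r ∈ Set.uIcc 0 s, HasDerivAt (fun r => b⁻¹ * Real.exp (-(b * (t - r))))
      (Real.exp (-(b * (t - r)))) r := by
    intro r _
    have h1 : HasDerivAt (fun r : ℝ => -(b * (t - r))) b r := by
      refine (((hasDerivAt_id' r).const_sub t).const_mul b).fun_neg.congr_deriv ?_
      ring
    have h2 := h1.exp.const_mul b⁻¹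
    refine h2.congr_deriv ?_
    field_simp
  rw [intervalIntegral.integral_eq_sub_of_hasDerivAt hder
    (Continuous.intervalIntegrable (by fun_prop) _ _)]
  have h1 : Real.exp (-(b * (t - s))) ≤ 1 := Real.exp_le_one_iff.2 (by nlinarith)
  have h2 := Real.exp_pos (-(b * (t - 0)))
  have h3 : 0 < b⁻¹ := by positivity
  nlinarith

namespace KernelBounds

theorem decayRate_nonneg (h : KernelBounds 𝔎 C c γ) {w : Fin 2 → ℤ}
    (hw : w ∈ freqBox (size γ)) : 0 ≤ decayRate 𝔎 γ w := by
  have h1 := (Complex.re_le_norm _).trans (h.norm_le w hw)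
  have h2 := h.pos
  exact mul_nonneg (by positivity) (by linarith)

theorem norm_greenHat_le (h : KernelBounds 𝔎 C c γ) {w : Fin 2 → ℤ} (hw : w ∈ freqBox (size γ))
    {τ : ℝ} (hτ : 0 ≤ τ) : ‖greenHat 𝔎 γ τ w‖ ≤ ‖kacHat 𝔎 γ w‖ := by
  rw [norm_greenHat]
  refine mul_le_of_le_one_left (norm_nonneg _) (Real.exp_le_one_iff.2 ?_)
  have := mul_nonneg (h.decayRate_nonneg hw) hτ
  linarith

/-- The time integral is controlled by the inverse decay rate, taken in the direction i of the
largest coordinate: it is O(γ² + |w_i|⁻²), and |w_i|⁻² is below the product of the inverse weights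
because i is maximal. -/
theorem integral_norm_greenHat_sq_le (h : KernelBounds 𝔎 C c γ) {w : Fin 2 → ℤ}
    (hw : w ∈ freqBox (size γ)) (hw0 : w ≠ 0) {s t : ℝ} (hst : s ≤ t) :
    ∫ r in (0 : ℝ)..s, ‖greenHat 𝔎 γ (t - r) w‖ ^ 2 ≤
      c⁻¹ * (γ ^ 2 * ‖kacHat 𝔎 γ w‖ + ∏ i, invWeight (w i)) := by
  have hγ := h.pos
  have hc := h.c_pos
  obtain ⟨i, hi, hmax⟩ : ∃ i, w i ≠ 0 ∧ ∀ j, |(w j : ℝ)| ≤ |(w i : ℝ)| := by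
    obtain ⟨i, -, hi⟩ := Finset.exists_max_image Finset.univ (fun j => |(w j : ℝ)|)
      ⟨0, Finset.mem_univ _⟩
    refine ⟨i, fun h0 => hw0 (funext fun j => ?_), fun j => hi j (Finset.mem_univ j)⟩
    have := hi j (Finset.mem_univ j)
    rw [h0, Int.cast_zero, abs_zero] at this
    have h1 : (w j : ℝ) = 0 := abs_eq_zero.1 (le_antisymm this (abs_nonneg _))
    exact_mod_cast h1
  set a := ‖kacHat 𝔎 γ w‖ with ha
  have ha0 : 0 ≤ a := norm_nonneg _
  have ha1 : a ≤ 1 := h.norm_le w hw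
  have hm1 : 1 ≤ |(w i : ℝ)| := by exact_mod_cast Int.one_le_abs hi
  have hre := h.re_bound w hw i
  have hx0 : 0 < (γ * w i) ^ 2 := by
    have : (w i : ℝ) ≠ 0 := by exact_mod_cast hi
    positivity
  have hmin : 0 < min 1 ((γ * (w i : ℝ)) ^ 2) := lt_min one_pos hx0
  have hb : 0 < decayRate 𝔎 γ w :=
    mul_pos (by positivity) (lt_of_lt_of_le (by positivity) hre)
  have hprod : (|(w i : ℝ)| ^ 2)⁻¹ ≤ ∏ i, invWeight (w i) := by
    rw [Fin.prod_univ_two, invWeight, invWeight, ← mul_inv]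
    refine inv_anti₀ (by positivity) ?_
    rw [sq]
    exact mul_le_mul (max_le hm1 (hmax 0)) (max_le hm1 (hmax 1)) (by positivity) (by positivity)
  have hinv : (decayRate 𝔎 γ w)⁻¹ ≤ c⁻¹ * (γ ^ 2 + (|(w i : ℝ)| ^ 2)⁻¹) := by
    have e1 : (γ ^ 2)⁻¹ * (c * min 1 ((γ * (w i : ℝ)) ^ 2)) ≤ decayRate 𝔎 γ w :=
      mul_le_mul_of_nonneg_left hre (by positivity)
    refine (inv_anti₀ (by positivity) e1).trans ?_
    rw [mul_inv, inv_inv, mul_inv]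
    have e2 : (min 1 ((γ * (w i : ℝ)) ^ 2))⁻¹ ≤ 1 + ((γ * (w i : ℝ)) ^ 2)⁻¹ := by
      rcases min_choice 1 ((γ * (w i : ℝ)) ^ 2) with hm | hm <;> rw [hm]
      · rw [inv_one]
        linarith [inv_pos.2 hx0]
      · linarith
    calc γ ^ 2 * (c⁻¹ * (min 1 ((γ * (w i : ℝ)) ^ 2))⁻¹)
        ≤ γ ^ 2 * (c⁻¹ * (1 + ((γ * (w i : ℝ)) ^ 2)⁻¹)) := by gcongr
      _ = c⁻¹ * (γ ^ 2 + (|(w i : ℝ)| ^ 2)⁻¹) := by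
          rw [mul_pow, sq_abs]
          field_simp
  have hinteg : ∫ r in (0 : ℝ)..s, ‖greenHat 𝔎 γ (t - r) w‖ ^ 2 ≤
      a ^ 2 * (2 * decayRate 𝔎 γ w)⁻¹ := by
    have e1 : ∀ r : ℝ, ‖greenHat 𝔎 γ (t - r) w‖ ^ 2 =
        a ^ 2 * Real.exp (-((2 * decayRate 𝔎 γ w) * (t - r))) := by
      intro r
      rw [norm_greenHat, mul_pow, ← Real.exp_nat_mul, mul_comm]
      congr 2
      push_cast
      ring
    simp only [e1]
    rw [intervalIntegral.integral_const_mul]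
    exact mul_le_mul_of_nonneg_left (integral_exp_decay_le (by positivity) hst) (by positivity)
  refine hinteg.trans ?_
  have hd0 : 0 < (decayRate 𝔎 γ w)⁻¹ := inv_pos.2 hb
  rw [mul_inv]
  calc a ^ 2 * (2⁻¹ * (decayRate 𝔎 γ w)⁻¹) ≤ a * (decayRate 𝔎 γ w)⁻¹ := by
        rw [← mul_assoc]
        exact mul_le_mul_of_nonneg_right (by nlinarith) hd0.le
    _ ≤ a * (c⁻¹ * (γ ^ 2 + (|(w i : ℝ)| ^ 2)⁻¹)) := by gcongr
    _ = c⁻¹ * (γ ^ 2 * a + a * (|(w i : ℝ)| ^ 2)⁻¹) := by ring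
    _ ≤ c⁻¹ * (γ ^ 2 * a + 1 * ∏ i, invWeight (w i)) := by gcongr
    _ = _ := by rw [one_mul]

theorem continuous_norm_greenHat (w : Fin 2 → ℤ) (t : ℝ) :
    Continuous fun r : ℝ => ‖greenHat 𝔎 γ (t - r) w‖ ^ 2 := by
  unfold greenHat
  fun_prop

theorem integral_sum_norm_greenHat_sq_le (h : KernelBounds 𝔎 C c γ) {s t : ℝ} (hs : 0 ≤ s)
    (hst : s ≤ t) :
    ∫ r in (0 : ℝ)..s, ∑ w ∈ freqBox (size γ), ‖greenHat 𝔎 γ (t - r) w‖ ^ 2 ≤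
      (t + 20 * C * c⁻¹) * logSize (size γ) ^ 2 := by
  have hC := h.one_le
  have hc := h.c_pos
  have hl := one_le_logSize (size γ)
  have ht : 0 ≤ t := hs.trans hst
  have hprod0 : ∀ w : Fin 2 → ℤ, 0 ≤ ∏ i, invWeight (w i) := fun w =>
    Finset.prod_nonneg fun i _ => (invWeight_pos _).le
  rw [intervalIntegral.integral_finsetSum fun w _ =>
    (continuous_norm_greenHat w t).intervalIntegrable _ _]
  have hterm : ∀ w ∈ freqBox (size γ), ∫ r in (0 : ℝ)..s, ‖greenHat 𝔎 γ (t - r) w‖ ^ 2 ≤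
      -- The zero mode does not decay and contributes the length of the time interval.
      (if w = 0 then t else 0) + c⁻¹ * (γ ^ 2 * ‖kacHat 𝔎 γ w‖ + ∏ i, invWeight (w i)) := by
    intro w hw
    split_ifs with hw0
    · have h1 : ∫ r in (0 : ℝ)..s, ‖greenHat 𝔎 γ (t - r) w‖ ^ 2 ≤ ∫ _r in (0 : ℝ)..s, (1 : ℝ) := by
        refine intervalIntegral.integral_mono_on hs
          ((continuous_norm_greenHat w t).intervalIntegrable _ _) intervalIntegrable_const
          fun r hr => ?_
        have e1 := (h.norm_greenHat_le hw (τ := t - r) (by linarith [hr.2])).trans (h.norm_le w hw)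
        exact pow_le_one₀ (norm_nonneg _) e1
      rw [intervalIntegral.integral_const, smul_eq_mul, mul_one, sub_zero] at h1
      have h2 : 0 ≤ c⁻¹ * (γ ^ 2 * ‖kacHat 𝔎 γ w‖ + ∏ i, invWeight (w i)) := by
        have := hprod0 w
        positivity
      linarith
    · rw [zero_add]
      exact h.integral_norm_greenHat_sq_le hw hw0 hst
  refine (Finset.sum_le_sum hterm).trans ?_
  rw [Finset.sum_add_distrib, ← Finset.mul_sum, Finset.sum_add_distrib, ← Finset.mul_sum]
  have h1 : ∑ w ∈ freqBox (size γ), (if w = 0 then t else 0) ≤ t := by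
    rw [Finset.sum_ite_eq']
    split_ifs
    · exact le_rfl
    · exact ht
  have h2 := h.sum_norm_kacHat_le
  have h3 := sum_prod_invWeight_le (size γ)
  have hl2 : 1 ≤ logSize (size γ) ^ 2 := one_le_pow₀ hl
  calc _ ≤ t + c⁻¹ * (16 * C * logSize (size γ) ^ 2 + 4 * logSize (size γ) ^ 2) := by gcongr
    _ ≤ t * logSize (size γ) ^ 2 + c⁻¹ * (20 * C * logSize (size γ) ^ 2) := by
        have e1 : t ≤ t * logSize (size γ) ^ 2 := le_mul_of_one_le_right ht hl2
        have e2 : 16 * C * logSize (size γ) ^ 2 + 4 * logSize (size γ) ^ 2 ≤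
            20 * C * logSize (size γ) ^ 2 := by nlinarith
        have e3 := mul_le_mul_of_nonneg_left e2 (inv_pos.2 hc).le
        linarith
    _ = _ := by ring

end KernelBounds

/-- The frequencies at most `N / 2`. -/
def lowBox (N : ℕ) : Finset (Fin 2 → ℤ) := (freqBox N).filter fun w => ∀ i, 2 * |w i| ≤ N

/-- The frequencies larger than `N / 2`. -/
def highBox (N : ℕ) : Finset (Fin 2 → ℤ) := (freqBox N).filter fun w => ¬ ∀ i, 2 * |w i| ≤ N

theorem highBox_subset (N : ℕ) : highBox N ⊆ freqBox N := Finset.filter_subset _ _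

theorem lowBox_subset (N : ℕ) : lowBox N ⊆ freqBox N := Finset.filter_subset _ _

theorem card_freqBox (N : ℕ) : (freqBox N).card = (2 * N + 1) ^ 2 := by
  rw [freqBox, Fintype.card_piFinset_const, card_Icc_neg]

namespace KernelBounds

/-- Some coordinate exceeds N/2, which is of order γ⁻², so γ|w_i| is of order γ⁻¹; this is inserted
into the decay and into the lower bound of `KernelBounds`. -/
theorem high (h : KernelBounds 𝔎 C c γ) {w : Fin 2 → ℤ} (hw : w ∈ highBox (size γ)) :
    ‖kacHat 𝔎 γ w‖ ≤ 8 * C * γ ^ 2 ∧ c * (γ ^ 2)⁻¹ ≤ decayRate 𝔎 γ w := by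
  have hγ := h.pos
  have hγ4 := h.le
  have hc := h.c_pos
  rw [highBox, Finset.mem_filter, not_forall] at hw
  obtain ⟨hwb, i, hi⟩ := hw
  have hi' : (size γ : ℝ) ≤ 2 * |(w i : ℝ)| := by exact_mod_cast (not_le.1 hi).le
  have hN := one_le_size_mul hγ
  have hlow : 1 / 8 ≤ γ ^ 2 * (γ * w i) ^ 2 := by
    have e1 : 15 / 16 ≤ γ ^ 2 * size γ := by nlinarith
    have e2 : 15 / 32 ≤ γ ^ 2 * |(w i : ℝ)| := by nlinarith [sq_nonneg γ]
    have e3 : γ ^ 2 * (γ * (w i : ℝ)) ^ 2 = (γ ^ 2 * |(w i : ℝ)|) ^ 2 := by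
      rw [mul_pow (γ ^ 2), sq_abs]
      ring
    rw [e3]
    nlinarith
  constructor
  · have h1 := h.decay w hwb i
    have h2 := norm_nonneg (kacHat 𝔎 γ w)
    have h3 : γ ^ 2 * (‖kacHat 𝔎 γ w‖ * (γ * w i) ^ 2) ≤ γ ^ 2 * C := by gcongr
    nlinarith
  · have h1 := h.re_bound w hwb i
    have h2 : (1 : ℝ) ≤ (γ * w i) ^ 2 := by nlinarith [sq_nonneg (γ * (w i : ℝ))]
    rw [min_eq_left h2, mul_one] at h1
    rw [decayRate, mul_comm c]
    gcongr

/-- There are O(γ⁻⁴) modes, each contributing O(γ⁴) times the exponential. -/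
theorem sum_high_le (h : KernelBounds 𝔎 C c γ) {τ : ℝ} (hτ : 0 ≤ τ) :
    ∑ w ∈ highBox (size γ), ‖greenHat 𝔎 γ τ w‖ ^ 2 ≤
      576 * C ^ 2 * Real.exp (-(c * (γ ^ 2)⁻¹ * τ)) ^ 2 := by
  have hγ := h.pos
  have hγ4 := h.le
  have hC := h.one_le
  have hterm : ∀ w ∈ highBox (size γ), ‖greenHat 𝔎 γ τ w‖ ^ 2 ≤
      (Real.exp (-(c * (γ ^ 2)⁻¹ * τ)) * (8 * C * γ ^ 2)) ^ 2 := by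
    intro w hw
    obtain ⟨h1, h2⟩ := h.high hw
    rw [norm_greenHat]
    gcongr
  refine (Finset.sum_le_card_nsmul _ _ _ hterm).trans ?_
  have hcard : ((highBox (size γ)).card : ℝ) ≤ (2 * size γ + 1) ^ 2 := by
    have := Finset.card_le_card (highBox_subset (size γ))
    rw [card_freqBox] at this
    exact_mod_cast this
  have hN := size_mul_le hγ
  have h3 : γ ^ 2 * (2 * size γ + 1) ≤ 3 := by nlinarith
  have h4 : (γ ^ 2 * (2 * (size γ : ℝ) + 1)) ^ 2 ≤ 3 ^ 2 := by gcongr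
  rw [nsmul_eq_mul]
  calc ((highBox (size γ)).card : ℝ) * (Real.exp (-(c * (γ ^ 2)⁻¹ * τ)) * (8 * C * γ ^ 2)) ^ 2
      ≤ (2 * size γ + 1) ^ 2 * (Real.exp (-(c * (γ ^ 2)⁻¹ * τ)) * (8 * C * γ ^ 2)) ^ 2 := by gcongr
    _ = 64 * C ^ 2 * Real.exp (-(c * (γ ^ 2)⁻¹ * τ)) ^ 2 *
        (γ ^ 2 * (2 * (size γ : ℝ) + 1)) ^ 2 := by ring
    _ ≤ 64 * C ^ 2 * Real.exp (-(c * (γ ^ 2)⁻¹ * τ)) ^ 2 * 3 ^ 2 := by gcongr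
    _ = _ := by ring

theorem sum_norm_greenHat_le (h : KernelBounds 𝔎 C c γ) {B : Finset (Fin 2 → ℤ)}
    (hB : B ⊆ freqBox (size γ)) {τ : ℝ} (hτ : 0 ≤ τ) :
    γ ^ 2 * ∑ w ∈ B, ‖greenHat 𝔎 γ τ w‖ ≤ 16 * C * logSize (size γ) ^ 2 := by
  refine le_trans ?_ h.sum_norm_kacHat_le
  refine mul_le_mul_of_nonneg_left ?_ (sq_nonneg γ)
  calc ∑ w ∈ B, ‖greenHat 𝔎 γ τ w‖ ≤ ∑ w ∈ B, ‖kacHat 𝔎 γ w‖ :=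
        Finset.sum_le_sum fun w hw => h.norm_greenHat_le (hB hw) hτ
    _ ≤ _ := Finset.sum_le_sum_of_subset_of_nonneg hB fun _ _ _ => norm_nonneg _

theorem sum_norm_greenHat_sq_le (h : KernelBounds 𝔎 C c γ) {B : Finset (Fin 2 → ℤ)}
    (hB : B ⊆ freqBox (size γ)) {τ : ℝ} (hτ : 0 ≤ τ) :
    γ ^ 2 * ∑ w ∈ B, ‖greenHat 𝔎 γ τ w‖ ^ 2 ≤ 16 * C * logSize (size γ) ^ 2 := by
  refine le_trans (mul_le_mul_of_nonneg_left (Finset.sum_le_sum fun w hw => ?_) (sq_nonneg γ))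
    (h.sum_norm_greenHat_le hB hτ)
  have h1 := (h.norm_greenHat_le (hB hw) hτ).trans (h.norm_le w (hB hw))
  exact pow_le_of_le_one (norm_nonneg _) h1 two_ne_zero

end KernelBounds

/-! #### The effect of a change of the configuration -/

/-- The part of the kernel of `P^γ_τ ⋆ K_γ` with frequencies in `B`. -/
def green (𝔎 : EuclideanSpace ℝ (Fin 2) → ℝ) (γ : ℝ) (B : Finset (Fin 2 → ℤ)) (τ : ℝ)
    (k : Lattice (size γ)) : ℂ :=
  (1 / 4) * ∑ w ∈ B, greenHat 𝔎 γ τ w * latticeChar w k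

/-- The contribution of the frequencies in `B` to the jump of `R` when the configuration changes
from `η` to `η'`. -/
def jumpSize (𝔎 : EuclideanSpace ℝ (Fin 2) → ℝ) (γ : ℝ) (B : Finset (Fin 2 → ℤ)) (τ : ℝ)
    (k : Lattice (size γ)) (η η' : Config (size γ)) : ℂ :=
  (γ⁻¹ * mesh (size γ) ^ 2 : ℝ) *
    ∑ l, green 𝔎 γ B τ (k - l) * ((spin η' l - spin η l : ℝ) : ℂ)

theorem spin_flip {N : ℕ} (η : Config N) (j l : Lattice N) :
    spin (flip η j) l - spin η l = if l = j then -2 * spin η j else 0 := by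
  rw [spin, spin, flip, Function.update_apply]
  split_ifs with h
  · subst h
    rw [spin]
    push_cast
    ring
  · ring

theorem abs_spin {N : ℕ} (η : Config N) (j : Lattice N) : |spin η j| = 1 := by
  rw [spin]
  rcases Int.units_eq_one_or (η j) with h | h <;> rw [h] <;> simp

theorem jumpSize_flip (B : Finset (Fin 2 → ℤ)) (τ : ℝ) (k : Lattice (size γ))
    (η : Config (size γ)) (j : Lattice (size γ)) :
    jumpSize 𝔎 γ B τ k η (flip η j) =
      (γ⁻¹ * mesh (size γ) ^ 2 : ℝ) * (green 𝔎 γ B τ (k - j) * ((-2 * spin η j : ℝ) : ℂ)) := by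
  rw [jumpSize, Finset.sum_eq_single j]
  · rw [spin_flip, if_pos rfl]
  · intro l _ hl
    rw [spin_flip, if_neg hl]
    simp
  · simp

theorem norm_jumpSize_flip (hγ : 0 < γ) (B : Finset (Fin 2 → ℤ)) (τ : ℝ) (k : Lattice (size γ))
    (η : Config (size γ)) (j : Lattice (size γ)) :
    ‖jumpSize 𝔎 γ B τ k η (flip η j)‖ =
      2 * (γ⁻¹ * mesh (size γ) ^ 2) * ‖green 𝔎 γ B τ (k - j)‖ := by
  have : 0 < γ⁻¹ * mesh (size γ) ^ 2 := by
    have := mesh_pos (size γ)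
    positivity
  rw [jumpSize_flip, norm_mul, norm_mul, Complex.norm_real, Complex.norm_real,
    Real.norm_of_nonneg this.le, norm_mul, Real.norm_eq_abs, Real.norm_eq_abs, abs_spin, abs_neg,
    abs_two]
  ring

theorem jumpSize_self (B : Finset (Fin 2 → ℤ)) (τ : ℝ) (k : Lattice (size γ))
    (η : Config (size γ)) : jumpSize 𝔎 γ B τ k η η = 0 := by
  simp [jumpSize]

namespace KernelBounds

/-- The prefactor γ⁻¹ mesh² is of order γ³, and the Green function is at most the sum of its Fourier
coefficients, which is O(γ⁻² log²). -/
theorem norm_jumpSize_flip_le (h : KernelBounds 𝔎 C c γ) {B : Finset (Fin 2 → ℤ)}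
    (hB : B ⊆ freqBox (size γ)) {τ : ℝ} (hτ : 0 ≤ τ) (k : Lattice (size γ))
    (η : Config (size γ)) (j : Lattice (size γ)) :
    ‖jumpSize 𝔎 γ B τ k η (flip η j)‖ ≤ 32 * C * γ * logSize (size γ) ^ 2 := by
  have hγ := h.pos
  have hm := mesh_size_le hγ
  have hm0 := mesh_pos (size γ)
  have h1 : ‖green 𝔎 γ B τ (k - j)‖ ≤ 1 / 4 * ∑ w ∈ B, ‖greenHat 𝔎 γ τ w‖ := by
    rw [green, norm_mul]
    have e1 : ‖(1 / 4 : ℂ)‖ = 1 / 4 := by norm_num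
    rw [e1]
    gcongr
    refine (norm_sum_le _ _).trans (le_of_eq (Finset.sum_congr rfl fun w _ => ?_))
    rw [norm_mul, norm_latticeChar, mul_one]
  have h2 := h.sum_norm_greenHat_le hB hτ
  rw [norm_jumpSize_flip hγ]
  have hs : 0 ≤ ∑ w ∈ B, ‖greenHat 𝔎 γ τ w‖ := Finset.sum_nonneg fun _ _ => norm_nonneg _
  calc 2 * (γ⁻¹ * mesh (size γ) ^ 2) * ‖green 𝔎 γ B τ (k - j)‖
      ≤ 2 * (γ⁻¹ * (2 * γ ^ 2) ^ 2) * (1 / 4 * ∑ w ∈ B, ‖greenHat 𝔎 γ τ w‖) := by gcongr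
    _ = 2 * γ * (γ ^ 2 * ∑ w ∈ B, ‖greenHat 𝔎 γ τ w‖) := by field_simp; ring
    _ ≤ 2 * γ * (16 * C * logSize (size γ) ^ 2) := by gcongr
    _ = _ := by ring

theorem sum_norm_jumpSize_flip_sq_le (h : KernelBounds 𝔎 C c γ) {B : Finset (Fin 2 → ℤ)}
    (hB : B ⊆ freqBox (size γ)) (τ : ℝ) (k : Lattice (size γ)) (η : Config (size γ)) :
    ∑ j, ‖jumpSize 𝔎 γ B τ k η (flip η j)‖ ^ 2 ≤
      4 * γ ^ 2 * ∑ w ∈ B, ‖greenHat 𝔎 γ τ w‖ ^ 2 := by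
  have hγ := h.pos
  have hm := mesh_size_le hγ
  have hm0 := mesh_pos (size γ)
  have h1 := sum_norm_sq_latticeChar hB (greenHat 𝔎 γ τ)
  have h2 : ∑ j, ‖jumpSize 𝔎 γ B τ k η (flip η j)‖ ^ 2 =
      4 * (γ ^ 2)⁻¹ * mesh (size γ) ^ 2 *
        ∑ l, mesh (size γ) ^ 2 * ‖green 𝔎 γ B τ l‖ ^ 2 := by
    rw [← Equiv.sum_comp (Equiv.subLeft k)
      fun l => mesh (size γ) ^ 2 * ‖green 𝔎 γ B τ l‖ ^ 2, Finset.mul_sum]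
    refine Finset.sum_congr rfl fun j _ => ?_
    rw [norm_jumpSize_flip hγ, Equiv.subLeft_apply]
    ring
  rw [h2]
  simp only [green]
  rw [h1]
  have hs : 0 ≤ ∑ w ∈ B, ‖greenHat 𝔎 γ τ w‖ ^ 2 := Finset.sum_nonneg fun _ _ => by positivity
  calc 4 * (γ ^ 2)⁻¹ * mesh (size γ) ^ 2 * (1 / 4 * ∑ w ∈ B, ‖greenHat 𝔎 γ τ w‖ ^ 2)
      ≤ 4 * (γ ^ 2)⁻¹ * (2 * γ ^ 2) ^ 2 * (1 / 4 * ∑ w ∈ B, ‖greenHat 𝔎 γ τ w‖ ^ 2) := by gcongr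
    _ = _ := by field_simp; ring

/-- Cauchy–Schwarz over the flipped site and Parseval for each factor: the high-frequency factor
gives γ times the exponential, the other one a logarithm. -/
theorem sum_norm_jumpSize_high_mul_le (h : KernelBounds 𝔎 C c γ) {B : Finset (Fin 2 → ℤ)}
    (hB : B ⊆ freqBox (size γ)) {τ : ℝ} (hτ : 0 ≤ τ) (k k' : Lattice (size γ))
    (η : Config (size γ)) :
    ∑ j, ‖jumpSize 𝔎 γ (highBox (size γ)) τ k η (flip η j)‖ *
        ‖jumpSize 𝔎 γ B τ k' η (flip η j)‖ ≤
      384 * C ^ 2 * γ * logSize (size γ) * Real.exp (-(c * (γ ^ 2)⁻¹ * τ)) := by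
  have hγ := h.pos
  have hC := h.one_le
  have hl := one_le_logSize (size γ)
  have h1 := h.sum_norm_jumpSize_flip_sq_le (highBox_subset _) τ k η
  have h2 := h.sum_norm_jumpSize_flip_sq_le hB τ k' η
  have h3 := h.sum_high_le hτ
  have h4 := h.sum_norm_greenHat_sq_le hB hτ
  have hcs := Finset.sum_mul_sq_le_sq_mul_sq Finset.univ
    (fun j => ‖jumpSize 𝔎 γ (highBox (size γ)) τ k η (flip η j)‖)
    (fun j => ‖jumpSize 𝔎 γ B τ k' η (flip η j)‖)
  refine le_of_sq_le_sq (hcs.trans ?_) (by positivity)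
  set E := Real.exp (-(c * (γ ^ 2)⁻¹ * τ)) with hE
  have h5 : ∑ j, ‖jumpSize 𝔎 γ (highBox (size γ)) τ k η (flip η j)‖ ^ 2 ≤
      4 * γ ^ 2 * (576 * C ^ 2 * E ^ 2) := h1.trans (by gcongr)
  have h6 : ∑ j, ‖jumpSize 𝔎 γ B τ k' η (flip η j)‖ ^ 2 ≤
      4 * (16 * C * logSize (size γ) ^ 2) := h2.trans (by linarith)
  calc _ ≤ (4 * γ ^ 2 * (576 * C ^ 2 * E ^ 2)) * (4 * (16 * C * logSize (size γ) ^ 2)) :=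
        mul_le_mul h5 h6 (Finset.sum_nonneg fun _ _ => by positivity) (by positivity)
    _ = 147456 * C ^ 3 * (γ ^ 2 * E ^ 2 * logSize (size γ) ^ 2) := by ring
    -- The power of C is raised to an even one so that the bound becomes a square; 147456 = 384².
    _ ≤ 147456 * C ^ 4 * (γ ^ 2 * E ^ 2 * logSize (size γ) ^ 2) := by
        gcongr 147456 * ?_ * _
        exact pow_le_pow_right₀ hC (by norm_num)
    _ = _ := by ring

end KernelBounds

end Green

/-! ### Newton's identities for iterated integrals -/

section Newton

variable {J : ℝ≥0 → Finset ℝ≥0} {a b : ℝ≥0 → ℂ}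

/-- Formally Σ I_n z^n is the stochastic exponential exp(Σ (-1)^k p_k z^{k+1}/(k+1)), and Newton's
identity is its logarithmic derivative in z. Here L denotes left limits. The identity for L is
carried along in the induction because the jumps of the next iterated integral involve I just before
the jump. -/
theorem newton_identity (hJ : IsJumpTimes J) {I L p d : ℕ → ℝ≥0 → ℂ}
    (hI0 : ∀ s, I 0 s = 1) (hL0 : ∀ s, L 0 s = 1)
    (hI : ∀ n, JumpPath J (I (n + 1)) (fun s => L n s * a s) fun s => I n s * b s)
    (hL : ∀ n s, I (n + 1) s = L (n + 1) s + L n s * a s)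
    (hp : ∀ k, JumpPath J (p k) (fun s => a s ^ (k + 1)) (d k))
    (hd0 : ∀ s, d 0 s = b s) (hd : ∀ k s, d (k + 1) s = 0) (n : ℕ) (s : ℝ≥0) :
    ((n + 1 : ℕ) : ℂ) * I (n + 1) s =
        ∑ k ∈ Finset.range (n + 1), (-1) ^ k * (I (n - k) s * p k s) ∧
      ((n + 1 : ℕ) : ℂ) * L (n + 1) s =
        ∑ k ∈ Finset.range (n + 1), (-1) ^ k * (L (n - k) s * (p k s - a s ^ (k + 1))) := by
  induction n generalizing s with
  | zero =>
    have h1 : I 1 s = p 0 s := (hI 0).ext_path (hp 0) (fun s => by rw [hL0]; ring)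
      (fun s => by rw [hI0, hd0, one_mul]) s
    have h2 := hL 0 s
    rw [hL0, h1] at h2
    simp only [zero_add, Nat.cast_one, one_mul, Finset.range_one, Finset.sum_singleton, pow_zero,
      Nat.sub_self, hI0, hL0, pow_one]
    exact ⟨h1, by rw [h2]; ring⟩
  | succ n ih =>
    have hprod : ∀ k ∈ Finset.range (n + 1), JumpPath J
        (fun s => (-1) ^ k * (I (n - k + 1) s * p k s))
        (fun s => (-1) ^ k * (L (n - k + 1) s * a s ^ (k + 1) +
          L (n - k) s * a s * (p k s - a s ^ (k + 1)) + L (n - k) s * a s * a s ^ (k + 1)))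
        (fun s => (-1) ^ k * (I (n - k) s * b s * p k s + I (n - k + 1) s * d k s)) := by
      intro k _
      have h := ((hI (n - k)).mul hJ (hp k)).const_mul ((-1) ^ k)
      have e : ∀ s, I (n - k + 1) s - L (n - k) s * a s = L (n - k + 1) s := fun s => by
        rw [hL]
        ring
      simp only [e] at h
      exact h
    have hlast := (hp (n + 1)).const_mul ((-1) ^ (n + 1))
    have hsum := (JumpPath.sum _ hprod).add hlast
    have hidx : ∀ k ∈ Finset.range (n + 1), n + 1 - k = n - k + 1 := fun k hk => by
      have := Finset.mem_range.1 hk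
      omega
    -- The terms of the product rule without p telescope; what remains is one copy of L_{n+1} a and
    -- the jump of the last power sum.
    have htel : ∀ s, ∑ k ∈ Finset.range (n + 1), ((-1) ^ k * (L (n + 1 - k) s * a s ^ (k + 1)) +
        (-1) ^ k * (L (n - k) s * a s ^ (k + 2))) =
        L (n + 1) s * a s - (-1) ^ (n + 1) * a s ^ (n + 2) := by
      intro s
      have h := Finset.sum_range_sub' (fun k => (-1 : ℂ) ^ k * (L (n + 1 - k) s * a s ^ (k + 1)))
        (n + 1)
      simp only [Nat.sub_self, hL0, Nat.sub_zero, pow_zero, one_mul, zero_add, pow_one] at h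
      rw [← h]
      refine Finset.sum_congr rfl fun k _ => ?_
      rw [show n + 1 - (k + 1) = n - k by omega]
      ring
    have hjump : ∀ s, ∑ k ∈ Finset.range (n + 1), (-1) ^ k * (L (n - k + 1) s * a s ^ (k + 1) +
          L (n - k) s * a s * (p k s - a s ^ (k + 1)) + L (n - k) s * a s * a s ^ (k + 1)) +
          (-1) ^ (n + 1) * a s ^ (n + 2) = ((n + 2 : ℕ) : ℂ) * (L (n + 1) s * a s) := by
      intro s
      have h1 := (ih s).2
      have h2 := htel s
      have h3 : ∑ k ∈ Finset.range (n + 1), (-1) ^ k * (L (n - k + 1) s * a s ^ (k + 1) +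
          L (n - k) s * a s * (p k s - a s ^ (k + 1)) + L (n - k) s * a s * a s ^ (k + 1)) =
          ∑ k ∈ Finset.range (n + 1), ((-1) ^ k * (L (n + 1 - k) s * a s ^ (k + 1)) +
            (-1) ^ k * (L (n - k) s * a s ^ (k + 2))) +
          a s * ∑ k ∈ Finset.range (n + 1),
            (-1) ^ k * (L (n - k) s * (p k s - a s ^ (k + 1))) := by
        rw [Finset.mul_sum, ← Finset.sum_add_distrib]
        refine Finset.sum_congr rfl fun k hk => ?_
        rw [hidx k hk]
        ring
      rw [h3, h2, ← h1]
      push_cast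
      ring
    have hdrift : ∀ s, ∑ k ∈ Finset.range (n + 1),
        (-1) ^ k * (I (n - k) s * b s * p k s + I (n - k + 1) s * d k s) +
          (-1) ^ (n + 1) * d (n + 1) s = ((n + 2 : ℕ) : ℂ) * (I (n + 1) s * b s) := by
      intro s
      have h1 := (ih s).1
      have h2 : ∑ k ∈ Finset.range (n + 1), (-1) ^ k * (I (n - k + 1) s * d k s) =
          I (n + 1) s * b s := by
        rw [Finset.sum_range_succ', Finset.sum_eq_zero fun k _ => by rw [hd]; ring, hd0]
        simp
      have h3 : ∑ k ∈ Finset.range (n + 1),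
          (-1) ^ k * (I (n - k) s * b s * p k s + I (n - k + 1) s * d k s) =
          b s * ∑ k ∈ Finset.range (n + 1), (-1) ^ k * (I (n - k) s * p k s) +
          ∑ k ∈ Finset.range (n + 1), (-1) ^ k * (I (n - k + 1) s * d k s) := by
        rw [Finset.mul_sum, ← Finset.sum_add_distrib]
        refine Finset.sum_congr rfl fun k _ => ?_
        ring
      rw [h3, h2, ← h1, hd]
      push_cast
      ring
    -- Both sides have the same jumps, by the identity for L, and the same drift, by the identity
    -- for I.
    have hpath := ((hI (n + 1)).const_mul ((n + 2 : ℕ) : ℂ)).ext_path hsum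
      (fun s => (hjump s).symm) (fun s => (hdrift s).symm) s
    have hsplit : ∀ F : ℕ → ℂ, ∑ k ∈ Finset.range (n + 1 + 1), (-1) ^ k * (I (n + 1 - k) s * F k) =
        ∑ k ∈ Finset.range (n + 1), (-1) ^ k * (I (n - k + 1) s * F k) +
          (-1) ^ (n + 1) * F (n + 1) := by
      intro F
      rw [Finset.sum_range_succ, Nat.sub_self, hI0, one_mul]
      congr 1
      exact Finset.sum_congr rfl fun k hk => by rw [hidx k hk]
    have hsplit' : ∀ F : ℕ → ℂ,
        ∑ k ∈ Finset.range (n + 1 + 1), (-1) ^ k * (L (n + 1 - k) s * F k) =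
        ∑ k ∈ Finset.range (n + 1), (-1) ^ k * (L (n - k + 1) s * F k) +
          (-1) ^ (n + 1) * F (n + 1) := by
      intro F
      rw [Finset.sum_range_succ, Nat.sub_self, hL0, one_mul]
      congr 1
      exact Finset.sum_congr rfl fun k hk => by rw [hidx k hk]
    refine ⟨by rw [hsplit fun k => p k s]; exact hpath, ?_⟩
    rw [hsplit' fun k => p k s - a s ^ (k + 1)]
    have h4 := hjump s
    have h5 := hL (n + 1) s
    have h6 : ((n + 1 + 1 : ℕ) : ℂ) * L (n + 1 + 1) s =
        ∑ k ∈ Finset.range (n + 1), (-1) ^ k * (I (n - k + 1) s * p k s) +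
          (-1) ^ (n + 1) * p (n + 1) s - ((n + 2 : ℕ) : ℂ) * (L (n + 1) s * a s) := by
      rw [← hpath, h5]
      push_cast
      ring
    rw [h6, ← h4]
    have h7 : ∑ k ∈ Finset.range (n + 1), (-1) ^ k * (I (n - k + 1) s * p k s) =
        ∑ k ∈ Finset.range (n + 1), (-1) ^ k * (L (n - k + 1) s * (p k s - a s ^ (k + 1))) +
        ∑ k ∈ Finset.range (n + 1), (-1) ^ k * (L (n - k + 1) s * a s ^ (k + 1) +
          L (n - k) s * a s * (p k s - a s ^ (k + 1)) + L (n - k) s * a s * a s ^ (k + 1)) := by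
      rw [← Finset.sum_add_distrib]
      refine Finset.sum_congr rfl fun k _ => ?_
      rw [hL (n - k)]
      ring
    rw [h7]
    ring

/-- The Appell property turns the defining recursion into a three-term recursion, which is Newton's
identity with the power sums beyond the second removed. -/
theorem pderiv_hermite (n : ℕ) :
    MvPolynomial.pderiv 0 (hermite (n + 1)) = ((n + 1 : ℕ) : MvPolynomial (Fin 2) ℂ) * hermite n := by
  induction n with
  | zero => simp [hermite]
  | succ n ih =>
    rw [hermite, map_sub, Derivation.leibniz, Derivation.leibniz, ih,
      MvPolynomial.pderiv_X_self, MvPolynomial.pderiv_X_of_ne (by decide)]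
    simp only [smul_eq_mul, mul_one, mul_zero, add_zero]
    rw [Derivation.leibniz, Derivation.map_natCast]
    simp only [smul_eq_mul, mul_zero, add_zero]
    have h : hermite (n + 1) = MvPolynomial.X 0 * hermite n -
      MvPolynomial.X 1 * MvPolynomial.pderiv 0 (hermite n) := rfl
    rw [h]
    push_cast
    ring

theorem eval_hermite_add_two (f : Fin 2 → ℂ) (n : ℕ) :
    MvPolynomial.eval f (hermite (n + 2)) = f 0 * MvPolynomial.eval f (hermite (n + 1)) -
      f 1 * (((n + 1 : ℕ) : ℂ) * MvPolynomial.eval f (hermite n)) := by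
  rw [hermite, pderiv_hermite]
  simp

/-- All terms are homogeneous of degree n + 1 in M, and their number n + 1 is cancelled by the
factor on the left. -/
theorem norm_le_of_newton {I p : ℕ → ℂ} {M : ℝ} (hM : 0 ≤ M) (h0 : I 0 = 1)
    (hp : ∀ k, ‖p k‖ ≤ M ^ (k + 1))
    (hI : ∀ n : ℕ, ((n + 1 : ℕ) : ℂ) * I (n + 1) =
      ∑ k ∈ Finset.range (n + 1), (-1) ^ k * (I (n - k) * p k)) (n : ℕ) : ‖I n‖ ≤ M ^ n := by
  induction n using Nat.strong_induction_on with
  | _ n ih =>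
    cases n with
    | zero => simp [h0]
    | succ n =>
      have h1 := congrArg norm (hI n)
      rw [norm_mul, Complex.norm_natCast] at h1
      have h2 : ‖∑ k ∈ Finset.range (n + 1), (-1) ^ k * (I (n - k) * p k)‖ ≤
          ((n + 1 : ℕ) : ℝ) * M ^ (n + 1) := by
        refine (norm_sum_le _ _).trans ((Finset.sum_le_card_nsmul _ _ (M ^ (n + 1))
          fun k hk => ?_).trans (by rw [Finset.card_range, nsmul_eq_mul]))
        have hk' := Finset.mem_range.1 hk
        rw [norm_mul, norm_pow, norm_neg, norm_one, one_pow, one_mul, norm_mul]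
        calc ‖I (n - k)‖ * ‖p k‖ ≤ M ^ (n - k) * M ^ (k + 1) :=
              mul_le_mul (ih _ (by omega)) (hp k) (norm_nonneg _) (by positivity)
          _ = M ^ (n + 1) := by
              rw [← pow_add]
              congr 1
              omega
      rw [← h1] at h2
      exact le_of_mul_le_mul_left h2 (by positivity)

/-- Subtracting the two recursions leaves the inherited errors of the two previous orders, the term
T - p_1, and n terms with a power sum p_k, k ≥ 2, each of the last two kinds carrying a factor δ.
The factor 4 per order is enough room for their sum. -/
theorem norm_hermite_sub_le {H I p : ℕ → ℂ} {T : ℂ} {M δ : ℝ} (hM : 0 ≤ M)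
    (hI0 : I 0 = 1) (hH0 : H 0 = 1) (hH1 : H 1 = p 0)
    (hI : ∀ n : ℕ, ((n + 1 : ℕ) : ℂ) * I (n + 1) =
      ∑ k ∈ Finset.range (n + 1), (-1) ^ k * (I (n - k) * p k))
    (hH : ∀ n : ℕ, ((n + 2 : ℕ) : ℂ) * H (n + 2) = p 0 * H (n + 1) - T * H n)
    (hp : ∀ k, ‖p k‖ ≤ M ^ (k + 1)) (hT : ‖T‖ ≤ M ^ 2) (hδ : 0 ≤ δ)
    (hTp : ‖T - p 1‖ ≤ δ * M ^ 2) (hpk : ∀ k, 2 ≤ k → ‖p k‖ ≤ δ * M ^ (k + 1)) (n : ℕ) :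
    ‖H n - I n‖ ≤ 4 ^ n * (δ * M ^ n) := by
  have hIb := norm_le_of_newton hM hI0 hp hI
  induction n using Nat.strong_induction_on with
  | _ n ih =>
    match n with
    | 0 =>
      rw [hH0, hI0]
      simpa using hδ
    | 1 =>
      have h1 := hI 0
      simp only [zero_add, Nat.cast_one, one_mul, Finset.range_one, Finset.sum_singleton, pow_zero,
        Nat.sub_self, hI0] at h1
      rw [hH1, h1, sub_self, norm_zero]
      positivity
    | n + 2 =>
      have e0 := ih (n + 1) (by omega)
      have e1 := ih n (by omega)
      have hsum := hI (n + 1)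
      rw [Finset.sum_range_succ', Finset.sum_range_succ'] at hsum
      simp only [zero_add, pow_zero, pow_one, one_mul, Nat.sub_zero, Nat.add_sub_cancel] at hsum
      have hid : ((n + 2 : ℕ) : ℂ) * (H (n + 2) - I (n + 2)) = p 0 * (H (n + 1) - I (n + 1)) -
          T * (H n - I n) - (T - p 1) * I n -
          ∑ k ∈ Finset.range n, (-1) ^ (k + 1 + 1) * (I (n + 1 - (k + 1 + 1)) * p (k + 1 + 1)) := by
        rw [mul_sub, hH]
        linear_combination -hsum
      have hS : ‖∑ k ∈ Finset.range n, (-1) ^ (k + 1 + 1) *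
          (I (n + 1 - (k + 1 + 1)) * p (k + 1 + 1))‖ ≤ n * (δ * M ^ (n + 2)) := by
        refine (norm_sum_le _ _).trans ((Finset.sum_le_card_nsmul _ _ (δ * M ^ (n + 2))
          fun k hk => ?_).trans (by rw [Finset.card_range, nsmul_eq_mul]))
        have hk' := Finset.mem_range.1 hk
        rw [norm_mul, norm_pow, norm_neg, norm_one, one_pow, one_mul, norm_mul]
        calc _ ≤ M ^ (n + 1 - (k + 1 + 1)) * (δ * M ^ (k + 1 + 1 + 1)) :=
              mul_le_mul (hIb _) (hpk _ (by omega)) (norm_nonneg _) (by positivity)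
          _ = δ * (M ^ (n + 1 - (k + 1 + 1)) * M ^ (k + 1 + 1 + 1)) := by ring
          _ = δ * M ^ (n + 2) := by
              rw [← pow_add]
              congr 2
              omega
      have hnorm := congrArg norm hid
      rw [norm_mul, Complex.norm_natCast] at hnorm
      have hb : ((n + 2 : ℕ) : ℝ) * ‖H (n + 2) - I (n + 2)‖ ≤
          (4 ^ (n + 1) + 4 ^ n + 1 + n) * (δ * M ^ (n + 2)) := by
        rw [hnorm]
        have t0 : ‖p 0 * (H (n + 1) - I (n + 1))‖ ≤ 4 ^ (n + 1) * (δ * M ^ (n + 2)) := by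
          rw [norm_mul]
          calc _ ≤ M ^ (0 + 1) * (4 ^ (n + 1) * (δ * M ^ (n + 1))) :=
                mul_le_mul (hp 0) e0 (norm_nonneg _) (by positivity)
            _ = _ := by ring
        have t1 : ‖T * (H n - I n)‖ ≤ 4 ^ n * (δ * M ^ (n + 2)) := by
          rw [norm_mul]
          calc _ ≤ M ^ 2 * (4 ^ n * (δ * M ^ n)) :=
                mul_le_mul hT e1 (norm_nonneg _) (by positivity)
            _ = _ := by ring
        have t2 : ‖(T - p 1) * I n‖ ≤ δ * M ^ (n + 2) := by
          rw [norm_mul]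
          calc _ ≤ δ * M ^ 2 * M ^ n :=
                mul_le_mul hTp (hIb n) (norm_nonneg _) (by positivity)
            _ = _ := by ring
        refine (norm_sub_le _ _).trans ?_
        refine (add_le_add ((norm_sub_le _ _).trans
          (add_le_add ((norm_sub_le _ _).trans (add_le_add t0 t1)) t2)) hS).trans (le_of_eq ?_)
        ring
      have hnum : (4 : ℝ) ^ (n + 1) + 4 ^ n + 1 + n ≤ ((n + 2 : ℕ) : ℝ) * 4 ^ (n + 2) := by
        have h4 : (1 : ℝ) ≤ 4 ^ n := one_le_pow₀ (by norm_num)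
        have hn0 : (0 : ℝ) ≤ n := Nat.cast_nonneg n
        push_cast
        rw [pow_succ, pow_succ, pow_succ]
        nlinarith
      have hpos : (0 : ℝ) < ((n + 2 : ℕ) : ℝ) := by positivity
      refine le_of_mul_le_mul_left (hb.trans ?_) hpos
      rw [← mul_assoc ((n + 2 : ℕ) : ℝ)]
      exact mul_le_mul_of_nonneg_right hnum (by positivity)

end Newton

/-! ### The paths of the rescaled spin system -/

section MacroPath

variable {𝔎 : EuclideanSpace ℝ (Fin 2) → ℝ} {γ β : ℝ}

/-- The spin system on the macroscopic time scale. -/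
def macroPath (γ : ℝ) {S : Type*} (σ : ℝ≥0 → S) (s : ℝ≥0) : S := σ (s / (γ ^ 2).toNNReal)

/-- The jump rates on the macroscopic time scale. -/
def macroRate (𝔎 : EuclideanSpace ℝ (Fin 2) → ℝ) (γ β : ℝ) {N : ℕ} (η : Config N)
    (j : Lattice N) : ℝ := (γ ^ 2)⁻¹ * rate 𝔎 γ β η j

theorem rate_mem_Icc {N : ℕ} (η : Config N) (j : Lattice N) : rate 𝔎 γ β η j ∈ Set.Icc 0 1 := by
  have hpos : ∀ η : Config N, 0 < gibbs 𝔎 γ β η := fun η =>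
    div_pos (Real.exp_pos _) (Finset.sum_pos (fun _ _ => Real.exp_pos _) Finset.univ_nonempty)
  have h1 := hpos η
  have h2 := hpos (flip η j)
  rw [rate]
  refine ⟨by positivity, ?_⟩
  rw [div_le_one (by positivity)]
  linarith

theorem macroRate_nonneg {N : ℕ} (η : Config N) (j : Lattice N) : 0 ≤ macroRate 𝔎 γ β η j :=
  mul_nonneg (by positivity) (rate_mem_Icc η j).1

theorem macroRate_le {N : ℕ} (η : Config N) (j : Lattice N) :
    macroRate 𝔎 γ β η j ≤ (γ ^ 2)⁻¹ :=
  mul_le_of_le_one_right (by positivity) (rate_mem_Icc η j).2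

theorem strictMono_div (hγ : 0 < γ) : StrictMono fun s : ℝ≥0 => s / (γ ^ 2).toNNReal := by
  intro a b hab
  have : 0 < (γ ^ 2).toNNReal := Real.toNNReal_pos.2 (by positivity)
  exact div_lt_div_of_pos_right hab this

theorem isStepPath_macroPath (hγ : 0 < γ) {S : Type*} {σ : ℝ≥0 → S} (hσ : IsStepPath σ) :
    IsStepPath (macroPath γ σ) := by
  have hc : Continuous fun s : ℝ≥0 => s / (γ ^ 2).toNNReal := by fun_prop
  have hm := strictMono_div hγ
  refine ⟨fun t => ?_, fun t => ?_⟩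
  · refine (tendsto_nhdsWithin_iff.2 ⟨(hc.tendsto t).mono_left nhdsWithin_le_nhds, ?_⟩ :
      Tendsto (fun s : ℝ≥0 => s / (γ ^ 2).toNNReal) (𝓝[>] t) (𝓝[>] _)).eventually (hσ.rc _)
    filter_upwards [self_mem_nhdsWithin] with s hs using hm hs
  · obtain ⟨η, hη⟩ := hσ.ll (t / (γ ^ 2).toNNReal)
    refine ⟨η, ?_⟩
    refine (tendsto_nhdsWithin_iff.2 ⟨(hc.tendsto t).mono_left nhdsWithin_le_nhds, ?_⟩ :
      Tendsto (fun s : ℝ≥0 => s / (γ ^ 2).toNNReal) (𝓝[<] t) (𝓝[<] _)).eventually hη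
    filter_upwards [self_mem_nhdsWithin] with s hs using hm hs

theorem integral_macroPath (hγ : 0 < γ) {S : Type*} (σ : ℝ≥0 → S) (g : S → ℝ) (s : ℝ≥0) :
    ∫ r in (0 : ℝ)..((s / (γ ^ 2).toNNReal : ℝ≥0) : ℝ), g (σ r.toNNReal) =
      ∫ u in (0 : ℝ)..s, (γ ^ 2)⁻¹ * g (macroPath γ σ u.toNNReal) := by
  have hγ2 : (0 : ℝ) < γ ^ 2 := by positivity
  have h1 := intervalIntegral.integral_comp_div (a := 0) (b := (s : ℝ))
    (fun r => g (σ r.toNNReal)) hγ2.ne'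
  have h2 : ∀ u : ℝ, macroPath γ σ u.toNNReal = σ (u / γ ^ 2).toNNReal := fun u => by
    rw [macroPath, Real.toNNReal_div' hγ2.le]
  rw [intervalIntegral.integral_const_mul]
  simp only [h2]
  rw [h1, zero_div, smul_eq_mul, ← mul_assoc, inv_mul_cancel₀ hγ2.ne', one_mul, NNReal.coe_div,
    Real.coe_toNNReal _ hγ2.le]

theorem inv_mul_generator {N : ℕ} (f : Config N → ℝ) (η : Config N) :
    (γ ^ 2)⁻¹ * generator 𝔎 γ β f η = jumpGenerator flip (macroRate 𝔎 γ β) f η := by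
  rw [generator, jumpGenerator, Finset.mul_sum]
  exact Finset.sum_congr rfl fun j _ => by rw [macroRate]; ring

theorem isJumpProcess_macroPath {Ω : Type u} {mΩ : MeasurableSpace Ω} {μ : Measure Ω}
    {ℱ : Filtration ℝ≥0 mΩ} {N : ℕ} {σ : ℝ≥0 → Ω → Config N} (hγ : 0 < γ)
    (h : IsGlauberDynamics 𝔎 γ β μ ℱ σ) :
    ∃ 𝒢 : Filtration ℝ≥0 mΩ, IsJumpProcess flip (macroRate 𝔎 γ β) μ 𝒢
      fun s ω => macroPath γ (fun r => σ r ω) s := by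
  have hm := (strictMono_div hγ).monotone
  refine ⟨⟨fun s => ℱ (s / (γ ^ 2).toNNReal), fun s t hst => ℱ.mono (hm hst),
    fun s => ℱ.le _⟩, ?_⟩
  refine ⟨fun t η => h.adapted _ η, fun ω => isStepPath_macroPath hγ
    ⟨h.right_continuous ω, h.left_limits ω⟩, fun f => ?_⟩
  have hM := h.martingale f
  have heq : (fun (t : ℝ≥0) ω => f (macroPath γ (fun r => σ r ω) t) -
      f (macroPath γ (fun r => σ r ω) 0) - ∫ r in (0 : ℝ)..t,
        jumpGenerator flip (macroRate 𝔎 γ β) f (macroPath γ (fun r => σ r ω) r.toNNReal)) =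
      fun t ω => (fun (t : ℝ≥0) ω => f (σ t ω) - f (σ 0 ω) -
        ∫ r in (0 : ℝ)..t, generator 𝔎 γ β f (σ r.toNNReal ω)) (t / (γ ^ 2).toNNReal) ω := by
    ext t ω
    dsimp only
    rw [integral_macroPath hγ (fun r => σ r ω) (generator 𝔎 γ β f)]
    simp only [inv_mul_generator, macroPath, zero_div]
  rw [heq]
  exact ⟨fun t => hM.1 _, fun s t hst => hM.2 _ _ (hm hst)⟩

theorem JumpPath.of_drift {S : Type*} {x : ℝ≥0 → S} [Finite S] (hx : IsStepPath x) (g : S → ℂ) :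
    JumpPath (jumps x) (fun s => ∫ u in (0 : ℝ)..s, g (x u.toNNReal)) (fun _ => 0)
      fun s => g (x s) := by
  refine ⟨fun s => by simp, fun _ _ => rfl, fun s => ?_, fun T => ?_⟩
  · refine tendsto_const_nhds.congr' ?_
    filter_upwards [hx.rc s] with r hr
    rw [hr]
  · have := Fintype.ofFinite S
    refine ⟨∑ η, ‖g η‖, fun u _ => ?_⟩
    exact Finset.single_le_sum (f := fun η => ‖g η‖) (fun _ _ => norm_nonneg _)
      (Finset.mem_univ (x u))

theorem JumpPath.stieltjes_continuous {J : ℝ≥0 → Finset ℝ≥0} {X a b : ℝ≥0 → ℂ}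
    (hJ : IsJumpTimes J) {f g : ℝ≥0 → ℂ} (h : JumpPath J X a b) (hg : ∀ s, g s = X s)
    (hf : Continuous f) :
    JumpPath J (fun s => stieltjes f g s) (fun s => f s * a s) (fun s => f s * b s) := by
  have hb : ∀ T : ℝ≥0, ∃ C, ∀ u ≤ T, ‖f u‖ ≤ C := fun T => by
    obtain ⟨B, hB⟩ := (isCompact_Icc (a := (0 : ℝ≥0)) (b := T)).exists_bound_of_continuousOn
      hf.continuousOn
    exact ⟨B, fun r hr => hB r ⟨bot_le, hr⟩⟩
  exact h.stieltjes_path hJ (c := 0) (fun s => by rw [hg, zero_add]) hf.measurable hb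
    (fun _ _ => rfl) (fun s => (hf.tendsto s).mono_left nhdsWithin_le_nhds) hb

/-- The martingale belongs to the averaged field h = κ ⋆ σ, so a flip enters R through P ⋆ K. The
extra factor K̂ supplies the decay at high frequencies. -/
theorem sum_heatKernel_mul_kac (τ : ℝ) (k l : Lattice (size γ)) :
    ∑ j, heatKernel 𝔎 γ τ (k - j) * (kac 𝔎 γ (j - l) : ℂ) =
      green 𝔎 γ (freqBox (size γ)) τ (k - l) := by
  have h1 : ∀ j : Lattice (size γ), heatKernel 𝔎 γ τ (k - j) = (1 / 4) *
      ∑ w ∈ freqBox (size γ), Complex.exp ((τ : ℂ) * ((γ : ℂ) ^ 2)⁻¹ * (kacHat 𝔎 γ w - 1)) *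
        latticeChar w (k - j) := fun j => rfl
  simp only [h1, green, greenHat, Finset.mul_sum, Finset.sum_mul]
  rw [Finset.sum_comm]
  refine Finset.sum_congr rfl fun w hw => ?_
  rw [kacHat_eq hw, ← Equiv.sum_comp (Equiv.addRight l)]
  simp only [Equiv.coe_addRight, add_sub_cancel_right, Finset.mul_sum, Finset.sum_mul]
  refine Finset.sum_congr rfl fun j _ => ?_
  rw [show k - (j + l) = k - l - j by abel, latticeChar_sub w (k - l) j]
  ring

theorem sum_heatKernel_mul_localField (τ : ℝ) (k : Lattice (size γ)) (η η' : Config (size γ)) :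
    ∑ j, (mesh (size γ) : ℂ) ^ 2 * (heatKernel 𝔎 γ τ (k - j) *
      ((γ⁻¹ * (localField 𝔎 γ η' j - localField 𝔎 γ η j) : ℝ) : ℂ)) =
      jumpSize 𝔎 γ (freqBox (size γ)) τ k η η' := by
  have h1 : ∀ j : Lattice (size γ), localField 𝔎 γ η' j - localField 𝔎 γ η j =
      ∑ l, kac 𝔎 γ (j - l) * (spin η' l - spin η l) := fun j => by
    rw [localField, localField, ← Finset.sum_sub_distrib]
    exact Finset.sum_congr rfl fun l _ => by ring
  simp only [h1, jumpSize, ← sum_heatKernel_mul_kac, Finset.mul_sum, Finset.sum_mul,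
    Complex.ofReal_sum]
  rw [Finset.sum_comm]
  refine Finset.sum_congr rfl fun l _ => Finset.sum_congr rfl fun j _ => ?_
  push_cast
  ring

theorem continuous_heatKernel (t : ℝ≥0) (k : Lattice (size γ)) :
    Continuous fun r : ℝ≥0 => heatKernel 𝔎 γ ((t : ℝ) - (r : ℝ)) k := by
  unfold heatKernel
  fun_prop

theorem macroMartingale_jumpPath (hγ : 0 < γ) {σ : ℝ≥0 → Config (size γ)} (hσ : IsStepPath σ)
    (k : Lattice (size γ)) :
    JumpPath (jumps (macroPath γ σ)) (fun s => (macroMartingale 𝔎 γ β σ s k : ℂ))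
      (fun s => ((γ⁻¹ * (localField 𝔎 γ (macroPath γ σ s) k -
        localField 𝔎 γ (leftVal (macroPath γ σ) s) k) : ℝ) : ℂ))
      (fun s => ∑ j, ((-macroRate 𝔎 γ β (macroPath γ σ s) j : ℝ) : ℂ) *
        ((γ⁻¹ * (localField 𝔎 γ (flip (macroPath γ σ s) j) k -
          localField 𝔎 γ (macroPath γ σ s) k) : ℝ) : ℂ)) := by
  have hx := isStepPath_macroPath hγ hσ
  have h1 := hx.jumpPath fun η => ((γ⁻¹ * localField 𝔎 γ η k : ℝ) : ℂ)
  have h2 := JumpPath.of_drift hx fun η => ∑ j, ((-macroRate 𝔎 γ β η j : ℝ) : ℂ) *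
        ((γ⁻¹ * (localField 𝔎 γ (flip η j) k - localField 𝔎 γ η k) : ℝ) : ℂ)
  have h3 := h1.add h2
  convert h3 using 1
  · ext s
    have e1 : ∀ η : Config (size γ), ∑ j, ((-macroRate 𝔎 γ β η j : ℝ) : ℂ) *
        ((γ⁻¹ * (localField 𝔎 γ (flip η j) k - localField 𝔎 γ η k) : ℝ) : ℂ) =
        ((-γ⁻¹ * ((γ ^ 2)⁻¹ * generator 𝔎 γ β (fun η => localField 𝔎 γ η k) η) : ℝ) : ℂ) := by
      intro η
      rw [inv_mul_generator, jumpGenerator, Finset.mul_sum]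
      push_cast
      exact Finset.sum_congr rfl fun j _ => by ring
    simp only [e1]
    rw [intervalIntegral.integral_ofReal, intervalIntegral.integral_const_mul,
      ← integral_macroPath hγ σ (generator 𝔎 γ β fun η => localField 𝔎 γ η k),
      macroMartingale, microMartingale]
    simp only [macroPath, zero_div]
    push_cast
    ring
  · ext s
    push_cast
    ring
  · ext s
    ring

/-- With the final time t fixed, the integrand is deterministic and continuous in r, so the jumps
and the drift of M are simply multiplied by it. -/
theorem R_jumpPath (hγ : 0 < γ) {σ : ℝ≥0 → Config (size γ)} (hσ : IsStepPath σ) (t : ℝ≥0)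
    (k : Lattice (size γ)) :
    JumpPath (jumps (macroPath γ σ)) (fun s => R 𝔎 γ β σ t s k)
      (fun s => jumpSize 𝔎 γ (freqBox (size γ)) (t - s) k (leftVal (macroPath γ σ) s)
        (macroPath γ σ s))
      (fun s => -∑ j, (macroRate 𝔎 γ β (macroPath γ σ s) j : ℂ) *
        jumpSize 𝔎 γ (freqBox (size γ)) (t - s) k (macroPath γ σ s)
          (flip (macroPath γ σ s) j)) := by
  have hx := isStepPath_macroPath hγ hσ
  have h1 := JumpPath.sum Finset.univ fun (j : Lattice (size γ)) _ =>
    ((macroMartingale_jumpPath (𝔎 := 𝔎) (β := β) hγ hσ j).stieltjes_continuous hx.isJumpTimes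
      (fun _ => rfl) (continuous_heatKernel (𝔎 := 𝔎) t (k - j))).const_mul
      ((mesh (size γ) : ℂ) ^ 2)
  convert h1 using 1
  · rfl
  · ext s
    rw [sum_heatKernel_mul_localField]
  · ext s
    simp only [← sum_heatKernel_mul_localField, Finset.mul_sum]
    rw [Finset.sum_comm, ← Finset.sum_neg_distrib]
    refine Finset.sum_congr rfl fun j _ => ?_
    rw [← Finset.sum_neg_distrib]
    refine Finset.sum_congr rfl fun l _ => ?_
    push_cast
    ring

theorem JumpPath.bracket {J : ℝ≥0 → Finset ℝ≥0} {X a b : ℝ≥0 → ℂ} (hJ : IsJumpTimes J)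
    (h : JumpPath J X a b) (s : ℝ≥0) : bracket X s = ∑ ρ ∈ J s, a ρ ^ 2 := by
  have h1 := (h.mul hJ h).add ((h.stieltjes_leftLim hJ h fun _ => rfl).const_mul (-2))
  have h2 := h1.eq s
  have e1 : ∀ ρ, (X ρ - a ρ) * a ρ + a ρ * (X ρ - a ρ) + a ρ * a ρ + -2 * ((X ρ - a ρ) * a ρ) =
      a ρ ^ 2 := fun ρ => by ring
  have e2 : ∀ ρ, b ρ * X ρ + X ρ * b ρ + -2 * (X ρ * b ρ) = 0 := fun ρ => by ring
  simp only [e1, e2, intervalIntegral.integral_zero, add_zero] at h2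
  rw [← h2, IsingKac.bracket]
  ring

end MacroPath

/-! ### Iterated integrals as paths -/

section Wick

variable {𝔎 : EuclideanSpace ℝ (Fin 2) → ℝ} {γ β : ℝ} {σ : ℝ≥0 → Config (size γ)} {t : ℝ≥0}
  {J : ℝ≥0 → Finset ℝ≥0} {a b : Lattice (size γ) → ℝ≥0 → ℂ}

theorem fourierTransform_jumpPath {N : ℕ} {X a b : Lattice N → ℝ≥0 → ℂ}
    (hR : ∀ k, JumpPath J (X k) (a k) (b k)) (w : Fin 2 → ℤ) :
    JumpPath J (fun s => fourierTransform (fun k => X k s) w)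
      (fun s => fourierTransform (fun k => a k s) w)
      (fun s => fourierTransform (fun k => b k s) w) := by
  unfold fourierTransform
  split_ifs
  · have h := JumpPath.sum Finset.univ fun (k : Lattice N) _ =>
      (hR k).const_mul ((mesh N : ℂ) ^ 2 * fourierMode (-w) (macroPoint k))
    simpa only [mul_right_comm] using h
  · exact JumpPath.zero_path

theorem trigExtension_jumpPath {N : ℕ} {X a b : Lattice N → ℝ≥0 → ℂ}
    (hR : ∀ k, JumpPath J (X k) (a k) (b k)) (x : Fin 2 → ℝ) :
    JumpPath J (fun s => trigExtension (fun k => X k s) x)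
      (fun s => trigExtension (fun k => a k s) x)
      (fun s => trigExtension (fun k => b k s) x) := by
  simp only [trigExtension_eq]
  exact JumpPath.sum Finset.univ fun k _ => (hR k).const_mul _

theorem freqBox_add {N n : ℕ} {u v : Fin 2 → ℤ} (hu : u ∈ freqBox (n * N)) (hv : v ∈ freqBox N) :
    u + v ∈ freqBox ((n + 1) * N) := by
  rw [mem_freqBox] at *
  intro i
  have h1 := Finset.mem_Icc.1 (hu i)
  have h2 := Finset.mem_Icc.1 (hv i)
  rw [Finset.mem_Icc, Pi.add_apply]
  push_cast at *
  constructor <;> linarith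

theorem sum_sub_eq {N n : ℕ} {F : (Fin 2 → ℤ) → ℂ} (hF : ∀ u, u ∉ freqBox (n * N) → F u = 0)
    {v : Fin 2 → ℤ} (hv : v ∈ freqBox N) :
    ∑ w ∈ freqBox ((n + 1) * N), F (w - v) = ∑ u ∈ freqBox (n * N), F u := by
  classical
  have h1 : ∑ u ∈ freqBox (n * N), F u =
      ∑ w ∈ (freqBox (n * N)).image fun u => u + v, F (w - v) := by
    rw [Finset.sum_image fun a _ b _ hab => add_right_cancel hab]
    simp
  rw [h1]
  symm
  refine Finset.sum_subset ?_ fun w _ hw => hF _ fun hmem => hw ?_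
  · intro w hw
    obtain ⟨u, hu, rfl⟩ := Finset.mem_image.1 hw
    exact freqBox_add hu hv
  · exact Finset.mem_image.2 ⟨w - v, hmem, sub_add_cancel w v⟩

/-- The box grows by N with every convolution, so no frequency is lost and the convolution of the
coefficients is the exact product of the functions at each x. -/
theorem sum_convolution {N n : ℕ} {F G : (Fin 2 → ℤ) → ℂ}
    (hF : ∀ u, u ∉ freqBox (n * N) → F u = 0) (x : Fin 2 → ℝ) :
    (1 / 4) * ∑ w ∈ freqBox ((n + 1) * N),
        (1 / 4) * (∑ v ∈ freqBox N, F (w - v) * G v) * fourierMode w x =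
      ((1 / 4) * ∑ u ∈ freqBox (n * N), F u * fourierMode u x) *
        ((1 / 4) * ∑ v ∈ freqBox N, G v * fourierMode v x) := by
  have h1 : ∀ w : Fin 2 → ℤ, (1 / 4) * (∑ v ∈ freqBox N, F (w - v) * G v) * fourierMode w x =
      (1 / 4) * ∑ v ∈ freqBox N, (F (w - v) * fourierMode (w - v) x) * (G v * fourierMode v x) := by
    intro w
    rw [mul_assoc, Finset.sum_mul]
    congr 1
    refine Finset.sum_congr rfl fun v _ => ?_
    have : fourierMode w x = fourierMode (w - v) x * fourierMode v x := by
      rw [← fourierMode_add, sub_add_cancel]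
    rw [this]
    ring
  simp only [h1]
  rw [← Finset.mul_sum, Finset.sum_comm]
  have h2 : ∀ v ∈ freqBox N, ∑ w ∈ freqBox ((n + 1) * N),
      (F (w - v) * fourierMode (w - v) x) * (G v * fourierMode v x) =
      (∑ u ∈ freqBox (n * N), F u * fourierMode u x) * (G v * fourierMode v x) := by
    intro v hv
    rw [← Finset.sum_mul, sum_sub_eq (F := fun u => F u * fourierMode u x)
      (fun u hu => by rw [hF u hu, zero_mul]) hv]
  rw [Finset.sum_congr rfl h2, ← Finset.mul_sum]
  ring

theorem stieltjes_zero_right (hJ : IsJumpTimes J) {Y a' b' : ℝ≥0 → ℂ} (h : JumpPath J Y a' b')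
    (s : ℝ≥0) : stieltjes (Function.leftLim Y) (fun _ => 0) s = 0 := by
  have h1 := JumpPath.stieltjes_leftLim hJ (JumpPath.zero_path (J := J)) h fun _ => rfl
  simpa using h1.eq s

theorem wickHat_succ_jumpPath (hJ : IsJumpTimes J)
    (hR : ∀ k, JumpPath J (fun s => R 𝔎 γ β σ t s k) (a k) (b k)) {n : ℕ}
    {A B : (Fin 2 → ℤ) → ℝ≥0 → ℂ}
    (hAB : ∀ w, JumpPath J (fun s => wickHat 𝔎 γ β σ t (n + 1) s w) (A w) (B w))
    (w : Fin 2 → ℤ) :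
    JumpPath J (fun s => wickHat 𝔎 γ β σ t (n + 2) s w)
      (fun s => ((n + 2 : ℕ) : ℂ) * ((1 / 4) * ∑ v ∈ freqBox (size γ),
        (wickHat 𝔎 γ β σ t (n + 1) s (w - v) - A (w - v) s) *
          fourierTransform (fun k => a k s) v))
      (fun s => ((n + 2 : ℕ) : ℂ) * ((1 / 4) * ∑ v ∈ freqBox (size γ),
        wickHat 𝔎 γ β σ t (n + 1) s (w - v) * fourierTransform (fun k => b k s) v)) := by
  have h1 := (((JumpPath.sum (freqBox (size γ)) fun v _ =>
    (fourierTransform_jumpPath hR v).stieltjes_leftLim hJ (hAB (w - v))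
      (fun _ => rfl)).const_mul (1 / 4)).const_mul ((n + 2 : ℕ) : ℂ))
  convert h1 using 1
  ext s
  rw [wickHat]
  congr 2
  refine tsum_eq_sum fun v hv => ?_
  have h0 : (fun r => fourierTransform (R 𝔎 γ β σ t r) v) = fun _ => 0 := by
    ext r
    exact if_neg hv
  rw [h0]
  exact stieltjes_zero_right hJ (hAB (w - v)) s

/-- The Fourier coefficients of the iterated integrals are paths of finite variation with
compactly supported frequencies. -/
theorem wickHat_jumpPath (hJ : IsJumpTimes J)
    (hR : ∀ k, JumpPath J (fun s => R 𝔎 γ β σ t s k) (a k) (b k)) (n : ℕ) :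
    ∃ A B : (Fin 2 → ℤ) → ℝ≥0 → ℂ,
      (∀ w, JumpPath J (fun s => wickHat 𝔎 γ β σ t (n + 1) s w) (A w) (B w)) ∧
      ∀ w, w ∉ freqBox ((n + 1) * size γ) → ∀ s,
        wickHat 𝔎 γ β σ t (n + 1) s w = 0 ∧ A w s = 0 ∧ B w s = 0 := by
  induction n with
  | zero =>
    have h0 : ∀ w, JumpPath J (fun s => wickHat 𝔎 γ β σ t (0 + 1) s w)
        (fun s => fourierTransform (fun k => a k s) w)
        (fun s => fourierTransform (fun k => b k s) w) := fun w => by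
      have h := fourierTransform_jumpPath hR w
      convert h using 2
      rw [zero_add, wickHat]
    refine ⟨fun w s => fourierTransform (fun k => a k s) w,
      fun w s => fourierTransform (fun k => b k s) w, h0, fun w hw s => ?_⟩
    rw [zero_add, one_mul] at hw
    rw [zero_add, wickHat]
    exact ⟨if_neg hw, if_neg hw, if_neg hw⟩
  | succ n ih =>
    obtain ⟨A, B, h1, h2⟩ := ih
    have h3 := wickHat_succ_jumpPath hJ hR h1
    have hsupp : ∀ w, w ∉ freqBox ((n + 1 + 1) * size γ) → ∀ v ∈ freqBox (size γ),
        w - v ∉ freqBox ((n + 1) * size γ) := by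
      intro w hw v hv hmem
      exact hw (by simpa using freqBox_add hmem hv)
    have hA0 : ∀ w, w ∉ freqBox ((n + 1 + 1) * size γ) → ∀ s, ∑ v ∈ freqBox (size γ),
          (wickHat 𝔎 γ β σ t (n + 1) s (w - v) - A (w - v) s) *
            fourierTransform (fun k => a k s) v = 0 := fun w hw s =>
      Finset.sum_eq_zero fun v hv => by
        rw [(h2 _ (hsupp w hw v hv) s).1, (h2 _ (hsupp w hw v hv) s).2.1, sub_zero, zero_mul]
    have hB0 : ∀ w, w ∉ freqBox ((n + 1 + 1) * size γ) → ∀ s, ∑ v ∈ freqBox (size γ),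
          wickHat 𝔎 γ β σ t (n + 1) s (w - v) * fourierTransform (fun k => b k s) v = 0 :=
      fun w hw s => Finset.sum_eq_zero fun v hv => by
        rw [(h2 _ (hsupp w hw v hv) s).1, zero_mul]
    refine ⟨_, _, h3, fun w hw s => ⟨?_, ?_, ?_⟩⟩
    · have h4 := (h3 w).ext_path JumpPath.zero_path (fun s => by rw [hA0 w hw s]; ring)
        (fun s => by rw [hB0 w hw s]; ring) s
      exact h4
    · rw [hA0 w hw s]
      ring
    · rw [hB0 w hw s]
      ring

theorem wick_one (s : ℝ≥0) (x : Fin 2 → ℝ) :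
    wick 𝔎 γ β σ t 1 s x = trigExtension (R 𝔎 γ β σ t s) x := by
  rw [wick, trigExtension]
  congr 1
  refine tsum_eq_sum fun w hw => ?_
  have : wickHat 𝔎 γ β σ t 1 s w = 0 := if_neg hw
  rw [this, zero_mul]

/-- The recursion for the iterated integrals at a point of the torus. -/
theorem wick_jumpPath (hJ : IsJumpTimes J)
    (hR : ∀ k, JumpPath J (fun s => R 𝔎 γ β σ t s k) (a k) (b k)) (x : Fin 2 → ℝ) (n : ℕ) :
    ∃ A B : ℝ≥0 → ℂ, JumpPath J (fun s => wick 𝔎 γ β σ t (n + 1) s x) A B ∧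
      JumpPath J (fun s => wick 𝔎 γ β σ t (n + 2) s x)
        (fun s => ((n + 2 : ℕ) : ℂ) * ((wick 𝔎 γ β σ t (n + 1) s x - A s) *
          trigExtension (fun k => a k s) x))
        (fun s => ((n + 2 : ℕ) : ℂ) * (wick 𝔎 γ β σ t (n + 1) s x *
          trigExtension (fun k => b k s) x)) := by
  have hfin : ∀ n s, wick 𝔎 γ β σ t (n + 1) s x = (1 / 4) *
      ∑ w ∈ freqBox ((n + 1) * size γ), wickHat 𝔎 γ β σ t (n + 1) s w * fourierMode w x := by
    intro n s
    obtain ⟨A, B, -, h2⟩ := wickHat_jumpPath hJ hR n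
    rw [wick]
    congr 1
    refine tsum_eq_sum fun w hw => ?_
    rw [(h2 w hw s).1, zero_mul]
  obtain ⟨A, B, h1, h2⟩ := wickHat_jumpPath hJ hR n
  have h3 := wickHat_succ_jumpPath hJ hR h1
  have p1 := (JumpPath.sum (freqBox ((n + 1) * size γ)) fun w _ =>
    (h1 w).const_mul (fourierMode w x)).const_mul (1 / 4)
  have p2 := (JumpPath.sum (freqBox ((n + 1 + 1) * size γ)) fun w _ =>
    (h3 w).const_mul (fourierMode w x)).const_mul (1 / 4)
  refine ⟨fun s => 1 / 4 * ∑ w ∈ freqBox ((n + 1) * size γ), fourierMode w x * A w s,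
    fun s => 1 / 4 * ∑ w ∈ freqBox ((n + 1) * size γ), fourierMode w x * B w s, ?_, ?_⟩
  · convert p1 using 1
    ext s
    rw [hfin]
    congr 1
    exact Finset.sum_congr rfl fun w _ => mul_comm _ _
  · convert p2 using 1
    · ext s
      rw [hfin (n + 1) s]
      congr 1
      exact Finset.sum_congr rfl fun w _ => mul_comm _ _
    · ext s
      have hc := sum_convolution (N := size γ) (n := n + 1)
        (F := fun u => wickHat 𝔎 γ β σ t (n + 1) s u - A u s)
        (G := fun v => fourierTransform (fun k => a k s) v)
        (fun u hu => by rw [(h2 u hu s).1, (h2 u hu s).2.1, sub_zero]) x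
      have e1 : wick 𝔎 γ β σ t (n + 1) s x - 1 / 4 * ∑ w ∈ freqBox ((n + 1) * size γ),
          fourierMode w x * A w s = 1 / 4 * ∑ u ∈ freqBox ((n + 1) * size γ),
          (wickHat 𝔎 γ β σ t (n + 1) s u - A u s) * fourierMode u x := by
        rw [hfin, ← mul_sub, ← Finset.sum_sub_distrib]
        congr 1
        exact Finset.sum_congr rfl fun w _ => by ring
      rw [e1, trigExtension, ← hc, Finset.mul_sum, Finset.mul_sum, Finset.mul_sum]
      refine Finset.sum_congr rfl fun w _ => ?_
      ring
    · ext s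
      have hc := sum_convolution (N := size γ) (n := n + 1)
        (F := fun u => wickHat 𝔎 γ β σ t (n + 1) s u)
        (G := fun v => fourierTransform (fun k => b k s) v)
        (fun u hu => (h2 u hu s).1) x
      rw [hfin, trigExtension, ← hc, Finset.mul_sum, Finset.mul_sum, Finset.mul_sum]
      refine Finset.sum_congr rfl fun w _ => ?_
      ring

/-- The algebraic description of `H_n - R^{:n:}` in terms of the jumps of `R`. -/
theorem norm_wickError_le (hJ : IsJumpTimes J)
    (hR : ∀ k, JumpPath J (fun s => R 𝔎 γ β σ t s k) (a k) (b k)) (x : Fin 2 → ℝ) (s : ℝ≥0)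
    {M δ : ℝ} (hM : 0 ≤ M) (hδ : 0 ≤ δ) (hδ1 : δ ≤ 1)
    (hRM : ‖trigExtension (R 𝔎 γ β σ t s) x‖ ≤ M)
    (hTM : ‖trigExtension (fun k => ∑ ρ ∈ J s, a k ρ ^ 2) x‖ ≤ M ^ 2)
    (hQM : ∑ ρ ∈ J s, ‖trigExtension (fun k => a k ρ) x‖ ^ 2 ≤ M ^ 2)
    (hjump : ∀ ρ ∈ J s, ‖trigExtension (fun k => a k ρ) x‖ ≤ δ * M)
    (hTQ : ‖trigExtension (fun k => ∑ ρ ∈ J s, a k ρ ^ 2) x -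
      ∑ ρ ∈ J s, trigExtension (fun k => a k ρ) x ^ 2‖ ≤ δ * M ^ 2) (n : ℕ) :
    ‖wickError 𝔎 γ β σ t (n + 1) s x‖ ≤ (n + 1).factorial * (4 ^ (n + 1) * (δ * M ^ (n + 1))) := by
  set ax : ℝ≥0 → ℂ := fun s => trigExtension (fun k => a k s) x with hax
  set bx : ℝ≥0 → ℂ := fun s => trigExtension (fun k => b k s) x with hbx
  have hX : JumpPath J (fun s => trigExtension (R 𝔎 γ β σ t s) x) ax bx :=
    trigExtension_jumpPath hR x
  -- Division by n! removes the factor n from the recursion, which becomes dI_{n+1} = I_n(r⁻) dR.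
  set I : ℕ → ℝ≥0 → ℂ := fun n s =>
    if n = 0 then 1 else ((n.factorial : ℂ))⁻¹ * wick 𝔎 γ β σ t n s x with hI
  set L : ℕ → ℝ≥0 → ℂ := fun n s =>
    if n = 0 then 1 else ((n.factorial : ℂ))⁻¹ *
      Function.leftLim (fun s => wick 𝔎 γ β σ t n s x) s with hL
  have hI1 : JumpPath J (I 1) (fun s => L 0 s * ax s) fun s => I 0 s * bx s := by
    convert hX using 1
    · ext s
      simp [hI, wick_one]
    · ext s
      simp [hL]
    · ext s
      simp [hI]
  have hfac : ∀ n : ℕ, (((n + 2).factorial : ℂ))⁻¹ * ((n + 2 : ℕ) : ℂ) =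
      (((n + 1).factorial : ℂ))⁻¹ := by
    intro n
    rw [Nat.factorial_succ (n + 1)]
    have h1 : ((n + 1).factorial : ℂ) ≠ 0 := by exact_mod_cast Nat.factorial_ne_zero _
    have h2 : ((n + 2 : ℕ) : ℂ) ≠ 0 := by exact_mod_cast (by omega : n + 2 ≠ 0)
    rw [Nat.cast_mul, mul_inv, mul_right_comm, inv_mul_cancel₀ h2, one_mul]
  have hpaths : ∀ n, JumpPath J (I (n + 1)) (fun s => L n s * ax s) fun s => I n s * bx s := by
    intro n
    cases n with
    | zero => exact hI1
    | succ n =>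
      obtain ⟨A, B, h1, h2⟩ := wick_jumpPath hJ hR x n
      have h3 := h2.const_mul ((((n + 2).factorial : ℂ))⁻¹)
      convert h3 using 1
      · ext s
        simp [hI]
      · ext s
        simp only [hL, Nat.succ_ne_zero, if_false]
        rw [h1.leftLim_eq hJ, ← mul_assoc, ← hfac n]
        simp only [hax]
        ring
      · ext s
        simp only [hI, Nat.succ_ne_zero, if_false]
        rw [← hfac n]
        simp only [hbx]
        ring
  have hIL : ∀ n s, I (n + 1) s = L (n + 1) s + L n s * ax s := by
    intro n s
    have h1 := hpaths n
    have hfn : (fun s => wick 𝔎 γ β σ t (n + 1) s x) =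
        fun s => (((n + 1).factorial : ℂ)) * I (n + 1) s := by
      ext s
      have h1 : ((n + 1).factorial : ℂ) ≠ 0 := by exact_mod_cast Nat.factorial_ne_zero _
      simp only [hI, Nat.succ_ne_zero, if_false]
      field_simp
    have h2 := (h1.const_mul (((n + 1).factorial : ℂ))).leftLim_eq hJ s
    have hne : ((n + 1).factorial : ℂ) ≠ 0 := by exact_mod_cast Nat.factorial_ne_zero _
    have h3 : L (n + 1) s = (((n + 1).factorial : ℂ))⁻¹ *
        Function.leftLim (fun s => wick 𝔎 γ β σ t (n + 1) s x) s := by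
      simp only [hL, Nat.succ_ne_zero, if_false]
    rw [h3, hfn, h2]
    field_simp
    ring
  -- The first power sum is R itself, including its drift; the others are pure jump sums.
  set p : ℕ → ℝ≥0 → ℂ := fun k s =>
    if k = 0 then trigExtension (R 𝔎 γ β σ t s) x else ∑ ρ ∈ J s, ax ρ ^ (k + 1) with hp
  set d : ℕ → ℝ≥0 → ℂ := fun k s => if k = 0 then bx s else 0 with hd
  have hpp : ∀ k, JumpPath J (p k) (fun s => ax s ^ (k + 1)) (d k) := by
    intro k
    cases k with
    | zero =>
      convert hX using 1
      · ext s
        simp [hp]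
      · ext s
        rw [zero_add, pow_one]
      · ext s
        simp [hd]
    | succ k =>
      refine ⟨fun s => ?_, fun ρ hρ => ?_, fun s => ?_, fun T => ⟨0, fun u _ => ?_⟩⟩
      · simp [hp, hd]
      · rw [hX.supp ρ hρ, zero_pow (Nat.succ_ne_zero _)]
      · simp only [hd, Nat.succ_ne_zero, if_false]
        exact tendsto_const_nhds
      · simp [hd]
  have hnewton := fun n => (newton_identity hJ (I := I) (L := L) (p := p) (d := d)
    (fun s => if_pos rfl) (fun s => if_pos rfl) hpaths hIL hpp (fun s => if_pos rfl)
    (fun k s => if_neg (Nat.succ_ne_zero k)) n s).1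
  set X := trigExtension (R 𝔎 γ β σ t s) x with hXd
  set T := trigExtension (fun k => ∑ ρ ∈ J s, a k ρ ^ 2) x with hT
  set H : ℕ → ℂ := fun n => ((n.factorial : ℂ))⁻¹ * MvPolynomial.eval ![X, T] (hermite n) with hH
  have hbr : (fun k => bracket (fun r => R 𝔎 γ β σ t r k) s) = fun k => ∑ ρ ∈ J s, a k ρ ^ 2 := by
    ext k
    exact (hR k).bracket hJ s
  have hjump2 : ∀ k, 2 ≤ k + 1 → ‖p k s‖ ≤ ∑ ρ ∈ J s, ‖ax ρ‖ ^ (k + 1) := by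
    intro k hk
    simp only [hp, if_neg (by omega : k ≠ 0)]
    refine (norm_sum_le _ _).trans (le_of_eq (Finset.sum_congr rfl fun ρ _ => norm_pow _ _))
  -- Each power beyond the second costs one factor of the largest jump, and hence gains δ.
  have hpow : ∀ k, ∑ ρ ∈ J s, ‖ax ρ‖ ^ (k + 2) ≤ (δ * M) ^ k * M ^ 2 := by
    intro k
    calc ∑ ρ ∈ J s, ‖ax ρ‖ ^ (k + 2) ≤ ∑ ρ ∈ J s, (δ * M) ^ k * ‖ax ρ‖ ^ 2 := by
          refine Finset.sum_le_sum fun ρ hρ => ?_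
          rw [pow_add]
          exact mul_le_mul_of_nonneg_right
            (pow_le_pow_left₀ (norm_nonneg _) (hjump ρ hρ) k) (by positivity)
      _ ≤ (δ * M) ^ k * M ^ 2 := by
          rw [← Finset.mul_sum]
          exact mul_le_mul_of_nonneg_left hQM (by positivity)
  have hmain := norm_hermite_sub_le (H := H) (I := fun n => I n s) (p := fun k => p k s) (T := T)
    (M := M) (δ := δ) hM (if_pos rfl) (by simp [hH, hermite]) (by simp [hH, hermite, hp, hXd])
    hnewton (fun n => ?_) (fun k => ?_) hTM hδ ?_ (fun k hk => ?_) (n + 1)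
  · have hne : (((n + 1).factorial : ℕ) : ℂ) ≠ 0 := by exact_mod_cast Nat.factorial_ne_zero _
    have hexp : wickError 𝔎 γ β σ t (n + 1) s x =
        ((n + 1).factorial : ℂ) * (H (n + 1) - I (n + 1) s) := by
      simp only [wickError, hbr, hH, hI, Nat.succ_ne_zero, if_false]
      field_simp
      rfl
    rw [hexp, norm_mul, Complex.norm_natCast]
    exact mul_le_mul_of_nonneg_left hmain (by positivity)
  · have h1 := eval_hermite_add_two ![X, T] n
    simp only [Matrix.cons_val_zero, Matrix.cons_val_one] at h1
    have hn1 : ((n.factorial : ℕ) : ℂ) ≠ 0 := by exact_mod_cast Nat.factorial_ne_zero _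
    have hn2 : ((n : ℂ) + 1) ≠ 0 := by exact_mod_cast (by omega : n + 1 ≠ 0)
    have hn3 : ((n : ℂ) + 2) ≠ 0 := by exact_mod_cast (by omega : n + 2 ≠ 0)
    have hn4 : ((n : ℂ) + 1 + 1) ≠ 0 := by exact_mod_cast (by omega : n + 1 + 1 ≠ 0)
    simp only [hH, hp, if_true, h1, Nat.factorial_succ]
    push_cast
    field_simp
    ring
  · cases k with
    | zero => simpa [hp] using hRM
    | succ k =>
      refine (hjump2 (k + 1) (by omega)).trans ((hpow k).trans ?_)
      calc (δ * M) ^ k * M ^ 2 ≤ (1 * M) ^ k * M ^ 2 := by gcongr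
        _ = M ^ (k + 1 + 1) := by ring
  · simpa [hp] using hTQ
  · obtain ⟨m, rfl⟩ : ∃ m, k = m + 2 := ⟨k - 2, by omega⟩
    refine (hjump2 (m + 2) (by omega)).trans ((hpow (m + 1)).trans ?_)
    calc (δ * M) ^ (m + 1) * M ^ 2 = δ * δ ^ m * M ^ (m + 2 + 1) := by ring
      _ ≤ δ * 1 * M ^ (m + 2 + 1) := by
          gcongr
          exact pow_le_one₀ hδ hδ1
      _ = _ := by ring

end Wick

/-! ### Compensators of the functionals of the jumps -/

section Compensator

variable {S I : Type*} [Finite S] [Fintype I] {x : ℝ≥0 → S} {φ : S → I → S} {q : S → I → ℝ}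

theorem IsStepPath.intervalIntegrable_comp (hx : IsStepPath x) {c : ℝ≥0 → S → ℝ}
    (hc : ∀ η, Continuous fun r => c r η) (y z : ℝ) :
    IntervalIntegrable (fun u : ℝ => c u.toNNReal (x u.toNNReal)) volume y z := by
  have := Fintype.ofFinite S
  obtain ⟨K, hK⟩ := exists_bound_of_continuous (W := fun r η _ => c r η) (fun η _ => hc η)
    (max y z).toNNReal
  have hm : Measurable fun r => ((c r (x r) : ℝ) : ℂ) := by
    refine measurable_of_right_continuous fun s => ?_
    have h1 : Tendsto (fun r => ((c r (x s) : ℝ) : ℂ)) (𝓝[>] s) (𝓝 ((c s (x s) : ℝ) : ℂ)) :=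
      ((Complex.continuous_ofReal.comp (hc (x s))).tendsto s).mono_left nhdsWithin_le_nhds
    refine h1.congr' ?_
    filter_upwards [hx.rc s] with r hr
    rw [hr]
  have h2 := intervalIntegrable_of_bdd hm (T := (max y z).toNNReal) (C := K)
    (fun u hu => by rw [Complex.norm_real]; exact hK u hu _ (x u))
    ((le_max_left y z).trans (Real.le_coe_toNNReal _))
    ((le_max_right y z).trans (Real.le_coe_toNNReal _))
  exact ⟨h2.1.re, h2.2.re⟩

theorem continuous_expRate {S : Type*} {φ : S → I → S} {q : S → I → ℝ} {W : ℝ≥0 → S → S → ℝ} (hW : ∀ η η', Continuous fun r => W r η η')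
    (η : S) : Continuous fun r => expRate φ q W r η := by
  unfold expRate
  exact continuous_finsetSum _ fun i _ => continuous_const.mul
    ((Real.continuous_exp.comp (hW _ _)).sub continuous_const)

/-- The compensator is replaced by a part v that depends on the state and a deterministic bound g.
For the projections of R the part v reproduces the drift of R; for nonnegative functionals it is
zero. -/
theorem sum_sub_integral_le (hx : IsStepPath x) {W : ℝ≥0 → S → S → ℝ}
    (hW : ∀ η η', Continuous fun r => W r η η') {v : ℝ≥0 → S → ℝ}
    (hv : ∀ η, Continuous fun r => v r η) {g : ℝ → ℝ} (hg : Continuous g) {a d : ℝ≥0}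
    (hle : ∀ r ≤ a + d, ∀ η, expRate φ q W r η ≤ v r η + g r) :
    ∑ ρ ∈ jumps x (a + d) with a < ρ, W ρ (leftVal x ρ) (x ρ) -
        ∫ u in (a : ℝ)..((a + d : ℝ≥0) : ℝ), v u.toNNReal (x u.toNNReal) ≤
      expFunctional φ q W a d x + ∫ u in (a : ℝ)..((a + d : ℝ≥0) : ℝ), g u := by
  have h1 := hx.intervalIntegrable_comp hv a ((a + d : ℝ≥0) : ℝ)
  have h2 := hx.intervalIntegrable_comp (continuous_expRate (φ := φ) (q := q) hW) a
    ((a + d : ℝ≥0) : ℝ)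
  have had : (a : ℝ) ≤ ((a + d : ℝ≥0) : ℝ) := by exact_mod_cast le_self_add
  have h3 : ∫ u in (a : ℝ)..((a + d : ℝ≥0) : ℝ), expRate φ q W u.toNNReal (x u.toNNReal) ≤
      ∫ u in (a : ℝ)..((a + d : ℝ≥0) : ℝ), (v u.toNNReal (x u.toNNReal) + g u) := by
    refine intervalIntegral.integral_mono_on had h2 (h1.add (hg.intervalIntegrable _ _))
      fun u hu => ?_
    have hu0 : 0 ≤ u := a.coe_nonneg.trans hu.1
    have h4 := hle u.toNNReal (Real.toNNReal_le_iff_le_coe.2 hu.2) (x u.toNNReal)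
    rwa [Real.coe_toNNReal u hu0] at h4
  rw [intervalIntegral.integral_add h1 (hg.intervalIntegrable _ _)] at h3
  rw [expFunctional]
  linarith

end Compensator

theorem exp_sub_one_le_two_mul {w : ℝ} (h0 : 0 ≤ w) (h1 : w ≤ 1) : Real.exp w - 1 ≤ 2 * w := by
  have h := Real.abs_exp_sub_one_le (x := w) (by rwa [abs_of_nonneg h0])
  rw [abs_of_nonneg h0] at h
  exact (le_abs_self _).trans h

theorem exp_sub_one_le_add_sq {w : ℝ} (h1 : |w| ≤ 1) : Real.exp w - 1 ≤ w + w ^ 2 := by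
  have h := (le_abs_self _).trans (Real.abs_exp_sub_one_sub_id_le h1)
  linarith

/-! ### The scaled functionals of the jumps of R and bounds on their compensators -/

section Functionals

variable {𝔎 : EuclideanSpace ℝ (Fin 2) → ℝ} {C c γ β : ℝ} {t : ℝ≥0}
  {x : ℝ≥0 → Config (size γ)}

/-- The inverse of the order of magnitude of the jumps of `γ⁻¹ R`. -/
def jumpScale (C γ : ℝ) : ℝ := (32 * C * logSize (size γ) ^ 2)⁻¹

theorem continuous_jumpSize (B : Finset (Fin 2 → ℤ)) (t : ℝ≥0) (k : Lattice (size γ))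
    (η η' : Config (size γ)) :
    Continuous fun r : ℝ≥0 => jumpSize 𝔎 γ B ((t : ℝ) - r) k η η' := by
  unfold jumpSize green greenHat
  fun_prop

namespace KernelBounds

theorem jumpScale_pos (h : KernelBounds 𝔎 C c γ) : 0 < jumpScale C γ := by
  have hC := h.one_le
  have hl := one_le_logSize (size γ)
  rw [jumpScale]
  positivity

theorem jumpScale_mul_norm_le (h : KernelBounds 𝔎 C c γ) {B : Finset (Fin 2 → ℤ)}
    (hB : B ⊆ freqBox (size γ)) {τ : ℝ} (hτ : 0 ≤ τ) (k : Lattice (size γ))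
    (η : Config (size γ)) (j : Lattice (size γ)) :
    jumpScale C γ * ‖jumpSize 𝔎 γ B τ k η (flip η j)‖ ≤ γ := by
  have hC := h.one_le
  have hl := one_le_logSize (size γ)
  refine (mul_le_mul_of_nonneg_left (h.norm_jumpSize_flip_le hB hτ k η j)
    h.jumpScale_pos.le).trans (le_of_eq ?_)
  rw [jumpScale]
  field_simp

theorem jumpScale_mul_logSize_le (h : KernelBounds 𝔎 C c γ) :
    jumpScale C γ * (C * logSize (size γ)) ≤ 1 / 32 := by
  have hC := h.one_le
  have hl := one_le_logSize (size γ)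
  rw [jumpScale, inv_mul_le_iff₀ (by positivity)]
  have h1 : C * logSize (size γ) ≤ C * logSize (size γ) ^ 2 := by
    gcongr
    exact le_self_pow₀ hl two_ne_zero
  linarith

theorem jumpScale_sq_mul_le (h : KernelBounds 𝔎 C c γ) :
    jumpScale C γ ^ 2 * (C ^ 2 * logSize (size γ) ^ 2) ≤ 1 / 1024 := by
  have h1 := h.jumpScale_mul_logSize_le
  have h0 := h.jumpScale_pos
  have hC := h.one_le
  have hl := one_le_logSize (size γ)
  calc jumpScale C γ ^ 2 * (C ^ 2 * logSize (size γ) ^ 2)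
      = (jumpScale C γ * (C * logSize (size γ))) ^ 2 := by ring
    _ ≤ (1 / 32) ^ 2 := by gcongr
    _ = _ := by norm_num

/-- The bound for the compensators of the functionals. -/
def _root_.IsingKac.compBound (C c : ℝ) (t : ℝ≥0) : ℝ := t + 20 * C * c⁻¹

theorem compBound_nonneg (h : KernelBounds 𝔎 C c γ) (t : ℝ≥0) : 0 ≤ compBound C c t := by
  have hC := h.one_le
  have hc := h.c_pos
  rw [compBound]
  positivity

/-- The squared scale cancels the logarithm in the time integral of the Green function, so the
compensators are bounded uniformly in γ. -/
theorem integral_jumpScale_sq_le (h : KernelBounds 𝔎 C c γ) {s : ℝ≥0} (hst : s ≤ t) :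
    ∫ r in (0 : ℝ)..s, jumpScale C γ ^ 2 *
      (4 * ∑ w ∈ freqBox (size γ), ‖greenHat 𝔎 γ (t - r) w‖ ^ 2) ≤ compBound C c t := by
  have hD := h.compBound_nonneg t
  have h1 := h.integral_sum_norm_greenHat_sq_le (s := s) (t := t) s.coe_nonneg
    (by exact_mod_cast hst)
  have h0 := h.jumpScale_pos
  have hC := h.one_le
  have hl := one_le_logSize (size γ)
  have h2 := h.jumpScale_sq_mul_le
  rw [intervalIntegral.integral_const_mul, intervalIntegral.integral_const_mul]
  have h3 : jumpScale C γ ^ 2 * logSize (size γ) ^ 2 ≤ 1 / 1024 := by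
    refine le_trans ?_ h2
    gcongr
    exact le_mul_of_one_le_left (by positivity) (one_le_pow₀ hC)
  calc _ ≤ jumpScale C γ ^ 2 * (4 * (compBound C c t * logSize (size γ) ^ 2)) := by
        gcongr
        exact h1
    _ = 4 * compBound C c t * (jumpScale C γ ^ 2 * logSize (size γ) ^ 2) := by ring
    _ ≤ 4 * compBound C c t * (1 / 1024) := by gcongr
    _ ≤ _ := by linarith

theorem sum_le_expFunctional (h : KernelBounds 𝔎 C c γ) (hx : IsStepPath x)
    {W : ℝ≥0 → Config (size γ) → Config (size γ) → ℝ}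
    (hW : ∀ η η', Continuous fun r => W r η η') {a d : ℝ≥0}
    (hW0 : ∀ r ≤ a + d, ∀ η j, 0 ≤ W r η (flip η j)) (hW1 : ∀ r ≤ a + d, ∀ η j,
      W r η (flip η j) ≤ 1) {g : ℝ → ℝ} (hg : Continuous g)
    (hle : ∀ r ≤ a + d, ∀ η, 2 * (γ ^ 2)⁻¹ * ∑ j, W r η (flip η j) ≤ g r) :
    ∑ ρ ∈ jumps x (a + d) with a < ρ, W ρ (leftVal x ρ) (x ρ) ≤
      expFunctional flip (macroRate 𝔎 γ β) W a d x +
        ∫ u in (a : ℝ)..((a + d : ℝ≥0) : ℝ), g u := by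
  have hγ := h.pos
  have h1 := sum_sub_integral_le (φ := flip) (q := macroRate 𝔎 γ β) hx hW (v := fun _ _ => 0)
    (fun _ => continuous_const) hg (a := a) (d := d) fun r hr η => ?_
  · simpa using h1
  rw [zero_add]
  refine le_trans ?_ (hle r hr η)
  rw [expRate, Finset.mul_sum]
  refine Finset.sum_le_sum fun j _ => ?_
  calc macroRate 𝔎 γ β η j * (Real.exp (W r η (flip η j)) - 1)
      ≤ (γ ^ 2)⁻¹ * (2 * W r η (flip η j)) := by
        refine mul_le_mul (macroRate_le η j) (exp_sub_one_le_two_mul (hW0 r hr η j) (hW1 r hr η j))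
          ?_ (by positivity)
        linarith [Real.one_le_exp (hW0 r hr η j)]
    _ = _ := by ring

end KernelBounds

/-- The scaled jumps of the projection of `ζ R(·, k)` to the real axis. -/
def linearJump (𝔎 : EuclideanSpace ℝ (Fin 2) → ℝ) (C γ : ℝ) (t : ℝ≥0) (ζ : ℂ)
    (k : Lattice (size γ)) (r : ℝ≥0) (η ξ : Config (size γ)) : ℝ :=
  jumpScale C γ * (ζ * jumpSize 𝔎 γ (freqBox (size γ)) ((t : ℝ) - r) k η ξ).re

/-- The scaled modulus of the jumps of `R(·, k)`. -/
def normJump (𝔎 : EuclideanSpace ℝ (Fin 2) → ℝ) (C γ : ℝ) (t : ℝ≥0)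
    (k : Lattice (size γ)) (r : ℝ≥0) (η ξ : Config (size γ)) : ℝ :=
  jumpScale C γ * ‖jumpSize 𝔎 γ (freqBox (size γ)) ((t : ℝ) - r) k η ξ‖

/-- The scaled product of the high frequency part of the jumps at `k` and of the part with
frequencies in `B` of the jumps at `k'`. -/
def highJump (𝔎 : EuclideanSpace ℝ (Fin 2) → ℝ) (C γ : ℝ) (t : ℝ≥0) (B : Finset (Fin 2 → ℤ))
    (k k' : Lattice (size γ)) (r : ℝ≥0) (η ξ : Config (size γ)) : ℝ :=
  jumpScale C γ ^ 2 * γ⁻¹ * (‖jumpSize 𝔎 γ (highBox (size γ)) ((t : ℝ) - r) k η ξ‖ *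
    ‖jumpSize 𝔎 γ B ((t : ℝ) - r) k' η ξ‖)

theorem continuous_linearJump (ζ : ℂ) (k : Lattice (size γ)) (η η' : Config (size γ)) :
    Continuous fun r => linearJump 𝔎 C γ t ζ k r η η' :=
  continuous_const.mul (Complex.continuous_re.comp
    (continuous_const.mul (continuous_jumpSize _ t k η η')))

theorem continuous_normJump (k : Lattice (size γ)) (η η' : Config (size γ)) :
    Continuous fun r => normJump 𝔎 C γ t k r η η' :=
  continuous_const.mul (continuous_jumpSize _ t k η η').norm

theorem continuous_highJump (B : Finset (Fin 2 → ℤ)) (k k' : Lattice (size γ))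
    (η η' : Config (size γ)) : Continuous fun r => highJump 𝔎 C γ t B k k' r η η' :=
  continuous_const.mul ((continuous_jumpSize _ t k η η').norm.mul
    (continuous_jumpSize _ t k' η η').norm)

namespace KernelBounds

/-- In e^w - 1 ≤ w + w² the linear term of the compensator matches the drift of R exactly. Only the
quadratic term remains, bounded through the sum of the squared jumps over all flips. -/
theorem linear_le_expFunctional (h : KernelBounds 𝔎 C c γ) {σ : ℝ≥0 → Config (size γ)}
    (hσ : IsStepPath σ) {s : ℝ≥0} (hst : s ≤ t) {ζ : ℂ} (hζ : ‖ζ‖ ≤ 1) (k : Lattice (size γ)) :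
    jumpScale C γ * (ζ * R 𝔎 γ β σ t s k).re ≤
      expFunctional flip (macroRate 𝔎 γ β) (linearJump 𝔎 C γ t ζ k) 0 s (macroPath γ σ) +
        compBound C c t := by
  have hγ := h.pos
  have hlam := h.jumpScale_pos
  set x := macroPath γ σ with hxd
  have hx : IsStepPath x := isStepPath_macroPath hγ hσ
  set W := linearJump 𝔎 C γ t ζ k with hWd
  -- Minus the drift of the scaled projection of R, as a function of the state.
  set v : ℝ≥0 → Config (size γ) → ℝ := fun r η =>
    ∑ j, macroRate 𝔎 γ β η j * W r η (flip η j) with hv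
  have hWle : ∀ r ≤ t, ∀ η j, |W r η (flip η j)| ≤
      jumpScale C γ * ‖jumpSize 𝔎 γ (freqBox (size γ)) ((t : ℝ) - r) k η (flip η j)‖ := by
    intro r hr η j
    simp only [hWd, linearJump]
    rw [abs_mul, abs_of_pos hlam]
    refine mul_le_mul_of_nonneg_left ((Complex.abs_re_le_norm _).trans ?_) hlam.le
    rw [norm_mul]
    exact mul_le_of_le_one_left (norm_nonneg _) hζ
  have h1 := sum_sub_integral_le (φ := flip) (q := macroRate 𝔎 γ β) hx
    (continuous_linearJump (C := C) (t := t) (𝔎 := 𝔎) ζ k) (v := v)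
    (fun η => continuous_finsetSum _ fun j _ =>
      continuous_const.mul (continuous_linearJump ζ k _ _))
    (g := fun r => jumpScale C γ ^ 2 *
      (4 * ∑ w ∈ freqBox (size γ), ‖greenHat 𝔎 γ (t - r) w‖ ^ 2))
    (by unfold greenHat; fun_prop) (a := 0) (d := s) fun r hr η => ?_
  · have h2 := h.integral_jumpScale_sq_le hst
    have h3 := (R_jumpPath (𝔎 := 𝔎) (β := β) hγ hσ t k).const_mul ((jumpScale C γ : ℂ) * ζ)
    have h4 : jumpScale C γ * (ζ * R 𝔎 γ β σ t s k).re =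
        ((jumpScale C γ : ℂ) * ζ * R 𝔎 γ β σ t s k).re := by
      rw [mul_assoc, Complex.re_ofReal_mul]
    have h5 := congrArg Complex.re (h3.eq s)
    have h6 : ∀ z : ℂ, ((jumpScale C γ : ℂ) * ζ * z).re = jumpScale C γ * (ζ * z).re := fun z => by
      rw [mul_assoc, Complex.re_ofReal_mul]
    have h7 := Complex.reCLM.intervalIntegral_comp_comm (h3.intervalIntegrable 0 s)
    simp only [Complex.reCLM_apply] at h7
    rw [Complex.add_re, Complex.re_sum, ← h7] at h5
    have h8 : ∀ u : ℝ≥0, ((jumpScale C γ : ℂ) * ζ * -∑ j, (macroRate 𝔎 γ β (x u) j : ℂ) *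
        jumpSize 𝔎 γ (freqBox (size γ)) ((t : ℝ) - u) k (x u) (flip (x u) j)).re = -v u (x u) := by
      intro u
      rw [h6, mul_neg, Finset.mul_sum, Complex.neg_re, Complex.re_sum, mul_neg, Finset.mul_sum]
      simp only [hv, hWd, linearJump]
      congr 1
      refine Finset.sum_congr rfl fun j _ => ?_
      rw [mul_left_comm, Complex.re_ofReal_mul, mul_left_comm]
    simp only [← hxd, h8] at h5
    rw [h4, h5]
    simp only [h6, intervalIntegral.integral_neg, zero_add, NNReal.coe_zero] at h1 ⊢
    have h9 : (jumps x s).filter (fun ρ => 0 < ρ) = jumps x s :=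
      Finset.filter_true_of_mem fun ρ hρ => (hx.isJumpTimes.mem s ρ hρ).1
    rw [h9] at h1
    refine le_trans (le_of_eq ?_) (h1.trans (add_le_add le_rfl h2))
    rw [sub_eq_add_neg]
    rfl
  · have hr' : r ≤ t := (zero_add s ▸ hr).trans hst
    have hr0 : 0 ≤ (t : ℝ) - r := sub_nonneg.2 (by exact_mod_cast hr')
    have hsq := h.sum_norm_jumpSize_flip_sq_le (Finset.Subset.refl (freqBox (size γ)))
      ((t : ℝ) - r) k η
    have hterm : ∀ j, macroRate 𝔎 γ β η j * (Real.exp (W r η (flip η j)) - 1) ≤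
        macroRate 𝔎 γ β η j * W r η (flip η j) + (γ ^ 2)⁻¹ * (jumpScale C γ ^ 2 *
          ‖jumpSize 𝔎 γ (freqBox (size γ)) ((t : ℝ) - r) k η (flip η j)‖ ^ 2) := by
      intro j
      have e1 := hWle r hr' η j
      have e2 := e1.trans (h.jumpScale_mul_norm_le (Finset.Subset.refl _) hr0 k η j)
      have e3 := exp_sub_one_le_add_sq (e2.trans (h.le.trans (by norm_num)))
      have e4 : W r η (flip η j) ^ 2 ≤ jumpScale C γ ^ 2 *
          ‖jumpSize 𝔎 γ (freqBox (size γ)) ((t : ℝ) - r) k η (flip η j)‖ ^ 2 := by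
        rw [← mul_pow, ← sq_abs]
        gcongr
      have e5 : macroRate 𝔎 γ β η j * W r η (flip η j) ^ 2 ≤ (γ ^ 2)⁻¹ * (jumpScale C γ ^ 2 *
          ‖jumpSize 𝔎 γ (freqBox (size γ)) ((t : ℝ) - r) k η (flip η j)‖ ^ 2) :=
        mul_le_mul (macroRate_le η j) e4 (sq_nonneg _) (by positivity)
      have e6 := mul_le_mul_of_nonneg_left e3 (macroRate_nonneg (𝔎 := 𝔎) (γ := γ) (β := β) η j)
      rw [mul_add] at e6
      linarith
    rw [expRate]
    refine (Finset.sum_le_sum fun j _ => hterm j).trans ?_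
    rw [Finset.sum_add_distrib, ← Finset.mul_sum, ← Finset.mul_sum]
    refine add_le_add le_rfl ?_
    calc _ ≤ (γ ^ 2)⁻¹ * (jumpScale C γ ^ 2 * (4 * γ ^ 2 *
          ∑ w ∈ freqBox (size γ), ‖greenHat 𝔎 γ (t - r) w‖ ^ 2)) := by gcongr
      _ = _ := by field_simp

theorem sq_le_expFunctional (h : KernelBounds 𝔎 C c γ) (hx : IsStepPath x)
    (k : Lattice (size γ)) :
    ∑ ρ ∈ jumps x t, normJump 𝔎 C γ t k ρ (leftVal x ρ) (x ρ) ^ 2 ≤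
      expFunctional flip (macroRate 𝔎 γ β) (fun r η η' => normJump 𝔎 C γ t k r η η' ^ 2) 0 t x +
        2 * compBound C c t := by
  have hγ := h.pos
  have hlam := h.jumpScale_pos
  have hγ1 : γ ≤ 1 := h.le.trans (by norm_num)
  have h1 := h.sum_le_expFunctional (β := β) hx (a := 0) (d := t)
    (W := fun r η η' => normJump 𝔎 C γ t k r η η' ^ 2)
    (fun η η' => (continuous_normJump k η η').pow 2) (fun _ _ _ _ => sq_nonneg _)
    (fun r hr η j => ?_) (g := fun r => 2 * (jumpScale C γ ^ 2 *
      (4 * ∑ w ∈ freqBox (size γ), ‖greenHat 𝔎 γ (t - r) w‖ ^ 2)))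
    (by unfold greenHat; fun_prop) (fun r hr η => ?_)
  · have h2 := h.integral_jumpScale_sq_le (t := t) le_rfl
    rw [intervalIntegral.integral_const_mul] at h1
    simp only [zero_add, NNReal.coe_zero] at h1
    have h9 : (jumps x t).filter (fun ρ => 0 < ρ) = jumps x t :=
      Finset.filter_true_of_mem fun ρ hρ => (hx.isJumpTimes.mem t ρ hρ).1
    rw [h9] at h1
    linarith
  · have hr0 : 0 ≤ (t : ℝ) - r := sub_nonneg.2 (by exact_mod_cast zero_add t ▸ hr)
    have e1 := h.jumpScale_mul_norm_le (Finset.Subset.refl _) hr0 k η j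
    refine pow_le_one₀ (mul_nonneg hlam.le (norm_nonneg _)) (e1.trans hγ1)
  · have hsq := h.sum_norm_jumpSize_flip_sq_le (Finset.Subset.refl (freqBox (size γ)))
      ((t : ℝ) - r) k η
    simp only [normJump, mul_pow]
    rw [← Finset.mul_sum]
    calc _ ≤ 2 * (γ ^ 2)⁻¹ * (jumpScale C γ ^ 2 * (4 * γ ^ 2 *
          ∑ w ∈ freqBox (size γ), ‖greenHat 𝔎 γ (t - r) w‖ ^ 2)) := by gcongr
      _ = _ := by field_simp

/-- The jump rate γ⁻² is cancelled by the time integral of exp(-cτ/γ²), and the remaining factor γ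
by the γ⁻¹ built into `highJump`. Hence the compensator stays bounded and the unscaled sum is
smaller by γ. -/
theorem high_le_expFunctional (h : KernelBounds 𝔎 C c γ) (hx : IsStepPath x)
    {B : Finset (Fin 2 → ℤ)} (hB : B ⊆ freqBox (size γ)) (k k' : Lattice (size γ)) :
    ∑ ρ ∈ jumps x t, highJump 𝔎 C γ t B k k' ρ (leftVal x ρ) (x ρ) ≤
      expFunctional flip (macroRate 𝔎 γ β) (highJump 𝔎 C γ t B k k') 0 t x + compBound C c t := by
  have hγ := h.pos
  have hC := h.one_le
  have hc := h.c_pos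
  have hl := one_le_logSize (size γ)
  have hlam := h.jumpScale_pos
  have hγ1 : γ ≤ 1 := h.le.trans (by norm_num)
  have h1 := h.sum_le_expFunctional (β := β) hx (a := 0) (d := t)
    (W := highJump 𝔎 C γ t B k k') (continuous_highJump B k k')
    (fun _ _ _ _ => by rw [highJump]; positivity)
    (fun r hr η j => ?_) (g := fun r => 2 * (γ ^ 2)⁻¹ * (jumpScale C γ ^ 2 * γ⁻¹ *
      (384 * C ^ 2 * γ * logSize (size γ) * Real.exp (-(c * (γ ^ 2)⁻¹ * (t - r))))))
    (by fun_prop) (fun r hr η => ?_)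
  · have h2 := integral_exp_decay_le (b := c * (γ ^ 2)⁻¹) (s := t) (t := t) (by positivity) le_rfl
    simp only [intervalIntegral.integral_const_mul] at h1
    simp only [zero_add, NNReal.coe_zero] at h1
    have h9 : (jumps x t).filter (fun ρ => 0 < ρ) = jumps x t :=
      Finset.filter_true_of_mem fun ρ hρ => (hx.isJumpTimes.mem t ρ hρ).1
    rw [h9] at h1
    refine h1.trans (add_le_add le_rfl ?_)
    have h3 := h.jumpScale_sq_mul_le
    calc _ ≤ 2 * (γ ^ 2)⁻¹ * (jumpScale C γ ^ 2 * γ⁻¹ *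
          (384 * C ^ 2 * γ * logSize (size γ) * (c * (γ ^ 2)⁻¹)⁻¹)) := by gcongr
      _ = 768 * c⁻¹ * (jumpScale C γ ^ 2 * (C ^ 2 * logSize (size γ))) := by
          field_simp
          ring
      _ ≤ 768 * c⁻¹ * (jumpScale C γ ^ 2 * (C ^ 2 * logSize (size γ) ^ 2)) := by
          gcongr
          exact le_self_pow₀ hl two_ne_zero
      _ ≤ 768 * c⁻¹ * (1 / 1024) := by gcongr
      _ ≤ compBound C c t := by
          have : 0 ≤ (t : ℝ) := t.coe_nonneg
          have e1 : c⁻¹ ≤ C * c⁻¹ := le_mul_of_one_le_left (by positivity) hC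
          have e2 : 0 < c⁻¹ := by positivity
          rw [compBound]
          nlinarith
  · have hr0 : 0 ≤ (t : ℝ) - r := sub_nonneg.2 (by exact_mod_cast zero_add t ▸ hr)
    have e1 := h.jumpScale_mul_norm_le (highBox_subset _) hr0 k η j
    have e2 := h.jumpScale_mul_norm_le hB hr0 k' η j
    rw [highJump]
    calc _ = γ⁻¹ * ((jumpScale C γ *
          ‖jumpSize 𝔎 γ (highBox (size γ)) ((t : ℝ) - r) k η (flip η j)‖) *
          (jumpScale C γ * ‖jumpSize 𝔎 γ B ((t : ℝ) - r) k' η (flip η j)‖)) := by ring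
      _ ≤ γ⁻¹ * (γ * γ) := by gcongr
      _ = γ := by field_simp
      _ ≤ 1 := hγ1
  · have hr0 : 0 ≤ (t : ℝ) - r := sub_nonneg.2 (by exact_mod_cast zero_add t ▸ hr)
    simp only [highJump]
    rw [← Finset.mul_sum]
    gcongr
    exact h.sum_norm_jumpSize_high_mul_le hB hr0 k k' η

theorem card_lattice_le (h : KernelBounds 𝔎 C c γ) :
    (Fintype.card (Lattice (size γ)) : ℝ) ≤ 9 * (γ ^ 4)⁻¹ := by
  have hγ := h.pos
  have hγ4 := h.le
  rw [card_lattice, ← div_eq_mul_inv, le_div_iff₀ (by positivity)]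
  push_cast
  have hN := size_mul_le hγ
  have h3 : γ ^ 2 * (2 * size γ + 1) ≤ 3 := by nlinarith
  have h4 : (γ ^ 2 * (2 * (size γ : ℝ) + 1)) ^ 2 ≤ 3 ^ 2 := by gcongr
  nlinarith

/-- A crude count: scaled jumps at most 1, at most 9γ⁻⁴ sites, rate γ⁻². It is used only over cells
of length t/n with n ≥ γ⁻⁶. -/
theorem sum_normJump_flip_le (h : KernelBounds 𝔎 C c γ) {r : ℝ≥0} (hr : r ≤ t)
    (k : Lattice (size γ)) (η : Config (size γ)) :
    (γ ^ 2)⁻¹ * ∑ j, normJump 𝔎 C γ t k r η (flip η j) ≤ 9 * (γ ^ 6)⁻¹ := by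
  have hγ := h.pos
  have hγ1 : γ ≤ 1 := h.le.trans (by norm_num)
  have hr0 : 0 ≤ (t : ℝ) - r := sub_nonneg.2 (by exact_mod_cast hr)
  have h1 : ∑ j, normJump 𝔎 C γ t k r η (flip η j) ≤ ∑ _j : Lattice (size γ), (1 : ℝ) :=
    Finset.sum_le_sum fun j _ =>
      (h.jumpScale_mul_norm_le (Finset.Subset.refl _) hr0 k η j).trans hγ1
  rw [Finset.sum_const, Finset.card_univ, nsmul_eq_mul, mul_one] at h1
  calc _ ≤ (γ ^ 2)⁻¹ * (9 * (γ ^ 4)⁻¹) := by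
        gcongr
        exact h1.trans h.card_lattice_le
    _ = _ := by field_simp

theorem window_le_expFunctional (h : KernelBounds 𝔎 C c γ) (hx : IsStepPath x) {a d : ℝ≥0}
    (had : a + d ≤ t) (k : Lattice (size γ)) :
    ∑ ρ ∈ jumps x (a + d) with a < ρ, normJump 𝔎 C γ t k ρ (leftVal x ρ) (x ρ) ≤
      expFunctional flip (macroRate 𝔎 γ β) (normJump 𝔎 C γ t k) a d x +
        18 * (γ ^ 6)⁻¹ * d := by
  have hγ := h.pos
  have hlam := h.jumpScale_pos
  have hγ1 : γ ≤ 1 := h.le.trans (by norm_num)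
  have h1 := h.sum_le_expFunctional (β := β) hx (a := a) (d := d)
    (W := normJump 𝔎 C γ t k) (continuous_normJump k)
    (fun _ _ _ _ => mul_nonneg hlam.le (norm_nonneg _))
    (fun r hr η j => ?_) (g := fun _ => 18 * (γ ^ 6)⁻¹) continuous_const (fun r hr η => ?_)
  · rw [intervalIntegral.integral_const, NNReal.coe_add, add_sub_cancel_left, smul_eq_mul,
      mul_comm (d : ℝ)] at h1
    exact h1
  · have hr0 : 0 ≤ (t : ℝ) - r := sub_nonneg.2 (by exact_mod_cast hr.trans had)
    exact (h.jumpScale_mul_norm_le (Finset.Subset.refl _) hr0 k η j).trans hγ1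
  · have := h.sum_normJump_flip_le (hr.trans had) k η
    linarith

end KernelBounds

end Functionals

/-! ### Trigonometric extension and products -/

section Products

variable {N : ℕ}

/-- The sum over ρ is taken inside the interpolation, so the Lebesgue constant is paid once and not
once per jump. -/
theorem sum_norm_trigExtension_le {ι : Type*} (A : Finset ι) {f : ι → Lattice N → ℂ} {K : ℝ}
    (hK : ∀ k, ∑ ρ ∈ A, ‖f ρ k‖ ≤ K) (x : Fin 2 → ℝ) :
    ∑ ρ ∈ A, ‖trigExtension (f ρ) x‖ ≤ (2 * logSize N) ^ 2 * K := by
  have hK0 : 0 ≤ K := (Finset.sum_nonneg fun _ _ => norm_nonneg _).trans (hK 0)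
  calc ∑ ρ ∈ A, ‖trigExtension (f ρ) x‖
      ≤ ∑ ρ ∈ A, ∑ k, ‖interpKernel N x k‖ * ‖f ρ k‖ := by
        refine Finset.sum_le_sum fun ρ _ => ?_
        rw [trigExtension_eq]
        exact (norm_sum_le _ _).trans (le_of_eq (Finset.sum_congr rfl fun k _ => norm_mul _ _))
    _ = ∑ k, ‖interpKernel N x k‖ * ∑ ρ ∈ A, ‖f ρ k‖ := by
        rw [Finset.sum_comm]
        exact Finset.sum_congr rfl fun k _ => (Finset.mul_sum _ _ _).symm
    _ ≤ ∑ k, ‖interpKernel N x k‖ * K :=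
        Finset.sum_le_sum fun k _ => mul_le_mul_of_nonneg_left (hK k) (norm_nonneg _)
    _ ≤ _ := by
        rw [← Finset.sum_mul]
        exact mul_le_mul_of_nonneg_right (sum_norm_interpKernel_le x) hK0

/-- The linear estimate is applied to each factor in turn with the other one frozen; this requires
control of the sums for all pairs of sites k, k'. -/
theorem sum_norm_trigExtension_mul_le {ι : Type*} (A : Finset ι) {f g : ι → Lattice N → ℂ} {K : ℝ}
    (hK : ∀ k k', ∑ ρ ∈ A, ‖f ρ k‖ * ‖g ρ k'‖ ≤ K) (x : Fin 2 → ℝ) :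
    ∑ ρ ∈ A, ‖trigExtension (f ρ) x‖ * ‖trigExtension (g ρ) x‖ ≤ ((2 * logSize N) ^ 2) ^ 2 * K := by
  have h1 : ∀ k, ∑ ρ ∈ A, ‖f ρ k‖ * ‖trigExtension (g ρ) x‖ ≤ (2 * logSize N) ^ 2 * K := by
    intro k
    have h2 := sum_norm_trigExtension_le A (f := fun ρ k' => (‖f ρ k‖ : ℂ) * g ρ k') (K := K)
      (fun k' => by simpa only [norm_mul, Complex.norm_real, norm_norm] using hK k k') x
    simpa only [trigExtension_const_mul, norm_mul, Complex.norm_real, norm_norm] using h2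
  have h3 := sum_norm_trigExtension_le A
    (f := fun ρ k => (‖trigExtension (g ρ) x‖ : ℂ) * f ρ k) (K := (2 * logSize N) ^ 2 * K)
    (fun k => by
      simpa only [norm_mul, Complex.norm_real, norm_norm, mul_comm] using h1 k) x
  simp only [trigExtension_const_mul, norm_mul, Complex.norm_real, norm_norm] at h3
  calc _ = ∑ ρ ∈ A, ‖trigExtension (g ρ) x‖ * ‖trigExtension (f ρ) x‖ :=
        Finset.sum_congr rfl fun ρ _ => mul_comm _ _
    _ ≤ _ := h3
    _ = _ := by ring

theorem trigExtension_add (f g : Lattice N → ℂ) (x : Fin 2 → ℝ) :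
    trigExtension (fun k => f k + g k) x = trigExtension f x + trigExtension g x := by
  simp only [trigExtension_eq, mul_add, Finset.sum_add_distrib]

theorem lowBox_add {w v : Fin 2 → ℤ} (hw : w ∈ lowBox N) (hv : v ∈ lowBox N) :
    w + v ∈ freqBox N := by
  rw [lowBox, Finset.mem_filter] at hw hv
  rw [mem_freqBox]
  intro i
  have h1 := hw.2 i
  have h2 := hv.2 i
  rw [Finset.mem_Icc, Pi.add_apply, ← abs_le]
  have := abs_add_le (w i) (v i)
  omega

theorem trigExtension_lowBox (d : (Fin 2 → ℤ) → ℂ) (x : Fin 2 → ℝ) :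
    trigExtension (fun k : Lattice N => ∑ w ∈ lowBox N, d w * latticeChar w k) x =
      ∑ w ∈ lowBox N, d w * fourierMode w x := by
  rw [trigExtension_sum]
  refine Finset.sum_congr rfl fun w hw => ?_
  rw [trigExtension_const_mul, trigExtension_latticeChar (lowBox_subset N hw)]

/-- Two frequencies of size at most N/2 add up inside the box, so the square produces no aliasing.
-/
theorem trigExtension_lowBox_sq (d : (Fin 2 → ℤ) → ℂ) (x : Fin 2 → ℝ) :
    trigExtension (fun k : Lattice N => (∑ w ∈ lowBox N, d w * latticeChar w k) ^ 2) x =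
      trigExtension (fun k : Lattice N => ∑ w ∈ lowBox N, d w * latticeChar w k) x ^ 2 := by
  rw [trigExtension_lowBox]
  simp only [sq, Finset.sum_mul_sum]
  rw [trigExtension_sum]
  refine Finset.sum_congr rfl fun w hw => ?_
  rw [trigExtension_sum]
  refine Finset.sum_congr rfl fun v hv => ?_
  have h1 : (fun k : Lattice N => d w * latticeChar w k * (d v * latticeChar v k)) =
      fun k => (d w * d v) * latticeChar (w + v) k := by
    ext k
    rw [latticeChar_add_left]
    ring
  rw [h1, trigExtension_const_mul, trigExtension_latticeChar (lowBox_add hw hv), fourierMode_add]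
  ring

/-- From a² - l² = g a + g l, on the lattice and again after interpolation: each remaining term
contains the part g. -/
theorem trigExtension_sq_sub {a l g : Lattice N → ℂ} (ha : ∀ k, a k = l k + g k) {x : Fin 2 → ℝ}
    (hl : trigExtension (fun k => l k ^ 2) x = trigExtension l x ^ 2) :
    trigExtension (fun k => a k ^ 2) x - trigExtension a x ^ 2 =
      (trigExtension (fun k => g k * a k) x + trigExtension (fun k => g k * l k) x) -
        (trigExtension g x * trigExtension a x + trigExtension g x * trigExtension l x) := by
  have h1 : (fun k => a k ^ 2) = fun k => l k ^ 2 + (g k * a k + g k * l k) := by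
    ext k
    rw [ha]
    ring
  have h2 : trigExtension a x = trigExtension l x + trigExtension g x := by
    rw [← trigExtension_add, funext ha]
  rw [h1, trigExtension_add (fun k => l k ^ 2), trigExtension_add (fun k => g k * a k), hl, h2]
  ring

end Products

/-! ### Splitting the jumps into low and high frequencies -/

section JumpDecomposition

variable {𝔎 : EuclideanSpace ℝ (Fin 2) → ℝ} {γ : ℝ}

theorem jumpSize_low_add_high (τ : ℝ) (k : Lattice (size γ)) (η η' : Config (size γ)) :
    jumpSize 𝔎 γ (freqBox (size γ)) τ k η η' =
      jumpSize 𝔎 γ (lowBox (size γ)) τ k η η' + jumpSize 𝔎 γ (highBox (size γ)) τ k η η' := by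
  have h1 : ∀ l, green 𝔎 γ (freqBox (size γ)) τ l =
      green 𝔎 γ (lowBox (size γ)) τ l + green 𝔎 γ (highBox (size γ)) τ l := by
    intro l
    rw [green, green, green, lowBox, highBox, ← mul_add, Finset.sum_filter_add_sum_filter_not]
  simp only [jumpSize, h1, add_mul, Finset.sum_add_distrib, mul_add]

theorem jumpSize_eq_sum (B : Finset (Fin 2 → ℤ)) (τ : ℝ) (k : Lattice (size γ))
    (η η' : Config (size γ)) :
    jumpSize 𝔎 γ B τ k η η' = ∑ w ∈ B, ((γ⁻¹ * mesh (size γ) ^ 2 : ℝ) * ((1 / 4) *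
      greenHat 𝔎 γ τ w * ∑ l, latticeChar (-w) l * ((spin η' l - spin η l : ℝ) : ℂ))) *
        latticeChar w k := by
  simp only [jumpSize, green, latticeChar_sub, Finset.mul_sum, Finset.sum_mul]
  rw [Finset.sum_comm]
  exact Finset.sum_congr rfl fun w _ => Finset.sum_congr rfl fun l _ => by ring

theorem trigExtension_jumpSize_low_sq (τ : ℝ) (η η' : Config (size γ)) (x : Fin 2 → ℝ) :
    trigExtension (fun k => jumpSize 𝔎 γ (lowBox (size γ)) τ k η η' ^ 2) x =
      trigExtension (fun k => jumpSize 𝔎 γ (lowBox (size γ)) τ k η η') x ^ 2 := by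
  simp only [jumpSize_eq_sum]
  exact trigExtension_lowBox_sq _ x

/-- The extension of the square of the jumps differs from the square of their extension only by
terms that involve high frequencies. -/
theorem trigExtension_jumpSize_sq_sub (τ : ℝ) (η η' : Config (size γ)) (x : Fin 2 → ℝ) :
    trigExtension (fun k => jumpSize 𝔎 γ (freqBox (size γ)) τ k η η' ^ 2) x -
        trigExtension (fun k => jumpSize 𝔎 γ (freqBox (size γ)) τ k η η') x ^ 2 =
      (trigExtension (fun k => jumpSize 𝔎 γ (highBox (size γ)) τ k η η' *
          jumpSize 𝔎 γ (freqBox (size γ)) τ k η η') x +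
        trigExtension (fun k => jumpSize 𝔎 γ (highBox (size γ)) τ k η η' *
          jumpSize 𝔎 γ (lowBox (size γ)) τ k η η') x) -
      (trigExtension (fun k => jumpSize 𝔎 γ (highBox (size γ)) τ k η η') x *
          trigExtension (fun k => jumpSize 𝔎 γ (freqBox (size γ)) τ k η η') x +
        trigExtension (fun k => jumpSize 𝔎 γ (highBox (size γ)) τ k η η') x *
          trigExtension (fun k => jumpSize 𝔎 γ (lowBox (size γ)) τ k η η') x) := by
  rw [trigExtension_sq_sub (fun k => jumpSize_low_add_high τ k η η')
    (trigExtension_jumpSize_low_sq τ η η' x)]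

end JumpDecomposition

/-! ### Control of the path between the points of a grid -/

theorem JumpPath.sub_eq {J : ℝ≥0 → Finset ℝ≥0} {X a b : ℝ≥0 → ℂ} (hJ : IsJumpTimes J)
    (h : JumpPath J X a b) {r s : ℝ≥0} (hrs : r ≤ s) :
    X s - X r = ∑ ρ ∈ J s with r < ρ, a ρ + ∫ u in (r : ℝ)..s, b u.toNNReal := by
  rw [h.eq s, h.eq r, hJ.filter r s hrs,
    ← intervalIntegral.integral_interval_sub_left (h.intervalIntegrable 0 s)
      (h.intervalIntegrable 0 r), ← Finset.sum_filter_add_sum_filter_not (J s) (· ≤ r) a]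
  simp only [not_le]
  ring

section Pathwise

variable {𝔎 : EuclideanSpace ℝ (Fin 2) → ℝ} {C c γ β : ℝ} {t : ℝ≥0} {σ : ℝ≥0 → Config (size γ)}
  {Y : ℝ} {n : ℕ}

/-- The directions along which the modulus of a complex number is controlled. -/
def directions : Finset ℂ := {1, -1, Complex.I, -Complex.I}

theorem norm_le_one_of_mem_directions {ζ : ℂ} (h : ζ ∈ directions) : ‖ζ‖ ≤ 1 := by
  simp only [directions, Finset.mem_insert, Finset.mem_singleton] at h
  rcases h with rfl | rfl | rfl | rfl <;> simp

/-- The exponential inequalities are one-sided and real, so a complex value is controlled through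
the signs of its real and imaginary parts. -/
theorem norm_le_of_directions {z : ℂ} {K : ℝ} (h : ∀ ζ ∈ directions, (ζ * z).re ≤ K) :
    ‖z‖ ≤ 2 * K := by
  have h1 := h 1 (by simp [directions])
  have h2 := h (-1) (by simp [directions])
  have h3 := h Complex.I (by simp [directions])
  have h4 := h (-Complex.I) (by simp [directions])
  simp only [one_mul, neg_mul, Complex.neg_re, Complex.I_mul_re, neg_neg] at h1 h2 h3 h4
  have h5 := Complex.norm_le_abs_re_add_abs_im z
  have h6 : |z.re| ≤ K := abs_le.2 ⟨by linarith, h1⟩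
  have h7 : |z.im| ≤ K := abs_le.2 ⟨by linarith, h4⟩
  linarith

/-- The functionals of the path that control the error are all at most `Y`. -/
structure FunctionalBounds (𝔎 : EuclideanSpace ℝ (Fin 2) → ℝ) (C γ β : ℝ) (t : ℝ≥0) (n : ℕ)
    (Y : ℝ) (x : ℝ≥0 → Config (size γ)) : Prop where
  nonneg : 0 ≤ Y
  linear : ∀ ζ ∈ directions, ∀ i ≤ n, ∀ k, expFunctional flip (macroRate 𝔎 γ β)
    (linearJump 𝔎 C γ t ζ k) 0 (partPoint 0 t n i) x ≤ Y
  sq : ∀ k, expFunctional flip (macroRate 𝔎 γ β)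
    (fun r η η' => normJump 𝔎 C γ t k r η η' ^ 2) 0 t x ≤ Y
  high : ∀ B, B = freqBox (size γ) ∨ B = lowBox (size γ) → ∀ k k', expFunctional flip
    (macroRate 𝔎 γ β) (highJump 𝔎 C γ t B k k') 0 t x ≤ Y
  window : ∀ i < n, ∀ k, expFunctional flip (macroRate 𝔎 γ β)
    (normJump 𝔎 C γ t k) (partPoint 0 t n i) (t / n) x ≤ Y
  flip : ∀ ρ ∈ jumps x t, ∃ j, x ρ = flip (leftVal x ρ) j

namespace FunctionalBounds

/-- The value at s is the value at the left end of its cell, plus the jumps and the drift since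
then. The cells are so short that even the crude bounds on the last two are of order one. -/
theorem jumpScale_mul_norm_R_le (hF : FunctionalBounds 𝔎 C γ β t n Y (macroPath γ σ))
    (h : KernelBounds 𝔎 C c γ) (hσ : IsStepPath σ) (hn : (γ ^ 6)⁻¹ ≤ n) {s : ℝ≥0} (hs : s ≤ t)
    (k : Lattice (size γ)) :
    jumpScale C γ * ‖R 𝔎 γ β σ t s k‖ ≤ 4 * (Y + 18 * compBound C c t) := by
  have hγ := h.pos
  have hlam := h.jumpScale_pos
  have hY := hF.nonneg
  have hD := h.compBound_nonneg t
  have hx : IsStepPath (macroPath γ σ) := isStepPath_macroPath hγ hσ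
  have hJ := hx.isJumpTimes
  have hR := R_jumpPath (𝔎 := 𝔎) (β := β) hγ hσ t k
  -- The cells are open on the left and miss time zero, where R vanishes.
  rcases eq_or_ne s 0 with rfl | hs0
  · have h0 : R 𝔎 γ β σ t 0 k = 0 := hR.zero hJ
    rw [h0, norm_zero, mul_zero]
    positivity
  have hnpos : (0 : ℝ) < n := lt_of_lt_of_le (by positivity) hn
  have hn0 : n ≠ 0 := by
    rintro rfl
    simp at hnpos
  have htD : (t : ℝ) ≤ compBound C c t := by
    have hC := h.one_le
    have hc := h.c_pos
    rw [compBound]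
    have : 0 ≤ 20 * C * c⁻¹ := by positivity
    linarith
  obtain ⟨i, hi, hi1, hi2⟩ := exists_partPoint (a := 0) (d := t) (bot_lt_iff_ne_bot.2 hs0)
    (by rwa [zero_add]) hn0
  set p := partPoint 0 t n i with hp
  have hpt : p + t / n ≤ t := by
    rw [hp, ← partPoint_succ]
    exact (partPoint_le 0 t hi).trans (zero_add t).le
  have hps : s ≤ p + t / n := by rwa [hp, ← partPoint_succ]
  have hstep : (γ ^ 6)⁻¹ * ((t / n : ℝ≥0) : ℝ) ≤ t := by
    rw [NNReal.coe_div, NNReal.coe_natCast, mul_div_assoc', div_le_iff₀ hnpos, mul_comm]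
    exact mul_le_mul_of_nonneg_left hn t.coe_nonneg
  have hgrid : jumpScale C γ * ‖R 𝔎 γ β σ t p k‖ ≤ 2 * (Y + compBound C c t) := by
    have h1 : ‖(jumpScale C γ : ℂ) * R 𝔎 γ β σ t p k‖ ≤ 2 * (Y + compBound C c t) := by
      refine norm_le_of_directions fun ζ hζ => ?_
      rw [mul_left_comm, Complex.re_ofReal_mul]
      exact (h.linear_le_expFunctional hσ (hi1.le.trans hs)
        (norm_le_one_of_mem_directions hζ) k).trans
        (add_le_add (hF.linear ζ hζ i hi.le k) le_rfl)
    rwa [norm_mul, Complex.norm_real, Real.norm_of_nonneg hlam.le] at h1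
  have hjump : jumpScale C γ * ‖∑ ρ ∈ jumps (macroPath γ σ) s with p < ρ,
      jumpSize 𝔎 γ (freqBox (size γ)) ((t : ℝ) - ρ) k (leftVal (macroPath γ σ) ρ)
        (macroPath γ σ ρ)‖ ≤ Y + 18 * compBound C c t := by
    have h1 := h.window_le_expFunctional (β := β) hx hpt k
    have h2 := hF.window i hi k
    calc _ ≤ jumpScale C γ * ∑ ρ ∈ jumps (macroPath γ σ) s with p < ρ,
          ‖jumpSize 𝔎 γ (freqBox (size γ)) ((t : ℝ) - ρ) k (leftVal (macroPath γ σ) ρ)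
            (macroPath γ σ ρ)‖ := mul_le_mul_of_nonneg_left (norm_sum_le _ _) hlam.le
      _ = ∑ ρ ∈ jumps (macroPath γ σ) s with p < ρ, normJump 𝔎 C γ t k ρ
            (leftVal (macroPath γ σ) ρ) (macroPath γ σ ρ) := Finset.mul_sum _ _ _
      _ ≤ ∑ ρ ∈ jumps (macroPath γ σ) (p + t / n) with p < ρ, normJump 𝔎 C γ t k ρ
            (leftVal (macroPath γ σ) ρ) (macroPath γ σ ρ) := by
          refine Finset.sum_le_sum_of_subset_of_nonneg (Finset.filter_subset_filter _ ?_)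
            fun _ _ _ => mul_nonneg hlam.le (norm_nonneg _)
          rw [hJ.filter s _ hps]
          exact Finset.filter_subset _ _
      _ ≤ _ := h1
      _ ≤ Y + 18 * compBound C c t := by
          refine add_le_add h2 ?_
          rw [mul_assoc]
          exact mul_le_mul_of_nonneg_left (hstep.trans htD) (by norm_num)
  -- The scaled drift is at most 9γ⁻⁶ and the cell has length t/n with n ≥ γ⁻⁶.
  have hdrift : jumpScale C γ * ‖∫ u in (p : ℝ)..s, -∑ j,
      (macroRate 𝔎 γ β (macroPath γ σ u.toNNReal) j : ℂ) *
        jumpSize 𝔎 γ (freqBox (size γ)) ((t : ℝ) - u.toNNReal) k (macroPath γ σ u.toNNReal)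
          (IsingKac.flip (macroPath γ σ u.toNNReal) j)‖ ≤ 9 * compBound C c t := by
    have hps' : (p : ℝ) ≤ s := by exact_mod_cast hi1.le
    have h1 := intervalIntegral.norm_integral_le_of_norm_le_const (a := (p : ℝ)) (b := s)
      (C := (jumpScale C γ)⁻¹ * (9 * (γ ^ 6)⁻¹))
      (f := fun u : ℝ => -∑ j, (macroRate 𝔎 γ β (macroPath γ σ u.toNNReal) j : ℂ) *
        jumpSize 𝔎 γ (freqBox (size γ)) ((t : ℝ) - u.toNNReal) k (macroPath γ σ u.toNNReal)
          (IsingKac.flip (macroPath γ σ u.toNNReal) j)) fun u hu => ?_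
    · rw [abs_of_nonneg (sub_nonneg.2 hps')] at h1
      have hps2 : (s : ℝ) - p ≤ ((t / n : ℝ≥0) : ℝ) := by
        have : (s : ℝ) ≤ ((p + t / n : ℝ≥0) : ℝ) := by exact_mod_cast hps
        rw [NNReal.coe_add] at this
        linarith
      calc _ ≤ jumpScale C γ * ((jumpScale C γ)⁻¹ * (9 * (γ ^ 6)⁻¹) * ((t / n : ℝ≥0) : ℝ)) := by
            refine mul_le_mul_of_nonneg_left (h1.trans ?_) hlam.le
            exact mul_le_mul_of_nonneg_left hps2 (by positivity)
        _ = 9 * ((γ ^ 6)⁻¹ * ((t / n : ℝ≥0) : ℝ)) := by field_simp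
        _ ≤ 9 * compBound C c t := by linarith [hstep.trans htD]
    · rw [Set.uIoc_of_le hps'] at hu
      have hut : u.toNNReal ≤ t :=
        Real.toNNReal_le_iff_le_coe.2 (hu.2.trans (by exact_mod_cast hs))
      rw [norm_neg, ← div_eq_inv_mul, le_div_iff₀ hlam, mul_comm]
      refine le_trans ?_ (h.sum_normJump_flip_le hut k (macroPath γ σ u.toNNReal))
      rw [Finset.mul_sum]
      refine (mul_le_mul_of_nonneg_left (norm_sum_le _ _) hlam.le).trans ?_
      rw [Finset.mul_sum]
      refine Finset.sum_le_sum fun j _ => ?_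
      rw [norm_mul, Complex.norm_real, Real.norm_of_nonneg (macroRate_nonneg _ j),
        mul_left_comm]
      exact mul_le_mul_of_nonneg_right (macroRate_le _ j) (mul_nonneg hlam.le (norm_nonneg _))
  have hsub := hR.sub_eq hJ hi1.le
  have hfin : ‖R 𝔎 γ β σ t s k‖ ≤ ‖R 𝔎 γ β σ t p k‖ + (‖∑ ρ ∈ jumps (macroPath γ σ) s with p < ρ,
      jumpSize 𝔎 γ (freqBox (size γ)) ((t : ℝ) - ρ) k (leftVal (macroPath γ σ) ρ)
        (macroPath γ σ ρ)‖ + ‖∫ u in (p : ℝ)..s, -∑ j,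
      (macroRate 𝔎 γ β (macroPath γ σ u.toNNReal) j : ℂ) *
        jumpSize 𝔎 γ (freqBox (size γ)) ((t : ℝ) - u.toNNReal) k (macroPath γ σ u.toNNReal)
          (IsingKac.flip (macroPath γ σ u.toNNReal) j)‖) := by
    rw [← add_sub_cancel (R 𝔎 γ β σ t p k) (R 𝔎 γ β σ t s k), hsub]
    exact (norm_add_le _ _).trans (add_le_add le_rfl (norm_add_le _ _))
  have := mul_le_mul_of_nonneg_left hfin hlam.le
  rw [mul_add, mul_add] at this
  linarith

/-- The pathwise bound for the error. -/
theorem norm_wickError_le (hF : FunctionalBounds 𝔎 C γ β t n Y (macroPath γ σ))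
    (h : KernelBounds 𝔎 C c γ) (hσ : IsStepPath σ) (hn : (γ ^ 6)⁻¹ ≤ n) {s : ℝ≥0} (hs : s ≤ t)
    (x : Fin 2 → ℝ) (m : ℕ) :
    ‖wickError 𝔎 γ β σ t (m + 1) s x‖ ≤ (m + 1).factorial * (4 ^ (m + 1) * (γ *
      (512 * C * logSize (size γ) ^ 4 * (1 + Y + 18 * compBound C c t)) ^ (m + 1))) := by
  have hγ := h.pos
  have hlam := h.jumpScale_pos
  have hY := hF.nonneg
  have hC := h.one_le
  have hD := h.compBound_nonneg t
  have hl := one_le_logSize (size γ)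
  have hx : IsStepPath (macroPath γ σ) := isStepPath_macroPath hγ hσ
  have hJ := hx.isJumpTimes
  set lam := jumpScale C γ with hlamd
  set Z := Y + 18 * compBound C c t with hZ
  have hZ0 : 0 ≤ Z := by positivity
  set Λ := (2 * logSize (size γ)) ^ 2 with hΛ
  have hΛ1 : 1 ≤ Λ := by
    rw [hΛ]
    exact one_le_pow₀ (by linarith)
  set X := macroPath γ σ with hX
  set a : Finset (Fin 2 → ℤ) → Lattice (size γ) → ℝ≥0 → ℂ := fun B k ρ =>
    jumpSize 𝔎 γ B ((t : ℝ) - ρ) k (leftVal X ρ) (X ρ) with ha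
  -- Two logarithms come from the Lebesgue constant Λ and two from the inverse of `jumpScale`; 512 =
  -- 4 · 4 · 32.
  have hM : 512 * C * logSize (size γ) ^ 4 * (1 + Y + 18 * compBound C c t) =
      4 * (Λ * lam⁻¹) * (1 + Z) := by
    rw [hlamd, jumpScale, inv_inv]
    ring
  rw [hM]
  set P := Λ * lam⁻¹ with hP
  have hP0 : 0 < P := by positivity
  have hsub : jumps X s ⊆ jumps X t := by
    rw [hJ.filter s t hs]
    exact Finset.filter_subset _ _
  have hsq : ∀ k, ∑ ρ ∈ jumps X s, ‖a (freqBox (size γ)) k ρ‖ ^ 2 ≤ (lam⁻¹) ^ 2 * Z := by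
    intro k
    have h1 := (h.sq_le_expFunctional (β := β) (t := t) hx k).trans (add_le_add (hF.sq k) le_rfl)
    have h2 : ∑ ρ ∈ jumps X s, ‖a (freqBox (size γ)) k ρ‖ ^ 2 ≤
        ∑ ρ ∈ jumps X t, ‖a (freqBox (size γ)) k ρ‖ ^ 2 :=
      Finset.sum_le_sum_of_subset_of_nonneg hsub fun _ _ _ => by positivity
    simp only [normJump, mul_pow] at h1
    rw [← Finset.mul_sum] at h1
    refine h2.trans ?_
    rw [inv_pow, ← div_eq_inv_mul, le_div_iff₀ (by positivity), mul_comm]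
    exact h1.trans (by linarith)
  have hhigh : ∀ B, B = freqBox (size γ) ∨ B = lowBox (size γ) → ∀ k k',
      ∑ ρ ∈ jumps X s, ‖a (highBox (size γ)) k ρ‖ * ‖a B k' ρ‖ ≤ γ * ((lam⁻¹) ^ 2 * Z) := by
    intro B hB k k'
    have hB' : B ⊆ freqBox (size γ) := by
      rcases hB with rfl | rfl
      · exact Finset.Subset.refl _
      · exact lowBox_subset _
    have h1 := (h.high_le_expFunctional (β := β) (t := t) hx hB' k k').trans
      (add_le_add (hF.high B hB k k') le_rfl)
    have h2 : ∑ ρ ∈ jumps X s, ‖a (highBox (size γ)) k ρ‖ * ‖a B k' ρ‖ ≤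
        ∑ ρ ∈ jumps X t, ‖a (highBox (size γ)) k ρ‖ * ‖a B k' ρ‖ :=
      Finset.sum_le_sum_of_subset_of_nonneg hsub fun _ _ _ => by positivity
    simp only [highJump] at h1
    rw [← Finset.mul_sum] at h1
    refine h2.trans ?_
    have h3 : γ * ((lam⁻¹) ^ 2 * Z) = Z / (lam ^ 2 * γ⁻¹) := by field_simp
    rw [h3, le_div_iff₀ (by positivity), mul_comm]
    exact h1.trans (by linarith)
  -- The size parameter M contains all logarithms, and the small parameter is δ = γ.
  refine IsingKac.norm_wickError_le hJ (a := a (freqBox (size γ)))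
    (fun k => R_jumpPath (𝔎 := 𝔎) (β := β) hγ hσ t k) x s (M := 4 * P * (1 + Z)) (δ := γ)
    (by positivity) hγ.le (h.le.trans (by norm_num)) ?_ ?_ ?_ ?_ ?_ m
  · refine (norm_trigExtension_le (C := lam⁻¹ * (4 * Z)) (fun k => ?_) x).trans ?_
    · rw [← div_eq_inv_mul, le_div_iff₀ hlam, mul_comm]
      exact hF.jumpScale_mul_norm_R_le h hσ hn hs k
    · calc Λ * (lam⁻¹ * (4 * Z)) = 4 * P * Z := by ring
        _ ≤ 4 * P * (1 + Z) := by gcongr; linarith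
  · refine (norm_trigExtension_le (C := (lam⁻¹) ^ 2 * Z) (fun k => ?_) x).trans ?_
    · refine (norm_sum_le _ _).trans (le_trans (le_of_eq ?_) (hsq k))
      exact Finset.sum_congr rfl fun ρ _ => norm_pow _ _
    · calc Λ * ((lam⁻¹) ^ 2 * Z) ≤ Λ ^ 2 * ((lam⁻¹) ^ 2 * Z) := by
            gcongr
            exact le_self_pow₀ hΛ1 two_ne_zero
        _ = P ^ 2 * Z := by rw [hP]; ring
        _ ≤ P ^ 2 * (16 * (1 + Z) ^ 2) := by gcongr; nlinarith
        _ = _ := by ring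
  · have h1 := sum_norm_trigExtension_mul_le (jumps X s)
      (f := fun ρ k => a (freqBox (size γ)) k ρ) (g := fun ρ k => a (freqBox (size γ)) k ρ)
      (K := (lam⁻¹) ^ 2 * Z) (fun k k' => ?_) x
    · simp only [← pow_two] at h1
      refine h1.trans ?_
      calc Λ ^ 2 * ((lam⁻¹) ^ 2 * Z) = P ^ 2 * Z := by rw [hP]; ring
        _ ≤ P ^ 2 * (16 * (1 + Z) ^ 2) := by gcongr; nlinarith
        _ = _ := by ring
    -- The bilinear estimate needs products at different sites, which are reduced to squares at
    -- single sites.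
    · have h2 : ∀ ρ, ‖a (freqBox (size γ)) k ρ‖ * ‖a (freqBox (size γ)) k' ρ‖ ≤
          (‖a (freqBox (size γ)) k ρ‖ ^ 2 + ‖a (freqBox (size γ)) k' ρ‖ ^ 2) / 2 := fun ρ => by
        nlinarith [sq_nonneg (‖a (freqBox (size γ)) k ρ‖ - ‖a (freqBox (size γ)) k' ρ‖)]
      refine (Finset.sum_le_sum fun ρ _ => h2 ρ).trans ?_
      rw [← Finset.sum_div, Finset.sum_add_distrib]
      linarith [hsq k, hsq k']
  · intro ρ hρ
    refine (norm_trigExtension_le (C := lam⁻¹ * γ) (fun k => ?_) x).trans ?_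
    · obtain ⟨j, hj⟩ := hF.flip ρ (hsub hρ)
      have hρt : 0 ≤ (t : ℝ) - ρ :=
        sub_nonneg.2 (by exact_mod_cast (hJ.mem t ρ (hsub hρ)).2)
      rw [← div_eq_inv_mul, le_div_iff₀ hlam, mul_comm]
      simp only [ha]
      rw [hj]
      exact h.jumpScale_mul_norm_le (Finset.Subset.refl _) hρt k _ j
    · calc Λ * (lam⁻¹ * γ) = γ * (P * 1) := by rw [hP]; ring
        _ ≤ γ * (4 * P * (1 + Z)) := by
            refine mul_le_mul_of_nonneg_left ?_ hγ.le
            nlinarith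
  · rw [trigExtension_sum (jumps X s) (fun ρ k => a (freqBox (size γ)) k ρ ^ 2),
      ← Finset.sum_sub_distrib]
    refine (norm_sum_le _ _).trans ?_
    -- Four terms per jump, each with a high-frequency factor: two interpolated products and two
    -- products of interpolations.
    have hterm : ∀ ρ, ‖trigExtension (fun k => a (freqBox (size γ)) k ρ ^ 2) x -
        trigExtension (fun k => a (freqBox (size γ)) k ρ) x ^ 2‖ ≤
        (‖trigExtension (fun k => a (highBox (size γ)) k ρ * a (freqBox (size γ)) k ρ) x‖ +
        ‖trigExtension (fun k => a (highBox (size γ)) k ρ * a (lowBox (size γ)) k ρ) x‖) +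
        (‖trigExtension (fun k => a (highBox (size γ)) k ρ) x‖ *
          ‖trigExtension (fun k => a (freqBox (size γ)) k ρ) x‖ +
        ‖trigExtension (fun k => a (highBox (size γ)) k ρ) x‖ *
          ‖trigExtension (fun k => a (lowBox (size γ)) k ρ) x‖) := by
      intro ρ
      simp only [ha]
      rw [trigExtension_jumpSize_sq_sub, ← norm_mul, ← norm_mul]
      exact (norm_sub_le _ _).trans (add_le_add (norm_add_le _ _) (norm_add_le _ _))
    refine (Finset.sum_le_sum fun ρ _ => hterm ρ).trans ?_
    rw [Finset.sum_add_distrib, Finset.sum_add_distrib, Finset.sum_add_distrib]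
    have hdiag : ∀ B, B = freqBox (size γ) ∨ B = lowBox (size γ) →
        ∑ ρ ∈ jumps X s, ‖trigExtension (fun k => a (highBox (size γ)) k ρ * a B k ρ) x‖ ≤
          Λ ^ 2 * (γ * ((lam⁻¹) ^ 2 * Z)) := by
      intro B hB
      refine (sum_norm_trigExtension_le (jumps X s)
        (f := fun ρ k => a (highBox (size γ)) k ρ * a B k ρ) (K := γ * ((lam⁻¹) ^ 2 * Z))
        (fun k => by simpa only [norm_mul] using hhigh B hB k k) x).trans ?_
      refine mul_le_mul_of_nonneg_right ?_ (by positivity)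
      exact le_self_pow₀ hΛ1 two_ne_zero
    have hprod : ∀ B, B = freqBox (size γ) ∨ B = lowBox (size γ) →
        ∑ ρ ∈ jumps X s, ‖trigExtension (fun k => a (highBox (size γ)) k ρ) x‖ *
          ‖trigExtension (fun k => a B k ρ) x‖ ≤ Λ ^ 2 * (γ * ((lam⁻¹) ^ 2 * Z)) := fun B hB =>
      sum_norm_trigExtension_mul_le (jumps X s) (f := fun ρ k => a (highBox (size γ)) k ρ)
        (g := fun ρ k => a B k ρ) (hhigh B hB) x
    have h1 := hdiag _ (Or.inl rfl)
    have h2 := hdiag _ (Or.inr rfl)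
    have h3 := hprod _ (Or.inl rfl)
    have h4 := hprod _ (Or.inr rfl)
    have h5 : 4 * (Λ ^ 2 * (γ * ((lam⁻¹) ^ 2 * Z))) ≤ γ * (4 * P * (1 + Z)) ^ 2 := by
      calc 4 * (Λ ^ 2 * (γ * ((lam⁻¹) ^ 2 * Z))) = γ * (P ^ 2 * (4 * Z)) := by rw [hP]; ring
        _ ≤ γ * (P ^ 2 * (16 * (1 + Z) ^ 2)) := by
            gcongr γ * (P ^ 2 * ?_)
            nlinarith
        _ = _ := by ring
    linarith

end FunctionalBounds

end Pathwise

/-! ### Exponential moments of the functionals -/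

section Moments

/-- A union bound for exponential moments: Z is the average of the exponentials of all functionals,
so its mean is at most 1 and each exponential is at most the number of functionals times Z. -/
theorem IsJumpProcess.exists_bound {S I : Type*} [Fintype S] [Fintype I] {φ : S → I → S}
    {q : S → I → ℝ} {Ω : Type u} {mΩ : MeasurableSpace Ω} {μ : Measure Ω}
    [IsProbabilityMeasure μ] {ℱ : Filtration ℝ≥0 mΩ} {X : ℝ≥0 → Ω → S}
    (h : IsJumpProcess φ q μ ℱ X) (hq : ∀ η i, 0 ≤ q η i) {ι : Type*} [Fintype ι] [Nonempty ι]
    {W : ι → ℝ≥0 → S → S → ℝ} (hW : ∀ i η η', Continuous fun r => W i r η η')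
    (hW0 : ∀ i r η, W i r η η = 0) (a d : ι → ℝ≥0) :
    ∃ Z : Ω → ℝ, Measurable Z ∧ (∀ ω, 0 ≤ Z ω) ∧ ∫⁻ ω, ENNReal.ofReal (Z ω) ∂μ ≤ 1 ∧
      ∀ i ω, expFunctional φ q (W i) (a i) (d i) (fun t => X t ω) ≤
        Real.log (Fintype.card ι) + Real.log (1 + Z ω) := by
  set F : ι → Ω → ℝ := fun i ω => expFunctional φ q (W i) (a i) (d i) fun t => X t ω with hF
  have hcard : 0 < (Fintype.card ι : ℝ) := by exact_mod_cast Fintype.card_pos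
  have hm : ∀ i, Measurable fun ω => Real.exp (F i ω) := fun i =>
    Real.measurable_exp.comp (h.measurable_expFunctional hq (hW i) (hW0 i) (a i) (d i))
  have h0 : ∀ ω, 0 ≤ ∑ i, Real.exp (F i ω) := fun ω =>
    Finset.sum_nonneg fun i _ => (Real.exp_pos _).le
  refine ⟨fun ω => (Fintype.card ι : ℝ)⁻¹ * ∑ i, Real.exp (F i ω),
    (Finset.measurable_fun_sum _ fun i _ => hm i).const_mul _,
    fun ω => mul_nonneg (by positivity) (h0 ω), ?_, fun i ω => ?_⟩
  · have h1 : ∀ ω, ENNReal.ofReal ((Fintype.card ι : ℝ)⁻¹ * ∑ i, Real.exp (F i ω)) =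
        ENNReal.ofReal ((Fintype.card ι : ℝ)⁻¹) * ∑ i, ENNReal.ofReal (Real.exp (F i ω)) :=
      fun ω => by
        rw [ENNReal.ofReal_mul (by positivity),
          ENNReal.ofReal_sum_of_nonneg fun i _ => (Real.exp_pos _).le]
    simp only [h1]
    rw [lintegral_const_mul _ (Finset.measurable_fun_sum _ fun i _ => (hm i).ennreal_ofReal),
      lintegral_finsetSum _ fun i _ => (hm i).ennreal_ofReal]
    calc _ ≤ ENNReal.ofReal ((Fintype.card ι : ℝ)⁻¹) * ∑ _i : ι, 1 := by
          gcongr with i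
          exact h.lintegral_exp_le_one hq (hW i) (hW0 i) (a i) (d i)
      _ = ENNReal.ofReal ((Fintype.card ι : ℝ)⁻¹) * ENNReal.ofReal (Fintype.card ι : ℝ) := by
          simp
      _ = 1 := by
          rw [← ENNReal.ofReal_mul (by positivity), inv_mul_cancel₀ hcard.ne', ENNReal.ofReal_one]
  · have h1 : Real.exp (F i ω) ≤ ∑ i, Real.exp (F i ω) :=
      Finset.single_le_sum (f := fun i => Real.exp (F i ω)) (fun _ _ => (Real.exp_pos _).le)
        (Finset.mem_univ i)
    have h2 : 0 < 1 + (Fintype.card ι : ℝ)⁻¹ * ∑ i, Real.exp (F i ω) := by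
      have := h0 ω
      positivity
    rw [← Real.log_mul hcard.ne' h2.ne', Real.le_log_iff_exp_le (by positivity)]
    refine h1.trans ?_
    rw [mul_add, mul_inv_cancel_left₀ hcard.ne']
    linarith

variable {𝔎 : EuclideanSpace ℝ (Fin 2) → ℝ} {C c γ β : ℝ}

theorem linearJump_self {t : ℝ≥0} {ζ : ℂ} {k : Lattice (size γ)} {r : ℝ≥0}
    {η : Config (size γ)} : linearJump 𝔎 C γ t ζ k r η η = 0 := by
  simp [linearJump, jumpSize_self]

theorem normJump_self {t : ℝ≥0} {k : Lattice (size γ)} {r : ℝ≥0} {η : Config (size γ)} :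
    normJump 𝔎 C γ t k r η η = 0 := by
  simp [normJump, jumpSize_self]

theorem highJump_self {t : ℝ≥0} {B : Finset (Fin 2 → ℤ)} {k k' : Lattice (size γ)} {r : ℝ≥0}
    {η : Config (size γ)} : highJump 𝔎 C γ t B k k' r η η = 0 := by
  simp [highJump, jumpSize_self]

/-- All functionals are controlled by the logarithm of one integrable variable. -/
theorem exists_functionalBounds {Ω : Type u} {mΩ : MeasurableSpace Ω} {μ : Measure Ω}
    [IsProbabilityMeasure μ] {ℱ : Filtration ℝ≥0 mΩ} {σ : ℝ≥0 → Ω → Config (size γ)}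
    (hγ : 0 < γ) (hσ : IsGlauberDynamics 𝔎 γ β μ ℱ σ) (C : ℝ) (t : ℝ≥0) (n : ℕ) :
    ∃ Z : Ω → ℝ, Measurable Z ∧ (∀ ω, 0 ≤ Z ω) ∧ ∫⁻ ω, ENNReal.ofReal (Z ω) ∂μ ≤ 1 ∧
      ∀ᵐ ω ∂μ, FunctionalBounds 𝔎 C γ β t n
        (Real.log (8 * (n + 1) * (Fintype.card (Lattice (size γ)) : ℝ) ^ 2) +
          Real.log (1 + Z ω)) (macroPath γ fun r => σ r ω) := by
  obtain ⟨𝒢, h⟩ := isJumpProcess_macroPath hγ hσ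
  have hq : ∀ (η : Config (size γ)) j, 0 ≤ macroRate 𝔎 γ β η j := macroRate_nonneg
  let T := Lattice (size γ)
  -- Projections of R at the grid times, squared jumps, products with high-frequency jumps, and sums
  -- over the cells. With n of order γ⁻⁶ their number is polynomial in γ⁻¹.
  let ι := (directions × Fin (n + 1) × T) ⊕ T ⊕ (Bool × T × T) ⊕ (Fin n × T)
  let W : ι → ℝ≥0 → Config (size γ) → Config (size γ) → ℝ :=
    Sum.elim (fun p => linearJump 𝔎 C γ t p.1 p.2.2) <|
    Sum.elim (fun k r η η' => normJump 𝔎 C γ t k r η η' ^ 2) <|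
    Sum.elim (fun p => highJump 𝔎 C γ t (if p.1 then freqBox (size γ) else lowBox (size γ))
      p.2.1 p.2.2) fun p => normJump 𝔎 C γ t p.2
  let a : ι → ℝ≥0 := Sum.elim (fun _ => 0) <| Sum.elim (fun _ => 0) <| Sum.elim (fun _ => 0)
    fun p => partPoint 0 t n p.1
  let d : ι → ℝ≥0 := Sum.elim (fun p => partPoint 0 t n p.2.1) <| Sum.elim (fun _ => t) <|
    Sum.elim (fun _ => t) fun _ => t / n
  have hne : Nonempty ι := ⟨Sum.inr (Sum.inl 0)⟩
  have hW : ∀ i η η', Continuous fun r => W i r η η' := by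
    rintro (p | k | p | p) η η'
    · exact continuous_linearJump _ _ η η'
    · exact (continuous_normJump k η η').pow 2
    · exact continuous_highJump _ _ _ η η'
    · exact continuous_normJump _ η η'
  have hW0 : ∀ i r η, W i r η η = 0 := by
    rintro (p | k | p | p) r η
    · exact linearJump_self
    · exact (congrArg (· ^ 2) normJump_self).trans (by norm_num)
    · exact highJump_self
    · exact normJump_self
  obtain ⟨Z, hZm, hZ0, hZ1, hZ⟩ := h.exists_bound hq hW hW0 a d
  refine ⟨Z, hZm, hZ0, hZ1, ?_⟩
  have hT : 1 ≤ Fintype.card T := Fintype.card_pos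
  have hcard : Fintype.card ι ≤ 8 * (n + 1) * Fintype.card T ^ 2 := by
    have hdir : Fintype.card directions ≤ 4 := by
      rw [Fintype.card_coe]
      exact Finset.card_le_four
    have e1 : Fintype.card ι = Fintype.card directions * ((n + 1) * Fintype.card T) +
        (Fintype.card T + (2 * (Fintype.card T * Fintype.card T) + n * Fintype.card T)) := by
      simp only [ι, Fintype.card_sum, Fintype.card_prod, Fintype.card_fin, Fintype.card_bool]
    rw [e1]
    have e2 : Fintype.card T ≤ Fintype.card T ^ 2 := Nat.le_self_pow two_ne_zero _
    have e3 : Fintype.card directions * ((n + 1) * Fintype.card T) ≤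
        4 * ((n + 1) * Fintype.card T ^ 2) := by gcongr
    have e4 : n * Fintype.card T ≤ n * Fintype.card T ^ 2 := by gcongr
    nlinarith
  have hlog : Real.log (Fintype.card ι) ≤
      Real.log (8 * (n + 1) * (Fintype.card (Lattice (size γ)) : ℝ) ^ 2) := by
    refine Real.log_le_log (by exact_mod_cast Fintype.card_pos) ?_
    exact_mod_cast hcard
  have hle : ∀ i ω, expFunctional flip (macroRate 𝔎 γ β) (W i) (a i) (d i)
      (macroPath γ fun r => σ r ω) ≤
        Real.log (8 * (n + 1) * (Fintype.card (Lattice (size γ)) : ℝ) ^ 2) +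
          Real.log (1 + Z ω) := fun i ω => (hZ i ω).trans (add_le_add hlog le_rfl)
  filter_upwards [h.ae_jumps hq t] with ω hω
  refine ⟨?_, fun ζ hζ i hi k => ?_, fun k => ?_, fun B hB k k' => ?_, fun i hi k => ?_, hω⟩
  · refine add_nonneg (Real.log_nonneg ?_) (Real.log_nonneg (by linarith [hZ0 ω]))
    have e1 : (1 : ℝ) ≤ (Fintype.card (Lattice (size γ)) : ℝ) ^ 2 :=
      one_le_pow₀ (by exact_mod_cast hT)
    have e2 : (0 : ℝ) ≤ n := n.cast_nonneg
    nlinarith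
  · exact hle (Sum.inl (⟨ζ, hζ⟩, ⟨i, Nat.lt_succ_of_le hi⟩, k)) ω
  · exact hle (Sum.inr (Sum.inl k)) ω
  · rcases hB with rfl | rfl
    · exact hle (Sum.inr (Sum.inr (Sum.inl (true, k, k')))) ω
    · exact hle (Sum.inr (Sum.inr (Sum.inl (false, k, k')))) ω
  · exact hle (Sum.inr (Sum.inr (Sum.inr (⟨i, hi⟩, k)))) ω

end Moments

/-! ### Logarithmic factors -/

section Logarithms

/-- From log y ≤ q y^{1/q}. Thus every power of 1 + log(1 + Z) is integrable as soon as Z is. -/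
theorem one_add_log_rpow_le {q y : ℝ} (hq : 0 < q) (hy : 1 ≤ y) :
    (1 + Real.log y) ^ q ≤ (1 + q) ^ q * y := by
  have hy0 : 0 < y := by linarith
  have h1 := Real.log_le_rpow_div hy0.le (ε := q⁻¹) (by positivity)
  rw [div_inv_eq_mul] at h1
  have h2 : 1 ≤ y ^ q⁻¹ := Real.one_le_rpow hy (by positivity)
  have h3 := Real.log_nonneg hy
  calc (1 + Real.log y) ^ q ≤ ((1 + q) * y ^ q⁻¹) ^ q :=
        Real.rpow_le_rpow (by positivity) (by nlinarith) hq.le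
    _ = (1 + q) ^ q * y := by
        rw [Real.mul_rpow (by positivity) (by positivity), ← Real.rpow_mul hy0.le,
          inv_mul_cancel₀ hq.ne', Real.rpow_one]

theorem logSize_size_le {γ : ℝ} (hγ : 0 < γ) (hγ1 : γ ≤ 1) :
    logSize (size γ) ≤ 2 * (1 + Real.log γ⁻¹) := by
  have h1 : logSize (size γ) ≤ 1 + (1 + Real.log (size γ)) := by
    have h := harmonic_le_one_add_log (size γ)
    rw [harmonic_eq_sum_Icc] at h
    push_cast at h
    rw [logSize]
    linarith
  have hN : 0 < (size γ : ℝ) := by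
    have : 1 ≤ size γ := Nat.le_floor (by
      rw [Nat.cast_one]
      exact (one_le_inv₀ (by positivity)).2 (pow_le_one₀ hγ.le hγ1))
    exact_mod_cast this
  have h2 : Real.log (size γ) ≤ 2 * Real.log γ⁻¹ := by
    have h3 : (size γ : ℝ) ≤ (γ⁻¹) ^ 2 := by
      rw [inv_pow]
      exact Nat.floor_le (by positivity)
    calc Real.log (size γ) ≤ Real.log ((γ⁻¹) ^ 2) := Real.log_le_log hN h3
      _ = 2 * Real.log γ⁻¹ := by rw [Real.log_pow]; norm_num
  linarith

theorem KernelBounds.log_card_le {𝔎 : EuclideanSpace ℝ (Fin 2) → ℝ} {C c γ : ℝ}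
    (h : KernelBounds 𝔎 C c γ) :
    Real.log (8 * (⌈(γ ^ 6)⁻¹⌉₊ + 1) * (Fintype.card (Lattice (size γ)) : ℝ) ^ 2) ≤
      1944 * (1 + Real.log γ⁻¹) := by
  have hγ := h.pos
  have hγ1 : γ ≤ 1 := h.le.trans (by norm_num)
  have hinv : 1 ≤ γ⁻¹ := (one_le_inv₀ hγ).2 hγ1
  have hlog : 0 ≤ Real.log γ⁻¹ := Real.log_nonneg hinv
  have h1 : (⌈(γ ^ 6)⁻¹⌉₊ : ℝ) + 1 ≤ 3 * (γ⁻¹) ^ 6 := by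
    have e1 := (Nat.ceil_lt_add_one (a := (γ ^ 6)⁻¹) (by positivity)).le
    have e2 : 1 ≤ (γ⁻¹) ^ 6 := one_le_pow₀ hinv
    rw [← inv_pow] at e1
    rw [← inv_pow]
    linarith
  have h2 := h.card_lattice_le
  rw [← inv_pow] at h2
  have hT : (1 : ℝ) ≤ Fintype.card (Lattice (size γ)) := by
    exact_mod_cast Fintype.card_pos
  calc _ ≤ Real.log (8 * (3 * (γ⁻¹) ^ 6) * (9 * (γ⁻¹) ^ 4) ^ 2) := by
        refine Real.log_le_log (by positivity) ?_
        gcongr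
    _ = Real.log (1944 * (γ⁻¹) ^ 14) := by congr 1; ring
    _ = Real.log 1944 + 14 * Real.log γ⁻¹ := by
        rw [Real.log_mul (by norm_num) (by positivity), Real.log_pow]
        norm_num
    _ ≤ 1944 * (1 + Real.log γ⁻¹) := by
        have := Real.log_le_self (x := 1944) (by norm_num)
        linarith

/-- The constant in front of `γ` in the pathwise bound. -/
def errorConst (C c : ℝ) (t : ℝ≥0) (n : ℕ) : ℝ :=
  n.factorial * (4 ^ n * (8192 * C * (1945 + 18 * compBound C c t)) ^ n)

/-- The moment of order `p` of the error in terms of an integrable variable. -/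
theorem FunctionalBounds.norm_wickError_rpow_le {𝔎 : EuclideanSpace ℝ (Fin 2) → ℝ} {C c γ β : ℝ}
    {t : ℝ≥0} {σ : ℝ≥0 → Config (size γ)} {z : ℝ} (hz : 0 ≤ z)
    (hF : FunctionalBounds 𝔎 C γ β t ⌈(γ ^ 6)⁻¹⌉₊
      (Real.log (8 * (⌈(γ ^ 6)⁻¹⌉₊ + 1) * (Fintype.card (Lattice (size γ)) : ℝ) ^ 2) +
        Real.log (1 + z)) (macroPath γ σ))
    (h : KernelBounds 𝔎 C c γ) (hσ : IsStepPath σ) {s : ℝ≥0} (hs : s ≤ t) (x : Fin 2 → ℝ)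
    {n : ℕ} (hn : 1 ≤ n) {p : ℝ} (hp : 1 ≤ p) :
    ‖wickError 𝔎 γ β σ t n s x‖ ^ p ≤
      (errorConst C c t n * (γ * (1 + Real.log γ⁻¹) ^ (5 * n))) ^ p *
        ((1 + n * p) ^ (n * p) * (1 + z)) := by
  have hγ := h.pos
  have hγ1 : γ ≤ 1 := h.le.trans (by norm_num)
  have hC := h.one_le
  have hD := h.compBound_nonneg t
  have hl := one_le_logSize (size γ)
  have hlog : 0 ≤ Real.log γ⁻¹ := Real.log_nonneg ((one_le_inv₀ hγ).2 hγ1)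
  have hlz : 0 ≤ Real.log (1 + z) := Real.log_nonneg (by linarith)
  obtain ⟨m, rfl⟩ : ∃ m, n = m + 1 := ⟨n - 1, by omega⟩
  have h1 := hF.norm_wickError_le h hσ (Nat.le_ceil _) hs x m
  have h2 := logSize_size_le hγ hγ1
  have h3 := h.log_card_le
  set L := 1 + Real.log γ⁻¹ with hL
  have hL1 : 1 ≤ L := by linarith
  set U := 1 + Real.log (1 + z) with hU
  have hU1 : 1 ≤ U := by linarith
  set Y := Real.log (8 * (⌈(γ ^ 6)⁻¹⌉₊ + 1) * (Fintype.card (Lattice (size γ)) : ℝ) ^ 2) with hY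
  have hY0 := hF.nonneg
  set D := compBound C c t with hDd
  -- The deterministic logarithm L and the random one U are both at least 1, so a sum is turned into
  -- a product that separates γ from chance. Together with the fourth power of `logSize` this yields
  -- L⁵.
  have h4 : 1 + (Y + Real.log (1 + z)) + 18 * D ≤ (1945 + 18 * D) * L * U := by
    have e1 : 1 + (Y + Real.log (1 + z)) + 18 * D ≤ 1944 * L + U + 18 * D := by linarith
    have e2 : L ≤ L * U := le_mul_of_one_le_right (by linarith) hU1
    have e3 : U ≤ L * U := le_mul_of_one_le_left (by linarith) hL1
    have e4 : 18 * D ≤ 18 * D * (L * U) :=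
      le_mul_of_one_le_right (by positivity) (by nlinarith)
    nlinarith
  have h5 : 512 * C * logSize (size γ) ^ 4 * (1 + (Y + Real.log (1 + z)) + 18 * D) ≤
      8192 * C * (1945 + 18 * D) * (L ^ 5 * U) := by
    calc _ ≤ 512 * C * (2 * L) ^ 4 * ((1945 + 18 * D) * L * U) := by gcongr
      _ = _ := by ring
  have h6 : ‖wickError 𝔎 γ β σ t (m + 1) s x‖ ≤
      errorConst C c t (m + 1) * (γ * L ^ (5 * (m + 1))) * U ^ (m + 1) := by
    refine h1.trans ?_
    calc _ ≤ ((m + 1).factorial : ℝ) * (4 ^ (m + 1) * (γ *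
          (8192 * C * (1945 + 18 * D) * (L ^ 5 * U)) ^ (m + 1))) := by gcongr
      _ = _ := by
          rw [errorConst, pow_mul, mul_pow _ (L ^ 5 * U), mul_pow (L ^ 5)]
          ring
  have hE : 0 ≤ errorConst C c t (m + 1) := by
    rw [errorConst]
    positivity
  have hnp : 0 < ((m + 1 : ℕ) : ℝ) * p := by positivity
  calc _ ≤ (errorConst C c t (m + 1) * (γ * L ^ (5 * (m + 1))) * U ^ (m + 1)) ^ p :=
        Real.rpow_le_rpow (norm_nonneg _) h6 (by linarith)
    _ = (errorConst C c t (m + 1) * (γ * L ^ (5 * (m + 1)))) ^ p *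
        U ^ (((m + 1 : ℕ) : ℝ) * p) := by
        rw [Real.mul_rpow (by positivity) (by positivity), ← Real.rpow_natCast U,
          ← Real.rpow_mul (by linarith)]
    _ ≤ _ := by
        refine mul_le_mul_of_nonneg_left ?_ (by positivity)
        exact one_add_log_rpow_le hnp (by linarith)

/-- Each of the n logarithms is bounded by a multiple of γ^{-κ/n}. -/
theorem one_add_log_pow_le {γ κ : ℝ} (hγ : 0 < γ) (hγ1 : γ ≤ 1) (hκ : 0 < κ) {n : ℕ}
    (hn : 1 ≤ n) :
    γ * (1 + Real.log γ⁻¹) ^ n ≤ (1 + n / κ) ^ n * γ ^ (1 - κ) := by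
  have hn0 : (0 : ℝ) < n := by exact_mod_cast hn
  have hinv : 1 ≤ γ⁻¹ := (one_le_inv₀ hγ).2 hγ1
  have h1 := Real.log_le_rpow_div (inv_pos.2 hγ).le (ε := κ / n) (by positivity)
  rw [div_div_eq_mul_div, mul_div_assoc] at h1
  have h2 : 1 ≤ (γ⁻¹) ^ (κ / n) := Real.one_le_rpow hinv (by positivity)
  have h3 := Real.log_nonneg hinv
  have h4 : (1 + Real.log γ⁻¹) ^ n ≤ ((1 + n / κ) * (γ⁻¹) ^ (κ / n)) ^ n :=
    pow_le_pow_left₀ (by positivity) (by nlinarith) n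
  have h5 : ((γ⁻¹) ^ (κ / n)) ^ n = γ ^ (-κ) := by
    rw [← Real.rpow_natCast, ← Real.rpow_mul (by positivity), div_mul_cancel₀ _ hn0.ne',
      Real.inv_rpow hγ.le, Real.rpow_neg hγ.le]
  rw [mul_pow, h5] at h4
  calc γ * (1 + Real.log γ⁻¹) ^ n ≤ γ * ((1 + n / κ) ^ n * γ ^ (-κ)) := by gcongr
    _ = (1 + n / κ) ^ n * γ ^ (1 - κ) := by
        rw [sub_eq_add_neg, Real.rpow_add hγ, Real.rpow_one]
        ring

end Logarithms

end IsingKac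

end

/-! ### The moment bound -/

theorem proposition5p3 (𝔎 : EuclideanSpace ℝ (Fin 2) → ℝ) (h𝔎 : IsingKac.IsKacKernel 𝔎) :
    ∃ γ₀ : ℝ, 0 < γ₀ ∧ γ₀ ≤ 1 / 3 ∧
      ∀ (n : ℕ) (κ : ℝ) (t : ℝ≥0) (p : ℝ), 1 ≤ n → 0 < κ → 0 < t → 1 ≤ p →
        ∃ C : ℝ, 0 < C ∧
          ∀ (γ : ℝ), 0 < γ → γ < γ₀ → ∀ (A : ℝ)
            (Ω : Type u) (mΩ : MeasurableSpace Ω) (μ : Measure Ω) (_ : IsProbabilityMeasure μ)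
            (ℱ : Filtration ℝ≥0 mΩ) (σ : ℝ≥0 → Ω → IsingKac.Config (IsingKac.size γ)),
            IsingKac.IsGlauberDynamics 𝔎 γ (IsingKac.invTemp 𝔎 γ A) μ ℱ σ →
              (∫⁻ ω, (⨆ x ∈ Set.Icc (-1 : Fin 2 → ℝ) 1, ⨆ s ∈ Set.Icc (0 : ℝ≥0) t,
                  ‖IsingKac.wickError 𝔎 γ (IsingKac.invTemp 𝔎 γ A) (fun r => σ r ω)
                    t n s x‖ₑ ^ p) ∂μ) ^ (1 / p)
                ≤ ENNReal.ofReal (C * γ ^ (1 - κ)) := by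
  obtain ⟨C, c, γ₀, hγ₀, hγ₀', hK⟩ := h𝔎.kernelBounds
  refine ⟨γ₀, hγ₀, hγ₀'.trans (by norm_num), fun n κ t p hn hκ _ hp => ?_⟩
  -- The kernel bounds at one admissible value of γ are enough to extract the signs of the constants
  -- C and c, which do not depend on γ.
  have hK₀ := hK (γ₀ / 2) (by positivity) (by linarith)
  have hE : 0 < IsingKac.errorConst C c t n := by
    have hC := hK₀.one_le
    have hD := hK₀.compBound_nonneg t
    rw [IsingKac.errorConst]
    positivity
  set q : ℝ := n * p with hq
  have hq0 : 0 < q := by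
    have : (0 : ℝ) < n := by exact_mod_cast hn
    positivity
  set E := IsingKac.errorConst C c t n with hEd
  have hp0 : p ≠ 0 := by linarith
  -- The pathwise constant, the price of absorbing 5n logarithms into γ^{-κ}, and the p-th root of
  -- the moment of order q = np of 1 + log(1 + Z), where 1 + Z has mean at most 2.
  refine ⟨E * (1 + ((5 * n : ℕ) : ℝ) / κ) ^ (5 * n) * (2 * (1 + q) ^ q) ^ (1 / p),
    by positivity, fun γ hγ hγ' A Ω mΩ μ _ ℱ σ hσ => ?_⟩
  have hb := hK γ hγ hγ'
  have hγ1 : γ ≤ 1 := hb.le.trans (by norm_num)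
  have hlog : 0 ≤ Real.log γ⁻¹ := Real.log_nonneg ((one_le_inv₀ hγ).2 hγ1)
  obtain ⟨Z, hZm, hZ0, hZ1, hZ⟩ :=
    IsingKac.exists_functionalBounds hγ hσ C t ⌈(γ ^ 6)⁻¹⌉₊
  set G := E * (γ * (1 + Real.log γ⁻¹) ^ (5 * n)) with hG
  have hG0 : 0 ≤ G := by positivity
  -- The pathwise bound is uniform in x and s, so the suprema are dominated pointwise by a function
  -- of Z and need not be measurable.
  have hmoment : ∫⁻ ω, (⨆ x ∈ Set.Icc (-1 : Fin 2 → ℝ) 1, ⨆ s ∈ Set.Icc (0 : ℝ≥0) t,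
      ‖IsingKac.wickError 𝔎 γ (IsingKac.invTemp 𝔎 γ A) (fun r => σ r ω) t n s x‖ₑ ^ p) ∂μ ≤
      ENNReal.ofReal (G ^ p * (2 * (1 + q) ^ q)) := by
    calc _ ≤ ∫⁻ ω, ENNReal.ofReal (G ^ p * (1 + q) ^ q) * (1 + ENNReal.ofReal (Z ω)) ∂μ := by
          refine lintegral_mono_ae ?_
          filter_upwards [hZ] with ω hω
          refine iSup₂_le fun x _ => iSup₂_le fun s hs => ?_
          rw [← ofReal_norm, ENNReal.ofReal_rpow_of_nonneg (norm_nonneg _) (by linarith),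
            ← ENNReal.ofReal_one, ← ENNReal.ofReal_add zero_le_one (hZ0 ω),
            ← ENNReal.ofReal_mul (by positivity), mul_assoc]
          exact ENNReal.ofReal_le_ofReal (hω.norm_wickError_rpow_le (hZ0 ω) hb
            ⟨hσ.right_continuous ω, hσ.left_limits ω⟩ hs.2 x hn hp)
      _ = ENNReal.ofReal (G ^ p * (1 + q) ^ q) * (1 + ∫⁻ ω, ENNReal.ofReal (Z ω) ∂μ) := by
          rw [lintegral_const_mul _ (hZm.ennreal_ofReal.const_add 1),
            lintegral_add_left measurable_const, lintegral_const, measure_univ, mul_one]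
      _ ≤ ENNReal.ofReal (G ^ p * (1 + q) ^ q) * ENNReal.ofReal 2 := by
          gcongr
          calc (1 : ℝ≥0∞) + ∫⁻ ω, ENNReal.ofReal (Z ω) ∂μ ≤ 1 + 1 := by gcongr
            _ = ENNReal.ofReal 2 := by norm_num
      _ = ENNReal.ofReal (G ^ p * (2 * (1 + q) ^ q)) := by
          rw [← ENNReal.ofReal_mul (by positivity)]
          congr 1
          ring
  refine (ENNReal.rpow_le_rpow hmoment (by positivity)).trans ?_
  rw [ENNReal.ofReal_rpow_of_nonneg (by positivity) (by positivity)]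
  refine ENNReal.ofReal_le_ofReal ?_
  rw [Real.mul_rpow (by positivity) (by positivity), ← Real.rpow_mul hG0, mul_one_div_cancel hp0,
    Real.rpow_one]
  calc G * (2 * (1 + q) ^ q) ^ (1 / p)
      ≤ E * ((1 + ((5 * n : ℕ) : ℝ) / κ) ^ (5 * n) * γ ^ (1 - κ)) *
        (2 * (1 + q) ^ q) ^ (1 / p) := by
        refine mul_le_mul_of_nonneg_right ?_ (by positivity)
        exact mul_le_mul_of_nonneg_left
          (IsingKac.one_add_log_pow_le hγ hγ1 hκ (n := 5 * n) (by omega)) hE.le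
    _ = _ := by ring
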